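/- **Setting.** All spaces are over $\mathbb{C}$. Let $n\ge 1$, let $\mathfrak g$ be a finite dimensional simple Lie algebra with a non-degenerate symmetric invariant bilinear form $(\cdot,\cdot)$, and let $\sigma_0,\dots,\sigma_n$ be commuting automorphisms of $\mathfrak g$ of finite orders $m_0,\dots,m_n$, with fixed primitive $m_i$-th roots of unity $\xi_i$. For $(k_0,\underline k)\in\mathbb Z\times\mathbb Z^n$ put $\mathfrak g(\bar k_0,\bar k)=\{x\in\mathfrak g:\sigma_i x=\xi_i^{k_i}x,\ 0\le i\le n\}$; let $\Gamma=\bigoplus_{i=1}^n m_i\mathbb Z$, $\Lambda=\mathbb Z^n/\Gamma$, and write $\bar k$ for the class of $\underline k$ in $\Lambda$. Let $\tau=L(\mathfrak g,\sigma)\oplus Z\oplus D$ be the twisted full toroidal Lie algebra: $L(\mathfrak g,\sigma)=\bigoplus \mathfrak g(\bar k_0,\bar k)\otimes t_0^{k_0}t^{\underline k}$; $Z$ is spanned by the $t^{r}K_i$ and $D$ has as a basis the $t^{r}d_i$ ($0\le i\le n$, $r\in m_0\mathbb Z\oplus\Gamma$, $t^r=t_0^{r_0}t_1^{r_1}\cdots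 t_n^{r_n}$), where the only linear relations in $Z$ are $\sum_i r_i t^rK_i=0$. The brackets are $$[X t^k,Y t^l]=[X,Y]t^{k+l}+(X,Y)\textstyle\sum_i k_i t^{k+l}K_i,\qquad [t^rd_a,Xt^k]=k_aXt^{k+r},$$ $$[t^rd_a,t^sK_b]=s_at^{r+s}K_b+\delta_{ab}\textstyle\sum_p r_pt^{r+s}K_p,\qquad [Z,\,L(\mathfrak g,\sigma)\oplus Z]=0,$$ $$[t^rd_a,t^sd_b]=s_at^{r+s}d_b-r_bt^{r+s}d_a+(c_2r_as_b-c_1s_ar_b)\textstyle\sum_p r_pt^{r+s}K_p$$ with fixed arbitrary $c_1,c_2\in\mathbb C$. Assume that $\mathfrak g(\bar 0,\bar 0)$ is simple, let $\mathfrak h(\bar 0)$ be a Cartan subalgebra of it, with set of non-zero roots $\Delta_0^\times$, and let $\Delta_{0,en}^\times=\Delta_0^\times\cup 2\Delta_{0,sh}^\times$ if $\Delta_0^\times$ is of type $B_l$, $l\ge 1$ ($\Delta_{0,sh}^\times$ the short roots; $B_1=A_1$, all of whose roots count as short), and $\Delta_{0,en}^\times=\Delta_0^\times$ otherwise. Assume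 that every weight of $\mathfrak h(\bar 0)$ on $\mathfrak g$ lies in $\Delta_{0,en}^\times\cup\{0\}$, and fix a positive system in $\Delta^\times_{0,en}$. Let $\tau_q=\{x\in\tau:[d_0,x]=qx\}$, so that $\tau_0$ is the centraliser of $d_0$, and let $\tau_+=\bigoplus_{q>0}\tau_q$. Let $\tau^0$ be the centraliser of $d_0$ and $\mathfrak h(\bar0)$ in $\tau$, and let $\tau^+$ be the sum of $\tau_+$ and of all $\{x\in\tau_0:[h,x]=\alpha(h)x\ \forall h\in\mathfrak h(\bar0)\}$, $\alpha>0$. For $\psi=(\psi(K_0),\dots,\psi(K_n))\in\mathbb C^{n+1}$, a $\tau$-module $V$ is in $\mathcal B_\psi$ if it is the direct sum of its joint eigenspaces for $d_0,\dots,d_n$, these are finite dimensional, each $K_i$ acts by $\psi(K_i)$, and the real parts of the eigenvalues of $d_0$ on $V$ are bounded above. Let $\mathfrak g(\sigma_0)=\{x\in\mathfrak g:\sigma_0x=x\}$ and $\mathfrak a=\{x\in\mathfrak g(\sigma_0):[\mathfrak h(\bar0),x]=0\}$, which are $\Lambda$-graded by $\sigma_1,\dots,\sigma_n$, and let $\mathfrak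 g(\sigma_0)_+$ be the sum of the $\mathfrak h(\bar0)$-weight spaces of $\mathfrak g(\sigma_0)$ for positive weights. Given a finite dimensional irreducible $\mathfrak{gl}_n$-module $W_1$, a finite dimensional $\Lambda$-graded irreducible $\mathfrak a$-module $W_2=\bigoplus_{\lambda\in\Lambda} W_{2,\lambda}$, $\underline\alpha\in\mathbb C^n$ and $d\in\mathbb C$, let $W_2(\sigma_0)$ be the unique $\Lambda$-graded irreducible quotient of $U(\mathfrak g(\sigma_0))\otimes_{U(\mathfrak a\oplus\mathfrak g(\sigma_0)_+)}W_2$ (with $\mathfrak g(\sigma_0)_+W_2=0$). For $C_0\in\mathbb C$ let $\tau^0$ act on $T'=\bigoplus_{\underline k\in\mathbb Z^n}W_1\otimes W_{2,\bar k}\otimes t^{\underline k}$, and $\tau_0$ on $S'=\bigoplus_{\underline k\in\mathbb Z^n}W_1\otimes W_2(\sigma_0)_{\bar k}\otimes t^{\underline k}$, by the formulas (for $\underline r\in\Gamma$, $\underline u\in\mathbb C^n$, $\underline k,\underline l\in\mathbb Z^n$, $1\le p\le n$, and $X$ of degree $\bar l$ in $\mathfrak a$, respectively in $\mathfrak g(\sigma_0)$;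 $E_{ij}$ the matrix units) $$\textstyle\sum_{i=1}^nu_it^{\underline r}d_i\cdot(v_1\otimes v_2\otimes t^{\underline k})=\Big(\sum_i u_i(k_i+\alpha_i)v_1+\sum_{i,j}u_ir_jE_{ji}v_1\Big)\otimes v_2\otimes t^{\underline k+\underline r},$$ $$Xt^{\underline l}\cdot(v_1\otimes v_2\otimes t^{\underline k})=v_1\otimes Xv_2\otimes t^{\underline k+\underline l},\qquad t^{\underline r}d_0\cdot(v_1\otimes v_2\otimes t^{\underline k})=d\,v_1\otimes v_2\otimes t^{\underline k+\underline r},$$ $$t^{\underline r}K_0\cdot(v_1\otimes v_2\otimes t^{\underline k})=C_0\,v_1\otimes v_2\otimes t^{\underline k+\underline r},\qquad t^{\underline r}K_p\cdot(v_1\otimes v_2\otimes t^{\underline k})=0.$$ **Theorem 5.5.** Let $V$ be an irreducible $\tau$-module in $\mathcal B_\psi$ with $C_0=\psi(K_0)\ne0$, and let $S=\{v\in V:\tau_+v=0\}$ and $T=\{v\in V:\tau^+v=0\}$. Then there are $W_1,W_2,\underline\alpha,d$ as above for which the formulas make $T'$ a $\tau^0$-module with $T\cong T'$ as $\tau^0$-modules.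 For every such choice the formulas make $S'$ a $\tau_0$-module, $S\cong S'$ as $\tau_0$-modules, and $W_2(\sigma_0)$ is finite dimensional. -/

import Mathlib

attribute [local instance 100] LieRing.ofAssociativeRing

open scoped TensorProduct DirectSum
noncomputable section
namespace Toroidal

/-- Exponent vectors of Laurent monomials in `N` variables. -/
abbrev Lat (N : ℕ) : Type := Fin N → ℤ

/-- An exponent vector regarded as a complex vector. -/
def Lat.vec {N : ℕ} (k : Lat N) : Fin N → ℂ := fun i => (k i : ℂ)

/-- The standard bilinear pairing `(u, k) = ∑ uᵢ kᵢ`. -/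
def pair {N : ℕ} : (Fin N → ℂ) →ₗ[ℂ] (Fin N → ℂ) →ₗ[ℂ] ℂ :=
  LinearMap.mk₂ ℂ (fun u v => ∑ i, u i * v i)
    (by intros; simp [add_mul, Finset.sum_add_distrib])
    (by intros; simp [mul_assoc, Finset.mul_sum])
    (by intros; simp [mul_add, Finset.sum_add_distrib])
    (by intros; simp [Finset.mul_sum, mul_left_comm])

/-- The bilinear map on finitely supported families with prescribed values `g k l a b` on the pair
of monomials `a t^k`, `b t^l`. -/
def bilExt {N : ℕ} {A B C : Type*} [AddCommGroup A] [Module ℂ A] [AddCommGroup B] [Module ℂ B]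
    [AddCommGroup C] [Module ℂ C] (g : Lat N → Lat N → A →ₗ[ℂ] B →ₗ[ℂ] C) :
    (Lat N →₀ A) →ₗ[ℂ] (Lat N →₀ B) →ₗ[ℂ] C :=
  Finsupp.lsum ℂ fun k => LinearMap.flip (Finsupp.lsum ℂ fun l => (g k l).flip)

section bilExt
variable {N : ℕ} {A B C : Type*} [AddCommGroup A] [Module ℂ A] [AddCommGroup B] [Module ℂ B]
    [AddCommGroup C] [Module ℂ C] (g : Lat N → Lat N → A →ₗ[ℂ] B →ₗ[ℂ] C)

@[simp] lemma bilExt_single (k l : Lat N) (a : A) (b : B) :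
    bilExt g (Finsupp.single k a) (Finsupp.single l b) = g k l a b := by
  simp [bilExt]

lemma bilExt_mem (S : Submodule ℂ C) (f : Lat N →₀ A) (h : Lat N →₀ B)
    (H : ∀ k l, g k l (f k) (h l) ∈ S) : bilExt g f h ∈ S := by
  rw [← Finsupp.sum_single f, ← Finsupp.sum_single h]
  simp only [Finsupp.sum, map_sum, LinearMap.sum_apply, bilExt_single]
  exact S.sum_mem fun i _ => S.sum_mem fun j _ => H _ _
end bilExt

/-- The data entering the construction: a non-degenerate symmetric invariant form on `𝔤`,
commuting automorphisms `σ₀, …, σₙ` of `𝔤` of finite orders `m₀, …, mₙ`, primitive `mᵢ`-th roots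
of unity `ξᵢ`, and the coefficients of the cocycle `φ = c₁ φ₁ + c₂ φ₂`. -/
structure TwistData (n : ℕ) (𝔤 : Type*) [LieRing 𝔤] [LieAlgebra ℂ 𝔤] where
  form : LinearMap.BilinForm ℂ 𝔤
  form_symm : ∀ x y, form x y = form y x
  form_invariant : form.lieInvariant 𝔤
  form_nondegenerate : form.Nondegenerate
  σ : Fin (n + 1) → (𝔤 ≃ₗ⁅ℂ⁆ 𝔤)
  σ_comm : ∀ i j x, σ i (σ j x) = σ j (σ i x)
  m : Fin (n + 1) → ℕ
  m_pos : ∀ i, 0 < m i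
  orderOf_σ : ∀ i, orderOf (σ i).toLinearEquiv = m i
  ξ : Fin (n + 1) → ℂ
  ξ_prim : ∀ i, IsPrimitiveRoot (ξ i) (m i)
  c₁ : ℂ
  c₂ : ℂ

/-- `dA`, the span of the elements `∑ᵢ kᵢ t^k Kᵢ` of `Ω_A`.  Here `Ω_A` is realised as the
finitely supported maps from exponents to `ℂ^{N}`, with `t^k Kᵢ = single k (eᵢ)`. -/
def exactForms (N : ℕ) : Submodule ℂ (Lat N →₀ (Fin N → ℂ)) :=
  Submodule.span ℂ (Set.range fun k : Lat N => Finsupp.single k k.vec)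

/-- `Ω_A / dA`. -/
abbrev Cen (N : ℕ) : Type := (Lat N →₀ (Fin N → ℂ)) ⧸ exactForms N

/-- The class in `Ω_A / dA` of `∑ᵢ wᵢ t^k Kᵢ`. -/
def cenMk {N : ℕ} (k : Lat N) : (Fin N → ℂ) →ₗ[ℂ] Cen N :=
  (exactForms N).mkQ ∘ₗ Finsupp.lsingle k

lemma cenMk_vec {N : ℕ} (k : Lat N) : cenMk k k.vec = 0 := by
  simp only [cenMk, LinearMap.comp_apply, Submodule.mkQ_apply, Submodule.Quotient.mk_eq_zero]
  exact Submodule.subset_span ⟨k, rfl⟩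

lemma cenMk_of_smul {N : ℕ} (k : Lat N) (c : ℂ) : cenMk k (c • k.vec) = 0 := by
  rw [map_smul, cenMk_vec, smul_zero]

section Bracket

variable {n : ℕ} {𝔤 : Type*} [LieRing 𝔤] [LieAlgebra ℂ 𝔤] (D : TwistData n 𝔤)

/-- `[X t^k, Y t^l]` without its central term. -/
def brLoop : (Lat (n + 1) →₀ 𝔤) →ₗ[ℂ] (Lat (n + 1) →₀ 𝔤) →ₗ[ℂ] (Lat (n + 1) →₀ 𝔤) :=
  bilExt fun k l => LinearMap.mk₂ ℂ (fun X Y => Finsupp.single (k + l) ⁅X, Y⁆)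
    (by intros; rw [add_lie, Finsupp.single_add]) (by intros; rw [smul_lie, Finsupp.smul_single])
    (by intros; rw [lie_add, Finsupp.single_add]) (by intros; rw [lie_smul, Finsupp.smul_single])

/-- The central term `(X, Y) ∑ᵢ kᵢ t^{k+l} Kᵢ` of `[X t^k, Y t^l]`. -/
def brLoopCen : (Lat (n + 1) →₀ 𝔤) →ₗ[ℂ] (Lat (n + 1) →₀ 𝔤) →ₗ[ℂ] Cen (n + 1) :=
  bilExt fun k l => LinearMap.mk₂ ℂ (fun X Y => D.form X Y • cenMk (k + l) k.vec)
    (by intros; simp [add_smul]) (by intros; simp [mul_smul])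
    (by intros; simp [add_smul]) (by intros; simp [mul_smul])

/-- `[t^r d_a, X t^k] = k_a X t^{k+r}`. -/
def brDerLoop : (Lat (n + 1) →₀ (Fin (n + 1) → ℂ)) →ₗ[ℂ] (Lat (n + 1) →₀ 𝔤) →ₗ[ℂ]
    (Lat (n + 1) →₀ 𝔤) :=
  bilExt fun r k => LinearMap.mk₂ ℂ (fun a X => Finsupp.single (k + r) (pair a k.vec • X))
    (by intros; rw [← Finsupp.single_add, map_add, LinearMap.add_apply, add_smul])
    (by intros; rw [Finsupp.smul_single, map_smul, LinearMap.smul_apply, smul_assoc])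
    (by intros; rw [← Finsupp.single_add, smul_add])
    (by intros; rw [Finsupp.smul_single, smul_comm])

/-- The action of `t^r d_a` on `Ω_A`:
`t^r d_a (t^s K_b) = s_a t^{r+s} K_b + δ_{ab} ∑ₚ rₚ t^{r+s} Kₚ`, modulo `dA`. -/
def brDerForm : (Lat (n + 1) →₀ (Fin (n + 1) → ℂ)) →ₗ[ℂ] (Lat (n + 1) →₀ (Fin (n + 1) → ℂ)) →ₗ[ℂ]
    Cen (n + 1) :=
  bilExt fun r s => LinearMap.mk₂ ℂ
    (fun a w => cenMk (r + s) (pair a s.vec • w + pair a w • r.vec))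
    (by intros; simp only [← map_add]; congr 1; simp only [map_add, LinearMap.add_apply]; module)
    (by intros; simp only [← map_smul]; congr 1; simp only [map_smul, LinearMap.smul_apply, smul_eq_mul]; module)
    (by intros; simp only [← map_add]; congr 1; simp only [map_add]; module)
    (by intros; simp only [← map_smul]; congr 1; simp only [map_smul, smul_eq_mul]; module)

lemma vec_add {N : ℕ} (k l : Lat N) : (k + l).vec = k.vec + l.vec := by
  ext i; simp [Lat.vec]

lemma brDerForm_exact (d : Lat (n + 1) →₀ (Fin (n + 1) → ℂ)) :
    exactForms (n + 1) ≤ LinearMap.ker (brDerForm d) := by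
  refine Submodule.span_le.2 ?_
  rintro _ ⟨s, rfl⟩
  simp only [SetLike.mem_coe, LinearMap.mem_ker]
  induction d using Finsupp.induction_linear with
  | zero => simp
  | add f g hf hg => simp [hf, hg]
  | single r a =>
    simp only [brDerForm, bilExt_single, LinearMap.mk₂_apply]
    have := cenMk_of_smul (r + s) (pair a s.vec)
    rw [vec_add] at this
    rw [← this]
    congr 1
    module

/-- The action of derivations on `Ω_A / dA`. -/
def brDerCen : (Lat (n + 1) →₀ (Fin (n + 1) → ℂ)) →ₗ[ℂ] Cen (n + 1) →ₗ[ℂ] Cen (n + 1) where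
  toFun d := (exactForms (n + 1)).liftQ (brDerForm d) (brDerForm_exact d)
  map_add' d e := by
    apply Submodule.linearMap_qext; ext; simp
  map_smul' c d := by
    apply Submodule.linearMap_qext; ext; simp

/-- `[t^r d_a, t^s d_b] = s_a t^{r+s} d_b - r_b t^{r+s} d_a`, without its central term. -/
def brDer : (Lat (n + 1) →₀ (Fin (n + 1) → ℂ)) →ₗ[ℂ] (Lat (n + 1) →₀ (Fin (n + 1) → ℂ)) →ₗ[ℂ]
    (Lat (n + 1) →₀ (Fin (n + 1) → ℂ)) :=
  bilExt fun r s => LinearMap.mk₂ ℂ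
    (fun a b => Finsupp.single (r + s) (pair a s.vec • b - pair b r.vec • a))
    (by intros; rw [← Finsupp.single_add]; congr 1; simp only [map_add, LinearMap.add_apply]; module)
    (by intros; rw [Finsupp.smul_single]; congr 1; simp only [map_smul, LinearMap.smul_apply, smul_eq_mul]; module)
    (by intros; rw [← Finsupp.single_add]; congr 1; simp only [map_add, LinearMap.add_apply]; module)
    (by intros; rw [Finsupp.smul_single]; congr 1; simp only [map_smul, LinearMap.smul_apply, smul_eq_mul]; module)

/-- The cocycle `φ = c₁ φ₁ + c₂ φ₂`, where
`φ₁(t^r d_a, t^s d_b) = - s_a r_b ∑ₚ rₚ t^{r+s} Kₚ` and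
`φ₂(t^r d_a, t^s d_b) = r_a s_b ∑ₚ rₚ t^{r+s} Kₚ`. -/
def cocycle : (Lat (n + 1) →₀ (Fin (n + 1) → ℂ)) →ₗ[ℂ] (Lat (n + 1) →₀ (Fin (n + 1) → ℂ)) →ₗ[ℂ]
    Cen (n + 1) :=
  bilExt fun r s => LinearMap.mk₂ ℂ
    (fun a b => (D.c₁ * -(pair a s.vec * pair b r.vec) + D.c₂ * (pair a r.vec * pair b s.vec)) •
      cenMk (r + s) r.vec)
    (by intros; simp only [map_add, LinearMap.add_apply]; module)
    (by intros; simp only [map_smul, LinearMap.smul_apply, smul_eq_mul]; module)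
    (by intros; simp only [map_add, LinearMap.add_apply]; module)
    (by intros; simp only [map_smul, LinearMap.smul_apply, smul_eq_mul]; module)


variable {D}

@[simp] lemma brLoop_single (k l : Lat (n + 1)) (X Y : 𝔤) :
    brLoop (Finsupp.single k X) (Finsupp.single l Y) = Finsupp.single (k + l) ⁅X, Y⁆ := by
  simp [brLoop]

@[simp] lemma brLoopCen_single (k l : Lat (n + 1)) (X Y : 𝔤) :
    brLoopCen D (Finsupp.single k X) (Finsupp.single l Y) = D.form X Y • cenMk (k + l) k.vec := by
  simp [brLoopCen]

@[simp] lemma brDerLoop_single (r k : Lat (n + 1)) (a : Fin (n + 1) → ℂ) (X : 𝔤) :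
    brDerLoop (Finsupp.single r a) (Finsupp.single k X) =
      Finsupp.single (k + r) (pair a k.vec • X) := by
  simp [brDerLoop]

@[simp] lemma brDerCen_single (r s : Lat (n + 1)) (a w : Fin (n + 1) → ℂ) :
    brDerCen (Finsupp.single r a) (cenMk s w) =
      cenMk (r + s) (pair a s.vec • w + pair a w • r.vec) := by
  simp [brDerCen, cenMk, brDerForm]

@[simp] lemma brDer_single (r s : Lat (n + 1)) (a b : Fin (n + 1) → ℂ) :
    brDer (Finsupp.single r a) (Finsupp.single s b) =
      Finsupp.single (r + s) (pair a s.vec • b - pair b r.vec • a) := by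
  simp [brDer]

@[simp] lemma cocycle_single (r s : Lat (n + 1)) (a b : Fin (n + 1) → ℂ) :
    cocycle D (Finsupp.single r a) (Finsupp.single s b) =
      (D.c₁ * -(pair a s.vec * pair b r.vec) + D.c₂ * (pair a r.vec * pair b s.vec)) •
        cenMk (r + s) r.vec := by
  simp [cocycle]

lemma cen_induction {N : ℕ} {p : Cen N → Prop} (z : Cen N)
    (h0 : p 0) (hadd : ∀ x y, p x → p y → p (x + y)) (hs : ∀ k w, p (cenMk k w)) : p z := by
  obtain ⟨w, rfl⟩ := Submodule.mkQ_surjective _ z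
  induction w using Finsupp.induction_linear with
  | zero => simpa using h0
  | add f g hf hg => rw [map_add]; exact hadd _ _ hf hg
  | single k w => exact hs k w

/-- Elements `cenMk k (c • k.vec)` may be added freely. -/
lemma cenMk_congr {N : ℕ} {k l : Lat N} {v w : Fin N → ℂ} (hkl : k = l) (c : ℂ)
    (h : v = w + c • l.vec) : cenMk k v = cenMk l w := by
  subst hkl; rw [h, map_add, cenMk_of_smul, add_zero]

section Identities

lemma brLoop_jacobi (f g h : Lat (n + 1) →₀ 𝔤) :
    brLoop f (brLoop g h) = brLoop (brLoop f g) h + brLoop g (brLoop f h) := by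
  induction f using Finsupp.induction_linear with
  | zero => simp
  | add f g hf hg => simp only [map_add, LinearMap.add_apply, hf, hg]; abel
  | single k X =>
  induction g using Finsupp.induction_linear with
  | zero => simp
  | add f g hf hg => simp only [map_add, LinearMap.add_apply, hf, hg]; abel
  | single l Y =>
  induction h using Finsupp.induction_linear with
  | zero => simp
  | add f g hf hg => simp only [map_add, hf, hg]; abel
  | single q Z =>
    simp only [brLoop_single, ← add_assoc]
    rw [add_comm l k, ← Finsupp.single_add, leibniz_lie]

lemma brLoop_skew (f g : Lat (n + 1) →₀ 𝔤) : brLoop f g + brLoop g f = 0 := by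
  induction f using Finsupp.induction_linear with
  | zero => simp
  | add f f' hf hg =>
    rw [map_add, map_add, LinearMap.add_apply, add_add_add_comm, hf, hg, add_zero]
  | single k X =>
  induction g using Finsupp.induction_linear with
  | zero => simp
  | add f f' hf hg =>
    rw [map_add, map_add, LinearMap.add_apply, add_add_add_comm, hf, hg, add_zero]
  | single l Y =>
    rw [brLoop_single, brLoop_single, add_comm l k, ← Finsupp.single_add, ← lie_skew X Y,
      neg_add_cancel, Finsupp.single_zero]

lemma brLoopCen_skew (f g : Lat (n + 1) →₀ 𝔤) : brLoopCen D f g + brLoopCen D g f = 0 := by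
  induction f using Finsupp.induction_linear with
  | zero => simp
  | add f f' hf hg =>
    rw [map_add, map_add, LinearMap.add_apply, add_add_add_comm, hf, hg, add_zero]
  | single k X =>
  induction g using Finsupp.induction_linear with
  | zero => simp
  | add f f' hf hg =>
    rw [map_add, map_add, LinearMap.add_apply, add_add_add_comm, hf, hg, add_zero]
  | single l Y =>
    rw [brLoopCen_single, brLoopCen_single, add_comm l k, D.form_symm Y X, ← smul_add, ← map_add,
      ← vec_add, cenMk_vec, smul_zero]

lemma brDer_skew (f g : Lat (n + 1) →₀ (Fin (n + 1) → ℂ)) : brDer f g + brDer g f = 0 := by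
  induction f using Finsupp.induction_linear with
  | zero => simp
  | add f f' hf hg =>
    rw [map_add, map_add, LinearMap.add_apply, add_add_add_comm, hf, hg, add_zero]
  | single k X =>
  induction g using Finsupp.induction_linear with
  | zero => simp
  | add f f' hf hg =>
    rw [map_add, map_add, LinearMap.add_apply, add_add_add_comm, hf, hg, add_zero]
  | single l Y =>
    rw [brDer_single, brDer_single, add_comm l k, ← Finsupp.single_add]
    simp

lemma cocycle_skew (f g : Lat (n + 1) →₀ (Fin (n + 1) → ℂ)) :
    cocycle D f g + cocycle D g f = 0 := by
  induction f using Finsupp.induction_linear with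
  | zero => simp
  | add f f' hf hg =>
    rw [map_add, map_add, LinearMap.add_apply, add_add_add_comm, hf, hg, add_zero]
  | single k X =>
  induction g using Finsupp.induction_linear with
  | zero => simp
  | add f f' hf hg =>
    rw [map_add, map_add, LinearMap.add_apply, add_add_add_comm, hf, hg, add_zero]
  | single l Y =>
    rw [cocycle_single, cocycle_single, add_comm l k, ← map_smul, ← map_smul, ← map_add]
    rw [cenMk_congr (w := 0) rfl (D.c₁ * -(pair X l.vec * pair Y k.vec) +
      D.c₂ * (pair X k.vec * pair Y l.vec)), map_zero]
    rw [vec_add]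
    module

lemma brLoopCen_jacobi (f g h : Lat (n + 1) →₀ 𝔤) :
    brLoopCen D f (brLoop g h) = brLoopCen D (brLoop f g) h + brLoopCen D g (brLoop f h) := by
  induction f using Finsupp.induction_linear with
  | zero => simp
  | add f g hf hg => simp only [map_add, LinearMap.add_apply, hf, hg]; abel
  | single k X =>
  induction g using Finsupp.induction_linear with
  | zero => simp
  | add f g hf hg => simp only [map_add, LinearMap.add_apply, hf, hg]; abel
  | single l Y =>
  induction h using Finsupp.induction_linear with
  | zero => simp
  | add f g hf hg => simp only [map_add, hf, hg]; abel
  | single q Z =>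
    simp only [brLoop_single, brLoopCen_single, ← map_smul]
    have h1 : D.form ⁅X, Y⁆ Z = D.form X ⁅Y, Z⁆ := by
      rw [← lie_skew, map_neg, LinearMap.neg_apply, D.form_invariant, neg_neg]
    have h2 : D.form Y ⁅X, Z⁆ = - D.form X ⁅Y, Z⁆ := by
      rw [← h1, D.form_invariant X Y Z, neg_neg]
    rw [h1, h2, show l + (k + q) = k + l + q by abel, show k + (l + q) = k + l + q by abel,
      ← map_add]
    congr 1
    rw [vec_add]
    module

lemma brDerLoop_brLoop (d : Lat (n + 1) →₀ (Fin (n + 1) → ℂ)) (f g : Lat (n + 1) →₀ 𝔤) :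
    brDerLoop d (brLoop f g) = brLoop (brDerLoop d f) g + brLoop f (brDerLoop d g) := by
  induction d using Finsupp.induction_linear with
  | zero => simp
  | add f g hf hg => simp only [map_add, LinearMap.add_apply, hf, hg]; abel
  | single r a =>
  induction f using Finsupp.induction_linear with
  | zero => simp
  | add f g hf hg => simp only [map_add, LinearMap.add_apply, hf, hg]; abel
  | single k X =>
  induction g using Finsupp.induction_linear with
  | zero => simp
  | add f g hf hg => simp only [map_add, hf, hg]; abel
  | single l Y =>
    simp only [brLoop_single, brDerLoop_single]
    rw [show k + r + l = k + l + r by abel, show k + (l + r) = k + l + r by abel,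
      ← Finsupp.single_add, vec_add, map_add, smul_lie, lie_smul, add_smul]

lemma brDerCen_brLoopCen (d : Lat (n + 1) →₀ (Fin (n + 1) → ℂ)) (f g : Lat (n + 1) →₀ 𝔤) :
    brDerCen d (brLoopCen D f g) =
      brLoopCen D (brDerLoop d f) g + brLoopCen D f (brDerLoop d g) := by
  induction d using Finsupp.induction_linear with
  | zero => simp
  | add f g hf hg => simp only [map_add, LinearMap.add_apply, hf, hg]; abel
  | single r a =>
  induction f using Finsupp.induction_linear with
  | zero => simp
  | add f g hf hg => simp only [map_add, LinearMap.add_apply, hf, hg]; abel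
  | single k X =>
  induction g using Finsupp.induction_linear with
  | zero => simp
  | add f g hf hg => simp only [map_add, hf, hg]; abel
  | single l Y =>
    simp only [brLoopCen_single, brDerLoop_single, map_smul, brDerCen_single, LinearMap.smul_apply,
      smul_eq_mul]
    rw [show k + r + l = r + (k + l) by abel, show k + (l + r) = r + (k + l) by abel]
    simp only [← map_smul, ← map_add]
    congr 1
    simp only [vec_add, map_add]
    module

lemma brDerLoop_brDer (d e : Lat (n + 1) →₀ (Fin (n + 1) → ℂ)) (f : Lat (n + 1) →₀ 𝔤) :
    brDerLoop (brDer d e) f = brDerLoop d (brDerLoop e f) - brDerLoop e (brDerLoop d f) := by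
  induction d using Finsupp.induction_linear with
  | zero => simp
  | add f g hf hg => simp only [map_add, LinearMap.add_apply, hf, hg]; abel
  | single r a =>
  induction e using Finsupp.induction_linear with
  | zero => simp
  | add f g hf hg => simp only [map_add, LinearMap.add_apply, hf, hg]; abel
  | single s b =>
  induction f using Finsupp.induction_linear with
  | zero => simp
  | add f g hf hg => simp only [map_add, hf, hg]; abel
  | single k X =>
    simp only [brDer_single, brDerLoop_single]
    rw [show k + s + r = k + (r + s) by abel, show k + r + s = k + (r + s) by abel,
      ← Finsupp.single_sub]
    congr 1
    simp only [vec_add, map_add, map_sub, map_smul, LinearMap.sub_apply, LinearMap.smul_apply,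
      smul_eq_mul]
    module

lemma brDerCen_brDer (d e : Lat (n + 1) →₀ (Fin (n + 1) → ℂ)) (z : Cen (n + 1)) :
    brDerCen (brDer d e) z = brDerCen d (brDerCen e z) - brDerCen e (brDerCen d z) := by
  induction d using Finsupp.induction_linear with
  | zero => simp
  | add f g hf hg => simp only [map_add, LinearMap.add_apply, hf, hg]; abel
  | single r a =>
  induction e using Finsupp.induction_linear with
  | zero => simp
  | add f g hf hg => simp only [map_add, LinearMap.add_apply, hf, hg]; abel
  | single s b =>
  induction z using cen_induction with
  | h0 => simp
  | hadd f g hf hg => simp only [map_add, hf, hg]; abel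
  | hs k w =>
    simp only [brDer_single, brDerCen_single]
    rw [show r + (s + k) = r + s + k by abel, show s + (r + k) = r + s + k by abel, ← map_sub]
    congr 1
    simp only [vec_add, map_add, map_sub, map_smul, LinearMap.sub_apply, LinearMap.smul_apply,
      smul_eq_mul]
    module

lemma brDer_jacobi (d e f : Lat (n + 1) →₀ (Fin (n + 1) → ℂ)) :
    brDer d (brDer e f) = brDer (brDer d e) f + brDer e (brDer d f) := by
  induction d using Finsupp.induction_linear with
  | zero => simp
  | add f g hf hg => simp only [map_add, LinearMap.add_apply, hf, hg]; abel
  | single r a =>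
  induction e using Finsupp.induction_linear with
  | zero => simp
  | add f g hf hg => simp only [map_add, LinearMap.add_apply, hf, hg]; abel
  | single s b =>
  induction f using Finsupp.induction_linear with
  | zero => simp
  | add f g hf hg => simp only [map_add, hf, hg]; abel
  | single k c =>
    simp only [brDer_single]
    rw [show r + (s + k) = r + s + k by abel, show s + (r + k) = r + s + k by abel,
      ← Finsupp.single_add]
    congr 1
    simp only [vec_add, map_add, map_sub, map_smul, LinearMap.sub_apply, LinearMap.smul_apply,
      smul_eq_mul]
    module

lemma cocycle_jacobi_single (r s k : Lat (n + 1)) (a b c : Fin (n + 1) → ℂ) :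
    brDerCen (Finsupp.single r a) (cocycle D (Finsupp.single s b) (Finsupp.single k c)) +
      cocycle D (Finsupp.single r a) (brDer (Finsupp.single s b) (Finsupp.single k c)) =
      (cocycle D (brDer (Finsupp.single r a) (Finsupp.single s b)) (Finsupp.single k c) -
        brDerCen (Finsupp.single k c) (cocycle D (Finsupp.single r a) (Finsupp.single s b))) +
      (brDerCen (Finsupp.single s b) (cocycle D (Finsupp.single r a) (Finsupp.single k c)) +
        cocycle D (Finsupp.single s b) (brDer (Finsupp.single r a) (Finsupp.single k c))) := by
  simp only [brDer_single, cocycle_single, map_smul, brDerCen_single]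
  rw [show r + (s + k) = r + s + k by abel, show s + (r + k) = r + s + k by abel,
    show k + (r + s) = r + s + k by abel]
  simp only [← map_smul, ← map_add, ← map_sub]
  refine cenMk_congr rfl ((D.c₁ * -(pair a s.vec * pair b r.vec) +
    D.c₂ * (pair a r.vec * pair b s.vec)) * pair c r.vec) ?_
  simp only [vec_add, map_add, map_sub, map_smul, LinearMap.sub_apply, LinearMap.smul_apply,
    smul_eq_mul]
  generalize pair a s.vec = as, pair a r.vec = ar, pair a k.vec = ak, pair b s.vec = bs,
    pair b r.vec = br, pair b k.vec = bk, pair c s.vec = cs, pair c r.vec = cr,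
    pair c k.vec = ck, D.c₁ = c₁, D.c₂ = c₂
  module

lemma six_term_add {M : Type*} [AddCommGroup M] {a b c d e f a' b' c' d' e' f' : M}
    (h : a + b = (c - d) + (e + f)) (h' : a' + b' = (c' - d') + (e' + f')) :
    (a + a') + (b + b') = ((c + c') - (d + d')) + ((e + e') + (f + f')) := by
  rw [add_add_add_comm, h, h']; abel

lemma cocycle_jacobi (d e f : Lat (n + 1) →₀ (Fin (n + 1) → ℂ)) :
    brDerCen d (cocycle D e f) + cocycle D d (brDer e f) =
      (cocycle D (brDer d e) f - brDerCen f (cocycle D d e)) +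
      (brDerCen e (cocycle D d f) + cocycle D e (brDer d f)) := by
  induction d using Finsupp.induction_linear with
  | zero => simp
  | add d d' hf hg =>
    simp only [map_add, LinearMap.add_apply]; exact six_term_add hf hg
  | single r a =>
  induction e using Finsupp.induction_linear with
  | zero => simp
  | add e e' hf hg =>
    simp only [map_add, LinearMap.add_apply]; exact six_term_add hf hg
  | single s b =>
  induction f using Finsupp.induction_linear with
  | zero => simp
  | add f f' hf hg =>
    simp only [map_add, LinearMap.add_apply]; exact six_term_add hf hg
  | single k c => exact cocycle_jacobi_single r s k a b c

end Identities

lemma lie_aux {M : Type*} [AddCommGroup M] [Module ℂ M] {x : M} (h : x + x = 0) : x = 0 := by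
  have : (2 : ℂ) • x = 0 := by rw [two_smul, h]
  simpa using this

variable (D)

/-- The untwisted full toroidal Lie algebra `𝔤 ⊗ A ⊕ Ω_A / dA ⊕ Der A`, on which the bracket
depends on the form and on the cocycle in `D`. A derivation `∑ᵢ aᵢ t^r dᵢ` is `single r a`. -/
def Full (_D : TwistData n 𝔤) : Type _ :=
  (Lat (n + 1) →₀ 𝔤) × Cen (n + 1) × (Lat (n + 1) →₀ (Fin (n + 1) → ℂ))

instance : AddCommGroup (Full D) :=
  inferInstanceAs (AddCommGroup ((Lat (n + 1) →₀ 𝔤) × Cen (n + 1) × (Lat (n + 1) →₀ (Fin (n + 1) → ℂ))))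

instance : Module ℂ (Full D) :=
  inferInstanceAs (Module ℂ ((Lat (n + 1) →₀ 𝔤) × Cen (n + 1) × (Lat (n + 1) →₀ (Fin (n + 1) → ℂ))))

namespace Full
variable {D}

@[ext] lemma ext {x y : Full D} (h1 : x.1 = y.1) (h2 : x.2.1 = y.2.1) (h3 : x.2.2 = y.2.2) :
    x = y := Prod.ext h1 (Prod.ext h2 h3)

@[simp] lemma add_fst (x y : Full D) : (x + y).1 = x.1 + y.1 := rfl
@[simp] lemma add_snd (x y : Full D) : (x + y).2.1 = x.2.1 + y.2.1 := rfl
@[simp] lemma add_thd (x y : Full D) : (x + y).2.2 = x.2.2 + y.2.2 := rfl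
@[simp] lemma smul_fst (c : ℂ) (y : Full D) : (c • y).1 = c • y.1 := rfl
@[simp] lemma smul_snd (c : ℂ) (y : Full D) : (c • y).2.1 = c • y.2.1 := rfl
@[simp] lemma smul_thd (c : ℂ) (y : Full D) : (c • y).2.2 = c • y.2.2 := rfl
@[simp] lemma zero_fst : (0 : Full D).1 = 0 := rfl
@[simp] lemma zero_snd : (0 : Full D).2.1 = 0 := rfl
@[simp] lemma zero_thd : (0 : Full D).2.2 = 0 := rfl

instance : Bracket (Full D) (Full D) where
  bracket x y :=
    (brLoop x.1 y.1 + (brDerLoop x.2.2 y.1 - brDerLoop y.2.2 x.1),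
     brLoopCen D x.1 y.1 + (brDerCen x.2.2 y.2.1 - brDerCen y.2.2 x.2.1) + cocycle D x.2.2 y.2.2,
     brDer x.2.2 y.2.2)

lemma lie_fst (x y : Full D) :
    ⁅x, y⁆.1 = brLoop x.1 y.1 + (brDerLoop x.2.2 y.1 - brDerLoop y.2.2 x.1) := rfl
lemma lie_snd (x y : Full D) : ⁅x, y⁆.2.1 = brLoopCen D x.1 y.1 +
    (brDerCen x.2.2 y.2.1 - brDerCen y.2.2 x.2.1) + cocycle D x.2.2 y.2.2 := rfl
lemma lie_thd (x y : Full D) : ⁅x, y⁆.2.2 = brDer x.2.2 y.2.2 := rfl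

instance : LieRing (Full D) where
  add_lie x y z := by
    ext1 <;> simp only [lie_fst, lie_snd, lie_thd, add_fst, add_snd, add_thd, map_add,
      LinearMap.add_apply] <;> abel
  lie_add x y z := by
    ext1 <;> simp only [lie_fst, lie_snd, lie_thd, add_fst, add_snd, add_thd, map_add,
      LinearMap.add_apply] <;> abel
  lie_self x := by
    ext1
    · simp only [lie_fst, sub_self, add_zero, zero_fst]
      exact lie_aux (brLoop_skew _ _)
    · simp only [lie_snd, sub_self, add_zero, zero_snd]
      rw [lie_aux (brLoopCen_skew _ _), lie_aux (cocycle_skew _ _), add_zero]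
    · exact lie_aux (brDer_skew _ _)
  leibniz_lie x y z := by
    ext1
    · have s1 := brLoop_skew (brDerLoop y.2.2 x.1) z.1
      have s2 := brLoop_skew (brDerLoop z.2.2 x.1) y.1
      simp only [lie_fst, lie_thd, add_fst, map_add, map_sub, LinearMap.add_apply,
        LinearMap.sub_apply, brLoop_jacobi x.1 y.1 z.1, brDerLoop_brLoop, brDerLoop_brDer]
      rw [eq_neg_of_add_eq_zero_right s2]
      abel
    · have s2 := eq_neg_of_add_eq_zero_right (brLoopCen_skew (D := D) (brDerLoop z.2.2 x.1) y.1)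
      have hc := eq_sub_of_add_eq (cocycle_jacobi (D := D) x.2.2 y.2.2 z.2.2)
      simp only [lie_fst, lie_snd, lie_thd, add_snd, map_add, map_sub, LinearMap.add_apply,
        LinearMap.sub_apply, brLoopCen_jacobi x.1 y.1 z.1, brDerCen_brLoopCen, brDerCen_brDer]
      rw [s2, hc]
      abel
    · exact brDer_jacobi _ _ _

instance : LieAlgebra ℂ (Full D) where
  lie_smul c x y := by
    ext1 <;> simp only [lie_fst, lie_snd, lie_thd, smul_fst, smul_snd, smul_thd, map_smul,
      LinearMap.smul_apply, smul_add, smul_sub]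
end Full

end Bracket
end Toroidal

namespace Toroidal

section Twisted

variable {n : ℕ} {𝔤 : Type*} [LieRing 𝔤] [LieAlgebra ℂ 𝔤] (D : TwistData n 𝔤)

/-- An invariant form on a simple Lie algebra is a multiple of the Killing form. -/
lemma form_eq_smul_killing [FiniteDimensional ℂ 𝔤] [LieAlgebra.IsSimple ℂ 𝔤]
    (B : LinearMap.BilinForm ℂ 𝔤) (hB : B.lieInvariant 𝔤) :
    ∃ c : ℂ, B = c • killingForm ℂ 𝔤 := by
  have hκ : (killingForm ℂ 𝔤).Nondegenerate := LieAlgebra.IsKilling.killingForm_nondegenerate ℂ 𝔤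
  have hκi : (killingForm ℂ 𝔤).lieInvariant 𝔤 := by
    intro x y z
    rw [killingForm, ← lie_skew, map_neg, LinearMap.neg_apply, LieModule.traceForm_apply_lie_apply]
  have : Nontrivial 𝔤 := by
    by_contra h
    rw [not_nontrivial_iff_subsingleton] at h
    exact LieAlgebra.IsSimple.non_abelian ℂ (L := 𝔤) ⟨fun x y => Subsingleton.elim _ _⟩
  obtain ⟨c, hc⟩ := Module.End.exists_eigenvalue
    (((killingForm ℂ 𝔤).toDual hκ).symm.toLinearMap ∘ₗ B : Module.End ℂ 𝔤)
  obtain ⟨v, hv, hv0⟩ := hc.exists_hasEigenvector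
  have key : B v = c • killingForm ℂ 𝔤 v := by
    have := Module.End.mem_eigenspace_iff.1 hv
    have h2 := congrArg ((killingForm ℂ 𝔤).toDual hκ) this
    rw [LinearMap.comp_apply, LinearEquiv.coe_coe, LinearEquiv.apply_symm_apply] at h2
    rw [h2]
    ext y
    simp [LinearMap.BilinForm.toDual_def]
  let I : LieIdeal ℂ 𝔤 :=
    { LinearMap.ker (B - c • killingForm ℂ 𝔤) with
      lie_mem := by
        intro x m hm
        simp only [AddSubsemigroup.mem_carrier, AddSubmonoid.mem_toSubsemigroup,
          Submodule.mem_toAddSubmonoid, LinearMap.mem_ker] at hm ⊢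
        ext y
        have := LinearMap.congr_fun hm ⁅x, y⁆
        simp only [LinearMap.sub_apply, LinearMap.smul_apply, LinearMap.zero_apply] at this ⊢
        rw [hB, hκi, smul_neg, ← neg_sub', this, neg_zero] }
  have hI : I = ⊤ := by
    refine (LieAlgebra.IsSimple.eq_bot_or_eq_top (R := ℂ) I).resolve_left fun h => hv0 ?_
    have : v ∈ I := by
      change v ∈ LinearMap.ker (B - c • killingForm ℂ 𝔤)
      simp [key]
    rw [h] at this
    simpa using this
  refine ⟨c, LinearMap.ext fun x => ?_⟩
  have : x ∈ I := hI ▸ LieSubmodule.mem_top x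
  change x ∈ LinearMap.ker (B - c • killingForm ℂ 𝔤) at this
  simpa [sub_eq_zero] using this

namespace TwistData

lemma form_σ [FiniteDimensional ℂ 𝔤] [LieAlgebra.IsSimple ℂ 𝔤] (i : Fin (n + 1)) (x y : 𝔤) :
    D.form (D.σ i x) (D.σ i y) = D.form x y := by
  obtain ⟨c, hc⟩ := form_eq_smul_killing D.form D.form_invariant
  rw [hc]
  simp [LieAlgebra.killingForm_of_equiv_apply]

/-- `𝔤(k̄)`, the joint eigenspace `{x | σᵢ x = ξᵢ^{kᵢ} x}`. -/
def gradeSpace (k : Lat (n + 1)) : Submodule ℂ 𝔤 where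
  carrier := {x | ∀ i, D.σ i x = D.ξ i ^ k i • x}
  add_mem' hx hy i := by rw [map_add, hx i, hy i, smul_add]
  zero_mem' i := by rw [map_zero, smul_zero]
  smul_mem' c x hx i := by rw [map_smul, hx i, smul_comm]

/-- The exponents `Γ₀ ⊕ Γ` of `A(m₀, m)`. -/
def gam : AddSubgroup (Lat (n + 1)) where
  carrier := {r | ∀ i, (D.m i : ℤ) ∣ r i}
  add_mem' ha hb i := dvd_add (ha i) (hb i)
  zero_mem' _ := dvd_zero _
  neg_mem' ha i := (dvd_neg).2 (ha i)

lemma ξ_ne_zero (i : Fin (n + 1)) : D.ξ i ≠ 0 := (D.ξ_prim i).ne_zero (D.m_pos i).ne'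

lemma gradeSpace_lie {k l : Lat (n + 1)} {x y : 𝔤} (hx : x ∈ D.gradeSpace k)
    (hy : y ∈ D.gradeSpace l) : ⁅x, y⁆ ∈ D.gradeSpace (k + l) := by
  intro i
  rw [LieEquiv.map_lie, hx i, hy i, smul_lie, lie_smul, smul_smul, Pi.add_apply,
    zpow_add₀ (D.ξ_ne_zero i)]

lemma gradeSpace_add_gam {k r : Lat (n + 1)} (hr : r ∈ D.gam) :
    D.gradeSpace (k + r) = D.gradeSpace k := by
  have : ∀ i, D.ξ i ^ (k + r) i = D.ξ i ^ k i := fun i => by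
    rw [Pi.add_apply, zpow_add₀ (D.ξ_ne_zero i), (D.ξ_prim i).zpow_eq_one_iff_dvd _ |>.2 (hr i),
      mul_one]
  ext x
  exact forall_congr' fun i => by rw [this i]

lemma form_eq_zero [FiniteDimensional ℂ 𝔤] [LieAlgebra.IsSimple ℂ 𝔤] {k l : Lat (n + 1)} {x y : 𝔤}
    (hx : x ∈ D.gradeSpace k) (hy : y ∈ D.gradeSpace l) (h : k + l ∉ D.gam) :
    D.form x y = 0 := by
  by_contra h0
  refine h fun i => ?_
  have := D.form_σ i x y
  rw [hx i, hy i, map_smul, map_smul, LinearMap.smul_apply, smul_smul, mul_comm, 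
    ← zpow_add₀ (D.ξ_ne_zero i), smul_eq_mul] at this
  exact ((D.ξ_prim i).zpow_eq_one_iff_dvd _).1 (mul_right_cancel₀ h0 (this.trans (one_mul _).symm))

/-- The multiloop algebra `L(𝔤, σ)`. -/
def loopPart : Submodule ℂ (Lat (n + 1) →₀ 𝔤) where
  carrier := {f | ∀ k, f k ∈ D.gradeSpace k}
  add_mem' hf hg k := add_mem (hf k) (hg k)
  zero_mem' _ := zero_mem _
  smul_mem' c _ hf k := Submodule.smul_mem _ c (hf k)

/-- `D(m₀, m) = Der A(m₀, m)`. -/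
def derPart : Submodule ℂ (Lat (n + 1) →₀ (Fin (n + 1) → ℂ)) where
  carrier := {d | ∀ r, r ∉ D.gam → d r = 0}
  add_mem' hf hg r hr := by rw [Finsupp.add_apply, hf r hr, hg r hr, add_zero]
  zero_mem' _ _ := rfl
  smul_mem' c _ hf r hr := by rw [Finsupp.smul_apply, hf r hr, smul_zero]

/-- `Z(m₀, m)`, as a subspace of `Ω_A / dA`: spanned by the `t^r Kᵢ` with `r ∈ Γ₀ ⊕ Γ`. -/
def cenPart : Submodule ℂ (Cen (n + 1)) :=
  Submodule.span ℂ {z | ∃ r ∈ D.gam, ∃ w, z = cenMk r w}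

lemma single_mem_derPart {r : Lat (n + 1)} (h : r ∈ D.gam) (a : Fin (n + 1) → ℂ) :
    Finsupp.single r a ∈ D.derPart := fun _ hs =>
  Finsupp.single_eq_of_ne (fun e => hs (e ▸ h))

lemma single_mem_loopPart {k : Lat (n + 1)} {X : 𝔤} (h : X ∈ D.gradeSpace k) :
    Finsupp.single k X ∈ D.loopPart := fun l => by
  by_cases e : l = k
  · subst e; simpa using h
  · rw [Finsupp.single_eq_of_ne e]; exact zero_mem _

lemma cenMk_mem {r : Lat (n + 1)} (h : r ∈ D.gam) (w : Fin (n + 1) → ℂ) :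
    cenMk r w ∈ D.cenPart := Submodule.subset_span ⟨r, h, w, rfl⟩

lemma brLoop_mem {f g : Lat (n + 1) →₀ 𝔤} (hf : f ∈ D.loopPart) (hg : g ∈ D.loopPart) :
    brLoop f g ∈ D.loopPart :=
  bilExt_mem _ _ _ _ fun k l => D.single_mem_loopPart (D.gradeSpace_lie (hf k) (hg l))

lemma brDerLoop_mem {d : Lat (n + 1) →₀ (Fin (n + 1) → ℂ)} {f : Lat (n + 1) →₀ 𝔤}
    (hd : d ∈ D.derPart) (hf : f ∈ D.loopPart) : brDerLoop d f ∈ D.loopPart := by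
  refine bilExt_mem _ _ _ _ fun r k => ?_
  by_cases h : r ∈ D.gam
  · refine D.single_mem_loopPart ?_
    rw [D.gradeSpace_add_gam h]
    exact Submodule.smul_mem _ _ (hf k)
  · rw [hd r h]; simp

lemma brLoopCen_mem [FiniteDimensional ℂ 𝔤] [LieAlgebra.IsSimple ℂ 𝔤] {f g : Lat (n + 1) →₀ 𝔤}
    (hf : f ∈ D.loopPart) (hg : g ∈ D.loopPart) : brLoopCen D f g ∈ D.cenPart := by
  refine bilExt_mem _ _ _ _ fun k l => ?_
  rw [LinearMap.mk₂_apply]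
  by_cases h : k + l ∈ D.gam
  · exact Submodule.smul_mem _ _ (D.cenMk_mem h _)
  · rw [D.form_eq_zero (hf k) (hg l) h, zero_smul]; exact zero_mem _

lemma brDer_mem {d e : Lat (n + 1) →₀ (Fin (n + 1) → ℂ)} (hd : d ∈ D.derPart)
    (he : e ∈ D.derPart) : brDer d e ∈ D.derPart := by
  refine bilExt_mem _ _ _ _ fun r s => ?_
  rw [LinearMap.mk₂_apply]
  by_cases h : r ∈ D.gam
  · by_cases h' : s ∈ D.gam
    · exact D.single_mem_derPart (add_mem h h') _
    · rw [he s h']; simp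
  · rw [hd r h]; simp

lemma cocycle_mem {d e : Lat (n + 1) →₀ (Fin (n + 1) → ℂ)} (hd : d ∈ D.derPart)
    (he : e ∈ D.derPart) : cocycle D d e ∈ D.cenPart := by
  refine bilExt_mem _ _ _ _ fun r s => ?_
  rw [LinearMap.mk₂_apply]
  by_cases h : r ∈ D.gam
  · by_cases h' : s ∈ D.gam
    · exact Submodule.smul_mem _ _ (D.cenMk_mem (add_mem h h') _)
    · rw [he s h']; simp
  · rw [hd r h]; simp

lemma brDerCen_mem {d : Lat (n + 1) →₀ (Fin (n + 1) → ℂ)} {z : Cen (n + 1)} (hd : d ∈ D.derPart)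
    (hz : z ∈ D.cenPart) : brDerCen d z ∈ D.cenPart := by
  suffices D.cenPart ≤ D.cenPart.comap (brDerCen d) from this hz
  refine Submodule.span_le.2 ?_
  rintro _ ⟨s, hs, w, rfl⟩
  simp only [Submodule.comap_coe, Set.mem_preimage, SetLike.mem_coe]
  change brDerForm d (Finsupp.single s w) ∈ _
  refine bilExt_mem _ _ _ _ fun r k => ?_
  rw [LinearMap.mk₂_apply]
  by_cases h : r ∈ D.gam
  · by_cases h' : k ∈ D.gam
    · exact D.cenMk_mem (add_mem h h') _
    · rw [Finsupp.single_eq_of_ne (fun e : k = s => h' (e.symm ▸ hs))]; simp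
  · rw [hd r h]; simp

variable [FiniteDimensional ℂ 𝔤] [LieAlgebra.IsSimple ℂ 𝔤]

/-- The twisted full toroidal Lie algebra `τ = L(𝔤, σ) ⊕ Z(m₀, m) ⊕ D(m₀, m)`. -/
def tau : LieSubalgebra ℂ (Full D) where
  carrier := {x | x.1 ∈ D.loopPart ∧ x.2.1 ∈ D.cenPart ∧ x.2.2 ∈ D.derPart}
  add_mem' hx hy := ⟨add_mem hx.1 hy.1, add_mem hx.2.1 hy.2.1, add_mem hx.2.2 hy.2.2⟩
  zero_mem' := ⟨zero_mem _, zero_mem _, zero_mem _⟩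
  smul_mem' c _ hx := ⟨Submodule.smul_mem _ c hx.1, Submodule.smul_mem _ c hx.2.1,
    Submodule.smul_mem _ c hx.2.2⟩
  lie_mem' hx hy :=
    ⟨add_mem (D.brLoop_mem hx.1 hy.1) (sub_mem (D.brDerLoop_mem hx.2.2 hy.1)
        (D.brDerLoop_mem hy.2.2 hx.1)),
      add_mem (add_mem (D.brLoopCen_mem hx.1 hy.1) (sub_mem (D.brDerCen_mem hx.2.2 hy.2.1)
        (D.brDerCen_mem hy.2.2 hx.2.1))) (D.cocycle_mem hx.2.2 hy.2.2),
      D.brDer_mem hx.2.2 hy.2.2⟩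

variable {D}

/-- `X t^k ∈ τ` for `X ∈ 𝔤(k̄)`. -/
def xx (k : Lat (n + 1)) (X : 𝔤) (hX : X ∈ D.gradeSpace k) : D.tau :=
  ⟨(Finsupp.single k X, 0, 0), D.single_mem_loopPart hX, zero_mem _, zero_mem _⟩

/-- `t^r Kᵢ ∈ τ` for `r ∈ Γ₀ ⊕ Γ`. -/
def kk (r : Lat (n + 1)) (hr : r ∈ D.gam) (i : Fin (n + 1)) : D.tau :=
  ⟨(0, cenMk r (Pi.single i 1), 0), zero_mem _, D.cenMk_mem hr _, zero_mem _⟩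

/-- `t^r dᵢ ∈ τ` for `r ∈ Γ₀ ⊕ Γ`. -/
def dd (r : Lat (n + 1)) (hr : r ∈ D.gam) (i : Fin (n + 1)) : D.tau :=
  ⟨(0, 0, Finsupp.single r (Pi.single i 1)), zero_mem _, zero_mem _, D.single_mem_derPart hr _⟩

end TwistData
end Twisted
end Toroidal

namespace Toroidal

section RootCombinatorics

variable {E : Type*} [AddCommGroup E] [Module ℂ E]

/-- `Φ` is a root system of type `B_l` whose short roots are `± εᵢ` (with `B₁ = A₁`, all roots of
which count as short). -/
def IsTypeB (Φ : Set E) {l : ℕ} (ε : Module.Basis (Fin l) ℂ E) : Prop :=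
  ∀ α, α ∈ Φ ↔ (∃ i, α = ε i ∨ α = -ε i) ∨
    ∃ i j, i ≠ j ∧ (α = ε i + ε j ∨ α = ε i - ε j ∨ α = -ε i - ε j)

/-- The enlarged set of non-zero roots: `Φ ∪ 2 Φ_short` if `Φ` is of type `B_l`, and `Φ`
otherwise. -/
def enlarge (Φ : Set E) : Set E :=
  Φ ∪ {α | ∃ (l : ℕ) (ε : Module.Basis (Fin l) ℂ E), IsTypeB Φ ε ∧
    ∃ i, α = (2 : ℂ) • ε i ∨ α = -((2 : ℂ) • ε i)}

/-- `P` is a choice of positive roots in `Φ`. -/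
structure IsPositiveSystem (Φ P : Set E) : Prop where
  subset : P ⊆ Φ
  pos_or_neg : ∀ α ∈ Φ, α ∈ P ∨ -α ∈ P
  not_both : ∀ α ∈ P, -α ∉ P
  add_mem : ∀ α ∈ P, ∀ β ∈ P, α + β ∈ Φ → α + β ∈ P

end RootCombinatorics

variable {n : ℕ} {𝔤 : Type*} [LieRing 𝔤] [LieAlgebra ℂ 𝔤]

namespace TwistData

variable (D : TwistData n 𝔤)

/-- `𝔤(0̄, 0̄)`, the subalgebra fixed by all the `σᵢ`. -/
def g00 : LieSubalgebra ℂ 𝔤 where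
  toSubmodule := D.gradeSpace 0
  lie_mem' hx hy := by simpa using D.gradeSpace_lie hx hy

/-- `𝔤(σ₀) = {x | σ₀ x = x}`. -/
def gFix : LieSubalgebra ℂ 𝔤 where
  carrier := {x | D.σ 0 x = x}
  add_mem' {x y} (hx : D.σ 0 x = x) (hy : D.σ 0 y = y) := by
    simp only [Set.mem_ofPred_eq, map_add, hx, hy]
  zero_mem' := map_zero _
  smul_mem' c x (hx : D.σ 0 x = x) := by simp only [Set.mem_ofPred_eq, map_smul, hx]
  lie_mem' {x y} (hx : D.σ 0 x = x) (hy : D.σ 0 y = y) := by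
    change D.σ 0 ⁅x, y⁆ = ⁅x, y⁆
    rw [LieEquiv.map_lie, hx, hy]

variable (H : LieSubalgebra ℂ D.g00)

/-- `𝔞 = {x ∈ 𝔤 | σ₀ x = x, [𝔥(0̄), x] = 0}`. -/
def cent : LieSubalgebra ℂ 𝔤 where
  carrier := {x | D.σ 0 x = x ∧ ∀ h : H, ⁅((h : D.g00) : 𝔤), x⁆ = 0}
  add_mem' hx hy := ⟨D.gFix.add_mem hx.1 hy.1, fun h => by rw [lie_add, hx.2, hy.2, add_zero]⟩
  zero_mem' := ⟨map_zero _, fun h => lie_zero _⟩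
  smul_mem' c x hx := ⟨D.gFix.smul_mem c hx.1, fun h => by rw [lie_smul, hx.2, smul_zero]⟩
  lie_mem' hx hy := ⟨D.gFix.lie_mem hx.1 hy.1, fun h => by
    rw [leibniz_lie, hx.2, hy.2, zero_lie, lie_zero, add_zero]⟩

lemma cent_le_gFix : D.cent H ≤ D.gFix := fun _ hx => hx.1

variable {D}

/-- The `𝔥(0̄)`-weight space `𝔤_α`. -/
def wtSpace (α : Module.Dual ℂ H) : Submodule ℂ 𝔤 where
  carrier := {x | ∀ h : H, ⁅((h : D.g00) : 𝔤), x⁆ = α h • x}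
  add_mem' hx hy h := by rw [lie_add, hx h, hy h, smul_add]
  zero_mem' h := by rw [lie_zero, smul_zero]
  smul_mem' c x hx h := by rw [lie_smul, hx h, smul_comm]

/-- `Δ(𝔤, 𝔥(0̄))`, the set of all weights (zero included). -/
def weights : Set (Module.Dual ℂ H) := {α | wtSpace H α ≠ ⊥}

/-- `Δ₀^×`, the non-zero roots of `𝔤(0̄, 0̄)` with respect to `𝔥(0̄)`. -/
def roots₀ : Set (Module.Dual ℂ H) := {α | α ≠ 0 ∧ D.gradeSpace 0 ⊓ wtSpace H α ≠ ⊥}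

/-- `Δ_{0,en}^×`. -/
def rootsEn : Set (Module.Dual ℂ H) := enlarge (roots₀ H)

/-- The exponent `(0, k)`, i.e. the monomial `t^k` without `t₀`. -/
def emb {N : ℕ} (k : Lat N) : Lat (N + 1) := Fin.cons 0 k

variable (D) in
/-- `Γ = m₁ℤ ⊕ ⋯ ⊕ mₙℤ`. -/
def Γ : AddSubgroup (Lat n) where
  carrier := {r | ∀ i : Fin n, (D.m i.succ : ℤ) ∣ r i}
  add_mem' ha hb i := dvd_add (ha i) (hb i)
  zero_mem' _ := dvd_zero _
  neg_mem' ha i := (dvd_neg).2 (ha i)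

variable (D) in
/-- `Λ = ℤⁿ / Γ`. -/
abbrev Lam : Type := Lat n ⧸ D.Γ

variable (D) in
/-- The class `k̄ ∈ Λ`. -/
def bar (k : Lat n) : D.Lam := QuotientAddGroup.mk k

lemma emb_mem_gam {r : Lat n} (hr : r ∈ D.Γ) : emb r ∈ D.gam := by
  intro i
  induction i using Fin.cases with
  | zero => exact dvd_zero _
  | succ i => exact hr i

variable [FiniteDimensional ℂ 𝔤] [LieAlgebra.IsSimple ℂ 𝔤]

variable (D) in
/-- The degree derivation `dᵢ ∈ τ`. -/
def d (i : Fin (n + 1)) : D.tau := dd 0 (zero_mem _) i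

variable (D) in
/-- The central element `Kᵢ ∈ τ`. -/
def K (i : Fin (n + 1)) : D.tau := kk 0 (zero_mem _) i

/-- `h ∈ 𝔥(0̄)` as an element of `τ`. -/
def hh (h : H) : D.tau := xx 0 ((h : D.g00) : 𝔤) (h : D.g00).2

lemma lie_lie_of_eq {L : Type*} [LieRing L] [LieAlgebra ℂ L] {h x y : L} {a b : ℂ}
    (hx : ⁅h, x⁆ = a • x) (hy : ⁅h, y⁆ = b • y) : ⁅h, ⁅x, y⁆⁆ = (a + b) • ⁅x, y⁆ := by
  rw [leibniz_lie, hx, hy, smul_lie, lie_smul, add_smul]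

variable (D) in
/-- `τ₀`, the centraliser of `d₀`. -/
def tau0 : LieSubalgebra ℂ D.tau where
  carrier := {x | ⁅D.d 0, x⁆ = 0}
  add_mem' {x y} (hx : ⁅D.d 0, x⁆ = 0) (hy : ⁅D.d 0, y⁆ = 0) := by
    change ⁅D.d 0, x + y⁆ = 0
    rw [lie_add, hx, hy, add_zero]
  zero_mem' := lie_zero _
  smul_mem' c x (hx : ⁅D.d 0, x⁆ = 0) := by
    change ⁅D.d 0, c • x⁆ = 0
    rw [lie_smul, hx, smul_zero]
  lie_mem' {x y} (hx : ⁅D.d 0, x⁆ = 0) (hy : ⁅D.d 0, y⁆ = 0) := by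
    change ⁅D.d 0, ⁅x, y⁆⁆ = 0
    rw [leibniz_lie, hx, hy, zero_lie, lie_zero, add_zero]

/-- `τ⁰`, the centraliser of `d₀` and `𝔥(0̄)`; it is `L(𝔞, σ) ⊕ Z⁰(m₀, m) ⊕ D⁰(m₀, m)`. -/
def tauUp0 : LieSubalgebra ℂ D.tau where
  carrier := {x | ⁅D.d 0, x⁆ = 0 ∧ ∀ h : H, ⁅hh H h, x⁆ = 0}
  add_mem' hx hy := ⟨D.tau0.add_mem hx.1 hy.1, fun h => by rw [lie_add, hx.2, hy.2, add_zero]⟩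
  zero_mem' := ⟨lie_zero _, fun h => lie_zero _⟩
  smul_mem' c x hx := ⟨D.tau0.smul_mem c hx.1, fun h => by rw [lie_smul, hx.2, smul_zero]⟩
  lie_mem' hx hy := ⟨D.tau0.lie_mem hx.1 hy.1, fun h => by
    rw [leibniz_lie, hx.2, hy.2, zero_lie, lie_zero, add_zero]⟩

section Modules

variable (V : Type*) [AddCommGroup V] [Module ℂ V] [LieRingModule D.tau V] [LieModule ℂ D.tau V]

variable (D) in
/-- The weight space of `V` for `d₀, …, dₙ` and the weight `lam`. -/
def weightSpace (lam : Fin (n + 1) → ℂ) : Submodule ℂ V where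
  carrier := {v | ∀ i, ⁅D.d i, v⁆ = lam i • v}
  add_mem' hv hw i := by rw [lie_add, hv i, hw i, smul_add]
  zero_mem' i := by rw [lie_zero, smul_zero]
  smul_mem' c v hv i := by rw [lie_smul, hv i, smul_comm]

variable (D) in
/-- The `τ`-module `V` belongs to `𝓑_ψ`, where `ψ : Z(τ) → ℂ` is given by its values on the basis
`K₀, …, Kₙ` of the centre. -/
structure IsBounded (ψ : Fin (n + 1) → ℂ) : Prop where
  isInternal : open Classical in DirectSum.IsInternal (D.weightSpace V)
  finiteDimensional : ∀ lam, FiniteDimensional ℂ (D.weightSpace V lam)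
  central : ∀ i (v : V), ⁅D.K i, v⁆ = ψ i • v
  bounded : ∃ M : ℝ, ∀ (μ : ℂ) (v : V), v ≠ 0 → ⁅D.d 0, v⁆ = μ • v → μ.re ≤ M

variable (D) in
/-- `S = {v | τ₊ v = 0}`, where `τ₊` is the sum of the `τ_q = {x | [d₀, x] = q x}`, `q > 0`. -/
def topS : LieSubmodule ℂ D.tau0 V where
  carrier := {v | ∀ q : ℤ, 0 < q → ∀ x : D.tau, ⁅D.d 0, x⁆ = (q : ℂ) • x → ⁅x, v⁆ = 0}
  add_mem' hv hw q hq x hx := by rw [lie_add, hv q hq x hx, hw q hq x hx, add_zero]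
  zero_mem' q hq x hx := lie_zero _
  smul_mem' c v hv q hq x hx := by rw [lie_smul, hv q hq x hx, smul_zero]
  lie_mem {y v} hv q hq x hx := by
    change ⁅x, ⁅(y : D.tau), v⁆⁆ = 0
    have hy : ⁅D.d 0, (y : D.tau)⁆ = (0 : ℂ) • (y : D.tau) := by rw [zero_smul]; exact y.2
    rw [leibniz_lie, hv q hq x hx, lie_zero, add_zero]
    exact hv q hq _ (by simpa using lie_lie_of_eq hx hy)

/-- `T = {v | τ⁺ v = 0}`, where `τ⁺` is the sum of `τ₊` and of the root spaces of `τ₀` for the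
positive roots `α ∈ P`. -/
def topT (P : Set (Module.Dual ℂ H)) : LieSubmodule ℂ (tauUp0 H) V where
  carrier := {v | v ∈ D.topS V ∧ ∀ α ∈ P, ∀ x : D.tau, ⁅D.d 0, x⁆ = 0 →
    (∀ h : H, ⁅hh H h, x⁆ = α h • x) → ⁅x, v⁆ = 0}
  add_mem' hv hw := ⟨add_mem hv.1 hw.1, fun α hα x h0 hx => by
    rw [lie_add, hv.2 α hα x h0 hx, hw.2 α hα x h0 hx, add_zero]⟩
  zero_mem' := ⟨zero_mem _, fun α hα x h0 hx => lie_zero _⟩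
  smul_mem' c v hv := ⟨Submodule.smul_mem _ c hv.1, fun α hα x h0 hx => by
    rw [lie_smul, hv.2 α hα x h0 hx, smul_zero]⟩
  lie_mem {y v} hv := by
    refine ⟨(D.topS V).lie_mem (x := (⟨y.1, y.2.1⟩ : D.tau0)) hv.1, fun α hα x h0 hx => ?_⟩
    change ⁅x, ⁅(y : D.tau), v⁆⁆ = 0
    rw [leibniz_lie, hv.2 α hα x h0 hx, lie_zero, add_zero]
    refine hv.2 α hα _ (D.tau0.lie_mem h0 y.2.1) fun h => ?_
    have hy : ⁅hh H h, (y : D.tau)⁆ = (0 : ℂ) • (y : D.tau) := by rw [zero_smul]; exact y.2.2 h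
    simpa using lie_lie_of_eq (hx h) hy

end Modules

section TensorModule

variable {W₁ U : Type*} [AddCommGroup W₁] [Module ℂ W₁] [AddCommGroup U] [Module ℂ U]

variable (W₁) in
/-- `⨁_{k ∈ ℤⁿ} W₁ ⊗ U_k̄ ⊗ t^k` for a `Λ`-graded space `U = ⨁ U_λ`. -/
abbrev TensorSpace (gr : D.Lam → Submodule ℂ U) : Type _ :=
  ⨁ k : Lat n, W₁ ⊗[ℂ] gr (D.bar k)

/-- The element `w ⊗ u ⊗ t^k`, for `u ∈ U_k̄`. -/
def mono {gr : D.Lam → Submodule ℂ U} (k : Lat n) (w : W₁) (u : U) (hu : u ∈ gr (D.bar k)) :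
    TensorSpace W₁ gr :=
  DirectSum.of (fun k : Lat n => W₁ ⊗[ℂ] gr (D.bar k)) k (w ⊗ₜ ⟨u, hu⟩)

/-- The representation `ρ` of the subalgebra `𝔱` of `τ` (which will be `τ₀` or `τ⁰`) on
`⨁ₖ W₁ ⊗ U_k̄ ⊗ t^k` is the one given on generators by the formulas below, where `U` is a
`Λ`-graded module of the subalgebra `𝔨` of `𝔤` (which will be `𝔤(σ₀)` or `𝔞`) with action `ρU`.
`D(u, r) = ∑ᵢ uᵢ t^r dᵢ`, and `E_{ji}` is a matrix unit.  The elements below that lie in `𝔱` span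
`𝔱 = τ₀` (for `𝔨 = 𝔤(σ₀)`) and `𝔱 = τ⁰` (for `𝔨 = 𝔞`), so that they determine `ρ`. -/
structure IsTensorAction (𝔱 : LieSubalgebra ℂ D.tau) (𝔨 : LieSubalgebra ℂ 𝔤)
    [LieRingModule (Matrix (Fin n) (Fin n) ℂ) W₁] (gr : D.Lam → Submodule ℂ U)
    (ρU : 𝔨 →ₗ⁅ℂ⁆ Module.End ℂ U) (α : Fin n → ℂ) (d C₀ : ℂ)
    (ρ : 𝔱 →ₗ⁅ℂ⁆ Module.End ℂ (TensorSpace W₁ gr)) : Prop where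
  der : ∀ (r : Lat n) (hr : r ∈ D.Γ) (u : Fin n → ℂ) (x : 𝔱),
    (x : D.tau) = ∑ i : Fin n, u i • dd (emb r) (emb_mem_gam hr) i.succ →
    ∀ (k : Lat n) (w : W₁) (v : U) (hv : v ∈ gr (D.bar k)), ∃ hv' : v ∈ gr (D.bar (k + r)),
      ρ x (mono k w v hv) = mono (k + r)
        ((∑ i, u i * (k i + α i)) • w +
          ∑ i, ∑ j, (u i * r j) • ⁅(Matrix.single j i 1 : Matrix (Fin n) (Fin n) ℂ), w⁆) v hv'
  loop : ∀ (l : Lat n) (X : 𝔤) (hX : X ∈ D.gradeSpace (emb l)) (hX' : X ∈ 𝔨) (x : 𝔱),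
    (x : D.tau) = xx (emb l) X hX →
    ∀ (k : Lat n) (w : W₁) (v : U) (hv : v ∈ gr (D.bar k)),
      ∃ hv' : ρU ⟨X, hX'⟩ v ∈ gr (D.bar (k + l)),
      ρ x (mono k w v hv) = mono (k + l) w (ρU ⟨X, hX'⟩ v) hv'
  der₀ : ∀ (r : Lat n) (hr : r ∈ D.Γ) (x : 𝔱), (x : D.tau) = dd (emb r) (emb_mem_gam hr) 0 →
    ∀ (k : Lat n) (w : W₁) (v : U) (hv : v ∈ gr (D.bar k)), ∃ hv' : v ∈ gr (D.bar (k + r)),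
      ρ x (mono k w v hv) = mono (k + r) (d • w) v hv'
  cen₀ : ∀ (r : Lat n) (hr : r ∈ D.Γ) (x : 𝔱), (x : D.tau) = kk (emb r) (emb_mem_gam hr) 0 →
    ∀ (k : Lat n) (w : W₁) (v : U) (hv : v ∈ gr (D.bar k)), ∃ hv' : v ∈ gr (D.bar (k + r)),
      ρ x (mono k w v hv) = mono (k + r) (C₀ • w) v hv'
  cen : ∀ (r : Lat n) (hr : r ∈ D.Γ) (p : Fin n) (x : 𝔱),
    (x : D.tau) = kk (emb r) (emb_mem_gam hr) p.succ →
    ∀ (k : Lat n) (w : W₁) (v : U) (hv : v ∈ gr (D.bar k)), ρ x (mono k w v hv) = 0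

end TensorModule

/-- A choice of a finite dimensional irreducible `𝔤𝔩ₙ`-module `W₁`, a finite dimensional `Λ`-graded
irreducible `𝔞`-module `W₂ = ⨁ W_{2,λ}`, a vector `α ∈ ℂⁿ` and a scalar `d` (by which `d₀` acts). -/
structure TopData (H : LieSubalgebra ℂ D.g00) where
  W₁ : Type
  [addCommGroup₁ : AddCommGroup W₁]
  [module₁ : Module ℂ W₁]
  [lieRingModule₁ : LieRingModule (Matrix (Fin n) (Fin n) ℂ) W₁]
  [lieModule₁ : LieModule ℂ (Matrix (Fin n) (Fin n) ℂ) W₁]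
  finiteDimensional₁ : FiniteDimensional ℂ W₁
  irreducible₁ : LieModule.IsIrreducible ℂ (Matrix (Fin n) (Fin n) ℂ) W₁
  W₂ : Type
  [addCommGroup₂ : AddCommGroup W₂]
  [module₂ : Module ℂ W₂]
  [lieRingModule₂ : LieRingModule (D.cent H) W₂]
  [lieModule₂ : LieModule ℂ (D.cent H) W₂]
  finiteDimensional₂ : FiniteDimensional ℂ W₂
  gr : D.Lam → Submodule ℂ W₂
  isInternal : open Classical in DirectSum.IsInternal gr
  lie_mem_gr : ∀ (l : Lat n) (x : D.cent H), (x : 𝔤) ∈ D.gradeSpace (emb l) →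
    ∀ (lam : D.Lam), ∀ w ∈ gr lam, ⁅x, w⁆ ∈ gr (D.bar l + lam)
  nontrivial₂ : Nontrivial W₂
  irreducible₂ : ∀ N : LieSubmodule ℂ (D.cent H) W₂,
    N.toSubmodule ≤ ⨆ lam, N.toSubmodule ⊓ gr lam → N = ⊥ ∨ N = ⊤
  α : Fin n → ℂ
  d : ℂ

attribute [instance] TopData.addCommGroup₁ TopData.module₁ TopData.lieRingModule₁
  TopData.lieModule₁ TopData.addCommGroup₂ TopData.module₂ TopData.lieRingModule₂
  TopData.lieModule₂

section Induced

variable {H} (E : TopData H) (P : Set (Module.Dual ℂ H))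

variable (D) in
/-- `U(𝔤(σ₀))`. -/
abbrev UFix : Type _ := UniversalEnvelopingAlgebra ℂ D.gFix

/-- The relations of the induced module `U(𝔤(σ₀)) ⊗_{U(𝔞 ⊕ 𝔤(σ₀)₊)} W₂` inside
`U(𝔤(σ₀)) ⊗_ℂ W₂`, where `𝔤(σ₀)₊ = ⨁_{α ∈ P} 𝔤(σ₀)_α` acts on `W₂` by zero. -/
def indRel : Submodule D.UFix (D.UFix ⊗[ℂ] E.W₂) :=
  Submodule.span D.UFix
    ({y | ∃ (x : D.cent H) (w : E.W₂),
        y = UniversalEnvelopingAlgebra.ι ℂ (⟨x, D.cent_le_gFix H x.2⟩ : D.gFix) ⊗ₜ[ℂ] w -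
          1 ⊗ₜ[ℂ] ⁅x, w⁆} ∪
     {y | ∃ α ∈ P, ∃ (x : D.gFix) (w : E.W₂), (x : 𝔤) ∈ wtSpace H α ∧
        y = UniversalEnvelopingAlgebra.ι ℂ x ⊗ₜ[ℂ] w})

/-- The induced module `U(𝔤(σ₀)) ⊗_{U(𝔞 ⊕ 𝔤(σ₀)₊)} W₂`. -/
abbrev Ind : Type _ := (D.UFix ⊗[ℂ] E.W₂) ⧸ indRel E P

/-- Homogeneous elements `x₁ ⋯ x_p ⊗ w` of the induced module, of degree
`deg x₁ + ⋯ + deg x_p + deg w ∈ Λ`. -/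
inductive IsHomog : D.Lam → Ind E P → Prop
  | base (lam : D.Lam) (w : E.W₂) (hw : w ∈ E.gr lam) :
      IsHomog lam (Submodule.Quotient.mk (1 ⊗ₜ[ℂ] w))
  | act (l : Lat n) (lam : D.Lam) (x : D.gFix) (hx : (x : 𝔤) ∈ D.gradeSpace (emb l))
      (y : Ind E P) (hy : IsHomog lam y) :
      IsHomog (D.bar l + lam) (UniversalEnvelopingAlgebra.ι ℂ x • y)

/-- The `Λ`-grading of the induced module. -/
def indGr (lam : D.Lam) : Submodule ℂ (Ind E P) := Submodule.span ℂ {y | IsHomog E P lam y}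

/-- The sum of all proper `Λ`-graded submodules of the induced module. -/
def maxGraded : Submodule D.UFix (Ind E P) :=
  sSup {N | N ≠ ⊤ ∧ N.restrictScalars ℂ ≤ ⨆ lam, N.restrictScalars ℂ ⊓ indGr E P lam}

/-- `W₂(σ₀)`, the unique `Λ`-graded irreducible quotient of the induced module. -/
abbrev W₂σ : Type _ := Ind E P ⧸ maxGraded E P

/-- The `Λ`-grading `W₂(σ₀) = ⨁ W₂(σ₀)_λ`. -/
def grσ (lam : D.Lam) : Submodule ℂ (W₂σ E P) :=
  (indGr E P lam).map ((maxGraded E P).mkQ.restrictScalars ℂ)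

/-- The action of `𝔤(σ₀)` on `W₂(σ₀)`. -/
def actσ : D.gFix →ₗ⁅ℂ⁆ Module.End ℂ (W₂σ E P) :=
  (AlgHom.toLieHom (Algebra.lsmul ℂ ℂ (W₂σ E P) : D.UFix →ₐ[ℂ] Module.End ℂ (W₂σ E P))).comp
    (UniversalEnvelopingAlgebra.ι ℂ)

variable (V : Type*) [AddCommGroup V] [Module ℂ V] [LieRingModule D.tau V] [LieModule ℂ D.tau V]

/-- `T` is isomorphic, as a `τ⁰`-module, to `T' = ⨁ₖ W₁ ⊗ W_{2,k̄} ⊗ t^k`. -/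
def TopTIso (C₀ : ℂ) : Prop :=
  ∃ ρ : tauUp0 H →ₗ⁅ℂ⁆ Module.End ℂ (TensorSpace E.W₁ E.gr),
    IsTensorAction (tauUp0 H) (D.cent H) E.gr (LieModule.toEnd ℂ (D.cent H) E.W₂) E.α E.d C₀ ρ ∧
    ∃ e : topT H V P ≃ₗ[ℂ] TensorSpace E.W₁ E.gr, ∀ x v, e ⁅x, v⁆ = ρ x (e v)

/-- `S` is isomorphic, as a `τ₀`-module, to `S' = ⨁ₖ W₁ ⊗ W₂(σ₀)_k̄ ⊗ t^k`. -/
def TopSIso (C₀ : ℂ) : Prop :=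
  ∃ ρ : D.tau0 →ₗ⁅ℂ⁆ Module.End ℂ (TensorSpace E.W₁ (grσ E P)),
    IsTensorAction D.tau0 D.gFix (grσ E P) (actσ E P) E.α E.d C₀ ρ ∧
    ∃ e : D.topS V ≃ₗ[ℂ] TensorSpace E.W₁ (grσ E P), ∀ x v, e ⁅x, v⁆ = ρ x (e v)

end Induced
end TwistData
end Toroidal

end

noncomputable section

namespace Toroidal

open Module (End)

section LinearAlgebra

variable {M : Type*} [AddCommGroup M] [Module ℂ M]

/-- A commuting family of operators preserving a nonzero finite dimensional subspace has a joint
eigenvector in it. -/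
lemma exists_joint_eigenvector (C : Set (End ℂ M)) (hC : ∀ u ∈ C, ∀ v ∈ C, u * v = v * u)
    (W : Submodule ℂ M) [FiniteDimensional ℂ W] (hW : W ≠ ⊥) (hst : ∀ u ∈ C, W ≤ W.comap u) :
    ∃ v ∈ W, v ≠ 0 ∧ ∀ u ∈ C, ∃ c : ℂ, u v = c • v := by
  let 𝒩 : Set (Submodule ℂ M) := {N | N ≤ W ∧ N ≠ ⊥ ∧ ∀ u ∈ C, N ≤ N.comap u}
  have hne : 𝒩.Nonempty := ⟨W, le_rfl, hW, hst⟩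
  let N := Function.argminOn (fun N : Submodule ℂ M => Module.finrank ℂ N) 𝒩 hne
  have hN : N ∈ 𝒩 := Function.argminOn_mem _ _ _
  have hmin : ∀ N' ∈ 𝒩, Module.finrank ℂ N ≤ Module.finrank ℂ N' := fun N' h =>
    Function.argminOn_le (fun N : Submodule ℂ M => Module.finrank ℂ N) 𝒩 h
  obtain ⟨hNW, hN0, hNst⟩ := hN
  obtain ⟨v, hvN, hv0⟩ := (Submodule.ne_bot_iff _).1 hN0
  refine ⟨v, hNW hvN, hv0, fun u hu => ?_⟩
  have : FiniteDimensional ℂ N := Submodule.finiteDimensional_of_le hNW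
  have : Nontrivial N := Submodule.nontrivial_iff_ne_bot.2 hN0
  obtain ⟨c, hc⟩ := Module.End.exists_eigenvalue (u.restrict (hNst u hu))
  obtain ⟨w, hw, hw0⟩ := hc.exists_hasEigenvector
  have hw' : u w = c • (w : M) := congrArg Subtype.val (Module.End.mem_eigenspace_iff.1 hw)
  have h1 : N ⊓ End.eigenspace u c ∈ 𝒩 := by
    refine ⟨inf_le_left.trans hNW, ?_, fun x hx y hy => ⟨hNst x hx hy.1, ?_⟩⟩
    · refine (Submodule.ne_bot_iff _).2 ⟨w, ⟨w.2, Module.End.mem_eigenspace_iff.2 hw'⟩, ?_⟩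
      simpa using hw0
    · have h3 := Module.End.mem_eigenspace_iff.1 hy.2
      refine Module.End.mem_eigenspace_iff.2 ?_
      have h4 := LinearMap.congr_fun (hC u hu x hx) y
      rw [Module.End.mul_apply, Module.End.mul_apply, h3, map_smul] at h4
      exact h4
  have h2 : N ⊓ End.eigenspace u c = N :=
    Submodule.eq_of_le_of_finrank_le inf_le_left (hmin _ h1)
  exact ⟨c, Module.End.mem_eigenspace_iff.1 (h2.ge hvN).2⟩

/-- Commuting nilpotent operators preserving a nonzero finite dimensional subspace kill a nonzero
vector in it. -/
lemma exists_joint_kernel (C : Set (End ℂ M)) (hC : ∀ u ∈ C, ∀ v ∈ C, u * v = v * u)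
    (W : Submodule ℂ M) [FiniteDimensional ℂ W] (hW : W ≠ ⊥) (hst : ∀ u ∈ C, W ≤ W.comap u)
    (hnil : ∀ u ∈ C, ∀ v ∈ W, ∃ k : ℕ, (u ^ k) v = 0) :
    ∃ v ∈ W, v ≠ 0 ∧ ∀ u ∈ C, u v = 0 := by
  obtain ⟨v, hv, hv0, h⟩ := exists_joint_eigenvector C hC W hW hst
  refine ⟨v, hv, hv0, fun u hu => ?_⟩
  obtain ⟨c, hc⟩ := h u hu
  obtain ⟨k, hk⟩ := hnil u hu v hv
  have : ∀ j : ℕ, (u ^ j) v = c ^ j • v := fun j => by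
    induction j with
    | zero => simp
    | succ j ih => rw [pow_succ', Module.End.mul_apply, ih, map_smul, hc, smul_smul, pow_succ]
  rw [this k, smul_eq_zero_iff_left hv0] at hk
  rw [hc, eq_zero_of_pow_eq_zero hk, zero_smul]

lemma pow_mul_eq_of_commutator {R : Type*} [Ring R] {a x w : R} (h : a * x = x * a + w)
    (hw : a * w = w * a) (k : ℕ) : a ^ (k + 1) * x = x * a ^ (k + 1) + (k + 1 : ℕ) • (w * a ^ k) := by
  have hwk : ∀ k, a ^ k * w = w * a ^ k := fun k => (Commute.pow_left (show Commute a w from hw) k)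
  induction k with
  | zero => simp [h]
  | succ k ih =>
    rw [pow_succ', mul_assoc, ih, mul_add, ← mul_assoc, h, add_mul, mul_smul_comm,
      ← mul_assoc a w, hw, mul_assoc x a, ← pow_succ', mul_assoc w a, ← pow_succ',
      succ_nsmul _ (k + 1)]
    abel

lemma exists_pow_eq_zero_of_fg {a : End ℂ M} {W : Submodule ℂ M} (hW : W.FG)
    (h : ∀ v ∈ W, ∃ k : ℕ, (a ^ k) v = 0) : ∃ k : ℕ, ∀ v ∈ W, (a ^ k) v = 0 := by
  obtain ⟨s, hs⟩ := hW
  have h' : ∀ v : s, ∃ k : ℕ, (a ^ k) v = 0 := fun v => h v (hs ▸ Submodule.subset_span v.2)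
  choose k hk using h'
  refine ⟨∑ v, k v, fun v hv => ?_⟩
  rw [← hs] at hv
  induction hv using Submodule.span_induction with
  | mem x hx =>
    have : k ⟨x, hx⟩ ≤ ∑ v, k v := Finset.single_le_sum (f := k) (fun _ _ => Nat.zero_le _)
      (Finset.mem_univ (⟨x, hx⟩ : s))
    obtain ⟨j, hj⟩ := Nat.exists_eq_add_of_le' this
    rw [hj, pow_add, Module.End.mul_apply, hk ⟨x, hx⟩, map_zero]
  | zero => simp
  | add x y _ _ hx hy => rw [map_add, hx, hy, add_zero]
  | smul c x _ hx => rw [map_smul, hx, smul_zero]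

lemma genEig_stable {u x : End ℂ M} {c : ℂ}
    (hw : u * (u * x - x * u) = (u * x - x * u) * u) {v : M}
    (hv : ∃ k : ℕ, ((u - c • 1) ^ k) v = 0) : ∃ k : ℕ, ((u - c • 1) ^ k) (x v) = 0 := by
  obtain ⟨k, hk⟩ := hv
  refine ⟨k + 1, ?_⟩
  have h1 : (u - c • 1) * x = x * (u - c • 1) + (u * x - x * u) := by
    simp only [sub_mul, mul_sub, smul_mul_assoc, one_mul, mul_smul_comm, mul_one]; abel
  have h2 : (u - c • 1) * (u * x - x * u) = (u * x - x * u) * (u - c • 1) := by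
    rw [sub_mul, hw, mul_sub (u * x - x * u) u, smul_mul_assoc, one_mul, mul_smul_comm, mul_one]
  have := LinearMap.congr_fun (pow_mul_eq_of_commutator h1 h2 k) v
  rw [Module.End.mul_apply] at this
  rw [this, LinearMap.add_apply, LinearMap.smul_apply, Module.End.mul_apply, Module.End.mul_apply,
    hk, pow_succ', Module.End.mul_apply, hk]
  simp

/-- A commuting space `C` of operators which preserve the finite dimensional pieces `W k` and which
is normalised, up to commuting factors, by an irreducible set of operators, consists of scalars. -/
lemma eq_smul_one_of_normalized {ι : Type*} [Nontrivial M] (W : ι → Submodule ℂ M)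
    (hWtop : ⨆ k, W k = ⊤) [∀ k, FiniteDimensional ℂ (W k)] (C : Submodule ℂ (End ℂ M))
    (hC : ∀ u ∈ C, ∀ v ∈ C, u * v = v * u) (hCW : ∀ u ∈ C, ∀ k, W k ≤ (W k).comap u)
    (X : Set (End ℂ M))
    (hirr : ∀ N : Submodule ℂ M, (∀ x ∈ X, N ≤ N.comap x) → N = ⊥ ∨ N = ⊤)
    (hX : ∀ x ∈ X, (∀ u ∈ C, u * x = x * u) ∨ ∃ g y : End ℂ M, x = g * y ∧
      (∀ u ∈ C, u * g = g * u) ∧ (∀ k, W k ≤ (W k).comap y) ∧ ∀ u ∈ C, u * y - y * u ∈ C)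
    {u : End ℂ M} (hu : u ∈ C) : ∃ c : ℂ, u = c • 1 := by
  obtain ⟨k₀, hk₀⟩ : ∃ k, W k ≠ ⊥ := by
    by_contra! h
    simp only [h, iSup_bot] at hWtop
    exact bot_ne_top hWtop
  have hcomm : ∀ x ∈ X, ∀ u ∈ C, u * (u * x - x * u) = (u * x - x * u) * u := by
    intro x hx u hu
    rcases hX x hx with h | ⟨g, y, rfl, hg, -, hy⟩
    · rw [h u hu, sub_self, mul_zero, zero_mul]
    · have : u * (g * y) - g * y * u = g * (u * y - y * u) := by
        rw [← mul_assoc, hg u hu]; noncomm_ring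
      rw [this, ← mul_assoc, hg u hu, mul_assoc, hC u hu _ (hy u hu), mul_assoc]
  have step1 : ∀ u ∈ C, ∃ c : ℂ, ∀ v, ∃ k : ℕ, ((u - c • 1) ^ k) v = 0 := by
    intro u hu
    obtain ⟨v, hv, hv0, h⟩ := exists_joint_eigenvector {u} (by simp) (W k₀) hk₀
      (by simpa using hCW u hu k₀)
    obtain ⟨c, hc⟩ := h u rfl
    refine ⟨c, ?_⟩
    let N : Submodule ℂ M :=
      { carrier := {v | ∃ k : ℕ, ((u - c • 1) ^ k) v = 0}
        add_mem' := by
          rintro a b ⟨i, hi⟩ ⟨j, hj⟩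
          refine ⟨i + j, ?_⟩
          rw [map_add]
          nth_rewrite 1 [add_comm i j]
          rw [pow_add, pow_add, Module.End.mul_apply, Module.End.mul_apply, hi, hj]
          simp
        zero_mem' := ⟨0, by simp⟩
        smul_mem' := by
          rintro a b ⟨i, hi⟩
          exact ⟨i, by rw [map_smul, hi, smul_zero]⟩ }
    have hN : N = ⊤ := by
      refine (hirr N fun x hx v hv => genEig_stable (hcomm x hx u hu) hv).resolve_left ?_
      refine (Submodule.ne_bot_iff _).2 ⟨v, ⟨1, ?_⟩, hv0⟩
      simp [hc]
    exact fun v => hN.ge (Submodule.mem_top (x := v))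
  have step2 : ∀ u ∈ C, ∀ y : End ℂ M, (∀ k, W k ≤ (W k).comap y) → u * y - y * u ∈ C →
      ∀ v, ∃ k : ℕ, ((u * y - y * u) ^ k) v = 0 := by
    intro u hu y hyW hy v
    obtain ⟨c, hc⟩ := step1 u hu
    obtain ⟨c', hc'⟩ := step1 _ hy
    suffices h0 : c' = 0 by simpa [h0] using hc' v
    by_contra hne
    have hinj : ∀ v, (u * y - y * u) v = 0 → v = 0 := by
      intro v hv
      obtain ⟨k, hk⟩ := hc' v
      have h1 : ∀ j : ℕ, ((u * y - y * u - c' • 1) ^ j) v = (-c') ^ j • v := fun j => by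
        induction j with
        | zero => simp
        | succ j ih =>
          rw [pow_succ', Module.End.mul_apply, ih, map_smul, LinearMap.sub_apply, hv,
            LinearMap.smul_apply, Module.End.one_apply, zero_sub, ← neg_smul, smul_smul, pow_succ]
      rw [h1 k] at hk
      exact (smul_eq_zero.1 hk).resolve_left (pow_ne_zero _ (neg_ne_zero.2 hne))
    have hFG : (W k₀).FG := (Submodule.fg_iff_finiteDimensional _).2 inferInstance
    obtain ⟨k, hk⟩ := exists_pow_eq_zero_of_fg (a := u - c • 1) hFG fun v _ => hc v
    have h1 : (u - c • 1) * y = y * (u - c • 1) + (u * y - y * u) := by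
      simp only [sub_mul, mul_sub, smul_mul_assoc, one_mul, mul_smul_comm, mul_one]; abel
    have h2 : (u - c • 1) * (u * y - y * u) = (u * y - y * u) * (u - c • 1) := by
      rw [sub_mul, hC u hu _ hy, mul_sub (u * y - y * u) u, smul_mul_assoc, one_mul,
        mul_smul_comm, mul_one]
    have hall : ∀ j : ℕ, (∀ v ∈ W k₀, ((u - c • 1) ^ j) v = 0) → W k₀ = ⊥ := by
      intro j
      induction j with
      | zero => exact fun h => (Submodule.eq_bot_iff _).2 fun v hv => by simpa using h v hv
      | succ j ih =>
        intro h
        refine ih fun v hv => ?_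
        have h3 := LinearMap.congr_fun (pow_mul_eq_of_commutator h1 h2 j) v
        rw [Module.End.mul_apply, h _ (hyW k₀ hv), LinearMap.add_apply, Module.End.mul_apply,
          h v hv, map_zero, zero_add, LinearMap.smul_apply, Module.End.mul_apply, eq_comm,
          ← Nat.cast_smul_eq_nsmul ℂ] at h3
        exact hinj _ ((smul_eq_zero.1 h3).resolve_left (by exact_mod_cast Nat.succ_ne_zero j))
    exact hk₀ (hall k hk)
  let C₀ : Set (End ℂ M) := {a | ∃ u ∈ C, ∃ c : ℂ, a = u - c • 1 ∧ ∀ v, ∃ k : ℕ, (a ^ k) v = 0}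
  let K : Submodule ℂ M := ⨅ a ∈ C₀, LinearMap.ker a
  have hK : K = ⊤ := by
    refine (hirr K ?_).resolve_left ?_
    · intro x hx v hv
      simp only [K, Submodule.mem_iInf, Submodule.mem_comap, LinearMap.mem_ker] at hv ⊢
      rintro _ ⟨u, hu, c, rfl, hnil⟩
      have hv1 := hv _ ⟨u, hu, c, rfl, hnil⟩
      rw [LinearMap.sub_apply, LinearMap.smul_apply, Module.End.one_apply, sub_eq_zero] at hv1
      rw [LinearMap.sub_apply, LinearMap.smul_apply, Module.End.one_apply, sub_eq_zero]
      rcases hX x hx with h | ⟨g, y, rfl, hg, hyW, hy⟩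
      · rw [← Module.End.mul_apply, h u hu, Module.End.mul_apply, hv1, map_smul]
      · have hv2 := hv _ ⟨_, hy u hu, 0, by simp, step2 u hu y hyW (hy u hu)⟩
        rw [LinearMap.sub_apply, sub_eq_zero, Module.End.mul_apply, Module.End.mul_apply, hv1,
          map_smul] at hv2
        rw [Module.End.mul_apply, ← Module.End.mul_apply, hg u hu, Module.End.mul_apply, hv2,
          map_smul]
    · have hcomm₀ : ∀ u ∈ C₀, ∀ v ∈ C₀, u * v = v * u := by
        rintro _ ⟨u, hu, c, rfl, -⟩ _ ⟨u', hu', c', rfl, -⟩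
        simp only [sub_mul, mul_sub, smul_mul_assoc, one_mul, mul_smul_comm, mul_one,
          hC u hu u' hu']
        rw [smul_sub, smul_sub, smul_comm c c']
        abel
      have hst₀ : ∀ u ∈ C₀, W k₀ ≤ (W k₀).comap u := by
        rintro _ ⟨u, hu, c, rfl, -⟩ v hv
        exact (W k₀).sub_mem (hCW u hu k₀ hv) ((W k₀).smul_mem c hv)
      have hnil₀ : ∀ u ∈ C₀, ∀ v ∈ W k₀, ∃ k : ℕ, (u ^ k) v = 0 := by
        rintro _ ⟨u, hu, c, rfl, h⟩ v _
        exact h v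
      obtain ⟨v, -, hv0, hv⟩ := exists_joint_kernel C₀ hcomm₀ (W k₀) hk₀ hst₀ hnil₀
      refine (Submodule.ne_bot_iff _).2 ⟨v, ?_, hv0⟩
      simpa [K, Submodule.mem_iInf] using hv
  obtain ⟨c, hc⟩ := step1 u hu
  refine ⟨c, LinearMap.ext fun v => ?_⟩
  have : v ∈ K := hK ▸ Submodule.mem_top
  simp only [K, Submodule.mem_iInf, LinearMap.mem_ker] at this
  exact sub_eq_zero.1 (this (u - c • 1) ⟨u, hu, c, rfl, hc⟩)

/-- If `L` is spanned by `Lm ∪ L₀ ∪ Lp`, the submodule generated by a space `N` of highest weight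
vectors is contained in the sum of `N` and any space `F` of lower vectors. -/
lemma lieSpan_le_sup {L : Type*} [LieRing L] [LieAlgebra ℂ L] [LieRingModule L M] [LieModule ℂ L M]
    {Lm L₀ Lp : Set L} (hL : Submodule.span ℂ (Lm ∪ L₀ ∪ Lp) = ⊤) (N F : Submodule ℂ M)
    (hpN : ∀ x ∈ Lp, ∀ v ∈ N, ⁅x, v⁆ = 0) (h0N : ∀ x ∈ L₀, ∀ v ∈ N, ⁅x, v⁆ ∈ N)
    (hmN : ∀ x ∈ Lm, ∀ v ∈ N, ⁅x, v⁆ ∈ F) (h0F : ∀ x ∈ L₀, ∀ v ∈ F, ⁅x, v⁆ ∈ F)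
    (hmF : ∀ x ∈ Lm, ∀ v ∈ F, ⁅x, v⁆ ∈ F) :
    (LieSubmodule.lieSpan ℂ L (N : Set M)).toSubmodule ≤ N ⊔ F := by
  let 𝒬 : Set (Submodule ℂ M) := {Q | N ≤ Q ∧ ∀ x ∈ Lm ∪ L₀, ∀ v ∈ Q, ⁅x, v⁆ ∈ Q}
  let Q : Submodule ℂ M := sInf 𝒬
  have hNQ : N ≤ Q := le_sInf fun _ h => h.1
  have hQ : ∀ x ∈ Lm ∪ L₀, ∀ v ∈ Q, ⁅x, v⁆ ∈ Q := fun x hx v hv =>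
    Submodule.mem_sInf.2 fun Q' hQ' => hQ'.2 x hx v (Submodule.mem_sInf.1 hv Q' hQ')
  let Q' : Submodule ℂ M :=
    { carrier := {v | v ∈ Q ∧ ∀ x : L, ⁅x, v⁆ ∈ Q}
      add_mem' := fun ha hb => ⟨add_mem ha.1 hb.1, fun x => by
        rw [lie_add]; exact add_mem (ha.2 x) (hb.2 x)⟩
      zero_mem' := ⟨zero_mem _, fun x => by rw [lie_zero]; exact zero_mem _⟩
      smul_mem' := fun c v hv => ⟨Submodule.smul_mem _ _ hv.1, fun x => by
        rw [lie_smul]; exact Submodule.smul_mem _ _ (hv.2 x)⟩ }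
  have hspan : ∀ v ∈ Q, (∀ x ∈ Lp, ⁅x, v⁆ ∈ Q) → ∀ x : L, ⁅x, v⁆ ∈ Q := by
    intro v hv hp x
    have hx : x ∈ Submodule.span ℂ (Lm ∪ L₀ ∪ Lp) := hL ▸ Submodule.mem_top
    induction hx using Submodule.span_induction with
    | mem x hx =>
      rcases hx with hx | hx
      · exact hQ x hx v hv
      · exact hp x hx
    | zero => rw [zero_lie]; exact zero_mem _
    | add x y _ _ hx hy => rw [add_lie]; exact add_mem hx hy
    | smul c x _ hx => rw [smul_lie]; exact Submodule.smul_mem _ _ hx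
  have hQ' : Q ≤ Q' := by
    refine sInf_le ⟨fun v hv => ⟨hNQ hv, hspan v (hNQ hv) fun x hx => ?_⟩, fun y hy v hv => ?_⟩
    · rw [hpN x hx v hv]; exact zero_mem _
    · refine ⟨hQ y hy v hv.1, hspan _ (hQ y hy v hv.1) fun x _ => ?_⟩
      rw [leibniz_lie]
      exact add_mem (hv.2 _) (hQ y hy _ (hv.2 x))
  let QL : LieSubmodule ℂ L M := { Q with lie_mem := fun {x v} hv => (hQ' hv).2 x }
  have h1 : LieSubmodule.lieSpan ℂ L (N : Set M) ≤ QL := LieSubmodule.lieSpan_le.2 hNQ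
  have h2 : Q ≤ N ⊔ F := by
    refine sInf_le ⟨le_sup_left, fun x hx v hv => ?_⟩
    obtain ⟨a, ha, b, hb, rfl⟩ := Submodule.mem_sup.1 hv
    rw [lie_add]
    rcases hx with hx | hx
    · exact Submodule.mem_sup_right (add_mem (hmN x hx a ha) (hmF x hx b hb))
    · exact add_mem (Submodule.mem_sup_left (h0N x hx a ha)) (Submodule.mem_sup_right (h0F x hx b hb))
  exact le_trans (show _ ≤ Q from h1) h2

/-- In a sum of eigenspaces of `T`, a `T`-stable subspace contains eigencomponents. -/
lemma eigencomponent_mem {T : End ℂ M} {N : Submodule ℂ M} (hN : N ≤ N.comap T) {a f : M} {μ : ℂ}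
    (ha : T a = μ • a) (hf : f ∈ ⨆ c, ⨆ (_ : c ≠ μ), End.eigenspace T c) (h : a + f ∈ N) :
    a ∈ N := by
  let T' : End ℂ (M ⧸ N) := N.mapQ N T hN
  have h1 : N.mkQ a ∈ End.eigenspace T' μ := by
    rw [End.mem_eigenspace_iff, ← map_smul, ← ha]; rfl
  have h2 : N.mkQ f ∈ ⨆ c, ⨆ (_ : c ≠ μ), End.eigenspace T' c := by
    have h3 : (⨆ c, ⨆ (_ : c ≠ μ), End.eigenspace T c) ≤
        (⨆ c, ⨆ (_ : c ≠ μ), End.eigenspace T' c).comap N.mkQ := by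
      refine iSup₂_le fun c hc v hv => ?_
      refine Submodule.mem_iSup_of_mem c (Submodule.mem_iSup_of_mem hc ?_)
      rw [End.mem_eigenspace_iff, ← map_smul, ← End.mem_eigenspace_iff.1 hv]; rfl
    exact h3 hf
  have h3 : N.mkQ a = - N.mkQ f := by
    rw [eq_neg_iff_add_eq_zero, ← map_add]
    exact (Submodule.Quotient.mk_eq_zero _).2 h
  have := (End.eigenspaces_iSupIndep T' μ).le_bot ⟨h1, h3 ▸ neg_mem h2⟩
  simpa using this

/-- An eigenvector in the span of a set of eigenvectors is in the span of those with the same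
eigenvalue. -/
lemma mem_span_eigenvectors {T : End ℂ M} {B : Set M} (hB : ∀ b ∈ B, ∃ c : ℂ, T b = c • b) {x : M}
    (hx : x ∈ Submodule.span ℂ B) {μ : ℂ} (hμ : T x = μ • x) :
    x ∈ Submodule.span ℂ {b ∈ B | T b = μ • b} := by
  have h1 : Submodule.span ℂ B ≤ Submodule.span ℂ {b ∈ B | T b = μ • b} ⊔
      ⨆ c, ⨆ (_ : c ≠ μ), End.eigenspace T c := by
    refine Submodule.span_le.2 fun b hb => ?_
    obtain ⟨c, hc⟩ := hB b hb
    by_cases h : c = μ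
    · exact Submodule.mem_sup_left (Submodule.subset_span ⟨hb, h ▸ hc⟩)
    · exact Submodule.mem_sup_right
        (Submodule.mem_iSup_of_mem c (Submodule.mem_iSup_of_mem h (End.mem_eigenspace_iff.2 hc)))
  obtain ⟨a, ha, f, hf, hx'⟩ := Submodule.mem_sup.1 (h1 hx)
  have hN : Submodule.span ℂ {b ∈ B | T b = μ • b} ≤ End.eigenspace T μ :=
    Submodule.span_le.2 fun b hb => End.mem_eigenspace_iff.2 hb.2
  have hf0 : x - a = f := by rw [← hx']; abel
  have : f ∈ End.eigenspace T μ := hf0 ▸ sub_mem (End.mem_eigenspace_iff.2 hμ) (hN ha)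
  have hf1 := (End.eigenspaces_iSupIndep T μ).le_bot ⟨this, hf⟩
  have hf2 : f = 0 := by simpa using hf1
  rw [← hx', hf2, add_zero]; exact ha

end LinearAlgebra
end Toroidal

namespace Toroidal

open Module (End)

section Graded

variable {M ι : Type*} [AddCommGroup M] [Module ℂ M]

/-- A family of subspaces whose sum is direct and is everything. -/
structure IsGrading (gr : ι → Submodule ℂ M) : Prop where
  indep : iSupIndep gr
  iSup_eq_top : ⨆ k, gr k = ⊤

lemma IsGrading.isInternal {gr : ι → Submodule ℂ M} (h : IsGrading gr) :
    open Classical in DirectSum.IsInternal gr := by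
  classical
  exact DirectSum.isInternal_submodule_of_iSupIndep_of_iSup_eq_top h.indep h.iSup_eq_top

lemma IsGrading.of_isInternal {gr : ι → Submodule ℂ M} {_ : DecidableEq ι}
    (h : DirectSum.IsInternal gr) : IsGrading gr := by
  exact ⟨h.submodule_iSupIndep, h.submodule_iSup_eq_top⟩

namespace IsGrading
variable {gr : ι → Submodule ℂ M} (h : IsGrading gr)

open Classical in
/-- The linear equivalence of a graded space with the direct sum of its pieces. -/
def equiv : (⨁ k, gr k) ≃ₗ[ℂ] M :=
  LinearEquiv.ofBijective (DirectSum.coeLinearMap gr) h.isInternal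

/-- The projection to the component of degree `k`. -/
def proj (k : ι) : End ℂ M :=
  (gr k).subtype ∘ₗ DirectSum.component ℂ ι (fun k => gr k) k ∘ₗ h.equiv.symm.toLinearMap

lemma equiv_of [inst : DecidableEq ι] (k : ι) (v : gr k) :
    h.equiv (DirectSum.of (fun k => gr k) k v) = v := by
  obtain rfl : inst = fun a b => Classical.propDecidable (a = b) := Subsingleton.elim _ _
  classical
  exact DirectSum.coeLinearMap_of _ _ _

lemma equiv_symm_of_mem [DecidableEq ι] {k : ι} {v : M} (hv : v ∈ gr k) :
    h.equiv.symm v = DirectSum.of (fun k => gr k) k ⟨v, hv⟩ := by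
  rw [LinearEquiv.symm_apply_eq, equiv_of]

lemma proj_mem (k : ι) (v : M) : h.proj k v ∈ gr k := Submodule.coe_mem _

lemma proj_of_mem {k : ι} {v : M} (hv : v ∈ gr k) : h.proj k v = v := by
  classical
  simp only [proj, LinearMap.comp_apply, LinearEquiv.coe_coe, equiv_symm_of_mem h hv]
  simp [← DirectSum.lof_eq_of ℂ]

lemma proj_of_ne {k l : ι} (hkl : l ≠ k) {v : M} (hv : v ∈ gr k) : h.proj l v = 0 := by
  classical
  simp only [proj, LinearMap.comp_apply, LinearEquiv.coe_coe, equiv_symm_of_mem h hv]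
  simp [DirectSum.component.of, ← DirectSum.lof_eq_of ℂ, hkl.symm]

include h in
lemma induction {p : M → Prop} (v : M) (hm : ∀ k, ∀ v ∈ gr k, p v) (h0 : p 0)
    (hadd : ∀ x y, p x → p y → p (x + y)) : p v :=
  Submodule.iSup_induction gr (motive := p) (h.iSup_eq_top ▸ Submodule.mem_top) hm h0 hadd

lemma mem_of_proj_mem {N : Submodule ℂ M} {v : M} (hv : ∀ k, h.proj k v ∈ N) : v ∈ N := by
  classical
  rw [← h.equiv.apply_symm_apply v]
  have hsum := DirectSum.sum_support_of (h.equiv.symm v)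
  rw [← hsum, map_sum]
  refine sum_mem fun k _ => ?_
  rw [equiv_of]
  exact hv k

lemma eq_zero_of_proj {v : M} (hv : ∀ k, h.proj k v = 0) : v = 0 := by
  have : v ∈ (⊥ : Submodule ℂ M) := h.mem_of_proj_mem fun k => by simp [hv k]
  simpa using this

lemma ext {v w : M} (hv : ∀ k, h.proj k v = h.proj k w) : v = w :=
  sub_eq_zero.1 (h.eq_zero_of_proj fun k => by rw [map_sub, hv, sub_self])

lemma proj_comm {M' ι' : Type*} [AddCommGroup M'] [Module ℂ M'] {gr' : ι' → Submodule ℂ M'}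
    (h' : IsGrading gr') {x : M →ₗ[ℂ] M'} {f : ι → ι'} (hf : f.Injective)
    (hx : ∀ k, ∀ v ∈ gr k, x v ∈ gr' (f k)) (k : ι) (v : M) :
    h'.proj (f k) (x v) = x (h.proj k v) := by
  induction v using h.induction with
  | hm l v hv =>
    by_cases hkl : k = l
    · subst hkl
      rw [h.proj_of_mem hv, h'.proj_of_mem (hx _ _ hv)]
    · rw [h.proj_of_ne hkl hv, map_zero, h'.proj_of_ne (fun e => hkl (hf e)) (hx _ _ hv)]
  | h0 => simp
  | hadd a b ha hb => simp only [map_add, ha, hb]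

lemma sum_proj [Fintype ι] (v : M) : ∑ k, h.proj k v = v := by
  induction v using h.induction with
  | hm l v hv =>
    rw [Finset.sum_eq_single l (fun k _ hk => h.proj_of_ne hk hv) (by simp), h.proj_of_mem hv]
  | h0 => simp
  | hadd a b ha hb => simp only [map_add, Finset.sum_add_distrib, ha, hb]

include h in
lemma linearMap_ext {M' : Type*} [AddCommGroup M'] [Module ℂ M'] {f g : M →ₗ[ℂ] M'}
    (hfg : ∀ k, ∀ v ∈ gr k, f v = g v) : f = g := by
  ext v
  induction v using h.induction with
  | hm k v hv => exact hfg k v hv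
  | h0 => simp
  | hadd a b ha hb => simp only [map_add, ha, hb]

lemma le_iSup_inf_iff {N : Submodule ℂ M} :
    N ≤ ⨆ k, N ⊓ gr k ↔ ∀ k, N ≤ N.comap (h.proj k) := by
  constructor
  · intro hN k v hv
    refine Submodule.iSup_induction (fun k => N ⊓ gr k) (motive := fun v => h.proj k v ∈ N)
      (hN hv) (fun l v hv => ?_) (by simp) (fun x y hx hy => ?_)
    · by_cases hkl : k = l
      · subst hkl; rw [h.proj_of_mem hv.2]; exact hv.1
      · rw [h.proj_of_ne hkl hv.2]; exact zero_mem _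
    · rw [map_add]; exact add_mem hx hy
  · intro hN v hv
    exact h.mem_of_proj_mem fun k => Submodule.mem_iSup_of_mem k ⟨hN k hv, h.proj_mem k v⟩

include h in
lemma map_equiv {M' : Type*} [AddCommGroup M'] [Module ℂ M'] (e : M ≃ₗ[ℂ] M') :
    IsGrading fun k => (gr k).map e.toLinearMap := by
  refine ⟨?_, ?_⟩
  · have := h.indep.map_orderIso (Submodule.orderIsoMapComap e)
    exact this
  · rw [← Submodule.map_iSup, h.iSup_eq_top, Submodule.map_top]
    exact LinearMap.range_eq_top.2 e.surjective

/-- The grading of a graded subspace. -/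
lemma comap_subtype {N : Submodule ℂ M} (hN : ∀ k, N ≤ N.comap (h.proj k)) :
    IsGrading fun k => (gr k).comap N.subtype := by
  refine ⟨?_, ?_⟩
  · rw [iSupIndep_def]
    intro k
    rw [Submodule.disjoint_def]
    intro v hv hv'
    have h1 : (v : M) ∈ ⨆ j, ⨆ (_ : j ≠ k), gr j := by
      have : (⨆ j, ⨆ (_ : j ≠ k), (gr j).comap N.subtype) ≤
          (⨆ j, ⨆ (_ : j ≠ k), gr j).comap N.subtype :=
        iSup₂_le fun j hj => Submodule.comap_mono (le_iSup₂_of_le j hj le_rfl)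
      exact this hv'
    exact Subtype.ext ((Submodule.disjoint_def.1 (h.indep k)) v hv h1)
  · refine eq_top_iff.2 fun v _ => ?_
    have h1 : (v : M) ∈ ⨆ k, N ⊓ gr k := h.le_iSup_inf_iff.2 hN v.2
    have h2 : (⨆ k, N ⊓ gr k) ≤ (⨆ k, (gr k).comap N.subtype).map N.subtype := by
      refine iSup_le fun k w hw => ⟨⟨w, hw.1⟩, Submodule.mem_iSup_of_mem k hw.2, rfl⟩
    obtain ⟨w, hw, hwv⟩ := h2 h1
    rwa [Subtype.ext (a1 := w) (a2 := v) hwv] at hw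

end IsGrading
end Graded

section Equivariant

variable {X W F : Type*} [AddCommGroup W] [Module ℂ W] [AddCommGroup F] [Module ℂ F]
  (a : X → End ℂ W) (b : X → End ℂ F)

/-- The space of linear maps intertwining the operators `a x` and `b x`. -/
def Intertwiners : Submodule ℂ (W →ₗ[ℂ] F) where
  carrier := {φ | ∀ x w, φ (a x w) = b x (φ w)}
  add_mem' hf hg x w := by simp only [LinearMap.add_apply, hf x w, hg x w, map_add]
  zero_mem' x w := by simp
  smul_mem' c f hf x w := by simp only [LinearMap.smul_apply, hf x w, map_smul]

/-- Evaluation `W ⊗ Hom(W, F) → F`. -/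
def evalIntertwiners : W ⊗[ℂ] Intertwiners a b →ₗ[ℂ] F :=
  TensorProduct.lift (LinearMap.flip (Intertwiners a b).subtype)

@[simp] lemma evalIntertwiners_tmul (w : W) (φ : Intertwiners a b) :
    evalIntertwiners a b (w ⊗ₜ φ) = φ.1 w := by simp [evalIntertwiners]

variable {a b}

/-- Schur's lemma. -/
lemma exists_eq_smul_of_commute [FiniteDimensional ℂ W] [Nontrivial W]
    (hirr : ∀ N : Submodule ℂ W, (∀ x, N ≤ N.comap (a x)) → N = ⊥ ∨ N = ⊤) (c : End ℂ W)
    (hc : ∀ x w, c (a x w) = a x (c w)) : ∃ μ : ℂ, ∀ w, c w = μ • w := by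
  obtain ⟨μ, hμ⟩ := Module.End.exists_eigenvalue c
  refine ⟨μ, fun w => ?_⟩
  have := (hirr (End.eigenspace c μ) fun x w hw => ?_).resolve_left hμ
  · exact End.mem_eigenspace_iff.1 (this.ge Submodule.mem_top)
  · rw [Submodule.mem_comap, End.mem_eigenspace_iff, hc, End.mem_eigenspace_iff.1 hw, map_smul]

lemma eq_zero_of_sum_eq_zero [FiniteDimensional ℂ W] [Nontrivial W]
    (hirr : ∀ N : Submodule ℂ W, (∀ x, N ≤ N.comap (a x)) → N = ⊥ ∨ N = ⊤) {ι : Type*}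
    (φ : ι → Intertwiners a b) (hφ : LinearIndependent ℂ φ) (s : Finset ι) (w : ι → W)
    (h : ∑ i ∈ s, (φ i).1 (w i) = 0) : ∀ i ∈ s, w i = 0 := by
  classical
  induction s using Finset.induction_on generalizing w with
  | empty => simp
  | insert j s hj ih =>
    by_cases hwj : w j = 0
    · rw [Finset.sum_insert hj, hwj, map_zero, zero_add] at h
      intro i hi
      rcases Finset.mem_insert.1 hi with rfl | hi
      · exact hwj
      · exact ih w h i hi
    exfalso
    let Ψ : (s → W) →ₗ[ℂ] F := ∑ i : s, (φ i).1 ∘ₗ LinearMap.proj i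
    have hΨ : ∀ v, Ψ v = ∑ i : s, (φ i).1 (v i) := fun v => by simp [Ψ, LinearMap.sum_apply]
    have hΨi : Function.Injective Ψ := by
      rw [← LinearMap.ker_eq_bot, Submodule.eq_bot_iff]
      intro v hv
      rw [LinearMap.mem_ker, hΨ] at hv
      have h2 := ih (fun i => if hi : i ∈ s then v ⟨i, hi⟩ else 0) (by
        rw [← Finset.sum_coe_sort, ← hv]
        exact Finset.sum_congr rfl fun i _ => by simp)
      ext i
      simpa using h2 i i.2
    have hΨx : ∀ x v, Ψ (fun i => a x (v i)) = b x (Ψ v) := fun x v => by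
      rw [hΨ, hΨ, map_sum]
      exact Finset.sum_congr rfl fun i _ => (φ i).2 x (v i)
    have hN : (LinearMap.range Ψ).comap (φ j).1 = ⊤ := by
      refine (hirr _ ?_).resolve_left ?_
      · rintro x v ⟨u, hu⟩
        refine ⟨fun i => a x (u i), ?_⟩
        rw [hΨx, hu, (φ j).2 x v]
      · refine (Submodule.ne_bot_iff _).2 ⟨w j, ⟨fun i => - w i, ?_⟩, hwj⟩
        rw [Finset.sum_insert hj] at h
        rw [hΨ, eq_neg_of_add_eq_zero_left h, ← Finset.sum_coe_sort s, ← Finset.sum_neg_distrib]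
        simp only [map_neg]
    have hmem : ∀ v, (φ j).1 v ∈ LinearMap.range Ψ := fun v => hN.ge (Submodule.mem_top (x := v))
    let c : W →ₗ[ℂ] (s → W) :=
      (LinearEquiv.ofInjective Ψ hΨi).symm.toLinearMap ∘ₗ (φ j).1.codRestrict _ hmem
    have hc : ∀ v, Ψ (c v) = (φ j).1 v := fun v => by
      have := (LinearEquiv.ofInjective Ψ hΨi).apply_symm_apply ⟨_, hmem v⟩
      exact congrArg Subtype.val this
    have hcx : ∀ x v, c (a x v) = fun i => a x (c v i) := fun x v => hΨi (by
      rw [hc, hΨx, hc, (φ j).2 x v])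
    have hμ : ∀ i : s, ∃ μ : ℂ, ∀ v, c v i = μ • v := fun i =>
      exists_eq_smul_of_commute hirr (LinearMap.proj i ∘ₗ c) fun x v => by
        simp [hcx]
    choose μ hμ using hμ
    have hφj : φ j = ∑ i : s, μ i • φ i := by
      ext v
      rw [← hc, hΨ]
      simp only [hμ, map_smul, Submodule.coe_sum, Submodule.coe_smul, LinearMap.sum_apply,
        LinearMap.smul_apply]
    have hspan : φ j ∈ Submodule.span ℂ (φ '' (s : Set ι)) := by
      rw [hφj]
      exact sum_mem fun i _ => Submodule.smul_mem _ _ (Submodule.subset_span ⟨i, i.2, rfl⟩)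
    exact hφ.notMem_span_image hj hspan

lemma evalIntertwiners_injective [FiniteDimensional ℂ W] [Nontrivial W]
    (hirr : ∀ N : Submodule ℂ W, (∀ x, N ≤ N.comap (a x)) → N = ⊥ ∨ N = ⊤) :
    Function.Injective (evalIntertwiners a b) := by
  rw [← LinearMap.ker_eq_bot, Submodule.eq_bot_iff]
  intro t ht
  let B := Module.Basis.ofVectorSpace ℂ (Intertwiners a b)
  obtain ⟨w, rfl⟩ := TensorProduct.eq_repr_basis_right B t
  rw [LinearMap.mem_ker, Finsupp.sum, map_sum] at ht
  simp only [evalIntertwiners_tmul] at ht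
  have := eq_zero_of_sum_eq_zero hirr B B.linearIndependent w.support w ht
  exact Finset.sum_eq_zero fun i hi => by simp only [this i hi, TensorProduct.zero_tmul]

end Equivariant
end Toroidal

namespace Toroidal
open Module (End)

namespace TwistData

variable {n : ℕ} {𝔤 : Type*} [LieRing 𝔤] [LieAlgebra ℂ 𝔤] (D : TwistData n 𝔤)

/-- The isomorphism `ℤⁿ → Γ`. -/
def sc (r : Lat n) : Lat n := fun i => (D.m i.succ : ℤ) * r i

lemma sc_add (r s : Lat n) : D.sc (r + s) = D.sc r + D.sc s := by
  ext i; simp [sc, mul_add]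

lemma sc_zero : D.sc 0 = 0 := by
  ext i; simp [sc]

lemma sc_neg (r : Lat n) : D.sc (-r) = - D.sc r := by
  ext i; simp [sc]

lemma sc_injective : Function.Injective D.sc := fun r s h => by
  ext i
  have h1 : (D.m i.succ : ℤ) * r i = D.m i.succ * s i := congrFun h i
  have h2 : (D.m i.succ : ℤ) ≠ 0 := by exact_mod_cast (D.m_pos i.succ).ne'
  exact mul_left_cancel₀ h2 h1

lemma sc_mem (r : Lat n) : D.sc r ∈ D.Γ := fun _ => dvd_mul_right _ _

lemma exists_sc_eq {r : Lat n} (h : r ∈ D.Γ) : ∃ s, D.sc s = r := by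
  choose s hs using h
  exact ⟨s, funext fun i => (hs i).symm⟩

lemma emb_add {N : ℕ} (k l : Lat N) : emb (k + l) = emb k + emb l := by
  ext i; refine Fin.cases ?_ (fun i => ?_) i <;> simp [emb]

lemma emb_zero {N : ℕ} : emb (0 : Lat N) = 0 := by
  ext i; refine Fin.cases ?_ (fun i => ?_) i <;> simp [emb]

lemma emb_tail {N : ℕ} {k : Lat (N + 1)} (h : k 0 = 0) : emb (Fin.tail k) = k := by
  ext i; refine Fin.cases ?_ (fun i => ?_) i <;> simp [emb, h, Fin.tail]

lemma emb_sc_mem (r : Lat n) : emb (D.sc r) ∈ D.gam := emb_mem_gam (D.sc_mem r)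

/-- The exponent `(0, sc r)` as a complex vector. -/
def sv (r : Lat n) : Fin (n + 1) → ℂ := (emb (D.sc r)).vec

lemma sv_add (r s : Lat n) : D.sv (r + s) = D.sv r + D.sv s := by
  rw [sv, sc_add, emb_add, vec_add]; rfl

lemma vec_zero {N : ℕ} : (0 : Lat N).vec = 0 := by ext; simp [Lat.vec]

lemma sv_zero : D.sv 0 = 0 := by rw [sv, sc_zero, emb_zero, vec_zero]

lemma sv_apply_zero (r : Lat n) : D.sv r 0 = 0 := by simp [sv, Lat.vec, emb]

lemma sv_apply_succ (r : Lat n) (i : Fin n) : D.sv r i.succ = D.sc r i := by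
  simp [sv, Lat.vec, emb]

lemma pair_single {N : ℕ} (i : Fin N) (v : Fin N → ℂ) : pair (Pi.single i 1) v = v i := by
  simp [pair, Pi.single_apply]

lemma pair_comm {N : ℕ} (u v : Fin N → ℂ) : pair u v = pair v u := by
  simp [pair, mul_comm]

variable {D}

lemma emb_sc_add (r s : Lat n) : emb (D.sc r) + emb (D.sc s) = emb (D.sc (r + s)) := by
  rw [sc_add, emb_add]

lemma gradeSpace_emb_add_sc (l r : Lat n) :
    D.gradeSpace (emb (l + D.sc r)) = D.gradeSpace (emb l) := by
  rw [emb_add, D.gradeSpace_add_gam (D.emb_sc_mem r)]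

lemma gradeSpace_emb_lie {k l : Lat n} {X Y : 𝔤} (hX : X ∈ D.gradeSpace (emb k))
    (hY : Y ∈ D.gradeSpace (emb l)) : ⁅X, Y⁆ ∈ D.gradeSpace (emb (k + l)) := by
  rw [emb_add]; exact D.gradeSpace_lie hX hY

variable [FiniteDimensional ℂ 𝔤] [LieAlgebra.IsSimple ℂ 𝔤]

/-- `∑ᵢ wᵢ t^r Kᵢ ∈ τ`. -/
def cc (r : Lat (n + 1)) (hr : r ∈ D.gam) (w : Fin (n + 1) → ℂ) : D.tau :=
  ⟨(0, cenMk r w, 0), zero_mem _, D.cenMk_mem hr _, zero_mem _⟩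

/-- `∑ᵢ aᵢ t^r dᵢ ∈ τ`. -/
def de (r : Lat (n + 1)) (hr : r ∈ D.gam) (a : Fin (n + 1) → ℂ) : D.tau :=
  ⟨(0, 0, Finsupp.single r a), zero_mem _, zero_mem _, D.single_mem_derPart hr _⟩

lemma dd_eq_de (r : Lat (n + 1)) (hr : r ∈ D.gam) (i : Fin (n + 1)) :
    dd r hr i = de r hr (Pi.single i 1) := rfl

section coe
variable (r : Lat (n + 1)) (hr : r ∈ D.gam) (w : Fin (n + 1) → ℂ)
  (k : Lat (n + 1)) (X : 𝔤) (hX : X ∈ D.gradeSpace k)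
@[simp] lemma cc_fst : (cc r hr w : Full D).1 = 0 := rfl
@[simp] lemma cc_snd : (cc r hr w : Full D).2.1 = cenMk r w := rfl
@[simp] lemma cc_thd : (cc r hr w : Full D).2.2 = 0 := rfl
@[simp] lemma de_fst : (de r hr w : Full D).1 = 0 := rfl
@[simp] lemma de_snd : (de r hr w : Full D).2.1 = 0 := rfl
@[simp] lemma de_thd : (de r hr w : Full D).2.2 = Finsupp.single r w := rfl
@[simp] lemma xx_fst : (xx k X hX : Full D).1 = Finsupp.single k X := rfl
@[simp] lemma xx_snd : (xx k X hX : Full D).2.1 = 0 := rfl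
@[simp] lemma xx_thd : (xx k X hX : Full D).2.2 = 0 := rfl
end coe

lemma tau_ext {x y : D.tau} (h1 : (x : Full D).1 = (y : Full D).1)
    (h2 : (x : Full D).2.1 = (y : Full D).2.1) (h3 : (x : Full D).2.2 = (y : Full D).2.2) : x = y :=
  Subtype.ext (Full.ext h1 h2 h3)

lemma cc_add (r : Lat (n + 1)) (hr : r ∈ D.gam) (w w' : Fin (n + 1) → ℂ) :
    cc r hr (w + w') = cc r hr w + cc r hr w' := by
  apply tau_ext <;> simp

lemma cc_smul (r : Lat (n + 1)) (hr : r ∈ D.gam) (c : ℂ) (w : Fin (n + 1) → ℂ) :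
    cc r hr (c • w) = c • cc r hr w := by
  apply tau_ext <;> simp

lemma de_add (r : Lat (n + 1)) (hr : r ∈ D.gam) (w w' : Fin (n + 1) → ℂ) :
    de r hr (w + w') = de r hr w + de r hr w' := by
  apply tau_ext <;> simp

lemma de_smul (r : Lat (n + 1)) (hr : r ∈ D.gam) (c : ℂ) (w : Fin (n + 1) → ℂ) :
    de r hr (c • w) = c • de r hr w := by
  apply tau_ext <;> simp

lemma xx_add (k : Lat (n + 1)) (X Y : 𝔤) (hX : X ∈ D.gradeSpace k) (hY : Y ∈ D.gradeSpace k) :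
    xx k (X + Y) (add_mem hX hY) = xx k X hX + xx k Y hY := by
  apply tau_ext <;> simp

lemma xx_smul (k : Lat (n + 1)) (c : ℂ) (X : 𝔤) (hX : X ∈ D.gradeSpace k) :
    xx k (c • X) (Submodule.smul_mem _ c hX) = c • xx k X hX := by
  apply tau_ext <;> simp

lemma cc_vec (r : Lat (n + 1)) (hr : r ∈ D.gam) : cc r hr r.vec = 0 := by
  apply tau_ext <;> simp [cenMk_vec]

lemma lie_de_cc (r s : Lat (n + 1)) (hr : r ∈ D.gam) (hs : s ∈ D.gam) (a w : Fin (n + 1) → ℂ) :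
    ⁅de r hr a, cc s hs w⁆ =
      cc (r + s) (add_mem hr hs) (pair a s.vec • w + pair a w • r.vec) := by
  apply tau_ext <;> simp [Full.lie_fst, Full.lie_snd, Full.lie_thd]

lemma lie_de_de (r s : Lat (n + 1)) (hr : r ∈ D.gam) (hs : s ∈ D.gam) (a b : Fin (n + 1) → ℂ) :
    ⁅de r hr a, de s hs b⁆ =
      de (r + s) (add_mem hr hs) (pair a s.vec • b - pair b r.vec • a) +
      (D.c₁ * -(pair a s.vec * pair b r.vec) + D.c₂ * (pair a r.vec * pair b s.vec)) •
        cc (r + s) (add_mem hr hs) r.vec := by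
  apply tau_ext <;> simp [Full.lie_fst, Full.lie_snd, Full.lie_thd]

lemma lie_de_xx (r k : Lat (n + 1)) (hr : r ∈ D.gam) (a : Fin (n + 1) → ℂ) (X : 𝔤)
    (hX : X ∈ D.gradeSpace k) (hX' : X ∈ D.gradeSpace (k + r)) :
    ⁅de r hr a, xx k X hX⁆ = pair a k.vec • xx (k + r) X hX' := by
  apply tau_ext <;> simp [Full.lie_fst, Full.lie_snd, Full.lie_thd]

lemma lie_cc_cc (r s : Lat (n + 1)) (hr : r ∈ D.gam) (hs : s ∈ D.gam) (v w : Fin (n + 1) → ℂ) :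
    ⁅cc r hr v, cc s hs w⁆ = 0 := by
  apply tau_ext <;> simp [Full.lie_fst, Full.lie_snd, Full.lie_thd]

lemma lie_cc_xx (r k : Lat (n + 1)) (hr : r ∈ D.gam) (w : Fin (n + 1) → ℂ) (X : 𝔤)
    (hX : X ∈ D.gradeSpace k) : ⁅cc r hr w, xx k X hX⁆ = 0 := by
  apply tau_ext <;> simp [Full.lie_fst, Full.lie_snd, Full.lie_thd]

lemma lie_xx_xx_of_mem (k l : Lat (n + 1)) (X Y : 𝔤) (hX : X ∈ D.gradeSpace k)
    (hY : Y ∈ D.gradeSpace l) (h : k + l ∈ D.gam) :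
    ⁅xx k X hX, xx l Y hY⁆ = xx (k + l) ⁅X, Y⁆ (D.gradeSpace_lie hX hY) +
      D.form X Y • cc (k + l) h k.vec := by
  apply tau_ext <;> simp [Full.lie_fst, Full.lie_snd, Full.lie_thd]

lemma lie_xx_xx_of_notMem (k l : Lat (n + 1)) (X Y : 𝔤) (hX : X ∈ D.gradeSpace k)
    (hY : Y ∈ D.gradeSpace l) (h : k + l ∉ D.gam) :
    ⁅xx k X hX, xx l Y hY⁆ = xx (k + l) ⁅X, Y⁆ (D.gradeSpace_lie hX hY) := by
  apply tau_ext <;> simp [Full.lie_fst, Full.lie_snd, Full.lie_thd, D.form_eq_zero hX hY h]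

variable (D) in
/-- The homogeneous generators of `τ`. -/
def gens : Set D.tau :=
  {x | ∃ k X hX, x = xx k X hX} ∪ {x | ∃ r hr w, x = cc r hr w} ∪ {x | ∃ r hr a, x = de r hr a}

lemma span_gens : Submodule.span ℂ D.gens = ⊤ := by
  refine eq_top_iff.2 fun x _ => ?_
  obtain ⟨⟨f, z, g⟩, hf, hz, hg⟩ := x
  change f ∈ D.loopPart at hf
  change z ∈ D.cenPart at hz
  change g ∈ D.derPart at hg
  have h1 : (⟨(f, 0, 0), hf, zero_mem _, zero_mem _⟩ : D.tau) ∈ Submodule.span ℂ D.gens := by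
    let i : D.loopPart →ₗ[ℂ] D.tau :=
      { toFun := fun f => ⟨(f.1, 0, 0), f.2, zero_mem _, zero_mem _⟩
        map_add' := fun a b => tau_ext rfl (add_zero _).symm (add_zero _).symm
        map_smul' := fun a b => tau_ext rfl (smul_zero _).symm (smul_zero _).symm }
    have h2 : (⟨f, hf⟩ : D.loopPart) =
        ∑ k ∈ f.support, ⟨Finsupp.single k (f k), D.single_mem_loopPart (hf k)⟩ := by
      refine Subtype.ext ?_
      rw [AddSubmonoidClass.coe_finsetSum]
      exact (Finsupp.sum_single f).symm
    have h3 := congrArg i h2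
    rw [map_sum] at h3
    change i ⟨f, hf⟩ ∈ _
    rw [h3]
    exact sum_mem fun k _ => Submodule.subset_span (Or.inl (Or.inl ⟨k, f k, hf k, rfl⟩))
  have h2 : (⟨(0, z, 0), zero_mem _, hz, zero_mem _⟩ : D.tau) ∈ Submodule.span ℂ D.gens := by
    let i : D.cenPart →ₗ[ℂ] D.tau :=
      { toFun := fun z => ⟨(0, z.1, 0), zero_mem _, z.2, zero_mem _⟩
        map_add' := fun a b => tau_ext (add_zero _).symm rfl (add_zero _).symm
        map_smul' := fun a b => tau_ext (smul_zero _).symm rfl (smul_zero _).symm }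
    change i ⟨z, hz⟩ ∈ _
    suffices h : ∀ z (hz : z ∈ D.cenPart), i ⟨z, hz⟩ ∈ Submodule.span ℂ D.gens from h z hz
    intro z hz
    refine Submodule.span_induction (p := fun z hz => i ⟨z, hz⟩ ∈ Submodule.span ℂ D.gens)
      ?_ ?_ ?_ ?_ hz
    · rintro _ ⟨r, hr, w, rfl⟩
      exact Submodule.subset_span (Or.inl (Or.inr ⟨r, hr, w, rfl⟩))
    · have : i 0 ∈ Submodule.span ℂ D.gens := by rw [map_zero]; exact zero_mem _
      exact this
    · intro x y hx hy h1 h2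
      have := add_mem h1 h2
      rwa [← map_add] at this
    · intro c x hx h1
      have := Submodule.smul_mem _ c h1
      rwa [← map_smul] at this
  have h3 : (⟨(0, 0, g), zero_mem _, zero_mem _, hg⟩ : D.tau) ∈ Submodule.span ℂ D.gens := by
    let i : D.derPart →ₗ[ℂ] D.tau :=
      { toFun := fun g => ⟨(0, 0, g.1), zero_mem _, zero_mem _, g.2⟩
        map_add' := fun a b => tau_ext (add_zero _).symm (add_zero _).symm rfl
        map_smul' := fun a b => tau_ext (smul_zero _).symm (smul_zero _).symm rfl }
    have hgs : ∀ r, Finsupp.single r (g r) ∈ D.derPart := fun r => by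
      by_cases h : r ∈ D.gam
      · exact D.single_mem_derPart h _
      · rw [hg r h, Finsupp.single_zero]; exact zero_mem _
    have h2 : (⟨g, hg⟩ : D.derPart) = ∑ r ∈ g.support, ⟨Finsupp.single r (g r), hgs r⟩ := by
      refine Subtype.ext ?_
      rw [AddSubmonoidClass.coe_finsetSum]
      exact (Finsupp.sum_single g).symm
    have h3 := congrArg i h2
    rw [map_sum] at h3
    change i ⟨g, hg⟩ ∈ _
    rw [h3]
    refine sum_mem fun r hr => ?_
    by_cases h : r ∈ D.gam
    · exact Submodule.subset_span (Or.inr ⟨r, h, g r, rfl⟩)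
    · exact absurd (hg r h) (Finsupp.mem_support_iff.1 hr)
  have h4 := add_mem (add_mem h1 h2) h3
  convert h4 using 1
  refine tau_ext (x := ⟨(f, z, g), _⟩) ?_ ?_ ?_
  · change f = f + 0 + 0
    rw [add_zero, add_zero]
  · change z = 0 + z + 0
    rw [add_zero, zero_add]
  · change g = 0 + 0 + g
    rw [zero_add, zero_add]

lemma d_eq (i : Fin (n + 1)) : D.d i = de 0 (zero_mem _) (Pi.single i 1) := rfl

lemma lie_d_xx (i : Fin (n + 1)) (k : Lat (n + 1)) (X : 𝔤) (hX : X ∈ D.gradeSpace k) :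
    ⁅D.d i, xx k X hX⁆ = (k i : ℂ) • xx k X hX := by
  rw [d_eq, lie_de_xx 0 k _ _ X hX (by simpa using hX), pair_single]
  simp [Lat.vec]

lemma lie_d_cc (i : Fin (n + 1)) (r : Lat (n + 1)) (hr : r ∈ D.gam) (w : Fin (n + 1) → ℂ) :
    ⁅D.d i, cc r hr w⁆ = (r i : ℂ) • cc r hr w := by
  rw [d_eq, lie_de_cc, pair_single, vec_zero, smul_zero, add_zero, cc_smul]
  simp [Lat.vec]

lemma lie_d_de (i : Fin (n + 1)) (r : Lat (n + 1)) (hr : r ∈ D.gam) (a : Fin (n + 1) → ℂ) :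
    ⁅D.d i, de r hr a⁆ = (r i : ℂ) • de r hr a := by
  rw [d_eq, lie_de_de, pair_single, vec_zero, map_zero, zero_smul, sub_zero, de_smul]
  have : cc (0 + r) (add_mem (zero_mem D.gam) hr) 0 = 0 := by apply tau_ext <;> simp
  rw [this]
  simp [Lat.vec]

variable (D) in
/-- `X t^l ∈ τ₀`. -/
def x0 (l : Lat n) (X : 𝔤) (hX : X ∈ D.gradeSpace (emb l)) : D.tau0 :=
  ⟨xx (emb l) X hX, by change ⁅D.d 0, _⁆ = 0; rw [lie_d_xx]; simp [emb]⟩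

variable (D) in
/-- `∑ᵢ wᵢ t^r Kᵢ ∈ τ₀`. -/
def c0 (r : Lat n) (w : Fin (n + 1) → ℂ) : D.tau0 :=
  ⟨cc (emb (D.sc r)) (D.emb_sc_mem r) w, by change ⁅D.d 0, _⁆ = 0; rw [lie_d_cc]; simp [emb]⟩

variable (D) in
/-- `∑ᵢ aᵢ t^r dᵢ ∈ τ₀`. -/
def e0 (r : Lat n) (a : Fin (n + 1) → ℂ) : D.tau0 :=
  ⟨de (emb (D.sc r)) (D.emb_sc_mem r) a, by change ⁅D.d 0, _⁆ = 0; rw [lie_d_de]; simp [emb]⟩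

lemma cc_congr {r s : Lat (n + 1)} (hr : r ∈ D.gam) (hs : s ∈ D.gam) (h : r = s)
    (w : Fin (n + 1) → ℂ) : cc r hr w = cc s hs w := by subst h; rfl

lemma de_congr {r s : Lat (n + 1)} (hr : r ∈ D.gam) (hs : s ∈ D.gam) (h : r = s)
    (w : Fin (n + 1) → ℂ) : de r hr w = de s hs w := by subst h; rfl

lemma xx_congr {k l : Lat (n + 1)} {X : 𝔤} (hk : X ∈ D.gradeSpace k) (hl : X ∈ D.gradeSpace l)
    (h : k = l) : xx k X hk = xx l X hl := by subst h; rfl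

lemma lie_e0_c0 (r s : Lat n) (a w : Fin (n + 1) → ℂ) :
    ⁅(D.e0 r a : D.tau0), D.c0 s w⁆ = D.c0 (r + s) (pair a (D.sv s) • w + pair a w • D.sv r) := by
  refine Subtype.ext ((lie_de_cc _ _ (D.emb_sc_mem r) (D.emb_sc_mem s) _ _).trans ?_)
  exact cc_congr (add_mem (D.emb_sc_mem r) (D.emb_sc_mem s)) (D.emb_sc_mem (r + s)) (emb_sc_add r s) _

lemma c0_add (r : Lat n) (v w : Fin (n + 1) → ℂ) : (D.c0 r (v + w) : D.tau0) = D.c0 r v + D.c0 r w :=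
  Subtype.ext (cc_add _ (D.emb_sc_mem r) _ _)
lemma c0_smul (r : Lat n) (c : ℂ) (w : Fin (n + 1) → ℂ) : (D.c0 r (c • w) : D.tau0) = c • D.c0 r w :=
  Subtype.ext (cc_smul _ (D.emb_sc_mem r) _ _)
lemma e0_add (r : Lat n) (v w : Fin (n + 1) → ℂ) : (D.e0 r (v + w) : D.tau0) = D.e0 r v + D.e0 r w :=
  Subtype.ext (de_add _ (D.emb_sc_mem r) _ _)
lemma e0_smul (r : Lat n) (c : ℂ) (w : Fin (n + 1) → ℂ) : (D.e0 r (c • w) : D.tau0) = c • D.e0 r w :=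
  Subtype.ext (de_smul _ (D.emb_sc_mem r) _ _)

lemma c0_sv (r : Lat n) : (D.c0 r (D.sv r) : D.tau0) = 0 := Subtype.ext (cc_vec _ (D.emb_sc_mem r))

lemma lie_e0_e0 (r s : Lat n) (a b : Fin (n + 1) → ℂ) :
    ⁅(D.e0 r a : D.tau0), D.e0 s b⁆ = D.e0 (r + s) (pair a (D.sv s) • b - pair b (D.sv r) • a) +
      (D.c₁ * -(pair a (D.sv s) * pair b (D.sv r)) + D.c₂ * (pair a (D.sv r) * pair b (D.sv s))) •
        D.c0 (r + s) (D.sv r) := by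
  refine Subtype.ext ((lie_de_de _ _ (D.emb_sc_mem r) (D.emb_sc_mem s) _ _).trans ?_)
  congr 1
  · exact de_congr (add_mem (D.emb_sc_mem r) (D.emb_sc_mem s)) (D.emb_sc_mem (r + s)) (emb_sc_add r s) _
  · congr 1
    exact cc_congr (add_mem (D.emb_sc_mem r) (D.emb_sc_mem s)) (D.emb_sc_mem (r + s)) (emb_sc_add r s) _

lemma lie_e0_x0 (r l : Lat n) (a : Fin (n + 1) → ℂ) (X : 𝔤) (hX : X ∈ D.gradeSpace (emb l))
    (hX' : X ∈ D.gradeSpace (emb (l + D.sc r))) :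
    ⁅D.e0 r a, D.x0 l X hX⁆ = pair a (emb l).vec • D.x0 (l + D.sc r) X hX' := by
  refine Subtype.ext ((lie_de_xx _ _ (D.emb_sc_mem r) _ X hX (by rwa [← emb_add])).trans ?_)
  change _ = pair a (emb l).vec • xx (emb (l + D.sc r)) X hX'
  congr 1
  exact xx_congr (by rwa [← emb_add]) hX' (emb_add _ _).symm

lemma lie_c0_c0 (r s : Lat n) (v w : Fin (n + 1) → ℂ) : ⁅(D.c0 r v : D.tau0), D.c0 s w⁆ = 0 :=
  Subtype.ext (lie_cc_cc _ _ (D.emb_sc_mem r) (D.emb_sc_mem s) _ _)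

lemma lie_c0_x0 (r l : Lat n) (w : Fin (n + 1) → ℂ) (X : 𝔤) (hX : X ∈ D.gradeSpace (emb l)) :
    ⁅D.c0 r w, D.x0 l X hX⁆ = 0 := Subtype.ext (lie_cc_xx _ _ (D.emb_sc_mem r) _ X hX)

/-- The bracket of `L(𝔤(σ₀), σ)` up to central elements without `K₀`. -/
lemma lie_x0_x0 (k l : Lat n) (X Y : 𝔤) (hX : X ∈ D.gradeSpace (emb k))
    (hY : Y ∈ D.gradeSpace (emb l)) :
    ∃ (r : Lat n) (w : Fin (n + 1) → ℂ), w 0 = 0 ∧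
      ⁅D.x0 k X hX, D.x0 l Y hY⁆ = D.x0 (k + l) ⁅X, Y⁆ (gradeSpace_emb_lie hX hY) + D.c0 r w := by
  by_cases h : k + l ∈ D.Γ
  · obtain ⟨r, hr⟩ := D.exists_sc_eq h
    have h' : emb k + emb l ∈ D.gam := by rw [← emb_add]; exact emb_mem_gam h
    refine ⟨r, D.form X Y • (emb k).vec, by simp [Lat.vec, emb], ?_⟩
    refine Subtype.ext ((lie_xx_xx_of_mem _ _ X Y hX hY h').trans ?_)
    rw [c0_smul]
    change _ = xx (emb (k + l)) ⁅X, Y⁆ (gradeSpace_emb_lie hX hY) +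
      D.form X Y • cc (emb (D.sc r)) (D.emb_sc_mem r) (emb k).vec
    congr 1
    · exact xx_congr (D.gradeSpace_lie hX hY) (gradeSpace_emb_lie hX hY) (emb_add _ _).symm
    · congr 1
      exact cc_congr h' (D.emb_sc_mem r) (by rw [hr, emb_add]) _
  · refine ⟨0, 0, rfl, ?_⟩
    have h' : emb k + emb l ∉ D.gam := fun h1 => h fun i => by
      have := h1 i.succ
      rwa [← emb_add] at this
    refine Subtype.ext ((lie_xx_xx_of_notMem _ _ X Y hX hY h').trans ?_)
    have : (D.c0 0 0 : D.tau0) = 0 := by have := c0_smul (D := D) 0 0 0; simpa using this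
    rw [this, add_zero]
    exact xx_congr (D.gradeSpace_lie hX hY) (gradeSpace_emb_lie hX hY) (emb_add _ _).symm

/-- `τ₀` is spanned by the elements `X t^l`, `t^r Kᵢ`, `t^r dᵢ`. -/
lemma tau0_span : Submodule.span ℂ ({x : D.tau0 | ∃ l X hX, x = D.x0 l X hX} ∪
    {x | ∃ r w, x = D.c0 r w} ∪ {x | ∃ r a, x = D.e0 r a}) = ⊤ := by
  refine eq_top_iff.2 fun x _ => ?_
  have hx : (x : D.tau) ∈ Submodule.span ℂ D.gens := span_gens (D := D) ▸ Submodule.mem_top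
  have h1 := mem_span_eigenvectors (T := LieAlgebra.ad ℂ D.tau (D.d 0)) (B := D.gens) ?_ hx (μ := 0)
    (by rw [zero_smul]; exact x.2)
  swap
  · rintro _ ((⟨k, X, hX, rfl⟩ | ⟨r, hr, w, rfl⟩) | ⟨r, hr, a, rfl⟩)
    · exact ⟨_, lie_d_xx _ _ _ _⟩
    · exact ⟨_, lie_d_cc _ _ _ _⟩
    · exact ⟨_, lie_d_de _ _ _ _⟩
  set G : Set D.tau0 := ({x : D.tau0 | ∃ l X hX, x = D.x0 l X hX} ∪
    {x | ∃ r w, x = D.c0 r w} ∪ {x | ∃ r a, x = D.e0 r a}) with hG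
  have key : Submodule.span ℂ {b ∈ D.gens | LieAlgebra.ad ℂ D.tau (D.d 0) b = (0 : ℂ) • b} ≤
      (Submodule.span ℂ G).map D.tau0.toSubmodule.subtype := by
    refine Submodule.span_le.2 ?_
    rintro b ⟨hb, hb0⟩
    by_cases hbz : b = 0
    · rw [hbz]; exact zero_mem _
    rw [LieAlgebra.ad_apply, zero_smul] at hb0
    have hΓ : ∀ {r : Lat (n + 1)}, r ∈ D.gam → Fin.tail r ∈ D.Γ := fun hr i => hr i.succ
    rcases hb with (⟨k, X, hX, rfl⟩ | ⟨r, hr, w, rfl⟩) | ⟨r, hr, a, rfl⟩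
    · rw [lie_d_xx, smul_eq_zero_iff_left hbz] at hb0
      have hk := emb_tail (k := k) (by exact_mod_cast hb0)
      have hX' : X ∈ D.gradeSpace (emb (Fin.tail k)) := by rwa [hk]
      exact ⟨D.x0 (Fin.tail k) X hX',
        Submodule.subset_span (Or.inl (Or.inl ⟨_, _, _, rfl⟩)), xx_congr hX' hX hk⟩
    · rw [lie_d_cc, smul_eq_zero_iff_left hbz] at hb0
      have hk := emb_tail (k := r) (by exact_mod_cast hb0)
      obtain ⟨s, hs⟩ := D.exists_sc_eq (hΓ hr)
      refine ⟨D.c0 s w, Submodule.subset_span (Or.inl (Or.inr ⟨_, _, rfl⟩)),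
        cc_congr (D.emb_sc_mem s) hr (by rw [hs, hk]) w⟩
    · rw [lie_d_de, smul_eq_zero_iff_left hbz] at hb0
      have hk := emb_tail (k := r) (by exact_mod_cast hb0)
      obtain ⟨s, hs⟩ := D.exists_sc_eq (hΓ hr)
      refine ⟨D.e0 s a, Submodule.subset_span (Or.inr ⟨_, _, rfl⟩),
        de_congr (D.emb_sc_mem s) hr (by rw [hs, hk]) a⟩
  obtain ⟨y, hy, hyx⟩ := key h1
  rwa [Subtype.ext (a1 := y) (a2 := x) hyx] at hy

end TwistData
end Toroidal

namespace Toroidal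
open Module (End)

namespace TwistData

variable {n : ℕ} {𝔤 : Type*} [LieRing 𝔤] [LieAlgebra ℂ 𝔤] {D : TwistData n 𝔤}
variable [FiniteDimensional ℂ 𝔤] [LieAlgebra.IsSimple ℂ 𝔤]
variable {V : Type*} [AddCommGroup V] [Module ℂ V] [LieRingModule D.tau V] [LieModule ℂ D.tau V]

lemma exists_weight_of_mem_gens {b : D.tau} (hb : b ∈ D.gens) :
    ∃ k : Lat (n + 1), ∀ i, ⁅D.d i, b⁆ = (k i : ℂ) • b := by
  rcases hb with (⟨k, X, hX, rfl⟩ | ⟨r, hr, w, rfl⟩) | ⟨r, hr, a, rfl⟩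
  · exact ⟨k, fun i => lie_d_xx _ _ _ _⟩
  · exact ⟨r, fun i => lie_d_cc _ _ _ _⟩
  · exact ⟨r, fun i => lie_d_de _ _ _ _⟩

lemma lie_lie_eigen {y x : D.tau} {v : V} {a b : ℂ} (hx : ⁅y, x⁆ = a • x) (hv : ⁅y, v⁆ = b • v) :
    ⁅y, ⁅x, v⁆⁆ = (a + b) • ⁅x, v⁆ := by
  rw [leibniz_lie, hx, hv, smul_lie, lie_smul, add_smul]

lemma mem_topS_iff {v : V} : v ∈ D.topS V ↔ ∀ b ∈ D.gens, ∀ k : Lat (n + 1), 0 < k 0 →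
    (∀ i, ⁅D.d i, b⁆ = (k i : ℂ) • b) → ⁅b, v⁆ = 0 := by
  constructor
  · intro hv b _ k hk hb
    exact hv (k 0) hk b (hb 0)
  · intro h q hq x hx
    have h1 := mem_span_eigenvectors (T := LieAlgebra.ad ℂ D.tau (D.d 0)) (B := D.gens)
      (fun b hb => by obtain ⟨k, hk⟩ := exists_weight_of_mem_gens hb; exact ⟨_, hk 0⟩)
      (x := x) (span_gens (D := D) ▸ Submodule.mem_top) hx
    have h2 : Submodule.span ℂ {b ∈ D.gens | LieAlgebra.ad ℂ D.tau (D.d 0) b = (q : ℂ) • b} ≤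
        LinearMap.ker ((LieModule.toEnd ℂ D.tau V).toLinearMap.flip v) := by
      refine Submodule.span_le.2 ?_
      rintro b ⟨hb, hbq⟩
      change ⁅b, v⁆ = 0
      by_cases hb0 : b = 0
      · rw [hb0, zero_lie]
      obtain ⟨k, hk⟩ := exists_weight_of_mem_gens hb
      have h3 : (k 0 : ℂ) = q := by
        have h4 : (k 0 : ℂ) • b = (q : ℂ) • b := (hk 0).symm.trans hbq
        exact smul_left_injective ℂ hb0 h4
      have h5 : k 0 = q := by exact_mod_cast h3
      exact h b hb k (h5 ▸ hq) hk
    exact h2 h1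

lemma lie_mem_weightSpace {x : D.tau} {k : Lat (n + 1)} (hx : ∀ i, ⁅D.d i, x⁆ = (k i : ℂ) • x)
    {lam : Fin (n + 1) → ℂ} {v : V} (hv : v ∈ D.weightSpace V lam) :
    ⁅x, v⁆ ∈ D.weightSpace V (k.vec + lam) := fun i => lie_lie_eigen (hx i) (hv i)

variable {ψ : Fin (n + 1) → ℂ}

lemma proj_mem_topS (G : IsGrading (D.weightSpace V)) {v : V} (hv : v ∈ D.topS V)
    (lam : Fin (n + 1) → ℂ) : G.proj lam v ∈ D.topS V := by
  rw [mem_topS_iff] at hv ⊢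
  intro b hb k hk hbk
  have := G.proj_comm G (x := LieModule.toEnd ℂ D.tau V b) (f := fun lam => k.vec + lam)
    (add_right_injective _) (fun lam v hv => lie_mem_weightSpace hbk hv) lam v
  rw [LieModule.toEnd_apply_apply, LieModule.toEnd_apply_apply, hv b hb k hk hbk, map_zero] at this
  exact this.symm

lemma top_le_sup_of_le_topS [LieModule.IsIrreducible ℂ D.tau V] (N : Submodule ℂ V)
    (hN : ∀ v ∈ N, v ∈ D.topS V) (h0 : ∀ x : D.tau, ⁅D.d 0, x⁆ = 0 → ∀ v ∈ N, ⁅x, v⁆ ∈ N) {c : ℂ}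
    (hc : ∀ v ∈ N, ⁅D.d 0, v⁆ = c • v) (hne : N ≠ ⊥) :
    ⊤ ≤ N ⊔ ⨆ q : ℕ, End.eigenspace (LieModule.toEnd ℂ D.tau V (D.d 0)) (c - (q + 1 : ℕ)) := by
  set F := ⨆ q : ℕ, End.eigenspace (LieModule.toEnd ℂ D.tau V (D.d 0)) (c - (q + 1 : ℕ)) with hF
  have hspan : LieSubmodule.lieSpan ℂ D.tau (N : Set V) = ⊤ := by
    refine (eq_bot_or_eq_top _).resolve_left fun h => hne ?_
    rw [LieSubmodule.lieSpan_eq_bot_iff] at h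
    exact (Submodule.eq_bot_iff _).2 h
  have hmem : ∀ {v : V} {q : ℕ}, ⁅D.d 0, v⁆ = (c - (q + 1 : ℕ)) • v → v ∈ F := fun {v q} hv =>
    Submodule.mem_iSup_of_mem q (End.mem_eigenspace_iff.2 hv)
  have hFi : ∀ (x : D.tau) (f : ℕ → ℕ), (∀ q, ∀ v : V, ⁅D.d 0, v⁆ = (c - (q + 1 : ℕ)) • v →
      ⁅D.d 0, ⁅x, v⁆⁆ = (c - (f q + 1 : ℕ)) • ⁅x, v⁆) → ∀ v ∈ F, ⁅x, v⁆ ∈ F := by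
    intro x f hx v hv
    refine Submodule.iSup_induction _ (motive := fun v => ⁅x, v⁆ ∈ F) hv (fun q v hv => ?_) ?_ ?_
    · exact hmem (hx q v (End.mem_eigenspace_iff.1 hv))
    · rw [lie_zero]; exact zero_mem _
    · intro a b ha hb; rw [lie_add]; exact add_mem ha hb
  have := lieSpan_le_sup (L := D.tau)
    (Lm := {x | ∃ q : ℕ, ⁅D.d 0, x⁆ = (-(q + 1 : ℕ) : ℂ) • x}) (L₀ := {x | ⁅D.d 0, x⁆ = 0})
    (Lp := {x | ∃ q : ℤ, 0 < q ∧ ⁅D.d 0, x⁆ = (q : ℂ) • x}) ?_ N F ?_ h0 ?_ ?_ ?_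
  · rwa [hspan] at this
  · refine eq_top_iff.2 ?_
    rw [← span_gens]
    refine Submodule.span_mono fun b hb => ?_
    obtain ⟨k, hk⟩ := exists_weight_of_mem_gens hb
    rcases lt_trichotomy (k 0) 0 with h | h | h
    · refine Or.inl (Or.inl ⟨(-(k 0) - 1).toNat, ?_⟩)
      rw [hk 0]
      congr 1
      have : (((-(k 0) - 1).toNat + 1 : ℕ) : ℤ) = - k 0 := by omega
      have h2 : (((-(k 0) - 1).toNat + 1 : ℕ) : ℂ) = - (k 0 : ℂ) := by exact_mod_cast this
      rw [h2, neg_neg]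
    · refine Or.inl (Or.inr ?_)
      change ⁅D.d 0, b⁆ = 0
      rw [hk 0, h]; simp
    · exact Or.inr ⟨k 0, h, hk 0⟩
  · rintro x ⟨q, hq, hx⟩ v hv
    exact hN v hv q hq x hx
  · rintro x ⟨q, hx⟩ v hv
    refine hmem (q := q) ?_
    rw [lie_lie_eigen hx (hc v hv)]
    congr 1; ring
  · intro x hx
    refine hFi x id fun q v hv => ?_
    rw [lie_lie_eigen (a := 0) (by rw [zero_smul]; exact hx) hv, zero_add]; rfl
  · rintro x ⟨p, hx⟩
    refine hFi x (fun q => q + p + 1) fun q v hv => ?_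
    rw [lie_lie_eigen hx hv]
    congr 1; push_cast; ring

lemma isGrading_eigenspace_d (G : IsGrading (D.weightSpace V)) :
    IsGrading fun c => End.eigenspace (LieModule.toEnd ℂ D.tau V (D.d 0)) c := by
  refine ⟨End.eigenspaces_iSupIndep _, eq_top_iff.2 ?_⟩
  rw [← G.iSup_eq_top]
  refine iSup_le fun lam => le_trans ?_ (le_iSup _ (lam 0))
  exact fun v hv => End.mem_eigenspace_iff.2 (hv 0)

lemma disjoint_eigenspace_sup {T : End ℂ V} {c c' : ℂ} (h : ∀ q : ℕ, c' ≠ c - (q + 1 : ℕ)) {v : V}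
    (hv : T v = c' • v) (hF : v ∈ ⨆ q : ℕ, End.eigenspace T (c - (q + 1 : ℕ))) : v = 0 := by
  have h1 : (⨆ q : ℕ, End.eigenspace T (c - (q + 1 : ℕ))) ≤ ⨆ b, ⨆ (_ : b ≠ c'),
      End.eigenspace T b := iSup_le fun q v hv =>
    Submodule.mem_iSup_of_mem _ (Submodule.mem_iSup_of_mem (h q).symm hv)
  have h2 : v ∈ ⨆ b, ⨆ (_ : b ≠ c'), End.eigenspace T b := h1 hF
  have h3 : v ∈ End.eigenspace T c' := End.mem_eigenspace_iff.2 hv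
  have h4 := (End.eigenspaces_iSupIndep T c').le_bot ⟨h3, h2⟩
  simpa using h4

variable (V) in
/-- The part of `S` on which `d₀` acts by `c`. -/
def topEigen (c : ℂ) : Submodule ℂ V where
  carrier := {v | v ∈ D.topS V ∧ ⁅D.d 0, v⁆ = c • v}
  add_mem' ha hb := ⟨add_mem ha.1 hb.1, by rw [lie_add, ha.2, hb.2, smul_add]⟩
  zero_mem' := ⟨zero_mem _, by rw [lie_zero, smul_zero]⟩
  smul_mem' a v hv := ⟨Submodule.smul_mem _ _ hv.1, by rw [lie_smul, hv.2, smul_comm]⟩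

lemma eq_or_of_topEigen_ne_bot [LieModule.IsIrreducible ℂ D.tau V] {c c' : ℂ}
    (hc : D.topEigen V c ≠ ⊥) (hc' : D.topEigen V c' ≠ ⊥) :
    c' = c ∨ ∃ q : ℕ, c' = c - (q + 1 : ℕ) := by
  by_contra! h
  refine hc' ((Submodule.eq_bot_iff _).2 fun w hw => ?_)
  have h0 := top_le_sup_of_le_topS (D.topEigen V c) (fun v hv => hv.1) (fun x hx v hv =>
      ⟨(D.topS V).lie_mem (x := ⟨x, hx⟩) hv.1, by
        have := lie_lie_eigen (a := 0) (by rw [zero_smul]; exact hx) hv.2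
        rwa [zero_add] at this⟩) (fun v hv => hv.2) hc
  obtain ⟨a, ha, f, hf, haf⟩ := Submodule.mem_sup.1 (h0 (Submodule.mem_top (x := w)))
  have hle : (⨆ q : ℕ, End.eigenspace (LieModule.toEnd ℂ D.tau V (D.d 0)) (c - (q + 1 : ℕ))) ≤
      ⨆ b, ⨆ (_ : b ≠ c'), End.eigenspace (LieModule.toEnd ℂ D.tau V (D.d 0)) b :=
    iSup_le fun q v hv => Submodule.mem_iSup_of_mem _ (Submodule.mem_iSup_of_mem (h.2 q).symm hv)
  have ha1 : a ∈ End.eigenspace (LieModule.toEnd ℂ D.tau V (D.d 0)) c :=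
    End.mem_eigenspace_iff.2 ha.2
  have h1 : w ∈ ⨆ b, ⨆ (_ : b ≠ c'), End.eigenspace (LieModule.toEnd ℂ D.tau V (D.d 0)) b := by
    rw [← haf]
    exact add_mem (Submodule.mem_iSup_of_mem c (Submodule.mem_iSup_of_mem h.1.symm ha1)) (hle hf)
  have h2 : w ∈ End.eigenspace (LieModule.toEnd ℂ D.tau V (D.d 0)) c' :=
    End.mem_eigenspace_iff.2 hw.2
  have h3 := (End.eigenspaces_iSupIndep _ c').le_bot ⟨h2, h1⟩
  simpa using h3

lemma eq_of_topEigen_ne_bot [LieModule.IsIrreducible ℂ D.tau V] {c c' : ℂ}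
    (hc : D.topEigen V c ≠ ⊥) (hc' : D.topEigen V c' ≠ ⊥) : c' = c := by
  rcases eq_or_of_topEigen_ne_bot hc hc' with h | ⟨q, h⟩
  · exact h
  rcases eq_or_of_topEigen_ne_bot hc' hc with h' | ⟨p, h'⟩
  · exact h'.symm
  exfalso
  rw [h] at h'
  have h3 : ((p + 1 + (q + 1) : ℕ) : ℂ) = 0 := by push_cast at h' ⊢; linear_combination h'
  exact absurd h3 (Nat.cast_ne_zero.2 (by omega))

lemma exists_topEigen_ne_bot [Nontrivial V] (hV : D.IsBounded V ψ) :
    ∃ d : ℂ, D.topEigen V d ≠ ⊥ := by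
  have G0 := isGrading_eigenspace_d (.of_isInternal hV.isInternal : IsGrading (D.weightSpace V))
  let A : Set ℝ := {x | ∃ (μ : ℂ) (v : V), v ≠ 0 ∧ ⁅D.d 0, v⁆ = μ • v ∧ μ.re = x}
  obtain ⟨M, hM⟩ := hV.bounded
  have hA : BddAbove A := ⟨M, by rintro _ ⟨μ, v, hv, h, rfl⟩; exact hM μ v hv h⟩
  have hAne : A.Nonempty := by
    by_contra h
    obtain ⟨v, hv⟩ := exists_ne (0 : V)
    refine hv (G0.eq_zero_of_proj fun c => ?_)
    by_contra h0
    exact h ⟨_, c, _, h0, End.mem_eigenspace_iff.1 (G0.proj_mem c v), rfl⟩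
  obtain ⟨_, ⟨μ, v, hv, hμ, rfl⟩, hlt⟩ := exists_lt_of_lt_csSup hAne (sub_one_lt (sSup A))
  refine ⟨μ, (Submodule.ne_bot_iff _).2 ⟨v, ⟨?_, hμ⟩, hv⟩⟩
  intro q hq x hx
  by_contra h0
  have h1 := le_csSup hA ⟨_, _, h0, lie_lie_eigen hx hμ, rfl⟩
  have h2 : (1 : ℝ) ≤ q := by exact_mod_cast hq
  simp only [Complex.add_re, Complex.intCast_re] at h1
  linarith

/-- `d₀` acts on `S ≠ 0` by a scalar. -/
lemma exists_d_topS [LieModule.IsIrreducible ℂ D.tau V] (hV : D.IsBounded V ψ) :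
    ∃ d : ℂ, (∀ v ∈ D.topS V, ⁅D.d 0, v⁆ = d • v) ∧ ∃ v ∈ D.topS V, v ≠ 0 := by
  have G0 := isGrading_eigenspace_d (.of_isInternal hV.isInternal : IsGrading (D.weightSpace V))
  have : Nontrivial V := LieModule.nontrivial_of_isIrreducible ℂ D.tau V
  obtain ⟨μ, hμ⟩ := exists_topEigen_ne_bot hV
  obtain ⟨v, hv, hv0⟩ := (Submodule.ne_bot_iff _).1 hμ
  refine ⟨μ, fun w hw => ?_, v, hv.1, hv0⟩
  have hproj : ∀ c, G0.proj c w ∈ D.topEigen V c := fun c => by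
    refine ⟨fun q hq x hx => ?_, End.mem_eigenspace_iff.1 (G0.proj_mem c w)⟩
    have := G0.proj_comm G0 (x := LieModule.toEnd ℂ D.tau V x) (f := fun c => q + c)
      (add_right_injective _) (fun lam v hv => End.mem_eigenspace_iff.2
        (lie_lie_eigen hx (End.mem_eigenspace_iff.1 hv))) c w
    rw [LieModule.toEnd_apply_apply, LieModule.toEnd_apply_apply, hw q hq x hx, map_zero] at this
    exact this.symm
  have hw2 : w = G0.proj μ w := by
    refine G0.ext fun c => ?_
    by_cases hc : c = μ
    · subst hc; rw [G0.proj_of_mem (G0.proj_mem c w)]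
    · rw [G0.proj_of_ne hc (G0.proj_mem μ w)]
      by_contra h0
      exact hc (eq_of_topEigen_ne_bot hμ ((Submodule.ne_bot_iff _).2 ⟨_, hproj c, h0⟩))
  rw [hw2]
  exact (hproj μ).2

/-- `S` is irreducible. -/
lemma topS_irreducible [LieModule.IsIrreducible ℂ D.tau V] {d : ℂ}
    (hd : ∀ v ∈ D.topS V, ⁅D.d 0, v⁆ = d • v) (N : Submodule ℂ (D.topS V))
    (hN : ∀ x : D.tau0, ∀ v ∈ N, ⁅x, v⁆ ∈ N) : N = ⊥ ∨ N = ⊤ := by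
  refine or_iff_not_imp_left.2 fun hne => eq_top_iff.2 fun s _ => ?_
  let i : (D.topS V) →ₗ[ℂ] V := (D.topS V).toSubmodule.subtype
  have h1 := top_le_sup_of_le_topS (N.map i) (by rintro _ ⟨v, _, rfl⟩; exact v.2) (c := d)
    (by rintro x hx _ ⟨v, hv, rfl⟩; exact ⟨⁅(⟨x, hx⟩ : D.tau0), v⁆, hN _ v hv, rfl⟩)
    (by rintro _ ⟨v, _, rfl⟩; exact hd _ v.2)
    (fun h => hne (Submodule.map_injective_of_injective (f := i) Subtype.val_injective
      (h.trans (Submodule.map_bot _).symm)))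
  obtain ⟨_, ⟨a, ha, rfl⟩, f, hf, hs⟩ := Submodule.mem_sup.1 (h1 (Submodule.mem_top (x := (s : V))))
  have hfS : f = ((s - a : D.topS V) : V) := by
    rw [LieSubmodule.coe_sub, ← hs]
    change f = i a + f - i a
    abel
  have hf0 : f = 0 := by
    refine disjoint_eigenspace_sup (c' := d) (fun q h => ?_) ?_ hf
    · have : ((q + 1 : ℕ) : ℂ) = 0 := by linear_combination h
      exact absurd this (Nat.cast_ne_zero.2 (Nat.succ_ne_zero _))
    · rw [hfS]; exact hd _ (s - a).2
  have : s = a := Subtype.ext (by rw [← hs, hf0, add_zero]; rfl)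
  exact this ▸ ha

end TwistData
end Toroidal

namespace Toroidal
open Module (End)

lemma pow_apply_pow_of_commutator {M : Type*} [AddCommGroup M] [Module ℂ M] {Z E : End ℂ M} {c : ℂ}
    (h : E * Z = Z * E - c • 1) {v : M} (hv : Z v = 0) (j : ℕ) :
    (Z ^ j) ((E ^ j) v) = (c ^ j * j.factorial) • v := by
  induction j with
  | zero => simp
  | succ j ih =>
    have h1 := LinearMap.congr_fun (pow_mul_eq_of_commutator (a := E) (x := Z) (w := -(c • 1))
      (by rw [h, sub_eq_add_neg]) (by simp) j) v
    simp only [Module.End.mul_apply, hv, map_zero, LinearMap.add_apply, LinearMap.smul_apply,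
      LinearMap.neg_apply, Module.End.one_apply] at h1
    have h2 : Z ((E ^ (j + 1)) v) = ((j + 1 : ℂ) * c) • (E ^ j) v := by
      have := eq_neg_of_add_eq_zero_left h1.symm
      rw [this, ← Nat.cast_smul_eq_nsmul ℂ, smul_neg, neg_neg, smul_smul]
      push_cast; rfl
    rw [pow_succ, Module.End.mul_apply, h2, map_smul, ih, smul_smul, Nat.factorial_succ]
    congr 1
    push_cast; ring

lemma vec_apply {N : ℕ} (k : Lat N) (i : Fin N) : k.vec i = k i := rfl

namespace TwistData

variable {n : ℕ} {𝔤 : Type*} [LieRing 𝔤] [LieAlgebra ℂ 𝔤] {D : TwistData n 𝔤}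
variable [FiniteDimensional ℂ 𝔤] [LieAlgebra.IsSimple ℂ 𝔤]

/-- `cc r` as a linear map. -/
def ccL (r : Lat (n + 1)) (hr : r ∈ D.gam) : (Fin (n + 1) → ℂ) →ₗ[ℂ] D.tau where
  toFun := cc r hr
  map_add' := cc_add r hr
  map_smul' := cc_smul r hr

variable {V : Type*} [AddCommGroup V] [Module ℂ V] [LieRingModule D.tau V] [LieModule ℂ D.tau V]
variable {ψ : Fin (n + 1) → ℂ}

lemma toEnd_cc_zero (hψ : ∀ i (v : V), ⁅D.K i, v⁆ = ψ i • v) (w : Fin (n + 1) → ℂ) (v : V) :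
    ⁅cc (D := D) 0 (zero_mem _) w, v⁆ = pair w ψ • v := by
  let f : (Fin (n + 1) → ℂ) →ₗ[ℂ] V :=
    (LieModule.toEnd ℂ D.tau V).toLinearMap.flip v ∘ₗ ccL 0 (zero_mem _)
  let g : (Fin (n + 1) → ℂ) →ₗ[ℂ] V := (pair.flip ψ).smulRight v
  have : f = g := (Pi.basisFun ℂ (Fin (n + 1))).ext fun i => by
    rw [Pi.basisFun_apply]
    change ⁅D.K i, v⁆ = pair (Pi.single i 1) ψ • v
    rw [hψ, pair_single]
  exact LinearMap.congr_fun this w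

omit [FiniteDimensional ℂ 𝔤] [LieAlgebra.IsSimple ℂ 𝔤] in
lemma cons_sc_mem (j : ℤ) (r : Lat n) :
    (Fin.cons (D.m 0 * j) (D.sc r) : Lat (n + 1)) ∈ D.gam := by
  intro i
  induction i using Fin.cases with
  | zero => exact dvd_mul_right _ _
  | succ i => exact D.sc_mem r i

lemma lie_de_cc_of_add_eq_zero {r s : Lat (n + 1)} (hr : r ∈ D.gam) (hs : s ∈ D.gam)
    (h : r + s = 0) (a w : Fin (n + 1) → ℂ) : ⁅de r hr a, cc s hs w⁆ =
      cc 0 (zero_mem _) (pair a s.vec • w + pair a w • r.vec) := by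
  rw [lie_de_cc]; exact cc_congr _ _ h _

/-- The operators `t^q K₀` have no kernel on `S`. -/
lemma eq_zero_of_lie_c0_eq_zero (hV : D.IsBounded V ψ) (hC₀ : ψ 0 ≠ 0) (q : Lat n) (hq : q ≠ 0)
    {v : V} (hv : v ∈ D.topS V) {lam : Fin (n + 1) → ℂ} (hlam : v ∈ D.weightSpace V lam)
    (h : ⁅cc (emb (D.sc q)) (D.emb_sc_mem q) (Pi.single 0 1), v⁆ = 0) : v = 0 := by
  by_contra hv0
  obtain ⟨a, ha⟩ : ∃ a, q a ≠ 0 := by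
    by_contra! h0; exact hq (funext h0)
  let φ := LieModule.toEnd ℂ D.tau V
  have hφ : ∀ x y, φ x * φ y = φ y * φ x + φ ⁅x, y⁆ := fun x y => by
    rw [LieHom.map_lie, Ring.lie_def]; abel
  let z : D.tau := cc (emb (D.sc q)) (D.emb_sc_mem q) (Pi.single 0 1)
  let e : D.tau := de (emb (D.sc (-q))) (D.emb_sc_mem _) (Pi.single a.succ 1)
  let B : ℕ → D.tau := fun j =>
    cc (Fin.cons (D.m 0 * (-1)) (D.sc (j • q))) (cons_sc_mem _ _) (Pi.single a.succ 1)
  let A : ℕ → D.tau := fun j =>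
    de (Fin.cons (D.m 0 * 1) (D.sc (-(j • q)))) (cons_sc_mem _ _) (Pi.single a.succ 1)
  have hne : ((D.sc q a : ℤ) : ℂ) ≠ 0 := by
    have : (D.m a.succ : ℤ) * q a ≠ 0 :=
      mul_ne_zero (by exact_mod_cast (D.m_pos _).ne') ha
    exact_mod_cast this
  have hez : φ e * φ z = φ z * φ e - (-(D.sc q a * ψ 0 : ℂ)) • 1 := by
    rw [hφ, neg_smul, sub_neg_eq_add]
    congr 1
    ext w
    change ⁅⁅e, z⁆, w⁆ = _
    rw [lie_de_cc_of_add_eq_zero (D.emb_sc_mem _) (D.emb_sc_mem q)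
      (by rw [← emb_add, ← sc_add, neg_add_cancel, sc_zero, emb_zero]),
      toEnd_cc_zero hV.central, pair_single, pair_single]
    simp [pair_single, vec_apply, emb]
  have hz : φ z v = 0 := h
  have hBz : ∀ j, φ (B j) * φ z = φ z * φ (B j) := fun j => by
    rw [hφ, lie_cc_cc, map_zero, add_zero]
  let u : ℕ → V := fun j => φ (B j) ((φ e ^ j) v)
  let κ : ℂ := D.sc q a * ψ a.succ - pair (D.sv q) ψ
  have hAB : ∀ (j : ℕ) (w : V), ⁅A j, ⁅B j, w⁆⁆ = ⁅B j, ⁅A j, w⁆⁆ + (D.m 0 * ψ 0 + j * κ) • w := by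
    intro j w
    rw [leibniz_lie, lie_de_cc_of_add_eq_zero (cons_sc_mem _ _) (cons_sc_mem _ _) ?_,
      toEnd_cc_zero hV.central, add_comm]
    · congr 2
      have h1 : Lat.vec (Fin.cons (D.m 0 * 1) (D.sc (-(j • q))) : Lat (n + 1)) =
          (D.m 0 : ℂ) • (Pi.single 0 1) - (j : ℂ) • D.sv q := by
        ext i
        refine Fin.cases ?_ (fun i => ?_) i
        · simp [vec_apply, sv_apply_zero]
        · simp [vec_apply, sv_apply_succ, sc, mul_left_comm]
      rw [h1, pair_single, pair_single, map_add, LinearMap.add_apply, map_smul, map_smul, map_sub,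
        map_smul, map_smul]
      simp [pair_single, vec_apply, sc, κ]
      ring
    · ext i
      refine Fin.cases ?_ (fun i => ?_) i <;> simp [sc]
  have hBv : ∀ j : ℕ, D.m 0 * ψ 0 + j * κ ≠ 0 → φ (B j) v ≠ 0 := by
    intro j hj h0
    have h1 := hAB j v
    rw [show ⁅B j, v⁆ = 0 from h0, lie_zero, hv (D.m 0) (by exact_mod_cast D.m_pos 0) (A j)
      ((lie_d_de 0 _ _ _).trans (congrArg (fun c : ℤ => (c : ℂ) • A j) (mul_one _))), lie_zero, zero_add] at h1
    exact (smul_ne_zero hj hv0) h1.symm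
  have hzu : ∀ i j, (φ z ^ i) (u j) = φ (B j) ((φ z ^ i) ((φ e ^ j) v)) := fun i j => by
    have : Commute (φ (B j)) (φ z ^ i) := Commute.pow_right (show Commute _ _ from hBz j) i
    exact (LinearMap.congr_fun this.eq ((φ e ^ j) v)).symm
  have hc : (-(D.sc q a * ψ 0 : ℂ)) ≠ 0 := neg_ne_zero.2 (mul_ne_zero hne hC₀)
  have hu1 : ∀ j : ℕ, D.m 0 * ψ 0 + j * κ ≠ 0 → (φ z ^ j) (u j) ≠ 0 := fun j hj => by
    rw [hzu, pow_apply_pow_of_commutator hez hz, map_smul]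
    exact smul_ne_zero (mul_ne_zero (pow_ne_zero _ hc) (by exact_mod_cast j.factorial_ne_zero))
      (hBv j hj)
  have hu2 : ∀ j : ℕ, (φ z ^ (j + 1)) (u j) = 0 := fun j => by
    rw [hzu, pow_succ', Module.End.mul_apply, pow_apply_pow_of_commutator hez hz, map_smul, hz,
      smul_zero, map_zero]
  have he : ∀ j : ℕ, (φ e ^ j) v ∈ D.weightSpace V ((emb (D.sc (-(j • q)))).vec + lam) := by
    intro j
    induction j with
    | zero => simpa [sc_zero, emb_zero, vec_zero] using hlam
    | succ j ih =>
      rw [pow_succ', Module.End.mul_apply]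
      have := lie_mem_weightSpace (x := e) (fun i => lie_d_de i _ _ _) ih
      have hj : -q + -(j • q) = -((j + 1) • q) := by rw [succ_nsmul]; abel
      rwa [← add_assoc, ← vec_add, ← emb_add, ← sc_add, hj] at this
  have hu : ∀ j, u j ∈ D.weightSpace V (Lat.vec (Fin.cons (-(D.m 0 : ℤ)) 0 : Lat (n + 1)) + lam) := by
    intro j
    have := lie_mem_weightSpace (x := B j) (fun i => lie_d_cc i _ _ _) (he j)
    have hs : (Fin.cons (D.m 0 * (-1)) (D.sc (j • q)) : Lat (n + 1)) + emb (D.sc (-(j • q))) =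
        Fin.cons (-(D.m 0 : ℤ)) 0 := by
      ext i
      refine Fin.cases ?_ (fun i => ?_) i <;> simp [sc, emb]
    rwa [← add_assoc, ← vec_add, hs] at this
  set U := D.weightSpace V (Lat.vec (Fin.cons (-(D.m 0 : ℤ)) 0 : Lat (n + 1)) + lam) with hU
  have : FiniteDimensional ℂ U := hV.finiteDimensional _
  have hmono : Monotone fun i => (LinearMap.ker (φ z ^ i)).comap U.subtype :=
    monotone_nat_of_le_succ fun i w hw => by
      simp only [Submodule.mem_comap, LinearMap.mem_ker] at hw ⊢
      rw [pow_succ', Module.End.mul_apply, hw, map_zero]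
  obtain ⟨N, hN⟩ := monotone_stabilizes_iff_noetherian.2
    (inferInstance : IsNoetherian ℂ U) ⟨_, hmono⟩
  have key : ∀ j : ℕ, N ≤ j → D.m 0 * ψ 0 + j * κ = 0 := fun j hj => by
    by_contra h0
    refine hu1 j h0 ?_
    have h2 : (⟨u j, hu j⟩ : U) ∈ (LinearMap.ker (φ z ^ (j + 1))).comap U.subtype := hu2 j
    have h3 := (hN (j + 1) (by omega)).symm.trans (hN j hj)
    exact (h3.le h2 : _)
  have h1 := key N le_rfl
  have h2 := key (N + 1) (by omega)
  have h3 : κ = 0 := by push_cast at h2; linear_combination h2 - h1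
  rw [h3, mul_zero, add_zero] at h1
  exact (mul_ne_zero (by exact_mod_cast (D.m_pos 0).ne') hC₀) h1

/-- The structure of the space `S` of highest weight vectors as a `τ₀`-module. -/
structure IsTop {M : Type*} [AddCommGroup M] [Module ℂ M] (π : D.tau0 →ₗ⁅ℂ⁆ End ℂ M)
    (gr : Lat n → Submodule ℂ M) (α : Fin n → ℂ) (d C₀ : ℂ) : Prop where
  nontrivial : Nontrivial M
  grading : IsGrading gr
  finite : ∀ k, FiniteDimensional ℂ (gr k)
  mem_gr : ∀ k v, v ∈ gr k ↔ ∀ i : Fin n, π (D.e0 0 (Pi.single i.succ 1)) v = (α i + k i) • v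
  d_zero : π (D.e0 0 (Pi.single 0 1)) = d • 1
  c_zero : π (D.c0 0 (Pi.single 0 1)) = C₀ • 1
  ne_zero : C₀ ≠ 0
  irreducible : ∀ N : Submodule ℂ M, (∀ x, N ≤ N.comap (π x)) → N = ⊥ ∨ N = ⊤
  c_injective : ∀ q v, π (D.c0 q (Pi.single 0 1)) v = 0 → v = 0

variable (V D) in
/-- The weight spaces of `S`. -/
def topGr (α : Fin n → ℂ) (d : ℂ) (k : Lat n) : Submodule ℂ (D.topS V) :=
  (D.weightSpace V (Fin.cons d fun i => α i + k i)).comap (D.topS V).toSubmodule.subtype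

lemma lie_mem_topGr {α : Fin n → ℂ} {d : ℂ} {x : D.tau0} {κ : Lat n}
    (hx : ∀ i, ⁅D.d i, (x : D.tau)⁆ = (emb κ i : ℂ) • (x : D.tau)) {k : Lat n} {v : D.topS V}
    (hv : v ∈ D.topGr V α d k) : ⁅x, v⁆ ∈ D.topGr V α d (k + κ) := by
  have h1 := lie_mem_weightSpace (V := V) hx hv
  have h2 : ((emb κ).vec + Fin.cons d fun i => α i + k i : Fin (n + 1) → ℂ) =
      Fin.cons d fun i => α i + (k + κ) i := by
    ext i
    refine Fin.cases ?_ (fun i => ?_) i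
    · simp [vec_apply, emb]
    · simp [vec_apply, emb]; ring
  rw [h2] at h1
  exact h1

lemma isTop_topS [LieModule.IsIrreducible ℂ D.tau V] (hV : D.IsBounded V ψ) (hC₀ : ψ 0 ≠ 0) {d : ℂ}
    (hd : ∀ v ∈ D.topS V, ⁅D.d 0, v⁆ = d • v) {α : Fin n → ℂ} {k₀ : Lat n} {v₀ : D.topS V}
    (hv₀ : v₀ ≠ 0) (hvk : v₀ ∈ D.topGr V α d k₀) :
    IsTop (LieModule.toEnd ℂ D.tau0 (D.topS V)) (D.topGr V α d) α d (ψ 0) := by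
  have G : IsGrading (D.weightSpace V) := .of_isInternal hV.isInternal
  have G1 := G.comap_subtype (N := (D.topS V).toSubmodule) fun lam v hv => proj_mem_topS G hv lam
  have hinj : Function.Injective fun k : Lat n =>
      (Fin.cons d fun i => α i + k i : Fin (n + 1) → ℂ) := fun k l h => by
    ext i
    simpa using congrFun h i.succ
  have hxl : ∀ l X hX i, ⁅D.d i, (D.x0 l X hX : D.tau)⁆ = (emb l i : ℂ) • (D.x0 l X hX : D.tau) :=
    fun l X hX i => lie_d_xx i _ X hX
  have hcr : ∀ r w i, ⁅D.d i, (D.c0 r w : D.tau)⁆ = (emb (D.sc r) i : ℂ) • (D.c0 r w : D.tau) :=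
    fun r w i => lie_d_cc i _ (D.emb_sc_mem r) w
  have her : ∀ r w i, ⁅D.d i, (D.e0 r w : D.tau)⁆ = (emb (D.sc r) i : ℂ) • (D.e0 r w : D.tau) :=
    fun r w i => lie_d_de i _ (D.emb_sc_mem r) w
  have Gr : IsGrading (D.topGr V α d) := by
    refine ⟨G1.indep.comp hinj, ?_⟩
    refine (topS_irreducible hd (⨆ k, D.topGr V α d k) fun x => ?_).resolve_left fun h => hv₀ ?_
    · have key : ∀ (x : D.tau0) (κ : Lat n),
          (∀ i, ⁅D.d i, (x : D.tau)⁆ = (emb κ i : ℂ) • (x : D.tau)) →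
          ∀ v ∈ ⨆ k, D.topGr V α d k, ⁅x, v⁆ ∈ ⨆ k, D.topGr V α d k := by
        intro x κ hx v hv
        refine Submodule.iSup_induction _ (motive := fun v => ⁅x, v⁆ ∈ ⨆ k, D.topGr V α d k) hv
          (fun k v hv => Submodule.mem_iSup_of_mem _ (lie_mem_topGr hx hv)) ?_ fun a b ha hb => ?_
        · rw [lie_zero]; exact zero_mem _
        · rw [lie_add]; exact add_mem ha hb
      intro v hv
      have hx := (tau0_span (D := D)).ge (Submodule.mem_top (x := x))
      induction hx using Submodule.span_induction with
      | mem x hx =>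
        rcases hx with (⟨l, X, hX, rfl⟩ | ⟨r, w, rfl⟩) | ⟨r, w, rfl⟩
        · exact key _ l (hxl l X hX) v hv
        · exact key _ _ (hcr r w) v hv
        · exact key _ _ (her r w) v hv
      | zero => rw [zero_lie]; exact zero_mem _
      | add x y _ _ hx hy => rw [add_lie]; exact add_mem hx hy
      | smul c x _ hx => rw [smul_lie]; exact Submodule.smul_mem _ _ hx
    · have := Submodule.mem_iSup_of_mem (p := D.topGr V α d) k₀ hvk
      rw [h] at this
      simpa using this
  have he0 : ∀ i, (D.e0 0 (Pi.single i 1) : D.tau) = D.d i := fun i =>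
    de_congr (D.emb_sc_mem 0) (zero_mem _) (by rw [sc_zero, emb_zero]) _
  have hc0 : ∀ i, (D.c0 0 (Pi.single i 1) : D.tau) = D.K i := fun i =>
    cc_congr (D.emb_sc_mem 0) (zero_mem _) (by rw [sc_zero, emb_zero]) _
  have hcoe : ∀ (x : D.tau0) (v : D.topS V), ((⁅x, v⁆ : D.topS V) : V) = ⁅(x : D.tau), (v : V)⁆ :=
    fun x v => rfl
  have hC0 : LieModule.toEnd ℂ D.tau0 (D.topS V) (D.c0 0 (Pi.single 0 1)) = ψ 0 • 1 := by
    ext v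
    change ((⁅D.c0 0 (Pi.single 0 1), v⁆ : D.topS V) : V) = ψ 0 • (v : V)
    rw [hcoe, hc0, hV.central]
  refine ⟨⟨v₀, 0, hv₀⟩, Gr, fun k => ?_, fun k v => ?_, ?_, hC0, hC₀,
    fun N hN => topS_irreducible hd N fun x v hv => hN x hv, fun q v hqv => ?_⟩
  · have := hV.finiteDimensional (Fin.cons d fun i => α i + k i)
    exact Module.Finite.of_injective
      ((D.topS V).toSubmodule.subtype.submoduleComap _) fun a b hab =>
        Subtype.ext (Subtype.ext (by
          have := congrArg Subtype.val hab
          exact this))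
  · constructor
    · intro hv i
      refine Subtype.ext ?_
      rw [LieModule.toEnd_apply_apply, hcoe, he0]
      exact hv i.succ
    · intro hv i
      refine Fin.cases ?_ (fun i => ?_) i
      · exact hd v v.2
      · have := congrArg Subtype.val (hv i)
        rw [LieModule.toEnd_apply_apply, hcoe, he0] at this
        exact this
  · ext v
    change ((⁅D.e0 0 (Pi.single 0 1), v⁆ : D.topS V) : V) = d • (v : V)
    rw [hcoe, he0, hd v v.2]
  · by_cases hq : q = 0
    · rw [hq, hC0] at hqv
      exact (smul_eq_zero.1 hqv).resolve_left hC₀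
    · refine Gr.eq_zero_of_proj fun k => ?_
      have h1 := Gr.proj_comm Gr
        (x := LieModule.toEnd ℂ D.tau0 (D.topS V) (D.c0 q (Pi.single 0 1)))
        (f := fun k => k + D.sc q) (add_left_injective _)
        (fun k v hv => lie_mem_topGr (hcr q _) hv) k v
      rw [hqv, map_zero] at h1
      refine Subtype.ext (eq_zero_of_lie_c0_eq_zero hV hC₀ q hq (Gr.proj k v).2 (Gr.proj_mem k v) ?_)
      exact (congrArg Subtype.val h1.symm : _)

end TwistData
end Toroidal

namespace Toroidal
open Module (End)

section DegZero
variable {ι M : Type*} [AddCommGroup M] [Module ℂ M]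

/-- The operators preserving every subspace `gr k`. -/
def degZero (gr : ι → Submodule ℂ M) : Submodule ℂ (End ℂ M) where
  carrier := {u | ∀ k, gr k ≤ (gr k).comap u}
  add_mem' ha hb k _ hv := (gr k).add_mem (ha k hv) (hb k hv)
  zero_mem' k _ _ := (gr k).zero_mem
  smul_mem' c _ ha k _ hv := Submodule.smul_mem _ c (ha k hv)

lemma mem_degZero {gr : ι → Submodule ℂ M} {u : End ℂ M} :
    u ∈ degZero gr ↔ ∀ k, gr k ≤ (gr k).comap u := Iff.rfl

lemma commute_of_mem_adjoin {S : Set (End ℂ M)} {y : End ℂ M} (hS : ∀ s ∈ S, s * y = y * s)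
    {u : End ℂ M} (hu : u ∈ Algebra.adjoin ℂ S) : u * y = y * u := by
  induction hu using Algebra.adjoin_induction with
  | mem x hx => exact hS x hx
  | algebraMap c => exact Algebra.commutes c y
  | add a b _ _ ha hb => rw [add_mul, mul_add, ha, hb]
  | mul a b _ _ ha hb => rw [mul_assoc, hb, ← mul_assoc, ha, mul_assoc]

lemma commutator_mem_adjoin {S : Set (End ℂ M)} {y : End ℂ M}
    (hS : ∀ s ∈ S, s * y - y * s ∈ Algebra.adjoin ℂ S)
    {u : End ℂ M} (hu : u ∈ Algebra.adjoin ℂ S) : u * y - y * u ∈ Algebra.adjoin ℂ S := by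
  induction hu using Algebra.adjoin_induction with
  | mem x hx => exact hS x hx
  | algebraMap c => rw [Algebra.commutes c y, sub_self]; exact zero_mem _
  | add a b _ _ ha hb =>
    have : (a + b) * y - y * (a + b) = (a * y - y * a) + (b * y - y * b) := by noncomm_ring
    rw [this]; exact add_mem ha hb
  | mul a b ha' hb' ha hb =>
    have : (a * b) * y - y * (a * b) = a * (b * y - y * b) + (a * y - y * a) * b := by noncomm_ring
    rw [this]; exact add_mem (mul_mem ha' hb) (mul_mem ha hb')

lemma inverse_commutator {R : Type*} [Ring R] {z zi y : R} (h1 : z * zi = 1) (h2 : zi * z = 1) :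
    zi * y - y * zi = - (zi * (z * y - y * z) * zi) := by
  rw [mul_sub, sub_mul, ← mul_assoc zi z, h2, one_mul, ← mul_assoc zi y, mul_assoc (zi * y), h1,
    mul_one]
  abel

end DegZero

namespace TwistData

variable {n : ℕ} {𝔤 : Type*} [LieRing 𝔤] [LieAlgebra ℂ 𝔤] {D : TwistData n 𝔤}
variable [FiniteDimensional ℂ 𝔤] [LieAlgebra.IsSimple ℂ 𝔤]

lemma c0_zero (r : Lat n) : D.c0 r 0 = 0 := by
  have := c0_smul (D := D) r 0 0
  simpa using this

lemma x0_congr {k l : Lat n} {X : 𝔤} (hk : X ∈ D.gradeSpace (emb k))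
    (hl : X ∈ D.gradeSpace (emb l)) (h : k = l) : D.x0 k X hk = D.x0 l X hl := by subst h; rfl

variable {M : Type*} [AddCommGroup M] [Module ℂ M] {π : D.tau0 →ₗ⁅ℂ⁆ End ℂ M}
    {gr : Lat n → Submodule ℂ M} {α : Fin n → ℂ} {d C₀ : ℂ}

lemma map_mul_map (x y : D.tau0) : π x * π y = π y * π x + π ⁅x, y⁆ := by
  rw [LieHom.map_lie, Ring.lie_def]; abel

lemma map_map_apply (x y : D.tau0) (v : M) : π x (π y v) = π y (π x v) + π ⁅x, y⁆ v :=
  LinearMap.congr_fun (map_mul_map x y) v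

namespace IsTop
variable (h : IsTop π gr α d C₀)
include h

lemma c0_mem {k : Lat n} {v : M} (hv : v ∈ gr k) (r : Lat n) (w : Fin (n + 1) → ℂ) :
    π (D.c0 r w) v ∈ gr (k + D.sc r) := by
  refine (h.mem_gr _ _).2 fun i => ?_
  rw [map_map_apply, (h.mem_gr k v).1 hv i, lie_e0_c0, pair_single, sv_zero, smul_zero, add_zero,
    zero_add, c0_smul, map_smul, map_smul, sv_apply_succ, LinearMap.smul_apply, ← add_smul]
  congr 1
  simp; ring

lemma e0_mem {k : Lat n} {v : M} (hv : v ∈ gr k) (r : Lat n) (w : Fin (n + 1) → ℂ) :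
    π (D.e0 r w) v ∈ gr (k + D.sc r) := by
  refine (h.mem_gr _ _).2 fun i => ?_
  rw [map_map_apply, (h.mem_gr k v).1 hv i, lie_e0_e0, pair_single, sv_zero, c0_zero, smul_zero,
    add_zero, zero_add, map_zero, zero_smul, sub_zero, e0_smul, map_smul, map_smul, sv_apply_succ,
    LinearMap.smul_apply, ← add_smul]
  congr 1
  simp; ring

lemma x0_mem {k : Lat n} {v : M} (hv : v ∈ gr k) (l : Lat n) (X : 𝔤)
    (hX : X ∈ D.gradeSpace (emb l)) : π (D.x0 l X hX) v ∈ gr (k + l) := by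
  refine (h.mem_gr _ _).2 fun i => ?_
  have hX' : X ∈ D.gradeSpace (emb (l + D.sc 0)) := by rwa [sc_zero, add_zero]
  rw [map_map_apply, (h.mem_gr k v).1 hv i, lie_e0_x0 _ _ _ X hX hX', pair_single,
    x0_congr hX' hX (by rw [sc_zero, add_zero]), map_smul, map_smul, LinearMap.smul_apply,
    ← add_smul]
  congr 1
  simp [Lat.vec, emb]; ring

lemma irreducible_gens (N : Submodule ℂ M) (hx : ∀ l X hX, N ≤ N.comap (π (D.x0 l X hX)))
    (hc : ∀ r w, N ≤ N.comap (π (D.c0 r w))) (he : ∀ r w, N ≤ N.comap (π (D.e0 r w))) :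
    N = ⊥ ∨ N = ⊤ := by
  refine h.irreducible N fun x v hv => ?_
  have hx' := (tau0_span (D := D)).ge (Submodule.mem_top (x := x))
  rw [Submodule.mem_comap]
  induction hx' using Submodule.span_induction with
  | mem x hx' =>
    rcases hx' with (⟨l, X, hX, rfl⟩ | ⟨r, w, rfl⟩) | ⟨r, w, rfl⟩
    · exact hx l X hX hv
    · exact hc r w hv
    · exact he r w hv
  | zero => simp
  | add x y _ _ hx hy => rw [map_add]; exact add_mem hx hy
  | smul c x _ hx => rw [map_smul]; exact Submodule.smul_mem _ _ hx

lemma c0_bijective (q : Lat n) : Function.Bijective (π (D.c0 q (Pi.single 0 1))) := by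
  have hinj : ∀ q, Function.Injective (π (D.c0 q (Pi.single 0 1))) := fun q =>
    (injective_iff_map_eq_zero _).2 (h.c_injective q)
  refine ⟨hinj q, fun v => ?_⟩
  change v ∈ LinearMap.range (π (D.c0 q (Pi.single 0 1)))
  induction v using h.grading.induction with
  | hm k v hv =>
    have := h.finite k
    let f : End ℂ (gr k) := ((π (D.c0 q (Pi.single 0 1)) * π (D.c0 (-q) (Pi.single 0 1)))).restrict
      (p := gr k) (q := gr k) fun v hv => by
        have := h.c0_mem (h.c0_mem hv (-q) (Pi.single 0 1)) q (Pi.single 0 1)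
        rwa [sc_neg, neg_add_cancel_right] at this
    have hf : Function.Injective f := fun a b hab =>
      Subtype.ext (hinj _ (hinj _ (congrArg Subtype.val hab)))
    obtain ⟨w, hw⟩ := (LinearMap.injective_iff_surjective.1 hf) ⟨v, hv⟩
    exact ⟨_, congrArg Subtype.val hw⟩
  | h0 => exact zero_mem _
  | hadd a b ha hb => exact add_mem ha hb

/-- Operators of degree zero in the algebra generated by the `t^q Kₚ` and the inverses of
the `t^q K₀` are scalars. -/
lemma exists_inverse_forall_scalar : ∃ Zi : Lat n → End ℂ M,
    (∀ q, π (D.c0 q (Pi.single 0 1)) * Zi q = 1) ∧ (∀ q, Zi q * π (D.c0 q (Pi.single 0 1)) = 1) ∧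
    (∀ q k, ∀ v ∈ gr (k + D.sc q), Zi q v ∈ gr k) ∧
    ∀ u ∈ Algebra.adjoin ℂ ({u | ∃ q w, u = π (D.c0 q w)} ∪ Set.range Zi), u ∈ degZero gr →
      ∃ c : ℂ, u = c • 1 := by
  let Z : Lat n → (M ≃ₗ[ℂ] M) := fun q => LinearEquiv.ofBijective _ (h.c0_bijective q)
  let Zi : Lat n → End ℂ M := fun q => (Z q).symm.toLinearMap
  have h1 : ∀ q, π (D.c0 q (Pi.single 0 1)) * Zi q = 1 := fun q =>
    LinearMap.ext fun v => (Z q).apply_symm_apply v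
  have h2 : ∀ q, Zi q * π (D.c0 q (Pi.single 0 1)) = 1 := fun q =>
    LinearMap.ext fun v => (Z q).symm_apply_apply v
  have h3 : ∀ q k, ∀ v ∈ gr (k + D.sc q), Zi q v ∈ gr k := by
    intro q k v hv
    obtain ⟨w, rfl⟩ := (h.c0_bijective q).2 v
    rw [← Module.End.mul_apply, h2, Module.End.one_apply]
    have h4 : w = h.grading.proj k w := (h.c0_bijective q).1 (by
      rw [← h.grading.proj_comm h.grading (f := fun k => k + D.sc q) (add_left_injective _)
        (fun k v hv => h.c0_mem hv q _), h.grading.proj_of_mem hv])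
    rw [h4]
    exact h.grading.proj_mem k w
  have hcommZ : ∀ (y : End ℂ M) q, π (D.c0 q (Pi.single 0 1)) * y = y * π (D.c0 q (Pi.single 0 1)) →
      Zi q * y = y * Zi q := fun y q hy => by
    calc Zi q * y = Zi q * y * (π (D.c0 q (Pi.single 0 1)) * Zi q) := by rw [h1, mul_one]
      _ = Zi q * (y * π (D.c0 q (Pi.single 0 1))) * Zi q := by simp only [mul_assoc]
      _ = (Zi q * π (D.c0 q (Pi.single 0 1))) * y * Zi q := by rw [← hy]; simp only [mul_assoc]
      _ = y * Zi q := by rw [h2, one_mul]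
  refine ⟨Zi, h1, h2, h3, fun u hu hu0 => ?_⟩
  set A := Algebra.adjoin ℂ ({u | ∃ q w, u = π (D.c0 q w)} ∪ Set.range Zi) with hA
  have hcA : ∀ q w, π (D.c0 q w) ∈ A := fun q w => Algebra.subset_adjoin (Or.inl ⟨q, w, rfl⟩)
  have hZA : ∀ q, Zi q ∈ A := fun q => Algebra.subset_adjoin (Or.inr ⟨q, rfl⟩)
  have hAcomm : ∀ y : End ℂ M, (∀ q w, π (D.c0 q w) * y = y * π (D.c0 q w)) →
      ∀ u ∈ A, u * y = y * u := fun y hy u hu => by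
    refine commute_of_mem_adjoin ?_ hu
    rintro _ (⟨q, w, rfl⟩ | ⟨q, rfl⟩)
    · exact hy q w
    · exact hcommZ y q (hy q _)
  have hcc : ∀ q w, ∀ u ∈ A, u * π (D.c0 q w) = π (D.c0 q w) * u := fun q w =>
    hAcomm _ fun r v => by rw [map_mul_map, lie_c0_c0, map_zero, add_zero]
  have hAA : ∀ v ∈ A, ∀ u ∈ A, u * v = v * u := fun v hv =>
    hAcomm v fun q w => (hcc q w v hv).symm
  have := h.nontrivial
  have := h.finite
  refine eq_smul_one_of_normalized (u := u) gr h.grading.iSup_eq_top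
    (Subalgebra.toSubmodule A ⊓ degZero gr)
    (fun u hu v hv => hAA v hv.1 u hu.1) (fun u hu => mem_degZero.1 hu.2)
    ({x | ∃ l X hX, x = π (D.x0 l X hX)} ∪ {x | ∃ r w, x = π (D.c0 r w)} ∪
      {x | ∃ r w, x = π (D.e0 r w)}) (fun N hN => ?_) ?_ ⟨hu, hu0⟩
  · exact h.irreducible_gens N (fun l X hX => hN _ (Or.inl (Or.inl ⟨l, X, hX, rfl⟩)))
      (fun r w => hN _ (Or.inl (Or.inr ⟨r, w, rfl⟩))) (fun r w => hN _ (Or.inr ⟨r, w, rfl⟩))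
  · rintro _ ((⟨l, X, hX, rfl⟩ | ⟨r, w, rfl⟩) | ⟨r, w, rfl⟩)
    · left
      exact fun u hu => hAcomm _ (fun q w => by
        rw [map_mul_map, lie_c0_x0, map_zero, add_zero]) u hu.1
    · left
      exact fun u hu => hcc r w u hu.1
    · right
      have hy0 : ∀ k, gr k ≤ (gr k).comap (Zi r * π (D.e0 r w)) := fun k v hv => h3 r k _ (h.e0_mem hv r w)
      refine ⟨π (D.c0 r (Pi.single 0 1)), Zi r * π (D.e0 r w), ?_, fun u hu => hcc _ _ u hu.1,
        hy0, fun u hu => ⟨?_, mem_degZero.2 fun k v hv =>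
          (gr k).sub_mem (mem_degZero.1 hu.2 k (hy0 k hv)) (hy0 k (mem_degZero.1 hu.2 k hv))⟩⟩
      · rw [← mul_assoc, h1, one_mul]
      · have hc : ∀ q v, π (D.c0 q v) * (Zi r * π (D.e0 r w)) - Zi r * π (D.e0 r w) * π (D.c0 q v)
            ∈ A := fun q v => by
          have : π (D.c0 q v) * (Zi r * π (D.e0 r w)) - Zi r * π (D.e0 r w) * π (D.c0 q v) =
              - (Zi r * π ⁅D.e0 r w, D.c0 q v⁆) := by
            rw [← mul_assoc, ← hcc q v _ (hZA r), mul_assoc, mul_assoc, map_mul_map (D.e0 r w),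
              mul_add]
            abel
          rw [this, lie_e0_c0]
          exact neg_mem (mul_mem (hZA r) (hcA _ _))
        refine commutator_mem_adjoin ?_ hu.1
        rintro _ (⟨q, v, rfl⟩ | ⟨q, rfl⟩)
        · exact hc q v
        · set y := Zi r * π (D.e0 r w)
          rw [inverse_commutator (h1 q) (h2 q)]
          exact neg_mem (mul_mem (mul_mem (hZA q) (hc q _)) (hZA q))

end IsTop
end TwistData
end Toroidal

namespace Toroidal
open Module (End)

namespace TwistData

variable {n : ℕ} {𝔤 : Type*} [LieRing 𝔤] [LieAlgebra ℂ 𝔤] {D : TwistData n 𝔤}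

lemma exists_pair_sv_ne_zero (r : Lat n) (hr : r ≠ 0) :
    ∃ i : Fin n, pair (Pi.single i.succ 1) (D.sv r) ≠ 0 := by
  obtain ⟨i, hi⟩ : ∃ i, r i ≠ 0 := by
    by_contra! h0; exact hr (funext h0)
  refine ⟨i, ?_⟩
  rw [pair_single, sv_apply_succ]
  have : (D.m i.succ : ℤ) * r i ≠ 0 := mul_ne_zero (by exact_mod_cast (D.m_pos _).ne') hi
  exact_mod_cast this

lemma sv_neg (r : Lat n) : D.sv (-r) = - D.sv r := by
  rw [eq_neg_iff_add_eq_zero, ← sv_add, neg_add_cancel, sv_zero]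

lemma sv_single (i : Fin n) : D.sv (Pi.single i 1) = (D.m i.succ : ℂ) • Pi.single i.succ 1 := by
  ext j
  refine Fin.cases ?_ (fun j => ?_) j
  · simp [sv_apply_zero]
  · by_cases hij : j = i
    · subst hij; simp [sv_apply_succ, sc]
    · simp [sv_apply_succ, sc, hij]

/-- A linear form vanishing on the exponents `sv r` only depends on the zeroth coordinate. -/
lemma apply_eq_of_sv_eq_zero {f : (Fin (n + 1) → ℂ) →ₗ[ℂ] ℂ} (hf : ∀ r, f (D.sv r) = 0)
    (w : Fin (n + 1) → ℂ) : f w = w 0 * f (Pi.single 0 1) := by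
  have : f = (LinearMap.proj 0).smulRight (f (Pi.single 0 1)) :=
    (Pi.basisFun ℂ (Fin (n + 1))).ext fun i => by
      rw [Pi.basisFun_apply]
      refine Fin.cases ?_ (fun i => ?_) i
      · simp
      · have h1 := hf (Pi.single i 1)
        rw [sv_single, map_smul, smul_eq_zero] at h1
        rw [h1.resolve_left (by exact_mod_cast (D.m_pos _).ne')]
        simp
  have h2 := LinearMap.congr_fun this w
  simpa using h2

variable [FiniteDimensional ℂ 𝔤] [LieAlgebra.IsSimple ℂ 𝔤]
variable {M : Type*} [AddCommGroup M] [Module ℂ M] {π : D.tau0 →ₗ⁅ℂ⁆ End ℂ M}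
    {gr : Lat n → Submodule ℂ M} {α : Fin n → ℂ} {d C₀ : ℂ}

namespace IsTop
variable (h : IsTop π gr α d C₀)
include h

/-- The products of the `t^q Kₚ` on `S`. -/
lemma c0_relations : (∀ r s, π (D.c0 r (Pi.single 0 1)) * π (D.c0 s (Pi.single 0 1)) =
      C₀ • π (D.c0 (r + s) (Pi.single 0 1))) ∧
    ∀ q w, π (D.c0 q w) = w 0 • π (D.c0 q (Pi.single 0 1)) := by
  obtain ⟨Zi, h1, h2, h3, hsc⟩ := h.exists_inverse_forall_scalar
  set E₀ : Fin (n + 1) → ℂ := Pi.single 0 1 with hE₀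
  have hpE : ∀ s, pair E₀ (D.sv s) = 0 := fun s => by rw [hE₀, pair_single, sv_apply_zero]
  set z : Lat n → End ℂ M := fun q => π (D.c0 q E₀) with hzdef
  have hzmem : ∀ q w, π (D.c0 q w) ∈
      Algebra.adjoin ℂ ({u | ∃ q w, u = π (D.c0 q w)} ∪ Set.range Zi) :=
    fun q w => Algebra.subset_adjoin (Or.inl ⟨q, w, rfl⟩)
  have hZimem : ∀ q, Zi q ∈ Algebra.adjoin ℂ ({u | ∃ q w, u = π (D.c0 q w)} ∪ Set.range Zi) :=
    fun q => Algebra.subset_adjoin (Or.inr ⟨q, rfl⟩)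
  have hlam' : ∀ q w, ∃ c : ℂ, π (D.c0 q w) = c • z q := by
    intro q w
    obtain ⟨c, hc⟩ := hsc _ (mul_mem (hZimem q) (hzmem q w))
      (mem_degZero.2 fun k v hv => h3 q k _ (h.c0_mem hv q w))
    refine ⟨c, ?_⟩
    rw [← one_mul (π (D.c0 q w)), ← h1 q, mul_assoc, hc, mul_smul_comm, mul_one]
  have hc' : ∀ r s, ∃ c : ℂ, z r * z s = c • z (r + s) := by
    intro r s
    obtain ⟨c, hc⟩ := hsc _ (mul_mem (hZimem (r + s)) (mul_mem (hzmem r E₀) (hzmem s E₀)))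
      (mem_degZero.2 fun k v hv => h3 (r + s) k _ (by
        have := h.c0_mem (h.c0_mem hv s E₀) r E₀
        rwa [sc_add, add_comm (D.sc r), ← add_assoc]))
    refine ⟨c, ?_⟩
    rw [← one_mul (z r * z s), ← h1 (r + s), mul_assoc, hc, mul_smul_comm, mul_one]
  choose lam hlam using hlam'
  choose c hc using hc'
  have := h.nontrivial
  have hzinj : ∀ {q} {a b : ℂ}, a • z q = b • z q → a = b := fun {q a b} hab => by
    have : z q ≠ 0 := fun h0 => one_ne_zero (α := End ℂ M) (by rw [← h1 q]; simp [z] at h0; simp [h0])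
    exact smul_left_injective ℂ this hab
  let L : ∀ q : Lat n, (Fin (n + 1) → ℂ) →ₗ[ℂ] ℂ := fun q =>
    { toFun := lam q
      map_add' := fun v w => hzinj (q := q) (by rw [add_smul, ← hlam, ← hlam, ← hlam, c0_add, map_add])
      map_smul' := fun a w => hzinj (q := q) (by
        rw [RingHom.id_apply, smul_eq_mul, mul_smul, ← hlam, ← hlam, c0_smul, map_smul]) }
  have hL : ∀ q w, π (D.c0 q w) = L q w • z q := hlam
  have hLE : ∀ q, L q E₀ = 1 := fun q => hzinj (q := q) (by rw [← hL, one_smul])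
  have hLsv : ∀ q, L q (D.sv q) = 0 := fun q => hzinj (q := q) (by rw [← hL, c0_sv, map_zero, zero_smul])
  have hez : ∀ r a s, π (D.e0 r a) * z s - z s * π (D.e0 r a) =
      (pair a (D.sv s) + a 0 * L (r + s) (D.sv r)) • z (r + s) := by
    intro r a s
    rw [hzdef, map_mul_map, add_sub_cancel_left, lie_e0_c0, hL, map_add, map_smul, map_smul, hLE,
      pair_comm a E₀, hE₀, pair_single, smul_eq_mul, smul_eq_mul, mul_one]
  have R1 : ∀ r a s w, L s w * (pair a (D.sv s) + a 0 * L (r + s) (D.sv r)) =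
      pair a (D.sv s) * L (r + s) w + pair a w * L (r + s) (D.sv r) := by
    intro r a s w
    refine hzinj (q := r + s) ?_
    rw [mul_smul, ← hez, smul_sub, ← mul_smul_comm, ← smul_mul_assoc, ← hL, map_mul_map,
      add_sub_cancel_left, lie_e0_c0, hL, map_add, map_smul, map_smul, smul_eq_mul, smul_eq_mul]
  have hcne : ∀ r s, c r s ≠ 0 := fun r s h0 => by
    have h4 := hc r s
    rw [h0, zero_smul] at h4
    have h5 : Zi s * (Zi r * (z r * z s)) = 1 := by
      rw [← mul_assoc (Zi r), h2, one_mul, h2]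
    rw [h4, mul_zero, mul_zero] at h5
    exact zero_ne_one h5
  have hcomm : ∀ r s, z r * z s = z s * z r := fun r s => by
    rw [hzdef, map_mul_map, lie_c0_c0, map_zero, add_zero]
  have hcsymm : ∀ r s, c r s = c s r := fun r s => hzinj (q := r + s) (by
    rw [← hc, hcomm, hc, add_comm])
  have hassoc : ∀ r s t, c r s * c (r + s) t = c s t * c r (s + t) := fun r s t => by
    refine hzinj (q := r + s + t) ?_
    rw [mul_smul, ← hc, ← smul_mul_assoc, ← hc, mul_assoc, hc, mul_smul_comm, hc, smul_smul, add_assoc]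
  have R2 : ∀ r a s t, (pair a (D.sv s) + a 0 * L (r + s) (D.sv r)) / c r s +
      (pair a (D.sv t) + a 0 * L (r + t) (D.sv r)) / c r t =
      (pair a (D.sv (s + t)) + a 0 * L (r + (s + t)) (D.sv r)) / c r (s + t) := by
    intro r a s t
    have h4 : (pair a (D.sv s) + a 0 * L (r + s) (D.sv r)) * c (r + s) t +
        (pair a (D.sv t) + a 0 * L (r + t) (D.sv r)) * c s (r + t) =
        c s t * (pair a (D.sv (s + t)) + a 0 * L (r + (s + t)) (D.sv r)) := by
      refine hzinj (q := r + (s + t)) ?_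
      have e1 : r + (s + t) = s + (r + t) := by abel
      rw [add_smul, mul_smul, mul_smul, mul_smul, ← hez, smul_sub, ← mul_smul_comm, ← smul_mul_assoc,
        ← hc, ← add_assoc r s t, ← hc, add_assoc, e1, ← hc, ← smul_mul_assoc, ← hez, ← mul_smul_comm,
        ← hez]
      noncomm_ring
    have h5 := hassoc r s t
    have h6 := hassoc r t s
    rw [hcsymm t s, add_comm t s, hcsymm (r + t) s] at h6
    have := hcne r s; have := hcne r t; have := hcne r (s + t)
    have h7 := hcne s t
    field_simp
    refine mul_left_cancel₀ h7 ?_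
    linear_combination c r s * c r t * h4 - (pair a (D.sv s) + a 0 * L (r + s) (D.sv r)) * c r t * h5
      - (pair a (D.sv t) + a 0 * L (r + t) (D.sv r)) * c r s * h6
  have hc2 : ∀ r s, c r (s + s) = c r s := by
    intro r s
    by_cases hs : s = 0
    · rw [hs, add_zero]
    obtain ⟨i, hi⟩ := exists_pair_sv_ne_zero (D := D) s hs
    have h4 := R2 r (Pi.single i.succ 1) s s
    have : (Pi.single i.succ 1 : Fin (n + 1) → ℂ) 0 = 0 := by simp
    rw [this, sv_add, map_add] at h4
    have h5 := hcne r s; have h6 := hcne r (s + s)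
    simp only [zero_mul, add_zero] at h4
    generalize c r (s + s) = x at h4 h6 ⊢
    field_simp at h4
    exact h4
  have hcC : ∀ r s, c r s = C₀ := by
    have h4 : ∀ r u, c r u = c r r := fun r u => by
      have h5 := hassoc r r (u - r)
      rw [hcsymm (r + r), hc2, hcsymm (u - r) r, add_sub_cancel, mul_comm] at h5
      exact (mul_left_cancel₀ (hcne r (u - r)) h5).symm
    intro r s
    rw [h4 r s, ← h4 r 0]
    refine hzinj (q := r) ?_
    have h5 := hc r 0
    have h6 : z 0 = C₀ • 1 := h.c_zero
    rw [h6, add_zero, mul_smul_comm, mul_one] at h5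
    exact h5.symm
  refine ⟨fun r s => by rw [← hcC r s]; exact hc r s, fun q w => ?_⟩
  rw [hL, apply_eq_of_sv_eq_zero (D := D) (f := L q), ← hE₀, hLE, mul_one]
  let A : Lat n → Lat n → ℂ := fun r s => L (r + s) (D.sv r)
  have hAadd : ∀ r s t, A r (s + t) = A r s + A r t := fun r s t => by
    have h4 := R2 r E₀ s t
    simp only [hpE, hcC, zero_add] at h4
    have h5 : E₀ 0 = 1 := by simp [hE₀]
    rw [h5] at h4
    have := h.ne_zero
    field_simp at h4
    exact h4.symm
  have hAanti : ∀ r s, A r s = - A s r := fun r s => by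
    have h4 := hLsv (r + s)
    rw [sv_add, map_add] at h4
    change L (r + s) (D.sv r) = - L (s + r) (D.sv s)
    rw [add_comm s r]; linear_combination h4
  have hL2 : ∀ r w, L (r + r) w = L r w := fun r w => by
    by_cases hr : r = 0
    · rw [hr, add_zero]
    obtain ⟨i, hi⟩ := exists_pair_sv_ne_zero (D := D) r hr
    have h4 := R1 r (Pi.single i.succ 1) r w
    have h5 : (Pi.single i.succ 1 : Fin (n + 1) → ℂ) 0 = 0 := by simp
    have h6 : L (r + r) (D.sv r) = 0 := by
      have := hAanti r r
      change L (r + r) (D.sv r) = - L (r + r) (D.sv r) at this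
      linear_combination this / 2
    rw [h5, h6, zero_mul, mul_zero, add_zero, add_zero] at h4
    exact mul_left_cancel₀ hi (by linear_combination -h4)
  have hA0 : ∀ r s, A r s = 0 := fun r s => by
    have h4 : A (r + r) (s + s) = 2 * A r s := by
      change L (r + r + (s + s)) (D.sv (r + r)) = 2 * L (r + s) (D.sv r)
      rw [show r + r + (s + s) = (r + s) + (r + s) by abel, hL2, sv_add, map_add]; ring
    rw [hAadd, hAanti (r + r) s, hAadd, hAanti s r] at h4
    linear_combination h4 / 2
  intro r
  have : L (r + (q - r)) (D.sv r) = 0 := hA0 r (q - r)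
  rwa [add_sub_cancel] at this

omit h in
variable (π C₀) in
/-- The operator `t^r`. -/
def trans (r : Lat n) : End ℂ M := C₀⁻¹ • π (D.c0 r (Pi.single 0 1))

lemma trans_zero : trans π C₀ 0 = 1 := by
  rw [trans, h.c_zero, smul_smul, inv_mul_cancel₀ h.ne_zero, one_smul]

lemma trans_add (r s : Lat n) : trans π C₀ (r + s) = trans π C₀ r * trans π C₀ s := by
  simp only [trans, smul_mul_assoc, mul_smul_comm]
  rw [h.c0_relations.1, smul_smul C₀⁻¹ C₀, inv_mul_cancel₀ h.ne_zero, one_smul]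

lemma c0_eq (r : Lat n) (w : Fin (n + 1) → ℂ) : π (D.c0 r w) = (w 0 * C₀) • trans π C₀ r := by
  rw [trans, smul_smul, mul_assoc, mul_inv_cancel₀ h.ne_zero, mul_one, h.c0_relations.2]

lemma trans_mul_comm (r s : Lat n) : trans π C₀ r * trans π C₀ s = trans π C₀ s * trans π C₀ r := by
  rw [← h.trans_add, add_comm, h.trans_add]

lemma trans_mul_neg (r : Lat n) : trans π C₀ r * trans π C₀ (-r) = 1 := by
  rw [← h.trans_add, add_neg_cancel, h.trans_zero]

lemma trans_neg_mul (r : Lat n) : trans π C₀ (-r) * trans π C₀ r = 1 := by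
  rw [← h.trans_add, neg_add_cancel, h.trans_zero]

lemma trans_mem {k : Lat n} {v : M} (hv : v ∈ gr k) (r : Lat n) :
    trans π C₀ r v ∈ gr (k + D.sc r) := Submodule.smul_mem _ _ (h.c0_mem hv r _)

omit h in
lemma x0_trans (l : Lat n) (X : 𝔤) (hX : X ∈ D.gradeSpace (emb l)) (r : Lat n) :
    trans π C₀ r * π (D.x0 l X hX) = π (D.x0 l X hX) * trans π C₀ r := by
  rw [trans, smul_mul_assoc, map_mul_map, lie_c0_x0, map_zero, add_zero, mul_smul_comm]

lemma e0_trans (r : Lat n) (a : Fin (n + 1) → ℂ) (s : Lat n) :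
    π (D.e0 r a) * trans π C₀ s =
      trans π C₀ s * π (D.e0 r a) + pair a (D.sv s) • trans π C₀ (r + s) := by
  have h1 : π (D.e0 r a) * trans π C₀ s =
      C₀⁻¹ • (π (D.e0 r a) * π (D.c0 s (Pi.single 0 1))) := by rw [trans, mul_smul_comm]
  rw [h1, map_mul_map, lie_e0_c0, h.c0_eq (r + s), smul_add, smul_smul, ← smul_mul_assoc]
  congr 2
  simp [sv_apply_zero, mul_comm, h.ne_zero]

lemma lie_e0_e0_eq (r s : Lat n) (a b : Fin (n + 1) → ℂ) : π (D.e0 r a) * π (D.e0 s b) =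
    π (D.e0 s b) * π (D.e0 r a) +
      π (D.e0 (r + s) (pair a (D.sv s) • b - pair b (D.sv r) • a)) := by
  rw [map_mul_map, lie_e0_e0, map_add, map_smul, h.c0_eq (r + s), sv_apply_zero, zero_mul, zero_smul,
    smul_zero, add_zero]

/-- `t^r d₀` acts on `S` as `d t^r`. -/
lemma e0_zero_eq (r : Lat n) : π (D.e0 r (Pi.single 0 1)) = d • trans π C₀ r := by
  set E₀ : Fin (n + 1) → ℂ := Pi.single 0 1 with hE₀
  have hpE : ∀ s, pair E₀ (D.sv s) = 0 := fun s => by rw [hE₀, pair_single, sv_apply_zero]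
  set T := trans π C₀ with hT
  let B : Lat n → End ℂ M := fun r => T (-r) * π (D.e0 r E₀)
  have hET : ∀ r s, π (D.e0 r E₀) * T s = T s * π (D.e0 r E₀) := fun r s => by
    rw [hT, h.e0_trans, hpE, zero_smul, add_zero]
  have hEE : ∀ r s, π (D.e0 r E₀) * π (D.e0 s E₀) = π (D.e0 s E₀) * π (D.e0 r E₀) := fun r s => by
    rw [h.lie_e0_e0_eq, hpE, hpE, zero_smul, sub_self, add_eq_left]
    have := e0_smul (D := D) (r + s) 0 0
    rw [smul_zero, zero_smul] at this
    rw [this, map_zero]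
  have hx : ∀ l X hX s, B s * π (D.x0 l X hX) = π (D.x0 l X hX) * B s := by
    intro l X hX s
    have hX' : X ∈ D.gradeSpace (emb (l + D.sc s)) := by rwa [gradeSpace_emb_add_sc]
    have h1 : π (D.e0 s E₀) * π (D.x0 l X hX) = π (D.x0 l X hX) * π (D.e0 s E₀) := by
      rw [map_mul_map, lie_e0_x0 _ _ _ _ hX hX', hE₀, pair_single]
      simp [Lat.vec, emb]
    simp only [B]
    rw [mul_assoc, h1, ← mul_assoc, hT, x0_trans, mul_assoc]
  have hBT : ∀ s r, B s * T r = T r * B s := fun s r => by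
    simp only [B]
    rw [mul_assoc, hET, ← mul_assoc, hT, h.trans_mul_comm, mul_assoc]
  have hBE : ∀ s r, B s * π (D.e0 r E₀) = π (D.e0 r E₀) * B s := fun s r => by
    simp only [B]
    rw [mul_assoc, hEE, ← mul_assoc, ← hET, mul_assoc]
  have hBe : ∀ s r (a : Fin (n + 1) → ℂ), B s * (T (-r) * π (D.e0 r a)) - T (-r) * π (D.e0 r a) * B s =
      pair a (D.sv s) • (B s - B (r + s)) := by
    intro s r a
    have h1 : π (D.e0 r a) * B s = B s * π (D.e0 r a) - pair a (D.sv s) • (T r * B s) +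
        pair a (D.sv s) • (T r * B (r + s)) := by
      simp only [B]
      rw [← mul_assoc, hT, h.e0_trans, add_mul, mul_assoc, h.lie_e0_e0_eq, hpE, zero_smul, sub_zero,
        mul_add, e0_smul, map_smul, mul_smul_comm, ← mul_assoc (trans π C₀ r), ← h.trans_add,
        ← mul_assoc (trans π C₀ r), ← h.trans_add, sv_neg, map_neg, neg_smul, neg_mul, smul_mul_assoc,
        show r + -(r + s) = -s by abel, mul_assoc (trans π C₀ (-s))]
      abel
    rw [← mul_assoc (B s), hBT, mul_assoc (T (-r)), mul_assoc (T (-r)), h1, mul_add, mul_sub, mul_smul_comm, mul_smul_comm,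
      ← mul_assoc _ (T r), ← mul_assoc _ (T r), hT, h.trans_neg_mul, one_mul, one_mul, smul_sub]
    abel
  have hmem : ∀ s, B s ∈ Submodule.span ℂ (Set.range B) := fun s => Submodule.subset_span ⟨s, rfl⟩
  have hspan : ∀ y : End ℂ M, (∀ s, B s * y = y * B s) →
      ∀ u ∈ Submodule.span ℂ (Set.range B), u * y = y * u := by
    intro y hy u hu
    induction hu using Submodule.span_induction with
    | mem u hu => obtain ⟨s, rfl⟩ := hu; exact hy s
    | zero => rw [zero_mul, mul_zero]
    | add a b _ _ ha hb => rw [add_mul, mul_add, ha, hb]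
    | smul c a _ ha => rw [smul_mul_assoc, ha, mul_smul_comm]
  have hBB : ∀ r s, B s * B r = B r * B s := fun r s => by
    simp only [B]
    rw [← mul_assoc]
    change B s * T (-r) * _ = _
    rw [hBT, mul_assoc, hBE, ← mul_assoc]
  have hdeg : ∀ (r : Lat n) (a : Fin (n + 1) → ℂ) k, gr k ≤ (gr k).comap (T (-r) * π (D.e0 r a)) :=
    fun r a k v hv => by
      have := h.trans_mem (h.e0_mem hv r a) (-r)
      rwa [sc_neg, add_neg_cancel_right] at this
  have := h.nontrivial
  have := h.finite
  have hsc : ∀ s, ∃ c : ℂ, B s = c • 1 := fun s => by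
    refine eq_smul_one_of_normalized gr h.grading.iSup_eq_top (Submodule.span ℂ (Set.range B))
      (fun u hu v hv => hspan v (fun s => (hspan _ (hBB s) v hv).symm) u hu) (fun u hu k v hv => ?_)
      ({x | ∃ l X hX, x = π (D.x0 l X hX)} ∪ Set.range T ∪ {x | ∃ r w, x = π (D.e0 r w)})
      (fun N hN => ?_) ?_ (hmem s)
    · induction hu using Submodule.span_induction with
      | mem u hu => obtain ⟨s, rfl⟩ := hu; exact hdeg s E₀ k hv
      | zero => simp
      | add a b _ _ ha hb => exact (gr k).add_mem ha hb
      | smul c a _ ha => exact (gr k).smul_mem _ ha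
    · refine h.irreducible_gens N (fun l X hX => hN _ (Or.inl (Or.inl ⟨l, X, hX, rfl⟩)))
        (fun r w v hv => ?_) (fun r w => hN _ (Or.inr ⟨r, w, rfl⟩))
      rw [Submodule.mem_comap, h.c0_eq]
      exact Submodule.smul_mem _ _ (hN _ (Or.inl (Or.inr ⟨r, rfl⟩)) hv)
    · rintro _ ((⟨l, X, hX, rfl⟩ | ⟨r, rfl⟩) | ⟨r, a, rfl⟩)
      · exact Or.inl fun u hu => hspan _ (hx l X hX) u hu
      · exact Or.inl fun u hu => hspan _ (fun s => hBT s r) u hu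
      · refine Or.inr ⟨T r, T (-r) * π (D.e0 r a), ?_, fun u hu => hspan _ (fun s => hBT s r) u hu,
          hdeg r a, fun u hu => ?_⟩
        · rw [← mul_assoc, hT, h.trans_mul_neg, one_mul]
        · induction hu using Submodule.span_induction with
          | mem u hu =>
            obtain ⟨s, rfl⟩ := hu
            rw [hBe]
            exact Submodule.smul_mem _ _ (sub_mem (hmem _) (hmem _))
          | zero => simp
          | add a b _ _ ha hb =>
            rw [add_mul, mul_add, add_sub_add_comm]; exact add_mem ha hb
          | smul c a _ ha =>
            rw [smul_mul_assoc, mul_smul_comm, ← smul_sub]; exact Submodule.smul_mem _ _ ha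
  choose c hc using hsc
  have hB0 : B 0 = d • 1 := by
    simp only [B]
    rw [neg_zero, hT, h.trans_zero, one_mul, h.d_zero]
  have hcd : B r = d • 1 := by
    by_cases hr : r = 0
    · rw [hr, hB0]
    · obtain ⟨i, hi⟩ := exists_pair_sv_ne_zero (D := D) r hr
      have h1 := hBe r (-r) (Pi.single i.succ 1)
      rw [hc r, smul_mul_assoc, mul_smul_comm, one_mul, mul_one, sub_self, neg_add_cancel, hB0,
        ← hc r] at h1
      exact sub_eq_zero.1 ((smul_eq_zero.1 h1.symm).resolve_left hi)
  have h2 : T r * B r = π (D.e0 r E₀) := by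
    simp only [B]
    rw [← mul_assoc, hT, h.trans_mul_neg, one_mul]
  rw [← h2, hcd, mul_smul_comm, mul_one]

end IsTop
end TwistData
end Toroidal

namespace Toroidal
open Module (End)

section Laurent

variable {n : ℕ}

/-- Laurent polynomials. -/
abbrev Laurent (n : ℕ) : Type := AddMonoidAlgebra ℂ (Lat n)

/-- The monomial `x^r`. -/
def mon (r : Lat n) : Laurent n := AddMonoidAlgebra.single r 1

lemma mon_add (r s : Lat n) : mon (r + s) = mon r * mon s := by
  simp [mon, AddMonoidAlgebra.single_mul_single]

lemma mon_zero : mon (0 : Lat n) = 1 := rfl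

variable {E : Type*} [AddCommGroup E] [Module ℂ E]

/-- The linear map with prescribed values on monomials. -/
def lext (f : Lat n → E) : Laurent n →ₗ[ℂ] E :=
  Finsupp.lsum ℂ (fun r => LinearMap.toSpanSingleton ℂ E (f r)) ∘ₗ
    (AddMonoidAlgebra.coeffLinearEquiv ℂ).toLinearMap

@[simp] lemma lext_mon (f : Lat n → E) (r : Lat n) : lext f (mon r) = f r := by
  simp [lext, mon]

lemma laurent_induction {p : Laurent n → Prop} (f : Laurent n) (h0 : p 0)
    (hadd : ∀ f g, p f → p g → p (f + g)) (hmon : ∀ (c : ℂ) r, p (c • mon r)) : p f := by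
  induction f using AddMonoidAlgebra.induction_linear with
  | zero => exact h0
  | add f g hf hg => exact hadd f g hf hg
  | single r c => simpa [mon] using hmon c r

lemma laurent_hom_ext {f g : Laurent n →ₗ[ℂ] E} (h : ∀ r, f (mon r) = g (mon r)) : f = g := by
  refine LinearMap.ext fun p => ?_
  induction p using laurent_induction with
  | h0 => simp
  | hadd p q hp hq => rw [map_add, map_add, hp, hq]
  | hmon c r => rw [map_smul, map_smul, h]

lemma laurent_bilinear_ext {f g : Laurent n →ₗ[ℂ] Laurent n →ₗ[ℂ] E}
    (h : ∀ r s, f (mon r) (mon s) = g (mon r) (mon s)) : f = g :=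
  laurent_hom_ext fun r => laurent_hom_ext fun s => h r s

/-- The operator `x^s ↦ (c + sⱼ) x^s xⱼ⁻¹`; for `c = 0` this is `∂ / ∂xⱼ`. -/
def lder (c : ℂ) (j : Fin n) : Laurent n →ₗ[ℂ] Laurent n :=
  lext fun s => (c + s j) • mon (s - Pi.single j 1)

lemma lder_mon (c : ℂ) (j : Fin n) (s : Lat n) :
    lder c j (mon s) = (c + s j) • mon (s - Pi.single j 1) := lext_mon _ _

lemma lder_mul (c : ℂ) (j : Fin n) (f g : Laurent n) :
    lder c j (f * g) = lder 0 j f * g + f * lder c j g := by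
  have : (LinearMap.mul ℂ (Laurent n)).compr₂ (lder c j) =
      (LinearMap.mul ℂ (Laurent n)) ∘ₗ (lder 0 j) + (LinearMap.mul ℂ (Laurent n)).compl₂ (lder c j) := by
    refine laurent_bilinear_ext fun r s => ?_
    simp only [LinearMap.compr₂_apply, LinearMap.mul_apply', LinearMap.add_apply,
      LinearMap.comp_apply, LinearMap.compl₂_apply]
    rw [← mon_add, lder_mon, lder_mon, lder_mon, smul_mul_assoc, mul_smul_comm, ← mon_add, ← mon_add,
      sub_add_eq_add_sub, add_sub_assoc, ← add_smul]
    congr 1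
    simp; ring
  exact LinearMap.congr_fun₂ this f g

lemma lder_eq (c : ℂ) (j : Fin n) (f : Laurent n) :
    lder c j f = lder 0 j f + f * lder c j 1 := by
  have := lder_mul c j f 1
  rwa [mul_one, mul_one] at this

/-- `xⱼ - 1`. -/
def yv (j : Fin n) : Laurent n := mon (Pi.single j 1) - 1

lemma lder_one (j : Fin n) : lder 0 j (1 : Laurent n) = 0 := by
  rw [← mon_zero, lder_mon]; simp

lemma lder_yv (i j : Fin n) : lder 0 i (yv j) = if i = j then 1 else 0 := by
  rw [yv, map_sub, lder_one, sub_zero, lder_mon]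
  split_ifs with h
  · subst h; simp [mon_zero]
  · simp [h]

/-- The ideal of Laurent polynomials vanishing at `(1, …, 1)`. -/
def aug (n : ℕ) : Ideal (Laurent n) := Ideal.span (Set.range yv)

lemma yv_mem (j : Fin n) : yv j ∈ aug n := Ideal.subset_span ⟨j, rfl⟩

lemma mon_sub_one_mem (r : Lat n) : mon r - 1 ∈ aug n := by
  let G : AddSubgroup (Lat n) :=
    { carrier := {r | mon r - 1 ∈ aug n}
      add_mem' := fun {r s} hr hs => by
        have : mon (r + s) - 1 = mon r * (mon s - 1) + (mon r - 1) := by rw [mon_add]; ring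
        change mon (r + s) - 1 ∈ aug n
        rw [this]
        exact add_mem (Ideal.mul_mem_left _ _ hs) hr
      zero_mem' := by
        change mon 0 - 1 ∈ aug n
        rw [mon_zero, sub_self]; exact zero_mem _
      neg_mem' := fun {r} hr => by
        have h1 : mon (-r) * mon r = 1 := by rw [← mon_add, neg_add_cancel, mon_zero]
        have : mon (-r) - 1 = -(mon (-r) * (mon r - 1)) := by rw [mul_sub, h1]; ring
        change mon (-r) - 1 ∈ aug n
        rw [this]
        exact neg_mem (Ideal.mul_mem_left _ _ hr) }
  have : r = ∑ j, r j • (Pi.single j 1 : Lat n) := by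
    ext i; simp [Finset.sum_apply, Pi.single_apply]
  have h2 : r ∈ G := by
    rw [this]
    exact sum_mem fun j _ => G.zsmul_mem (yv_mem j) _
  exact h2

lemma sum_eq_zero_of_mem_aug {f : Laurent n} (hf : f ∈ aug n) :
    lext (fun _ => (1 : ℂ)) f = 0 := by
  obtain ⟨a, rfl⟩ := (Submodule.mem_span_range_iff_exists_fun _).1 hf
  rw [map_sum]
  refine Finset.sum_eq_zero fun j _ => ?_
  have : lext (fun _ => (1 : ℂ)) ∘ₗ LinearMap.mulRight ℂ (yv j) = 0 := laurent_hom_ext fun r => by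
    simp [yv, mul_sub, ← mon_add]
  exact LinearMap.congr_fun this (a j)

lemma lder_mem_pow (c : ℂ) (j : Fin n) (m : ℕ) {f : Laurent n} (hf : f ∈ aug n ^ (m + 1)) :
    lder c j f ∈ aug n ^ m := by
  rw [lder_eq]
  refine add_mem ?_ (Ideal.mul_mem_right _ _ (Ideal.pow_le_pow_right (Nat.le_succ m) hf))
  induction m generalizing f with
  | zero => simp
  | succ m ih =>
    rw [pow_succ] at hf
    induction hf using Submodule.mul_induction_on' with
    | mem_mul_mem a ha b hb =>
      rw [lder_mul]
      refine add_mem ?_ (Ideal.mul_mem_right _ _ ha)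
      rw [pow_succ]
      exact Ideal.mul_mem_mul (ih ha) hb
    | add x _ y _ hx hy => rw [map_add]; exact add_mem hx hy

/-- The Euler operator. -/
def euler : Laurent n →ₗ[ℂ] Laurent n := ∑ j, LinearMap.mulLeft ℂ (yv j) ∘ₗ lder 0 j

lemma euler_apply (f : Laurent n) : euler f = ∑ j, yv j * lder 0 j f := by
  simp [euler, LinearMap.sum_apply]

lemma euler_mul (f g : Laurent n) : euler (f * g) = euler f * g + f * euler g := by
  simp only [euler_apply, lder_mul, Finset.sum_mul, Finset.mul_sum, ← Finset.sum_add_distrib]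
  exact Finset.sum_congr rfl fun j _ => by ring

lemma euler_mem (f : Laurent n) : euler f ∈ aug n := by
  rw [euler_apply]
  exact sum_mem fun j _ => Ideal.mul_mem_right _ _ (yv_mem j)

lemma euler_sub_mem_sq {f : Laurent n} (hf : f ∈ aug n) : euler f - f ∈ aug n ^ 2 := by
  obtain ⟨a, rfl⟩ := (Submodule.mem_span_range_iff_exists_fun _).1 hf
  rw [map_sum, ← Finset.sum_sub_distrib]
  refine sum_mem fun j _ => ?_
  have h1 : euler (yv j) = yv j := by simp [euler_apply, lder_yv]
  rw [smul_eq_mul, euler_mul, h1, add_sub_cancel_right, sq]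
  exact Ideal.mul_mem_mul (euler_mem _) (yv_mem j)

lemma euler_sub_mem (m : ℕ) {f : Laurent n} (hf : f ∈ aug n ^ m) :
    euler f - (m : ℂ) • f ∈ aug n ^ (m + 1) := by
  induction m generalizing f with
  | zero => simpa using euler_mem f
  | succ m ih =>
    rw [pow_succ] at hf
    induction hf using Submodule.mul_induction_on' with
    | mem_mul_mem a ha b hb =>
      have : euler (a * b) - ((m + 1 : ℕ) : ℂ) • (a * b) =
          (euler a - (m : ℂ) • a) * b + a * (euler b - b) := by
        rw [euler_mul, sub_mul, smul_mul_assoc]; push_cast; rw [add_smul, one_smul]; ring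
      rw [this]
      refine add_mem ?_ ?_
      · rw [pow_succ]; exact Ideal.mul_mem_mul (ih ha) hb
      · rw [show m + 1 + 1 = m + 2 by ring, pow_add]
        exact Ideal.mul_mem_mul ha (euler_sub_mem_sq hb)
    | add x _ y _ hx hy =>
      have : euler (x + y) - ((m + 1 : ℕ) : ℂ) • (x + y) =
          (euler x - ((m + 1 : ℕ) : ℂ) • x) + (euler y - ((m + 1 : ℕ) : ℂ) • y) := by
        rw [map_add, smul_add]; abel
      rw [this]; exact add_mem hx hy

lemma exists_aug_pow_le {N : ℕ} : ∃ m : ℕ,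
    aug n ^ m ≤ Ideal.span (Set.range fun j : Fin n => yv j ^ N) := by
  refine Ideal.exists_pow_le_of_le_radical_of_fg ?_ ?_
  · refine Ideal.span_le.2 ?_
    rintro _ ⟨j, rfl⟩
    exact ⟨N, Ideal.subset_span ⟨j, rfl⟩⟩
  · exact ⟨(Set.finite_range yv).toFinset, by simp [aug]⟩

end Laurent
end Toroidal

namespace Toroidal
open Module (End)

section Jets

lemma exists_bound_eigenvalue {E : Type*} [AddCommGroup E] [Module ℂ E] [FiniteDimensional ℂ E]
    (T : End ℂ E) : ∃ N : ℕ, ∀ a : ℕ, N ≤ a → ∀ v, T v = (a : ℂ) • v → v = 0 := by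
  have h1 : Set.Finite {a : ℕ | T.HasEigenvalue a} :=
    Set.Finite.preimage (Nat.cast_injective (R := ℂ)).injOn T.finite_hasEigenvalue
  obtain ⟨N, hN⟩ := h1.bddAbove
  refine ⟨N + 1, fun a ha v hv => ?_⟩
  by_contra h0
  have := hN (Module.End.hasEigenvalue_of_hasEigenvector
    (Module.End.hasEigenvector_iff.2 ⟨End.mem_eigenspace_iff.2 hv, h0⟩) : T.HasEigenvalue a)
  omega

variable {F : Type*} [AddCommGroup F] [Module ℂ F]

/-- The commutator as a bilinear map. -/
def commL : End ℂ F →ₗ[ℂ] End ℂ F →ₗ[ℂ] End ℂ F :=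
  LinearMap.mul ℂ (End ℂ F) - (LinearMap.mul ℂ (End ℂ F)).flip

lemma commL_apply (a b : End ℂ F) : commL a b = a * b - b * a := rfl

lemma exists_pow_eq_zero_of_commL [FiniteDimensional ℂ F] {e u : End ℂ F} {b : ℕ} (hb : 0 < b)
    (h : commL e u = (b : ℂ) • u) : ∃ k : ℕ, u ^ k = 0 := by
  obtain ⟨N, hN⟩ := exists_bound_eigenvalue (commL e)
  have h1 : ∀ k : ℕ, commL e (u ^ k) = ((k * b : ℕ) : ℂ) • u ^ k := by
    intro k
    induction k with
    | zero => simp [commL_apply]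
    | succ k ih =>
      rw [commL_apply] at ih h ⊢
      have : e * u ^ (k + 1) - u ^ (k + 1) * e = (e * u ^ k - u ^ k * e) * u + u ^ k * (e * u - u * e) := by
        rw [pow_succ]; noncomm_ring
      rw [this, ih, h, smul_mul_assoc, mul_smul_comm, ← pow_succ, ← add_smul]
      congr 1; push_cast; ring
  exact ⟨N, hN (N * b) (Nat.le_mul_of_pos_right N hb) _ (h1 N)⟩

variable {n : ℕ} {Λ K : Type*}

/-- A finite dimensional graded irreducible representation, by operators `ρ j r` and `Y k s`, of the
semidirect product of the vector fields and the currents on a torus that vanish at `1`. -/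
structure JetRep (gr : Λ → Submodule ℂ F) (ρ : Fin n → Lat n → End ℂ F) (Y : K → Lat n → End ℂ F)
    (c : K → Fin n → ℂ) : Prop where
  finite : FiniteDimensional ℂ F
  nontrivial : Nontrivial F
  grading : IsGrading gr
  comm_ρ : ∀ i j r s, commL (ρ i r) (ρ j s) =
    (s i : ℂ) • (ρ j (r + s) - ρ j s) - (r j : ℂ) • (ρ i (r + s) - ρ i r)
  comm_Y : ∀ j k r s, commL (ρ j r) (Y k s) = (c k j + s j) • (Y k (r + s) - Y k s)
  comm_Y_Y : ∀ k k', ∃ k'', ∀ r s, commL (Y k r) (Y k' s) = Y k'' (r + s)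
  zero : ∀ j, ρ j 0 = 0
  irreducible : ∀ N : Submodule ℂ F, (∀ l, N ≤ N.comap (grading.proj l)) →
    (∀ j r, N ≤ N.comap (ρ j r)) → (∀ k s, N ≤ N.comap (Y k s)) → N = ⊥ ∨ N = ⊤
  deg_ρ : ∀ j r l, ∀ v ∈ gr l, ρ j r v ∈ gr l
  deg_Y : ∀ k, ∃ f : Λ → Λ, f.Injective ∧ ∀ s l, ∀ v ∈ gr l, Y k s v ∈ gr (f l)

namespace JetRep

variable {gr : Λ → Submodule ℂ F} {ρ : Fin n → Lat n → End ℂ F} {Y : K → Lat n → End ℂ F}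
    {c : K → Fin n → ℂ} (h : JetRep gr ρ Y c)

/-- The operator of the vector field `f ∂ⱼ`. -/
def vf (ρ : Fin n → Lat n → End ℂ F) (j : Fin n) : Laurent n →ₗ[ℂ] End ℂ F :=
  lext fun r => ρ j (r - Pi.single j 1)

include h

lemma commL_vf (i j : Fin n) {f g : Laurent n} (hf : f ∈ aug n) (hg : g ∈ aug n) :
    commL (vf ρ i f) (vf ρ j g) = vf ρ j (f * lder 0 i g) - vf ρ i (g * lder 0 j f) := by
  let P : Fin n → Fin n → (Laurent n →ₗ[ℂ] End ℂ F) := fun i j =>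
    lext fun s => ((s i : ℂ) - if i = j then 1 else 0) • ρ j (s - Pi.single j 1)
  let ε : Laurent n →ₗ[ℂ] ℂ := lext fun _ => 1
  have key : commL.compl₁₂ (vf ρ i) (vf ρ j) =
      ((LinearMap.mul ℂ (Laurent n)).compl₂ (lder 0 i)).compr₂ (vf ρ j) -
      (((LinearMap.mul ℂ (Laurent n)).compl₂ (lder 0 j)).compr₂ (vf ρ i)).flip -
      (LinearMap.lsmul ℂ (End ℂ F) ∘ₗ ε).compl₂ (P i j) +
      ((LinearMap.lsmul ℂ (End ℂ F) ∘ₗ ε).compl₂ (P j i)).flip := by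
    refine laurent_bilinear_ext fun r s => ?_
    simp only [LinearMap.compl₁₂_apply, LinearMap.add_apply, LinearMap.sub_apply,
      LinearMap.compr₂_apply, LinearMap.compl₂_apply, LinearMap.flip_apply, LinearMap.mul_apply',
      LinearMap.comp_apply, vf, lext_mon, ε, P, lder_mon, ← mon_add, map_smul,
      LinearMap.lsmul_apply]
    rw [h.comm_ρ]
    have e1 : r - Pi.single i 1 + (s - Pi.single j 1) = r + s - Pi.single i 1 - Pi.single j 1 := by abel
    have e2 : r + (s - Pi.single i 1) - Pi.single j 1 = r + s - Pi.single i 1 - Pi.single j 1 := by abel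
    have e3 : s + (r - Pi.single j 1) - Pi.single i 1 = r + s - Pi.single i 1 - Pi.single j 1 := by abel
    rw [e1, e2, e3]
    by_cases hij : i = j
    · subst hij
      simp only [Pi.sub_apply, Pi.single_eq_same, if_true]
      push_cast
      module
    · have h1 : (Pi.single j 1 : Lat n) i = 0 := by simp [hij]
      have h2 : (Pi.single i 1 : Lat n) j = 0 := by simp [Ne.symm hij]
      simp only [Pi.sub_apply, h1, h2, hij, Ne.symm hij, if_false]
      push_cast
      module
  have := LinearMap.congr_fun₂ key f g
  simp only [LinearMap.compl₁₂_apply, LinearMap.add_apply, LinearMap.sub_apply,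
      LinearMap.compr₂_apply, LinearMap.compl₂_apply, LinearMap.flip_apply, LinearMap.mul_apply',
      LinearMap.comp_apply, ε, sum_eq_zero_of_mem_aug hf, sum_eq_zero_of_mem_aug hg, map_zero,
      LinearMap.zero_apply, add_zero, sub_zero] at this
  exact this

lemma commL_vf_Y (j : Fin n) (k : K) {f : Laurent n} (hf : f ∈ aug n) (g : Laurent n) :
    commL (vf ρ j f) (lext (Y k) g) = lext (Y k) (f * lder (c k j) j g) := by
  let P : Laurent n →ₗ[ℂ] End ℂ F := lext fun s => (c k j + s j) • Y k s
  let ε : Laurent n →ₗ[ℂ] ℂ := lext fun _ => 1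
  have key : commL.compl₁₂ (vf ρ j) (lext (Y k)) =
      ((LinearMap.mul ℂ (Laurent n)).compl₂ (lder (c k j) j)).compr₂ (lext (Y k)) -
      (LinearMap.lsmul ℂ (End ℂ F) ∘ₗ ε).compl₂ P := by
    refine laurent_bilinear_ext fun r s => ?_
    simp only [LinearMap.compl₁₂_apply, LinearMap.sub_apply,
      LinearMap.compr₂_apply, LinearMap.compl₂_apply, LinearMap.mul_apply',
      LinearMap.comp_apply, vf, lext_mon, ε, P, lder_mon, ← mon_add, map_smul,
      LinearMap.lsmul_apply]
    rw [h.comm_Y, show r - Pi.single j 1 + s = r + (s - Pi.single j 1) by abel]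
    module
  have := LinearMap.congr_fun₂ key f g
  simp only [LinearMap.compl₁₂_apply, LinearMap.sub_apply,
      LinearMap.compr₂_apply, LinearMap.compl₂_apply, LinearMap.mul_apply',
      LinearMap.comp_apply, ε, sum_eq_zero_of_mem_aug hf, map_zero,
      LinearMap.zero_apply, sub_zero] at this
  exact this

lemma commL_Y_Y (k k' : K) : ∃ k'', ∀ f g : Laurent n,
    commL (lext (Y k) f) (lext (Y k') g) = lext (Y k'') (f * g) := by
  obtain ⟨k'', hk⟩ := h.comm_Y_Y k k'
  refine ⟨k'', fun f g => ?_⟩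
  have key : commL.compl₁₂ (lext (Y k)) (lext (Y k')) =
      (LinearMap.mul ℂ (Laurent n)).compr₂ (lext (Y k'')) := by
    refine laurent_bilinear_ext fun r s => ?_
    simp only [LinearMap.compl₁₂_apply, LinearMap.compr₂_apply, LinearMap.mul_apply', lext_mon,
      ← mon_add, hk]
  exact LinearMap.congr_fun₂ key f g

end JetRep
end Jets
end Toroidal

namespace Toroidal
open Module (End)

section Jets
variable {F : Type*} [AddCommGroup F] [Module ℂ F] {n : ℕ} {Λ K : Type*}

lemma yv_mul_lder_pow (i j : Fin n) (a : ℕ) :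
    yv i * lder 0 j (yv i ^ a) = if j = i then (a : ℂ) • yv i ^ a else 0 := by
  induction a with
  | zero => simp [lder_one]
  | succ a ih =>
    rw [pow_succ, lder_mul, lder_yv, mul_add, ← mul_assoc, ih]
    split_ifs with h
    · rw [smul_mul_assoc, ← pow_succ, mul_one, mul_comm (yv i) (yv i ^ a), ← pow_succ]
      push_cast
      module
    · simp

lemma mul_lder_mem {a b c : ℕ} (j : Fin n) (z : ℂ) {f g : Laurent n} (hf : f ∈ aug n ^ a)
    (hg : g ∈ aug n ^ b) (hc : c + 1 ≤ a + b) : f * lder z j g ∈ aug n ^ c := by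
  cases b with
  | zero => exact Ideal.mul_mem_right _ _ (Ideal.pow_le_pow_right (by omega) hf)
  | succ b =>
    have := Ideal.mul_mem_mul hf (lder_mem_pow z j b hg)
    rw [← pow_add] at this
    exact Ideal.pow_le_pow_right (by omega) this

namespace JetRep

variable {gr : Λ → Submodule ℂ F} {ρ : Fin n → Lat n → End ℂ F} {Y : K → Lat n → End ℂ F}
    {c : K → Fin n → ℂ} (h : JetRep gr ρ Y c)

/-- The vector fields vanishing to order `b + 1` and the currents vanishing to order `b` at the
point `1` act trivially. -/
def Vanish (ρ : Fin n → Lat n → End ℂ F) (Y : K → Lat n → End ℂ F) (b : ℕ) : Prop :=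
  (∀ j, ∀ f ∈ aug n ^ (b + 1), vf ρ j f = 0) ∧ ∀ k, ∀ f ∈ aug n ^ b, lext (Y k) f = 0

include h

lemma exists_vf_pow_eq_zero : ∃ N, 0 < N ∧ ∀ i, ∀ a, N ≤ a → vf ρ i (yv i ^ a) = 0 := by
  have := h.finite
  have h1 : ∀ i, ∃ N : ℕ, ∀ a, N ≤ a → vf ρ i (yv i ^ (a + 1)) = 0 := by
    intro i
    obtain ⟨N, hN⟩ := exists_bound_eigenvalue (commL (vf ρ i (yv i)))
    refine ⟨N, fun a ha => hN a ha _ ?_⟩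
    rw [h.commL_vf i i (yv_mem i) (Ideal.pow_le_self (Nat.succ_ne_zero a)
      (Ideal.pow_mem_pow (yv_mem i) _)), yv_mul_lder_pow, lder_yv, if_pos rfl, if_pos rfl,
      mul_one, map_smul]
    push_cast
    module
  choose N hN using h1
  refine ⟨∑ i, N i + 1, Nat.succ_pos _, fun i a ha => ?_⟩
  have h2 := Finset.single_le_sum (f := N) (fun i _ => Nat.zero_le (N i)) (Finset.mem_univ i)
  obtain ⟨a, rfl⟩ : ∃ a', a = a' + 1 := ⟨a - 1, by omega⟩
  exact hN i a (by omega)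

lemma exists_vanish : ∃ M, Vanish ρ Y M := by
  obtain ⟨N, hN0, hN⟩ := h.exists_vf_pow_eq_zero
  have hp : ∀ i : Fin n, yv i ^ N ∈ aug n := fun i =>
    Ideal.pow_le_self hN0.ne' (Ideal.pow_mem_pow (yv_mem i) _)
  have h1 : ∀ i j, ∀ f ∈ aug n, vf ρ j (yv i ^ N * f) = 0 := by
    intro i j f hf
    have e1 := h.commL_vf i j (hp i) (Ideal.mul_mem_left _ (yv i) hf)
    have e2 := h.commL_vf i j (Ideal.mul_mem_left _ (yv i) (hp i)) hf
    rw [mul_comm (yv i) (yv i ^ N), ← pow_succ, hN i _ (Nat.le_succ N)] at e2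
    rw [hN i _ le_rfl] at e1
    rw [pow_succ] at e2
    simp only [map_zero, LinearMap.zero_apply] at e1 e2
    rw [lder_mul, lder_yv, if_pos rfl] at e1
    rw [lder_mul, lder_yv] at e2
    have e3 : vf ρ j (yv i ^ N * f) + (if j = i then vf ρ i (yv i ^ N * f) else 0) = 0 := by
      have e4 := e1.symm.trans e2
      have a1 : yv i ^ N * (1 * f + yv i * lder 0 i f) =
        yv i ^ N * f + yv i ^ N * yv i * lder 0 i f := by ring
      split_ifs at e4 ⊢ with hji
      · have a2 : f * (lder 0 j (yv i ^ N) * yv i + yv i ^ N * 1) =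
          yv i * f * lder 0 j (yv i ^ N) + yv i ^ N * f := by ring
        rw [a1, a2, map_add, map_add] at e4
        have := sub_eq_zero.2 e4
        rw [← this]; abel
      · have a2 : f * (lder 0 j (yv i ^ N) * yv i + yv i ^ N * 0) =
          yv i * f * lder 0 j (yv i ^ N) := by ring
        rw [a1, a2, map_add] at e4
        have := sub_eq_zero.2 e4
        rw [add_zero, ← this]; abel
    split_ifs at e3 with hji
    · subst hji
      rw [← two_smul ℂ] at e3
      exact (smul_eq_zero.1 e3).resolve_left two_ne_zero
    · simpa using e3
  have h2 : ∀ i k, ∀ g, lext (Y k) (yv i ^ N * g) = 0 := by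
    intro i k g
    have e1 := h.commL_vf_Y i k (hp i) (yv i * g)
    have e2 := h.commL_vf_Y i k (Ideal.mul_mem_left _ (yv i) (hp i)) g
    rw [mul_comm (yv i) (yv i ^ N), ← pow_succ, hN i _ (Nat.le_succ N)] at e2
    rw [hN i _ le_rfl] at e1
    rw [pow_succ] at e2
    simp only [map_zero, LinearMap.zero_apply] at e1 e2
    rw [lder_mul, lder_yv, if_pos rfl] at e1
    have a1 : yv i ^ N * (1 * g + yv i * lder (c k i) i g) =
        yv i ^ N * g + yv i ^ N * yv i * lder (c k i) i g := by ring
    rwa [a1, map_add, ← e2, add_zero, eq_comm] at e1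
  obtain ⟨m, hm⟩ := exists_aug_pow_le (n := n) (N := N)
  refine ⟨m, fun j f hf => ?_, fun k f hf => ?_⟩
  · rw [pow_succ'] at hf
    induction hf using Submodule.mul_induction_on' with
    | mem_mul_mem a ha b hb =>
      obtain ⟨q, rfl⟩ := (Submodule.mem_span_range_iff_exists_fun _).1 (hm hb)
      rw [Finset.mul_sum, map_sum]
      refine Finset.sum_eq_zero fun i _ => ?_
      rw [smul_eq_mul, show a * (q i * yv i ^ N) = yv i ^ N * (q i * a) by ring]
      exact h1 _ _ _ (Ideal.mul_mem_left _ _ ha)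
    | add x _ y _ hx hy => rw [map_add, hx, hy, add_zero]
  · obtain ⟨q, rfl⟩ := (Submodule.mem_span_range_iff_exists_fun _).1 (hm hf)
    rw [map_sum]
    refine Finset.sum_eq_zero fun i _ => ?_
    rw [smul_eq_mul, mul_comm]
    exact h2 _ _ _

lemma commL_euler_vf {b : ℕ} (hb : Vanish ρ Y (b + 1)) (j : Fin n) {f : Laurent n}
    (hf : f ∈ aug n ^ (b + 1)) : commL (∑ i, vf ρ i (yv i)) (vf ρ j f) = (b : ℂ) • vf ρ j f := by
  have hf' : f ∈ aug n := Ideal.pow_le_self (Nat.succ_ne_zero b) hf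
  rw [map_sum, LinearMap.sum_apply]
  simp only [h.commL_vf _ j (yv_mem _) hf', lder_yv, mul_ite, mul_one, mul_zero]
  rw [Finset.sum_sub_distrib, ← map_sum, ← euler_apply]
  have h1 := hb.1 j _ (euler_sub_mem (b + 1) hf)
  rw [map_sub, sub_eq_zero, map_smul] at h1
  rw [h1, Finset.sum_eq_single j (fun i _ hi => by rw [if_neg (Ne.symm hi), map_zero]) (by simp),
    if_pos rfl]
  push_cast
  module

lemma commL_euler_Y {b : ℕ} (hb : Vanish ρ Y (b + 1)) (k : K) {f : Laurent n}
    (hf : f ∈ aug n ^ b) :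
    commL (∑ i, vf ρ i (yv i)) (lext (Y k) f) = (b : ℂ) • lext (Y k) f := by
  rw [map_sum, LinearMap.sum_apply]
  simp only [h.commL_vf_Y _ k (yv_mem _)]
  rw [← map_sum]
  have h1 : ∑ i, yv i * lder (c k i) i f - (b : ℂ) • f ∈ aug n ^ (b + 1) := by
    have : ∑ i, yv i * lder (c k i) i f - (b : ℂ) • f =
        (euler f - (b : ℂ) • f) + ∑ i, f * yv i * lder (c k i) i 1 := by
      rw [euler_apply, sub_add_eq_add_sub, ← Finset.sum_add_distrib]
      congr 1
      refine Finset.sum_congr rfl fun i _ => ?_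
      rw [lder_eq]; ring
    rw [this]
    refine add_mem (euler_sub_mem b hf) (sum_mem fun i _ => Ideal.mul_mem_right _ _ ?_)
    rw [pow_succ]
    exact Ideal.mul_mem_mul hf (yv_mem i)
  have h2 := hb.2 k _ h1
  rwa [map_sub, sub_eq_zero, map_smul] at h2

lemma vf_mem (j : Fin n) (f : Laurent n) (l : Λ) {v : F} (hv : v ∈ gr l) : vf ρ j f v ∈ gr l := by
  induction f using laurent_induction with
  | h0 => simp
  | hadd x y hx hy => rw [map_add]; exact add_mem hx hy
  | hmon r z => rw [map_smul, vf, lext_mon]; exact Submodule.smul_mem _ _ (h.deg_ρ _ _ _ _ hv)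

lemma vanish_of_succ {b : ℕ} (hb0 : 0 < b) (hb : Vanish ρ Y (b + 1)) : Vanish ρ Y b := by
  have := h.finite
  have := h.nontrivial
  let C : Set (End ℂ F) :=
    {u | (∃ j, ∃ f ∈ aug n ^ (b + 1), u = vf ρ j f) ∨ ∃ k, ∃ f ∈ aug n ^ b, u = lext (Y k) f}
  let N : Submodule ℂ F := ⨅ u : C, LinearMap.ker u.1
  have hN : ∀ v, v ∈ N ↔ (∀ j, ∀ f ∈ aug n ^ (b + 1), vf ρ j f v = 0) ∧
      ∀ k, ∀ f ∈ aug n ^ b, lext (Y k) f v = 0 := by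
    intro v
    simp only [N, Submodule.mem_iInf, LinearMap.mem_ker, Subtype.forall]
    refine ⟨fun H => ⟨fun j f hf => H _ (.inl ⟨j, f, hf, rfl⟩),
      fun k f hf => H _ (.inr ⟨k, f, hf, rfl⟩)⟩, fun H u hu => ?_⟩
    rcases hu with ⟨j, f, hf, rfl⟩ | ⟨k, f, hf, rfl⟩
    · exact H.1 j f hf
    · exact H.2 k f hf
  have self : ∀ {a : ℕ} {f : Laurent n}, f ∈ aug n ^ (a + 1) → f ∈ aug n :=
    fun hf => Ideal.pow_le_self (Nat.succ_ne_zero _) hf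
  have one : ∀ {f : Laurent n}, f ∈ aug n → f ∈ aug n ^ 1 := fun hf => by rwa [pow_one]
  have top : ∀ {f : Laurent n}, f ∈ aug n ^ 0 := by simp
  have hcommYY : ∀ k k', ∀ f g, f ∈ aug n ^ b → g ∈ aug n ^ b →
      commL (lext (Y k) f) (lext (Y k') g) = 0 := by
    intro k k' f g hf hg
    obtain ⟨k'', hk⟩ := h.commL_Y_Y k k'
    rw [hk]
    refine hb.2 _ _ (Ideal.pow_le_pow_right (show b + 1 ≤ b + b by omega) ?_)
    rw [pow_add]
    exact Ideal.mul_mem_mul hf hg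
  have hcomm : ∀ u ∈ C, ∀ v ∈ C, u * v = v * u := by
    intro u hu v hv
    rw [← sub_eq_zero, ← commL_apply]
    rcases hu with ⟨i, f, hf, rfl⟩ | ⟨k, f, hf, rfl⟩ <;>
      rcases hv with ⟨j, g, hg, rfl⟩ | ⟨k', g, hg, rfl⟩
    · rw [h.commL_vf i j (self hf) (self hg), hb.1 _ _ (mul_lder_mem i 0 hf hg (by omega)),
        hb.1 _ _ (mul_lder_mem j 0 hg hf (by omega)), sub_zero]
    · rw [h.commL_vf_Y i _ (self hf), hb.2 _ _ (mul_lder_mem i _ hf hg (by omega))]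
    · rw [commL_apply, ← neg_sub, ← commL_apply, h.commL_vf_Y j _ (self hg),
        hb.2 _ _ (mul_lder_mem j _ hg hf (by omega)), neg_zero]
    · exact hcommYY _ _ _ _ hf hg
  have hnil : ∀ u ∈ C, ∃ k : ℕ, u ^ k = 0 := by
    rintro u (⟨i, f, hf, rfl⟩ | ⟨k, f, hf, rfl⟩)
    · exact exists_pow_eq_zero_of_commL hb0 (h.commL_euler_vf hb i hf)
    · exact exists_pow_eq_zero_of_commL hb0 (h.commL_euler_Y hb k hf)
  have hne : N ≠ ⊥ := by
    obtain ⟨v, -, hv0, hv⟩ := exists_joint_kernel C hcomm ⊤ top_ne_bot (fun _ _ _ _ => trivial)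
      fun u hu v _ => (hnil u hu).imp fun k hk => by rw [hk, LinearMap.zero_apply]
    refine (Submodule.ne_bot_iff _).2 ⟨v, ?_, hv0⟩
    simp only [N, Submodule.mem_iInf, LinearMap.mem_ker, Subtype.forall]
    exact hv
  have swap : ∀ (x y : End ℂ F) v, x (y v) = y (x v) + commL x y v := by
    intro x y v
    rw [commL_apply, LinearMap.sub_apply, Module.End.mul_apply, Module.End.mul_apply]; abel
  have swap' : ∀ (x y : End ℂ F) v, x (y v) = y (x v) - commL y x v := by
    intro x y v
    rw [commL_apply, LinearMap.sub_apply, Module.End.mul_apply, Module.End.mul_apply]; abel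
  have hdeg : ∀ l, N ≤ N.comap (h.grading.proj l) := by
    intro l v hv
    rw [Submodule.mem_comap, hN]
    rw [hN] at hv
    refine ⟨fun j f hf => ?_, fun k f hf => ?_⟩
    · rw [← h.grading.proj_comm h.grading (f := id) Function.injective_id
        (fun l v hv => h.vf_mem j f l hv), hv.1 j f hf, map_zero]
    · obtain ⟨φ, hφ, hY⟩ := h.deg_Y k
      have : ∀ g l, ∀ v ∈ gr l, lext (Y k) g v ∈ gr (φ l) := by
        intro g l v hv
        induction g using laurent_induction with
        | h0 => simp
        | hadd x y hx hy => rw [map_add]; exact add_mem hx hy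
        | hmon r z => rw [map_smul, lext_mon]; exact Submodule.smul_mem _ _ (hY _ _ _ hv)
      rw [← h.grading.proj_comm h.grading hφ (this f), hv.2 k f hf, map_zero]
  have hρ : ∀ j r, N ≤ N.comap (ρ j r) := by
    intro j r v hv
    rw [Submodule.mem_comap, hN]
    rw [hN] at hv
    have e : ρ j r = vf ρ j (mon (r + Pi.single j 1) - mon (Pi.single j 1)) := by
      rw [vf, map_sub, lext_mon, lext_mon, add_sub_cancel_right, sub_self, h.zero, sub_zero]
    have hx : mon (r + Pi.single j 1) - mon (Pi.single j 1) ∈ aug n := by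
      rw [← sub_sub_sub_cancel_right _ _ 1]
      exact sub_mem (mon_sub_one_mem _) (mon_sub_one_mem _)
    rw [e]
    refine ⟨fun i f hf => ?_, fun k f hf => ?_⟩
    · rw [swap, hv.1 i f hf, map_zero, zero_add, h.commL_vf i j (self hf) hx, LinearMap.sub_apply,
        hv.1 _ _ (mul_lder_mem i 0 hf (one hx) (by omega)),
        hv.1 _ _ (mul_lder_mem j 0 (one hx) hf (by omega)), sub_zero]
    · rw [swap', hv.2 k f hf, map_zero, zero_sub, h.commL_vf_Y j _ hx,
        hv.2 _ _ (mul_lder_mem j _ (one hx) hf (by omega)), neg_zero]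
  have hY : ∀ k s, N ≤ N.comap (Y k s) := by
    intro k s v hv
    rw [Submodule.mem_comap, hN]
    rw [hN] at hv
    have e : Y k s = lext (Y k) (mon s) := (lext_mon _ _).symm
    rw [e]
    refine ⟨fun i f hf => ?_, fun k' f hf => ?_⟩
    · rw [swap, hv.1 i f hf, map_zero, zero_add, h.commL_vf_Y i k (self hf),
        hv.2 _ _ (mul_lder_mem i _ hf top (by omega))]
    · obtain ⟨k'', hk⟩ := h.commL_Y_Y k' k
      rw [swap, hv.2 k' f hf, map_zero, zero_add, hk, hv.2 _ _ (Ideal.mul_mem_right _ _ hf)]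
  have hT := (h.irreducible N hdeg hρ hY).resolve_left hne
  refine ⟨fun j f hf => LinearMap.ext fun v => ?_, fun k f hf => LinearMap.ext fun v => ?_⟩
  · exact ((hN v).1 (hT ▸ Submodule.mem_top)).1 j f hf
  · exact ((hN v).1 (hT ▸ Submodule.mem_top)).2 k f hf

lemma vanish_one : Vanish ρ Y 1 := by
  obtain ⟨M, hM⟩ := h.exists_vanish
  have h1 : ∀ b, Vanish ρ Y (b + 1) → Vanish ρ Y 1 := by
    intro b
    induction b with
    | zero => exact id
    | succ b ih => exact fun hb => ih (h.vanish_of_succ b.succ_pos hb)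
  refine h1 M ⟨fun j f hf => hM.1 j f (Ideal.pow_le_pow_right (by omega) hf),
    fun k f hf => hM.2 k f (Ideal.pow_le_pow_right (by omega) hf)⟩

theorem current_eq (k : K) (s : Lat n) : Y k s = Y k 0 := by
  have := h.vanish_one.2 k (mon s - 1) (by simpa using mon_sub_one_mem s)
  rwa [map_sub, ← mon_zero, lext_mon, lext_mon, sub_eq_zero] at this

theorem field_add (j : Fin n) (r s : Lat n) : ρ j (r + s) = ρ j r + ρ j s := by
  have h1 : (mon r - 1) * (mon s - 1) * mon (Pi.single j 1) ∈ aug n ^ (1 + 1) := by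
    refine Ideal.mul_mem_right _ _ ?_
    rw [pow_succ, pow_one]
    exact Ideal.mul_mem_mul (mon_sub_one_mem r) (mon_sub_one_mem s)
  have e : (mon r - 1) * (mon s - 1) * mon (Pi.single j 1) = mon (r + s + Pi.single j 1) -
      mon (r + Pi.single j 1) - mon (s + Pi.single j 1) + mon (Pi.single j 1) := by
    simp only [mon_add]; ring
  have h2 := h.vanish_one.1 j _ h1
  rw [e, vf, map_add, map_sub, map_sub] at h2
  simp only [lext_mon, add_sub_cancel_right, sub_self, h.zero, add_zero] at h2
  rw [← sub_eq_zero, ← h2]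
  abel

end JetRep
end Jets
end Toroidal

namespace Toroidal
open Module (End)
namespace TwistData
variable {n : ℕ} {𝔤 : Type*} [LieRing 𝔤] [LieAlgebra ℂ 𝔤] {D : TwistData n 𝔤}

instance finite_lam : Finite D.Lam := by
  let f : Lat n →+ ∀ i : Fin n, ZMod (D.m i.succ) :=
    { toFun := fun k i => (k i : ZMod (D.m i.succ))
      map_zero' := by ext i; simp
      map_add' := fun a b => by ext i; simp }
  have hker : D.Γ = f.ker := by
    ext r
    rw [AddMonoidHom.mem_ker]
    change (∀ i : Fin n, (D.m i.succ : ℤ) ∣ r i) ↔ _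
    rw [funext_iff]
    exact forall_congr' fun i => (ZMod.intCast_zmod_eq_zero_iff_dvd _ _).symm
  have : ∀ i : Fin n, NeZero (D.m i.succ) := fun i => ⟨(D.m_pos _).ne'⟩
  rw [Lam, hker]
  exact Finite.of_injective _ (QuotientAddGroup.kerLift_injective f)

lemma bar_eq_iff {k l : Lat n} : D.bar k = D.bar l ↔ ∃ r, k + D.sc r = l := by
  rw [bar, bar, QuotientAddGroup.eq]
  constructor
  · intro h
    obtain ⟨s, hs⟩ := D.exists_sc_eq h
    exact ⟨s, by rw [hs]; abel⟩
  · rintro ⟨r, rfl⟩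
    rw [neg_add_cancel_left]; exact D.sc_mem r

lemma bar_add_sc (k r : Lat n) : D.bar (k + D.sc r) = D.bar k := (bar_eq_iff.2 ⟨r, rfl⟩).symm

lemma bar_out (lam : D.Lam) : D.bar lam.out = lam := QuotientAddGroup.out_eq' lam

lemma bar_add (k l : Lat n) : D.bar (k + l) = D.bar k + D.bar l := rfl

variable {M : Type*} [AddCommGroup M] [Module ℂ M]

variable (D) in
/-- A graded vector space on which the group `Γ` acts by invertible translations. -/
structure IsTranslation (gr : Lat n → Submodule ℂ M) (T : Lat n → End ℂ M) : Prop where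
  grading : IsGrading gr
  finite : ∀ k, FiniteDimensional ℂ (gr k)
  zero : T 0 = 1
  add : ∀ r s, T (r + s) = T r * T s
  mem : ∀ k r, ∀ v ∈ gr k, T r v ∈ gr (k + D.sc r)

/-- The span of the elements `T r v - v`. -/
def transKer (T : Lat n → End ℂ M) : Submodule ℂ M := Submodule.span ℂ {v | ∃ r w, v = T r w - w}

/-- The space of coinvariants of the translations. -/
abbrev Fiber (T : Lat n → End ℂ M) : Type _ := M ⧸ transKer T

/-- The operator induced on the coinvariants by an operator that commutes with translations. -/
def desc (T : Lat n → End ℂ M) (u : End ℂ M) : End ℂ (Fiber T) :=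
  open Classical in
  if h : transKer T ≤ (transKer T).comap u then (transKer T).mapQ (transKer T) u h else 0

/-- The projection to the coinvariants. -/
abbrev toFiber (T : Lat n → End ℂ M) : M →ₗ[ℂ] Fiber T := (transKer T).mkQ

lemma toFiber_surjective (T : Lat n → End ℂ M) : Function.Surjective (toFiber T) :=
  Submodule.mkQ_surjective _

lemma toFiber_trans (T : Lat n → End ℂ M) (r : Lat n) (v : M) :
    toFiber T (T r v) = toFiber T v := by
  rw [← sub_eq_zero, ← map_sub]
  exact (Submodule.Quotient.mk_eq_zero _).2 (Submodule.subset_span ⟨r, v, rfl⟩)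

lemma desc_apply {T : Lat n → End ℂ M} {u : End ℂ M} (hu : ∀ r, u * T r = T r * u) (v : M) :
    desc T u (toFiber T v) = toFiber T (u v) := by
  have h : transKer T ≤ (transKer T).comap u := by
    refine Submodule.span_le.2 ?_
    rintro _ ⟨r, w, rfl⟩
    rw [SetLike.mem_coe, Submodule.mem_comap, map_sub]
    have := LinearMap.congr_fun (hu r) w
    rw [Module.End.mul_apply, Module.End.mul_apply] at this
    rw [this]
    exact Submodule.subset_span ⟨r, u w, rfl⟩
  rw [desc, dif_pos h]
  rfl

lemma fiber_hom_ext {T : Lat n → End ℂ M} {f g : End ℂ (Fiber T)}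
    (hfg : ∀ v, f (toFiber T v) = g (toFiber T v)) : f = g := by
  refine LinearMap.ext fun x => ?_
  obtain ⟨v, rfl⟩ := toFiber_surjective T x
  exact hfg v

/-- The `Λ`-grading of the coinvariants. -/
def fiberGr (gr : Lat n → Submodule ℂ M) (T : Lat n → End ℂ M) (lam : D.Lam) :
    Submodule ℂ (Fiber T) := (gr lam.out).map (toFiber T)

namespace IsTranslation

variable {gr : Lat n → Submodule ℂ M} {T : Lat n → End ℂ M} (t : IsTranslation D gr T)
include t

lemma apply_neg (r : Lat n) (v : M) : T (-r) (T r v) = v := by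
  rw [← Module.End.mul_apply, ← t.add, neg_add_cancel, t.zero, Module.End.one_apply]

/-- The projection of `M` to the sum of the components of chosen degrees. -/
lemma exists_section : ∃ p : Fiber T →ₗ[ℂ] M, (∀ x, toFiber T (p x) = x) ∧
    (∀ k, ∀ v ∈ gr k, ∃ s, p (toFiber T v) = T s v) ∧
    ∀ k, ∀ v ∈ gr k, p (toFiber T v) ∈ gr (D.bar k).out := by
  classical
  have hs : ∀ k : Lat n, ∃ s, k + D.sc s = (D.bar k).out := fun k =>
    bar_eq_iff.1 (bar_out (D.bar k)).symm
  choose s hs using hs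
  let Q : M →ₗ[ℂ] M := DirectSum.toModule ℂ (Lat n) M (fun k => T (s k) ∘ₗ (gr k).subtype) ∘ₗ
    t.grading.equiv.symm.toLinearMap
  have hQ : ∀ k, ∀ v ∈ gr k, Q v = T (s k) v := by
    intro k v hv
    simp only [Q, LinearMap.comp_apply, LinearEquiv.coe_coe, t.grading.equiv_symm_of_mem hv]
    rw [← DirectSum.lof_eq_of ℂ, DirectSum.toModule_lof]
    rfl
  have hle : transKer T ≤ LinearMap.ker Q := by
    refine Submodule.span_le.2 ?_
    rintro _ ⟨r, w, rfl⟩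
    rw [SetLike.mem_coe, LinearMap.mem_ker, map_sub, sub_eq_zero]
    induction w using t.grading.induction with
    | hm k v hv =>
      rw [hQ k v hv, hQ _ _ (t.mem k r v hv), ← Module.End.mul_apply, ← t.add]
      congr 2
      apply D.sc_injective
      have h1 := hs (k + D.sc r)
      rw [bar_add_sc, ← hs k, add_assoc] at h1
      rw [sc_add, add_comm]
      exact add_left_cancel h1
    | h0 => simp
    | hadd x y hx hy => simp only [map_add, hx, hy]
  refine ⟨(transKer T).liftQ Q hle, fun x => ?_, fun k v hv => ⟨s k, hQ k v hv⟩, fun k v hv => ?_⟩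
  · obtain ⟨v, rfl⟩ := toFiber_surjective T x
    change toFiber T (Q v) = _
    induction v using t.grading.induction with
    | hm k v hv => rw [hQ k v hv, toFiber_trans]
    | h0 => simp
    | hadd x y hx hy => simp only [map_add, hx, hy]
  · change Q v ∈ _
    rw [hQ k v hv, ← hs k]
    exact t.mem k _ v hv

lemma toFiber_mem {k : Lat n} {v : M} (hv : v ∈ gr k) : toFiber T v ∈ fiberGr gr T (D.bar k) := by
  obtain ⟨p, h1, h2, h3⟩ := t.exists_section
  exact ⟨p (toFiber T v), h3 k v hv, h1 _⟩

lemma exists_toFiber_eq {k : Lat n} {x : Fiber T} (hx : x ∈ fiberGr gr T (D.bar k)) :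
    ∃ v ∈ gr k, toFiber T v = x := by
  obtain ⟨v, hv, rfl⟩ := hx
  obtain ⟨r, hr⟩ := bar_eq_iff.1 (bar_out (D.bar k))
  exact ⟨T r v, hr ▸ t.mem _ r v hv, toFiber_trans T r v⟩

lemma eq_zero_of_toFiber {k : Lat n} {v : M} (hv : v ∈ gr k) (h0 : toFiber T v = 0) : v = 0 := by
  obtain ⟨p, h1, h2, h3⟩ := t.exists_section
  obtain ⟨s, hs⟩ := h2 k v hv
  rw [h0, map_zero] at hs
  rw [← t.apply_neg s v, ← hs, map_zero]

lemma fiber_grading : IsGrading (fiberGr (D := D) gr T) := by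
  obtain ⟨p, h1, h2, h3⟩ := t.exists_section
  have hp : ∀ lam, ∀ x ∈ fiberGr (D := D) gr T lam, p x ∈ gr lam.out := by
    rintro lam _ ⟨v, hv, rfl⟩
    have := h3 _ v hv
    rwa [bar_out] at this
  refine ⟨?_, ?_⟩
  · rw [iSupIndep_def]
    intro lam
    rw [Submodule.disjoint_def]
    intro x hx hx'
    have hi : iSupIndep fun lam : D.Lam => gr lam.out := t.grading.indep.comp fun a b hab => by
      rw [← bar_out a, hab, bar_out]
    have h4 : p x ∈ ⨆ μ : D.Lam, ⨆ _ : μ ≠ lam, gr μ.out := by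
      have h5 : (⨆ μ : D.Lam, ⨆ _ : μ ≠ lam, fiberGr (D := D) gr T μ) ≤
          (⨆ μ : D.Lam, ⨆ _ : μ ≠ lam, gr μ.out).comap p :=
        iSup₂_le fun μ hμ x hx => Submodule.mem_iSup_of_mem μ (Submodule.mem_iSup_of_mem hμ
          (hp μ x hx))
      exact h5 hx'
    rw [← h1 x, (Submodule.disjoint_def.1 (iSupIndep_def.1 hi lam)) _ (hp lam x hx) h4, map_zero]
  · rw [eq_top_iff]
    rintro x -
    obtain ⟨v, rfl⟩ := toFiber_surjective T x
    induction v using t.grading.induction with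
    | hm k v hv => exact Submodule.mem_iSup_of_mem _ (t.toFiber_mem hv)
    | h0 => simp
    | hadd x y hx hy => rw [map_add]; exact add_mem hx hy

lemma finite_fiber : FiniteDimensional ℂ (Fiber T) := by
  have := t.finite
  have h1 : ∀ lam, FiniteDimensional ℂ (fiberGr (D := D) gr T lam) := fun lam => by
    rw [fiberGr]; infer_instance
  have h2 : FiniteDimensional ℂ (⨆ lam, fiberGr (D := D) gr T lam : Submodule ℂ (Fiber T)) :=
    inferInstance
  rw [t.fiber_grading.iSup_eq_top] at h2
  exact Module.Finite.equiv (Submodule.topEquiv (R := ℂ) (M := Fiber T))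

lemma desc_mem {u : End ℂ M} (hu : ∀ r, u * T r = T r * u) {l : Lat n}
    (hm : ∀ k, ∀ v ∈ gr k, u v ∈ gr (k + l)) (lam : D.Lam) {x : Fiber T}
    (hx : x ∈ fiberGr gr T lam) : desc T u x ∈ fiberGr gr T (D.bar l + lam) := by
  rw [← bar_out lam] at hx
  obtain ⟨v, hv, rfl⟩ := t.exists_toFiber_eq hx
  rw [desc_apply hu, ← bar_out lam, ← bar_add, add_comm]
  exact t.toFiber_mem (hm _ v hv)

end IsTranslation

variable [FiniteDimensional ℂ 𝔤] [LieAlgebra.IsSimple ℂ 𝔤] {π : D.tau0 →ₗ⁅ℂ⁆ End ℂ M}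
    {gr : Lat n → Submodule ℂ M} {α : Fin n → ℂ} {d C₀ : ℂ}

namespace IsTop
variable (π C₀) in
/-- The operator `t^{-r} · t^r d_a - d_a`. -/
def del (r : Lat n) (a : Fin (n + 1) → ℂ) : End ℂ M :=
  trans π C₀ (-r) * π (D.e0 r a) - π (D.e0 0 a)

variable (h : IsTop π gr α d C₀)
include h

lemma isTranslation : IsTranslation D gr (trans π C₀) :=
  ⟨h.grading, h.finite, h.trans_zero, h.trans_add, fun _ r _ hv => h.trans_mem hv r⟩

lemma del_trans (r s : Lat n) (a : Fin (n + 1) → ℂ) :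
    del π C₀ r a * trans π C₀ s = trans π C₀ s * del π C₀ r a := by
  rw [del, sub_mul, mul_assoc, h.e0_trans, h.e0_trans, mul_add, ← mul_assoc, h.trans_mul_comm (-r) s,
    mul_smul_comm, ← h.trans_add (-r) (r + s), neg_add_cancel_left, zero_add, mul_sub, mul_assoc]
  abel

lemma commL_del (r s : Lat n) (a b : Fin (n + 1) → ℂ) :
    commL (del π C₀ r a) (del π C₀ s b) =
      pair a (D.sv s) • (del π C₀ (r + s) b - del π C₀ s b) -
      pair b (D.sv r) • (del π C₀ (r + s) a - del π C₀ r a) := by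
  let B : Lat n → (Fin (n + 1) → ℂ) → End ℂ M := fun r a => trans π C₀ (-r) * π (D.e0 r a)
  have hd : ∀ r a, del π C₀ r a = B r a - B 0 a := fun r a => by
    simp only [B, del, neg_zero, h.trans_zero, one_mul]
  have h1 : ∀ r s a b, B r a * B s b = trans π C₀ (-(r + s)) * (π (D.e0 r a) * π (D.e0 s b)) -
      pair a (D.sv s) • B s b := by
    intro r s a b
    simp only [B]
    rw [mul_assoc, ← mul_assoc (π (D.e0 r a)), h.e0_trans, add_mul, mul_add, smul_mul_assoc,
      mul_smul_comm, ← mul_assoc _ (trans π C₀ (r + -s)), ← h.trans_add, neg_add_cancel_left,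
      sv_neg, map_neg, neg_smul, ← sub_eq_add_neg, mul_assoc (trans π C₀ (-s)),
      ← mul_assoc (trans π C₀ (-r)), ← h.trans_add, neg_add]
  have h2 : ∀ r s a b, B r a * B s b - B s b * B r a = pair a (D.sv s) • (B (r + s) b - B s b) -
      pair b (D.sv r) • (B (r + s) a - B r a) := by
    intro r s a b
    rw [h1, h1 s r b a, add_comm s r, h.lie_e0_e0_eq r s a b, mul_add]
    have : trans π C₀ (-(r + s)) * π (D.e0 (r + s) (pair a (D.sv s) • b - pair b (D.sv r) • a)) =
        pair a (D.sv s) • B (r + s) b - pair b (D.sv r) • B (r + s) a := by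
      rw [sub_eq_add_neg, ← neg_smul, e0_add, e0_smul, e0_smul, map_add, map_smul, map_smul,
        mul_add, mul_smul_comm, mul_smul_comm, neg_smul, ← sub_eq_add_neg]
    rw [this, smul_sub, smul_sub]
    abel
  have h3 := h2 r s a b
  have h4 := h2 0 s a b
  have h5 := h2 r 0 a b
  have h6 := h2 0 0 a b
  simp only [zero_add, add_zero, sv_zero, map_zero, zero_smul, sub_self, smul_zero] at h4 h5 h6
  rw [commL_apply, hd, hd, hd, hd]
  have : (B r a - B 0 a) * (B s b - B 0 b) - (B s b - B 0 b) * (B r a - B 0 a) =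
      (B r a * B s b - B s b * B r a) - (B 0 a * B s b - B s b * B 0 a) -
      (B r a * B 0 b - B 0 b * B r a) + (B 0 a * B 0 b - B 0 b * B 0 a) := by noncomm_ring
  rw [this, h3, h4, h5, h6, sub_zero, sub_zero, add_zero]
  simp only [sub_sub_sub_cancel_right]

omit h in
lemma commL_del_x0 (r l : Lat n) (a : Fin (n + 1) → ℂ) (X : 𝔤) (hX : X ∈ D.gradeSpace (emb l))
    (hX' : X ∈ D.gradeSpace (emb (l + D.sc r))) :
    commL (del π C₀ r a) (π (D.x0 l X hX)) = pair a (emb l).vec •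
      (trans π C₀ (-r) * π (D.x0 (l + D.sc r) X hX') - π (D.x0 l X hX)) := by
  have hX0 : X ∈ D.gradeSpace (emb (l + D.sc 0)) := by rwa [sc_zero, add_zero]
  rw [commL_apply, del, sub_mul, mul_assoc, map_mul_map (D.e0 r a), lie_e0_x0 r l a X hX hX',
    map_mul_map (D.e0 0 a), lie_e0_x0 0 l a X hX hX0, x0_congr hX0 hX (by rw [sc_zero, add_zero]), mul_sub, mul_add,
    ← mul_assoc, x0_trans, map_smul, map_smul, mul_assoc, mul_smul_comm, smul_sub]
  abel

lemma x0_mul_x0 (k l : Lat n) (X Y : 𝔤) (hX : X ∈ D.gradeSpace (emb k))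
    (hY : Y ∈ D.gradeSpace (emb l)) : commL (π (D.x0 k X hX)) (π (D.x0 l Y hY)) =
      π (D.x0 (k + l) ⁅X, Y⁆ (gradeSpace_emb_lie hX hY)) := by
  obtain ⟨r, w, hw, e⟩ := lie_x0_x0 k l X Y hX hY
  rw [commL_apply, map_mul_map, e, map_add, h.c0_eq, hw, zero_mul, zero_smul]
  abel

lemma e0_eq_del (r : Lat n) (a : Fin (n + 1) → ℂ) :
    π (D.e0 r a) = trans π C₀ r * (del π C₀ r a + π (D.e0 0 a)) := by
  rw [del, sub_add_cancel, ← mul_assoc, h.trans_mul_neg, one_mul]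

lemma e0_zero_apply {k : Lat n} {v : M} (hv : v ∈ gr k) (u : Fin n → ℂ) :
    π (D.e0 0 (Fin.cons 0 u)) v = (∑ i, u i * (k i + α i)) • v := by
  let f : (Fin n → ℂ) →ₗ[ℂ] M :=
    { toFun := fun u => π (D.e0 0 (Fin.cons 0 u)) v
      map_add' := fun u w => by
        rw [← LinearMap.add_apply, ← map_add, ← e0_add]
        congr 3
        ext i; refine Fin.cases ?_ (fun i => ?_) i <;> simp
      map_smul' := fun c u => by
        rw [RingHom.id_apply, ← LinearMap.smul_apply, ← map_smul, ← e0_smul]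
        congr 3
        ext i; refine Fin.cases ?_ (fun i => ?_) i <;> simp }
  let g : (Fin n → ℂ) →ₗ[ℂ] M := (pair.flip fun i => (k i : ℂ) + α i).smulRight v
  have : f = g := (Pi.basisFun ℂ (Fin n)).ext fun i => by
    rw [Pi.basisFun_apply]
    change π (D.e0 0 (Fin.cons 0 (Pi.single i 1))) v = pair (Pi.single i 1) _ • v
    have e : (Fin.cons 0 (Pi.single i 1) : Fin (n + 1) → ℂ) = Pi.single i.succ 1 := by
      ext j; refine Fin.cases ?_ (fun j => ?_) j
      · simp
      · simp [Pi.single_apply]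
    rw [pair_single, e, (h.mem_gr k v).1 hv i, add_comm]
  exact LinearMap.congr_fun this u

end IsTop
end TwistData
end Toroidal

namespace Toroidal
open Module (End)

lemma iSup_iInf_eigenspace_eq_top {ι M : Type*} [AddCommGroup M] [Module ℂ M]
    [FiniteDimensional ℂ M] (f : ι → End ℂ M) (hc : ∀ i j, f i * f j = f j * f i)
    (hs : ∀ i, (f i).IsSemisimple) : ⨆ χ : ι → ℂ, ⨅ i, (f i).eigenspace (χ i) = ⊤ := by
  have h := Module.End.iSup_iInf_maxGenEigenspace_eq_top_of_iSup_maxGenEigenspace_eq_top_of_commute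
    f (fun i j _ => hc i j) fun i => Module.End.iSup_maxGenEigenspace_eq_top (f i)
  simpa only [fun i μ => (hs i).isFinitelySemisimple.maxGenEigenspace_eq_eigenspace μ] using h

lemma iSupIndep_iInf_eigenspace {ι M : Type*} [AddCommGroup M] [Module ℂ M] (f : ι → End ℂ M)
    (hc : ∀ i j, f i * f j = f j * f i) :
    iSupIndep fun χ : ι → ℂ => ⨅ i, (f i).eigenspace (χ i) := by
  have h := Module.End.independent_iInf_maxGenEigenspace_of_forall_mapsTo f fun i j φ =>
    Module.End.mapsTo_maxGenEigenspace_of_comm (hc j i) φ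
  have hle : ∀ i μ, (f i).eigenspace μ ≤ (f i).maxGenEigenspace μ := fun i μ =>
    ((f i).genEigenspace μ).mono le_top
  exact h.mono fun χ => iInf_mono fun i => hle i (χ i)

lemma IsGrading.proj_apply_comm {ι M : Type*} [AddCommGroup M] [Module ℂ M]
    {gr : ι → Submodule ℂ M} (h : IsGrading gr) {x : End ℂ M} (hx : ∀ k, ∀ v ∈ gr k, x v ∈ gr k)
    (k : ι) (v : M) : h.proj k (x v) = x (h.proj k v) :=
  h.proj_comm h (f := id) Function.injective_id hx k v

lemma IsGrading.exists_linearMap {ι M N : Type*} [AddCommGroup M] [Module ℂ M] [AddCommGroup N]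
    [Module ℂ N] {gr : ι → Submodule ℂ M} (h : IsGrading gr) (f : ∀ k, gr k →ₗ[ℂ] N) :
    ∃ F : M →ₗ[ℂ] N, ∀ k v hv, F v = f k ⟨v, hv⟩ := by
  classical
  refine ⟨DirectSum.toModule ℂ ι N f ∘ₗ h.equiv.symm.toLinearMap, fun k v hv => ?_⟩
  simp only [LinearMap.comp_apply, LinearEquiv.coe_coe, h.equiv_symm_of_mem hv]
  rw [← DirectSum.lof_eq_of ℂ, DirectSum.toModule_lof]

namespace TwistData
variable {n : ℕ} {𝔤 : Type*} [LieRing 𝔤] [LieAlgebra ℂ 𝔤] {D : TwistData n 𝔤}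

section gFix

lemma σ_iterate (i : Fin (n + 1)) (x : 𝔤) : (D.σ i)^[D.m i] x = x := by
  have h1 : ∀ k : ℕ, ((D.σ i).toLinearEquiv ^ k) x = (D.σ i)^[k] x := by
    intro k
    induction k with
    | zero => rfl
    | succ k ih =>
      rw [pow_succ', Function.iterate_succ_apply', ← ih]
      rfl
  rw [← h1, ← D.orderOf_σ i, pow_orderOf_eq_one]
  rfl

variable (D) in
/-- The action of `σᵢ` on `𝔤(σ₀)`. -/
def σFix (i : Fin (n + 1)) : End ℂ D.gFix :=
  ((D.σ i).toLinearEquiv.toLinearMap.restrict (p := D.gFix.toSubmodule) (q := D.gFix.toSubmodule)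
    fun x (hx : D.σ 0 x = x) => by
      change D.σ 0 (D.σ i x) = D.σ i x
      rw [D.σ_comm, hx])

lemma σFix_apply (i : Fin (n + 1)) (x : D.gFix) : (D.σFix i x : 𝔤) = D.σ i x := rfl

lemma σFix_comm (i j : Fin (n + 1)) : D.σFix i * D.σFix j = D.σFix j * D.σFix i :=
  LinearMap.ext fun x => Subtype.ext (D.σ_comm i j x)

lemma σFix_pow (i : Fin (n + 1)) : D.σFix i ^ D.m i = 1 := by
  have h1 : ∀ (k : ℕ) (x : D.gFix), ((D.σFix i ^ k) x : 𝔤) = (D.σ i)^[k] x := by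
    intro k x
    induction k with
    | zero => rfl
    | succ k ih =>
      rw [pow_succ', Function.iterate_succ_apply', ← ih]
      rfl
  exact LinearMap.ext fun x => Subtype.ext ((h1 _ x).trans (σ_iterate i (x : 𝔤)))

lemma σFix_isSemisimple (i : Fin (n + 1)) : (D.σFix i).IsSemisimple := by
  refine Module.End.isSemisimple_of_squarefree_aeval_eq_zero (p := Polynomial.X ^ D.m i - 1) ?_ ?_
  · refine Polynomial.Separable.squarefree ?_
    have h : ((D.m i : ℕ) : ℂ) ≠ 0 := Nat.cast_ne_zero.2 (D.m_pos i).ne'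
    exact (Polynomial.X_pow_sub_one_separable_iff).2 h
  · simp [σFix_pow]

lemma exists_zpow_of_eigenvector {i : Fin (n + 1)} {x : D.gFix} (hx : x ≠ 0) {μ : ℂ}
    (h : D.σFix i x = μ • x) : ∃ a : ℤ, D.ξ i ^ a = μ := by
  have h1 : ∀ k : ℕ, (D.σFix i ^ k) x = μ ^ k • x := by
    intro k
    induction k with
    | zero => simp
    | succ k ih => rw [pow_succ', Module.End.mul_apply, ih, map_smul, h, smul_smul, pow_succ]
  have h2 := h1 (D.m i)
  rw [σFix_pow, Module.End.one_apply] at h2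
  have h3 : μ ^ D.m i = 1 := by
    have : (μ ^ D.m i - 1) • x = 0 := by rw [sub_smul, one_smul, ← h2, sub_self]
    exact sub_eq_zero.1 ((smul_eq_zero.1 this).resolve_right hx)
  have : NeZero (D.m i) := ⟨(D.m_pos i).ne'⟩
  obtain ⟨a, -, ha⟩ := (D.ξ_prim i).eq_pow_of_pow_eq_one h3
  exact ⟨a, by rw [zpow_natCast, ha]⟩

lemma mem_gradeSpace_of_eigenvector {x : D.gFix} (hx : x ≠ 0) {μ : Fin (n + 1) → ℂ}
    (h : ∀ i, D.σFix i x = μ i • x) : ∃ l : Lat n, (x : 𝔤) ∈ D.gradeSpace (emb l) := by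
  choose a ha using fun i => exists_zpow_of_eigenvector hx (h i)
  refine ⟨Fin.tail a, fun i => ?_⟩
  refine Fin.cases ?_ (fun i => ?_) i
  · rw [show D.σ 0 (x : 𝔤) = x from x.2]
    simp [emb]
  · rw [← σFix_apply, h, ← ha]
    rfl

lemma mem_gFix_of_mem_gradeSpace {l : Lat n} {X : 𝔤} (hX : X ∈ D.gradeSpace (emb l)) :
    X ∈ D.gFix := by
  have := hX 0
  change D.σ 0 X = X
  simpa [emb] using this

variable (D) in
/-- The `Λ`-grading of `𝔤(σ₀)`. -/
def gFixGr (lam : D.Lam) : Submodule ℂ D.gFix :=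
  (D.gradeSpace (emb lam.out)).comap D.gFix.toSubmodule.subtype

lemma mem_gFixGr_bar {l : Lat n} {x : D.gFix} :
    x ∈ D.gFixGr (D.bar l) ↔ (x : 𝔤) ∈ D.gradeSpace (emb l) := by
  obtain ⟨r, hr⟩ := bar_eq_iff.1 (bar_out (D.bar l)).symm
  change (x : 𝔤) ∈ D.gradeSpace (emb (D.bar l).out) ↔ _
  rw [← hr, gradeSpace_emb_add_sc]

lemma gFixGr_iSupIndep : iSupIndep D.gFixGr := by
  let χ : D.Lam → Fin (n + 1) → ℂ := fun lam i => D.ξ i ^ emb lam.out i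
  have hχ : Function.Injective χ := by
    intro a b hab
    rw [← bar_out a, ← bar_out b, bar, bar, QuotientAddGroup.eq]
    intro i
    have h1 : D.ξ i.succ ^ a.out i = D.ξ i.succ ^ b.out i := congrFun hab i.succ
    rw [← (D.ξ_prim i.succ).zpow_eq_one_iff_dvd, Pi.add_apply, Pi.neg_apply,
      zpow_add₀ (D.ξ_ne_zero _), ← h1, ← zpow_add₀ (D.ξ_ne_zero _), neg_add_cancel, zpow_zero]
  refine ((iSupIndep_iInf_eigenspace D.σFix σFix_comm).comp hχ).mono fun lam x hx => ?_
  rw [Function.comp_apply, Submodule.mem_iInf]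
  exact fun i => End.mem_eigenspace_iff.2 (Subtype.ext (hx i))

lemma gFixGr_grading [FiniteDimensional ℂ 𝔤] : IsGrading D.gFixGr := by
  refine ⟨gFixGr_iSupIndep, ?_⟩
  rw [eq_top_iff, ← iSup_iInf_eigenspace_eq_top D.σFix σFix_comm σFix_isSemisimple]
  refine iSup_le fun χ x hx => ?_
  by_cases h0 : x = 0
  · rw [h0]; exact zero_mem _
  rw [Submodule.mem_iInf] at hx
  obtain ⟨l, hl⟩ := mem_gradeSpace_of_eigenvector h0 fun i => End.mem_eigenspace_iff.1 (hx i)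
  exact Submodule.mem_iSup_of_mem (D.bar l) (mem_gFixGr_bar.2 hl)

end gFix

/-- A finite dimensional `Λ`-graded irreducible representation of `𝔤𝔩ₙ ⊕ 𝔤(σ₀)`. -/
structure FiberRep {F : Type*} [AddCommGroup F] [Module ℂ F] (grF : D.Lam → Submodule ℂ F)
    (g : Matrix (Fin n) (Fin n) ℂ →ₗ⁅ℂ⁆ End ℂ F) (x : D.gFix →ₗ⁅ℂ⁆ End ℂ F) : Prop where
  finite : FiniteDimensional ℂ F
  nontrivial : Nontrivial F
  grading : IsGrading grF
  comm : ∀ A X, g A * x X = x X * g A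
  g_mem : ∀ A lam, ∀ v ∈ grF lam, g A v ∈ grF lam
  x_mem : ∀ (l : Lat n) (X : D.gFix), (X : 𝔤) ∈ D.gradeSpace (emb l) → ∀ lam, ∀ v ∈ grF lam,
    x X v ∈ grF (D.bar l + lam)
  irreducible : ∀ N : Submodule ℂ F, (∀ lam, N ≤ N.comap (grading.proj lam)) →
    (∀ A, N ≤ N.comap (g A)) → (∀ X, N ≤ N.comap (x X)) → N = ⊥ ∨ N = ⊤

variable [FiniteDimensional ℂ 𝔤] [LieAlgebra.IsSimple ℂ 𝔤] {M : Type*} [AddCommGroup M] [Module ℂ M]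
    {π : D.tau0 →ₗ⁅ℂ⁆ End ℂ M} {gr : Lat n → Submodule ℂ M} {α : Fin n → ℂ} {d C₀ : ℂ}

/-- The evaluation at the point `(1, …, 1)` of a module of tensor fields. -/
structure IsEval {F : Type*} [AddCommGroup F] [Module ℂ F] (π : D.tau0 →ₗ⁅ℂ⁆ End ℂ M)
    (gr : Lat n → Submodule ℂ M) (α : Fin n → ℂ) (d C₀ : ℂ) (grF : D.Lam → Submodule ℂ F)
    (g : Matrix (Fin n) (Fin n) ℂ →ₗ⁅ℂ⁆ End ℂ F) (x : D.gFix →ₗ⁅ℂ⁆ End ℂ F) (q : M →ₗ[ℂ] F) :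
    Prop where
  mem : ∀ k, ∀ v ∈ gr k, q v ∈ grF (D.bar k)
  inj : ∀ k, ∀ v ∈ gr k, q v = 0 → v = 0
  surj : ∀ k, ∀ y ∈ grF (D.bar k), ∃ v ∈ gr k, q v = y
  c0 : ∀ r w v, q (π (D.c0 r w) v) = (w 0 * C₀) • q v
  e0_zero : ∀ r v, q (π (D.e0 r (Pi.single 0 1)) v) = d • q v
  e0 : ∀ r u k, ∀ v ∈ gr k, q (π (D.e0 r (Fin.cons 0 u)) v) =
    (∑ i, u i * (k i + α i)) • q v +
      ∑ i, ∑ j, (u i * D.sc r j) • g (Matrix.single j i 1) (q v)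
  x0 : ∀ l X hX v, q (π (D.x0 l X hX) v) = x ⟨X, mem_gFix_of_mem_gradeSpace hX⟩ (q v)

namespace IsTop
variable (h : IsTop π gr α d C₀)
include h

omit h in
lemma x0_trans' (l : Lat n) (X : 𝔤) (hX : X ∈ D.gradeSpace (emb l)) (r : Lat n) :
    π (D.x0 l X hX) * trans π C₀ r = trans π C₀ r * π (D.x0 l X hX) := (x0_trans l X hX r).symm

lemma fiber_irreducible (N : Submodule ℂ (Fiber (trans π C₀)))
    (hN : ∀ lam, N ≤ N.comap (h.isTranslation.fiber_grading.proj lam))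
    (hd : ∀ r u, N ≤ N.comap (desc _ (del π C₀ r (Fin.cons 0 u))))
    (hx : ∀ l X hX, N ≤ N.comap (desc _ (π (D.x0 l X hX)))) : N = ⊥ ∨ N = ⊤ := by
  have t := h.isTranslation
  let N' : Submodule ℂ M := ⨅ k, N.comap (toFiber (trans π C₀) ∘ₗ h.grading.proj k)
  have hN' : ∀ v, v ∈ N' ↔ ∀ k, toFiber (trans π C₀) (h.grading.proj k v) ∈ N := fun v => by
    simp [N', Submodule.mem_iInf]
  have hTN : ∀ r, N' ≤ N'.comap (trans π C₀ r) := by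
    intro r v hv
    rw [Submodule.mem_comap, hN']
    rw [hN'] at hv
    intro k
    obtain ⟨k, rfl⟩ : ∃ k', k = k' + D.sc r := ⟨k - D.sc r, by abel⟩
    rw [h.grading.proj_comm h.grading (f := (· + D.sc r)) (add_left_injective _)
      (fun k v hv => h.trans_mem hv r), toFiber_trans]
    exact hv k
  have hDN : ∀ r u, N' ≤ N'.comap (del π C₀ r (Fin.cons 0 u)) := by
    intro r u v hv
    rw [Submodule.mem_comap, hN']
    rw [hN'] at hv
    intro k
    have hdeg : ∀ k, ∀ v ∈ gr k, del π C₀ r (Fin.cons 0 u) v ∈ gr k := by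
      intro k v hv
      rw [del, LinearMap.sub_apply, Module.End.mul_apply]
      refine sub_mem ?_ ?_
      · have := h.trans_mem (h.e0_mem hv r (Fin.cons 0 u)) (-r)
        rwa [sc_neg, add_neg_cancel_right] at this
      · have := h.e0_mem hv 0 (Fin.cons 0 u)
        rwa [sc_zero, add_zero] at this
    rw [h.grading.proj_apply_comm hdeg k v,
      ← desc_apply (fun s => h.del_trans r s _)]
    exact hd r u (hv k)
  have hE : ∀ u, N' ≤ N'.comap (π (D.e0 0 (Fin.cons 0 u))) := by
    intro u v hv
    rw [Submodule.mem_comap, hN']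
    rw [hN'] at hv
    intro k
    rw [h.grading.proj_apply_comm (fun k v hv => by
      have := h.e0_mem hv 0 (Fin.cons 0 u)
      rwa [sc_zero, add_zero] at this) k v, h.e0_zero_apply (h.grading.proj_mem k v), map_smul]
    exact N.smul_mem _ (hv k)
  have key := h.irreducible_gens N' ?_ ?_ ?_
  · rcases key with h0 | h1
    · left
      rw [Submodule.eq_bot_iff]
      intro y hy
      refine t.fiber_grading.eq_zero_of_proj fun lam => ?_
      obtain ⟨v, hv, hvy⟩ := t.fiber_grading.proj_mem lam y
      rw [← hvy]
      have hyN : toFiber (trans π C₀) v ∈ N := hvy ▸ hN lam hy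
      have : v ∈ N' := by
        rw [hN']
        intro k
        by_cases hk : k = lam.out
        · subst hk; rwa [h.grading.proj_of_mem hv]
        · rw [h.grading.proj_of_ne hk hv, map_zero]; exact zero_mem _
      rw [h0, Submodule.mem_bot] at this
      rw [this, map_zero]
    · right
      rw [eq_top_iff]
      rintro y -
      obtain ⟨v, rfl⟩ := toFiber_surjective _ y
      induction v using h.grading.induction with
      | hm k v hv =>
        have := (hN' v).1 (h1 ▸ Submodule.mem_top) k
        rwa [h.grading.proj_of_mem hv] at this
      | h0 => simp
      | hadd x y hx hy => rw [map_add]; exact add_mem hx hy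
  · intro l X hX v hv
    rw [Submodule.mem_comap, hN']
    rw [hN'] at hv
    intro k
    obtain ⟨k, rfl⟩ : ∃ k', k = k' + l := ⟨k - l, by abel⟩
    rw [h.grading.proj_comm h.grading (f := (· + l)) (add_left_injective _)
      (fun k v hv => h.x0_mem hv l X hX), ← desc_apply (x0_trans' l X hX)]
    exact hx l X hX (hv k)
  · intro r w v hv
    rw [Submodule.mem_comap, h.c0_eq, LinearMap.smul_apply]
    exact N'.smul_mem _ (hTN r hv)
  · intro r w v hv
    have e : w = w 0 • Pi.single 0 1 + Fin.cons 0 (Fin.tail w) := by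
      ext i
      refine Fin.cases ?_ (fun i => ?_) i
      · simp
      · simp [Fin.tail]
    rw [Submodule.mem_comap, e, e0_add, e0_smul, map_add, map_smul, h.e0_zero_eq, h.e0_eq_del r,
      LinearMap.add_apply, LinearMap.smul_apply, LinearMap.smul_apply, Module.End.mul_apply,
      LinearMap.add_apply]
    exact add_mem (N'.smul_mem _ (N'.smul_mem _ (hTN r hv)))
      (hTN r (add_mem (hDN r (Fin.tail w) hv) (hE (Fin.tail w) hv)))

end IsTop
end TwistData
end Toroidal

namespace Toroidal
open Module (End)

/-- A representation of `𝔤𝔩ₙ` from operators that satisfy the relations of the matrix units. -/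
lemma exists_gl_rep {n : ℕ} {F : Type*} [AddCommGroup F] [Module ℂ F]
    (G : Fin n → Fin n → End ℂ F)
    (hG : ∀ j i l k, commL (G j i) (G l k) =
      (if i = l then G j k else 0) - if k = j then G l i else 0) :
    ∃ g : Matrix (Fin n) (Fin n) ℂ →ₗ⁅ℂ⁆ End ℂ F, (∀ j i, g (Matrix.single j i 1) = G j i) ∧
      ∀ A, g A = ∑ j, ∑ i, A j i • G j i := by
  let g : Matrix (Fin n) (Fin n) ℂ →ₗ[ℂ] End ℂ F :=
    { toFun := fun A => ∑ j, ∑ i, A j i • G j i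
      map_add' := fun A B => by simp [add_smul, Finset.sum_add_distrib]
      map_smul' := fun c A => by simp [mul_smul, Finset.smul_sum] }
  have hg : ∀ j i c, g (Matrix.single j i c) = c • G j i := by
    intro j i c
    change ∑ j', ∑ i', Matrix.single j i c j' i' • G j' i' = _
    rw [Finset.sum_eq_single j, Finset.sum_eq_single i, Matrix.single_apply_same]
    · intro i' _ hi; rw [Matrix.single_apply_of_col_ne _ _ (Ne.symm hi), zero_smul]
    · simp
    · intro j' _ hj
      exact Finset.sum_eq_zero fun i' _ => by
        rw [Matrix.single_apply_of_row_ne (Ne.symm hj), zero_smul]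
    · simp
  refine ⟨{ g with map_lie' := ?_ }, fun j i => (hg j i 1).trans (one_smul _ _), fun _ => rfl⟩
  intro A B
  change g ⁅A, B⁆ = ⁅g A, g B⁆
  rw [Ring.lie_def, Ring.lie_def, ← commL_apply]
  induction A using Matrix.induction_on' with
  | h_zero => simp
  | h_add A A' hA hA' =>
    rw [map_add, map_add, LinearMap.add_apply, ← hA, ← hA', ← map_add]; congr 1; noncomm_ring
  | h_std_basis j i c =>
  induction B using Matrix.induction_on' with
  | h_zero => simp
  | h_add A A' hA hA' =>
    rw [map_add, map_add, ← hA, ← hA', ← map_add]; congr 1; noncomm_ring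
  | h_std_basis l k c' =>
    rw [hg, hg, map_smul, map_smul, LinearMap.smul_apply, hG, map_sub]
    by_cases h1 : i = l
    · subst h1
      rw [Matrix.single_mul_single_same, hg, if_pos rfl]
      by_cases h2 : k = j
      · subst h2
        rw [Matrix.single_mul_single_same, hg, if_pos rfl]
        module
      · rw [Matrix.single_mul_single_of_ne _ _ _ _ h2, map_zero, if_neg h2]
        module
    · rw [Matrix.single_mul_single_of_ne _ _ _ _ h1, map_zero, if_neg h1]
      by_cases h2 : k = j
      · subst h2
        rw [Matrix.single_mul_single_same, hg, if_pos rfl]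
        module
      · rw [Matrix.single_mul_single_of_ne _ _ _ _ h2, map_zero, if_neg h2]
        module

namespace TwistData
variable {n : ℕ} {𝔤 : Type*} [LieRing 𝔤] [LieAlgebra ℂ 𝔤] {D : TwistData n 𝔤}
  [FiniteDimensional ℂ 𝔤] [LieAlgebra.IsSimple ℂ 𝔤] {M : Type*} [AddCommGroup M] [Module ℂ M]

section desc
variable {T : Lat n → End ℂ M} {u v : End ℂ M}

lemma desc_add (hu : ∀ r, u * T r = T r * u) (hv : ∀ r, v * T r = T r * v) :
    desc T (u + v) = desc T u + desc T v := fiber_hom_ext fun y => by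
  rw [LinearMap.add_apply, desc_apply hu, desc_apply hv, desc_apply fun r => by
    rw [add_mul, mul_add, hu, hv], LinearMap.add_apply, map_add]

lemma desc_smul (hu : ∀ r, u * T r = T r * u) (c : ℂ) :
    desc T (c • u) = c • desc T u := fiber_hom_ext fun y => by
  rw [LinearMap.smul_apply, desc_apply hu, desc_apply fun r => by
    rw [smul_mul_assoc, hu, mul_smul_comm], LinearMap.smul_apply, map_smul]

lemma desc_sub (hu : ∀ r, u * T r = T r * u) (hv : ∀ r, v * T r = T r * v) :
    desc T (u - v) = desc T u - desc T v := fiber_hom_ext fun y => by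
  rw [LinearMap.sub_apply, desc_apply hu, desc_apply hv, desc_apply fun r => by
    rw [sub_mul, mul_sub, hu, hv], LinearMap.sub_apply, map_sub]

lemma commL_desc (hu : ∀ r, u * T r = T r * u) (hv : ∀ r, v * T r = T r * v) :
    commL (desc T u) (desc T v) = desc T (commL u v) := fiber_hom_ext fun y => by
  have h3 : ∀ r, commL u v * T r = T r * commL u v := fun r => by
    rw [commL_apply, sub_mul, mul_sub, mul_assoc, mul_assoc, hu, hv, ← mul_assoc, ← mul_assoc, hu,
      hv, mul_assoc, mul_assoc]
  rw [desc_apply h3, commL_apply, commL_apply, LinearMap.sub_apply, LinearMap.sub_apply,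
    Module.End.mul_apply, Module.End.mul_apply, desc_apply hu, desc_apply hv, desc_apply hu,
    desc_apply hv, map_sub]
  rfl

end desc

lemma x0_add (l : Lat n) (X Y : 𝔤) (hX : X ∈ D.gradeSpace (emb l)) (hY : Y ∈ D.gradeSpace (emb l)) :
    D.x0 l (X + Y) (add_mem hX hY) = D.x0 l X hX + D.x0 l Y hY :=
  Subtype.ext (xx_add (emb l) X Y hX hY)

lemma x0_smul (l : Lat n) (c : ℂ) (X : 𝔤) (hX : X ∈ D.gradeSpace (emb l)) :
    D.x0 l (c • X) (Submodule.smul_mem _ c hX) = c • D.x0 l X hX :=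
  Subtype.ext (xx_smul (emb l) c X hX)

variable {π : D.tau0 →ₗ⁅ℂ⁆ End ℂ M} {gr : Lat n → Submodule ℂ M} {α : Fin n → ℂ} {d C₀ : ℂ}

namespace IsTop
variable (h : IsTop π gr α d C₀)
include h

variable (π C₀) in
/-- The operators induced by `del` on the fiber. -/
def rho (j : Fin n) (r : Lat n) : End ℂ (Fiber (trans π C₀)) :=
  desc _ (del π C₀ r (Fin.cons 0 (Pi.single j (D.m j.succ : ℂ)⁻¹)))

variable (π C₀) in
/-- The operators induced by `X t^l` on the fiber. -/
def cur (p : {p : Lat n × 𝔤 // p.2 ∈ D.gradeSpace (emb p.1)}) (s : Lat n) :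
    End ℂ (Fiber (trans π C₀)) :=
  desc _ (π (D.x0 (p.1.1 + D.sc s) p.1.2 (by rw [gradeSpace_emb_add_sc]; exact p.2)))

omit h in
lemma cons_single (j : Fin n) (c : ℂ) :
    (Fin.cons 0 (Pi.single j c) : Fin (n + 1) → ℂ) = c • Pi.single j.succ 1 := by
  ext i
  refine Fin.cases ?_ (fun i => ?_) i
  · simp
  · simp [Pi.single_apply]

omit h [FiniteDimensional ℂ 𝔤] [LieAlgebra.IsSimple ℂ 𝔤] in
lemma m_ne_zero (j : Fin (n + 1)) : (D.m j : ℂ) ≠ 0 := Nat.cast_ne_zero.2 (D.m_pos j).ne'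

omit h [FiniteDimensional ℂ 𝔤] [LieAlgebra.IsSimple ℂ 𝔤] in
lemma pair_cons_sv (j : Fin n) (s : Lat n) :
    pair (Fin.cons 0 (Pi.single j (D.m j.succ : ℂ)⁻¹)) (D.sv s) = s j := by
  rw [cons_single, map_smul, LinearMap.smul_apply, pair_single, sv_apply_succ, sc, smul_eq_mul]
  push_cast
  rw [inv_mul_cancel_left₀ (m_ne_zero _)]

omit h [FiniteDimensional ℂ 𝔤] [LieAlgebra.IsSimple ℂ 𝔤] in
lemma pair_cons_emb (j : Fin n) (l : Lat n) (s : Lat n) :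
    pair (Fin.cons 0 (Pi.single j (D.m j.succ : ℂ)⁻¹)) (emb (l + D.sc s)).vec =
      l j / D.m j.succ + s j := by
  rw [cons_single, map_smul, LinearMap.smul_apply, pair_single, smul_eq_mul]
  have : (emb (l + D.sc s)).vec j.succ = l j + D.m j.succ * s j := by
    simp [Lat.vec, emb, sc]
  rw [this, mul_add, inv_mul_cancel_left₀ (m_ne_zero _), div_eq_inv_mul]

lemma desc_del_cons (r : Lat n) (u : Fin n → ℂ) :
    desc _ (del π C₀ r (Fin.cons 0 u)) = ∑ j, (u j * D.m j.succ) • rho π C₀ j r := by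
  let f : (Fin n → ℂ) →ₗ[ℂ] End ℂ (Fiber (trans π C₀)) :=
    { toFun := fun u => desc _ (del π C₀ r (Fin.cons 0 u))
      map_add' := fun u w => by
        rw [← desc_add (fun s => h.del_trans r s _) (fun s => h.del_trans r s _)]
        congr 1
        have : (Fin.cons 0 (u + w) : Fin (n + 1) → ℂ) = Fin.cons 0 u + Fin.cons 0 w := by
          ext i; refine Fin.cases ?_ (fun i => ?_) i <;> simp
        rw [this, del, e0_add, e0_add, map_add, map_add, mul_add, del, del]
        abel
      map_smul' := fun c u => by
        rw [RingHom.id_apply, ← desc_smul (fun s => h.del_trans r s _)]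
        congr 1
        have : (Fin.cons 0 (c • u) : Fin (n + 1) → ℂ) = c • Fin.cons 0 u := by
          ext i; refine Fin.cases ?_ (fun i => ?_) i <;> simp
        rw [this, del, e0_smul, e0_smul, map_smul, map_smul, mul_smul_comm, ← smul_sub, del] }
  change f u = ∑ j, (u j * D.m j.succ) • f (Pi.single j (D.m j.succ : ℂ)⁻¹)
  have hu : u = ∑ j, (u j * D.m j.succ) • (Pi.single j (D.m j.succ : ℂ)⁻¹ : Fin n → ℂ) := by
    ext i
    rw [Finset.sum_apply, Finset.sum_eq_single i]
    · rw [Pi.smul_apply, Pi.single_eq_same, smul_eq_mul, mul_assoc, mul_inv_cancel₀ (m_ne_zero _),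
        mul_one]
    · intro j _ hj; rw [Pi.smul_apply, Pi.single_eq_of_ne (Ne.symm hj), smul_zero]
    · simp
  conv_lhs => rw [hu]
  simp only [map_sum, map_smul]

lemma jetRep : JetRep (fiberGr (D := D) gr (trans π C₀)) (rho π C₀) (cur π C₀)
    fun p j => (p.1.1 j : ℂ) / D.m j.succ where
  finite := h.isTranslation.finite_fiber
  nontrivial := by
    have := h.nontrivial
    by_contra h0
    rw [not_nontrivial_iff_subsingleton] at h0
    obtain ⟨v, hv⟩ := exists_ne (0 : M)
    refine hv (h.grading.eq_zero_of_proj fun k => ?_)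
    exact h.isTranslation.eq_zero_of_toFiber (h.grading.proj_mem k v) (Subsingleton.elim _ _)
  grading := h.isTranslation.fiber_grading
  comm_ρ i j r s := by
    have ht := fun r a s => h.del_trans (a := a) r s
    have e1 : ∀ {c : ℂ} {u : End ℂ M}, (∀ s, u * trans π C₀ s = trans π C₀ s * u) →
      ∀ s, (c • u) * trans π C₀ s = trans π C₀ s * (c • u) := fun hu s => by
        rw [smul_mul_assoc, hu, mul_smul_comm]
    have e2 : ∀ {u v : End ℂ M}, (∀ s, u * trans π C₀ s = trans π C₀ s * u) →
      (∀ s, v * trans π C₀ s = trans π C₀ s * v) →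
      ∀ s, (u - v) * trans π C₀ s = trans π C₀ s * (u - v) := fun hu hv s => by
        rw [sub_mul, mul_sub, hu, hv]
    simp only [rho]
    rw [commL_desc (ht _ _) (ht _ _), h.commL_del, pair_cons_sv, pair_cons_sv,
      desc_sub (e1 (e2 (ht _ _) (ht _ _))) (e1 (e2 (ht _ _) (ht _ _))),
      desc_smul (e2 (ht _ _) (ht _ _)), desc_smul (e2 (ht _ _) (ht _ _)),
      desc_sub (ht _ _) (ht _ _), desc_sub (ht _ _) (ht _ _)]
  comm_Y j p r s := by
    have hX : p.1.2 ∈ D.gradeSpace (emb (p.1.1 + D.sc s)) := by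
      rw [gradeSpace_emb_add_sc]; exact p.2
    have hX' : p.1.2 ∈ D.gradeSpace (emb (p.1.1 + D.sc s + D.sc r)) := by
      rw [gradeSpace_emb_add_sc]; exact hX
    have hX'' : p.1.2 ∈ D.gradeSpace (emb (p.1.1 + D.sc (r + s))) := by
      rw [gradeSpace_emb_add_sc]; exact p.2
    have t0 := x0_trans' (π := π) (C₀ := C₀) (p.1.1 + D.sc s) p.1.2 hX
    refine fiber_hom_ext fun y => ?_
    simp only [rho, cur]
    rw [commL_desc (fun s => h.del_trans _ s _) t0, commL_del_x0 r _ _ _ hX hX', pair_cons_emb,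
      desc_apply, LinearMap.smul_apply, LinearMap.smul_apply, LinearMap.sub_apply,
      LinearMap.sub_apply, desc_apply (x0_trans' _ _ _), desc_apply t0, map_smul, map_sub,
      Module.End.mul_apply, toFiber_trans, x0_congr hX' hX'' (by rw [sc_add]; abel)]
    intro k
    rw [smul_mul_assoc, mul_smul_comm, sub_mul, mul_sub, t0, mul_assoc, x0_trans', ← mul_assoc,
      h.trans_mul_comm _ k, mul_assoc]
  comm_Y_Y p p' := by
    refine ⟨⟨(p.1.1 + p'.1.1, ⁅p.1.2, p'.1.2⁆), gradeSpace_emb_lie p.2 p'.2⟩, fun r s => ?_⟩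
    simp only [cur]
    rw [commL_desc (x0_trans' _ _ _) (x0_trans' _ _ _), h.x0_mul_x0]
    congr 2
    exact x0_congr _ _ (by rw [sc_add]; abel)
  zero j := by
    have : del π C₀ 0 (Fin.cons 0 (Pi.single j (D.m j.succ : ℂ)⁻¹)) = (0 : ℂ) • 1 := by
      rw [del, neg_zero, h.trans_zero, one_mul, sub_self, zero_smul]
    rw [rho, this, desc_smul (fun r => by rw [one_mul, mul_one]), zero_smul]
  irreducible N hN hρ hY := by
    refine h.fiber_irreducible N hN (fun r u v hv => ?_) fun l X hX v hv => ?_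
    · rw [Submodule.mem_comap, h.desc_del_cons, LinearMap.sum_apply]
      exact sum_mem fun j _ => N.smul_mem _ (hρ j r hv)
    · have := hY ⟨(l, X), hX⟩ 0 hv
      have e : cur π C₀ ⟨(l, X), hX⟩ 0 = desc _ (π (D.x0 l X hX)) := by
        simp only [cur]
        congr 2
        exact x0_congr _ _ (by rw [sc_zero, add_zero])
      rwa [e] at this
  deg_ρ j r lam v hv := by
    have := h.isTranslation.desc_mem (l := 0) (fun s => h.del_trans r s
      (Fin.cons 0 (Pi.single j (D.m j.succ : ℂ)⁻¹))) (fun k v hv => by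
        rw [add_zero, del, LinearMap.sub_apply, Module.End.mul_apply]
        refine sub_mem ?_ ?_
        · have := h.trans_mem (h.e0_mem hv r (Fin.cons 0 (Pi.single j (D.m j.succ : ℂ)⁻¹))) (-r)
          rwa [sc_neg, add_neg_cancel_right] at this
        · have := h.e0_mem hv 0 (Fin.cons 0 (Pi.single j (D.m j.succ : ℂ)⁻¹))
          rwa [sc_zero, add_zero] at this) lam hv
    rwa [show D.bar 0 = 0 from rfl, zero_add] at this
  deg_Y p := ⟨fun lam => D.bar p.1.1 + lam, add_right_injective _, fun s lam v hv => by
    have := h.isTranslation.desc_mem (x0_trans' (π := π) (C₀ := C₀) (p.1.1 + D.sc s) p.1.2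
      (by rw [gradeSpace_emb_add_sc]; exact p.2)) (fun k v hv => h.x0_mem hv _ _ _) lam hv
    rwa [bar_add_sc] at this⟩

end IsTop
end TwistData
end Toroidal

namespace Toroidal
open Module (End)
namespace TwistData
variable {n : ℕ} {𝔤 : Type*} [LieRing 𝔤] [LieAlgebra ℂ 𝔤] {D : TwistData n 𝔤}
  [FiniteDimensional ℂ 𝔤] [LieAlgebra.IsSimple ℂ 𝔤] {M : Type*} [AddCommGroup M] [Module ℂ M]
variable {π : D.tau0 →ₗ⁅ℂ⁆ End ℂ M} {gr : Lat n → Submodule ℂ M} {α : Fin n → ℂ} {d C₀ : ℂ}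

omit [FiniteDimensional ℂ 𝔤] [LieAlgebra.IsSimple ℂ 𝔤] in
lemma mem_gFixGr {lam : D.Lam} {x : D.gFix} :
    x ∈ D.gFixGr lam ↔ (x : 𝔤) ∈ D.gradeSpace (emb lam.out) := Iff.rfl

namespace IsTop

lemma desc_x0_add (l : Lat n) (X Y : 𝔤) (hX : X ∈ D.gradeSpace (emb l))
    (hY : Y ∈ D.gradeSpace (emb l)) :
    desc (trans π C₀) (π (D.x0 l (X + Y) (add_mem hX hY))) =
      desc (trans π C₀) (π (D.x0 l X hX)) + desc (trans π C₀) (π (D.x0 l Y hY)) := by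
  rw [x0_add l X Y hX hY, map_add, desc_add (x0_trans' _ _ _) (x0_trans' _ _ _)]

lemma desc_x0_smul (l : Lat n) (c : ℂ) (X : 𝔤) (hX : X ∈ D.gradeSpace (emb l)) :
    desc (trans π C₀) (π (D.x0 l (c • X) (Submodule.smul_mem _ c hX))) =
      c • desc (trans π C₀) (π (D.x0 l X hX)) := by
  rw [x0_smul l c X hX, map_smul, desc_smul (x0_trans' _ _ _)]

variable (h : IsTop π gr α d C₀)
include h

lemma rho_eq (j : Fin n) (r : Lat n) :
    rho π C₀ j r = ∑ i, (r i : ℂ) • rho π C₀ j (Pi.single i 1) := by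
  let f : Lat n →+ End ℂ (Fiber (trans π C₀)) :=
    { toFun := rho π C₀ j
      map_zero' := h.jetRep.zero j
      map_add' := h.jetRep.field_add j }
  have hr : r = ∑ i, r i • (Pi.single i 1 : Lat n) := by
    ext i; simp [Finset.sum_apply, Pi.single_apply]
  change f r = ∑ i, (r i : ℂ) • f (Pi.single i 1)
  conv_lhs => rw [hr]
  rw [map_sum]
  exact Finset.sum_congr rfl fun i _ =>
    (map_zsmul f _ _).trans (Int.cast_smul_eq_zsmul ℂ _ _).symm

lemma commL_rho (i j : Fin n) (r s : Lat n) : commL (rho π C₀ i r) (rho π C₀ j s) =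
    (s i : ℂ) • rho π C₀ j r - (r j : ℂ) • rho π C₀ i s := by
  rw [h.jetRep.comm_ρ, h.jetRep.field_add, h.jetRep.field_add, add_sub_cancel_right,
    add_sub_cancel_left]

theorem exists_gFix_rep : ∃ x : D.gFix →ₗ⁅ℂ⁆ End ℂ (Fiber (trans π C₀)),
    ∀ l X hX, x ⟨X, mem_gFix_of_mem_gradeSpace hX⟩ = desc _ (π (D.x0 l X hX)) := by
  have hG := gFixGr_grading (D := D)
  obtain ⟨x, hx⟩ := hG.exists_linearMap (N := End ℂ (Fiber (trans π C₀))) fun lam =>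
    { toFun := fun X => desc _ (π (D.x0 lam.out X.1 X.2))
      map_add' := fun X Y => desc_x0_add (C₀ := C₀) lam.out X.1.1 Y.1.1 X.2 Y.2
      map_smul' := fun c X => desc_x0_smul (C₀ := C₀) lam.out c X.1.1 X.2 }
  have hx' : ∀ l X hX, x ⟨X, mem_gFix_of_mem_gradeSpace hX⟩ = desc _ (π (D.x0 l X hX)) := by
    intro l X hX
    rw [hx (D.bar l) _ (mem_gFixGr_bar.2 hX)]
    obtain ⟨r, hr⟩ := bar_eq_iff.1 (bar_out (D.bar l)).symm
    have h1 := h.jetRep.current_eq ⟨(l, X), hX⟩ r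
    simp only [cur] at h1
    have e1 : D.x0 (D.bar l).out X (by rw [← hr, gradeSpace_emb_add_sc]; exact hX) =
      D.x0 (l + D.sc r) X (by rw [gradeSpace_emb_add_sc]; exact hX) := x0_congr _ _ hr.symm
    have e2 : D.x0 (l + D.sc 0) X (by rw [gradeSpace_emb_add_sc]; exact hX) = D.x0 l X hX :=
      x0_congr _ _ (by rw [sc_zero, add_zero])
    rw [e2] at h1
    change desc _ (π (D.x0 (D.bar l).out X _)) = _
    rw [e1, h1]
  refine ⟨{ x with map_lie' := fun {X Y} => ?_ }, hx'⟩
  change x ⁅X, Y⁆ = ⁅x X, x Y⁆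
  rw [Ring.lie_def, ← commL_apply]
  induction X using hG.induction with
  | h0 => simp
  | hadd X X' hX hX' => rw [add_lie, map_add, map_add, map_add, hX, hX', LinearMap.add_apply]
  | hm k X hX =>
  induction Y using hG.induction with
  | h0 => simp
  | hadd X X' hX hX' => rw [lie_add, map_add, map_add, map_add, hX, hX']
  | hm l Y hY =>
    rw [mem_gFixGr] at hX hY
    have h1 := hx' k.out X.1 hX
    have h2 := hx' l.out Y.1 hY
    have h3 := hx' (k.out + l.out) ⁅X.1, Y.1⁆ (gradeSpace_emb_lie hX hY)
    change x X = _ at h1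
    change x Y = _ at h2
    change x ⁅X, Y⁆ = _ at h3
    rw [h1, h2, h3, commL_desc (x0_trans' _ _ _) (x0_trans' _ _ _), h.x0_mul_x0]

theorem exists_fiberRep : ∃ (g : Matrix (Fin n) (Fin n) ℂ →ₗ⁅ℂ⁆ End ℂ (Fiber (trans π C₀)))
    (x : D.gFix →ₗ⁅ℂ⁆ End ℂ (Fiber (trans π C₀))),
    FiberRep (fiberGr gr (trans π C₀)) g x ∧
      IsEval π gr α d C₀ (fiberGr gr (trans π C₀)) g x (toFiber (trans π C₀)) := by
  have t := h.isTranslation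
  obtain ⟨x, hx⟩ := h.exists_gFix_rep
  obtain ⟨g, hg, hg'⟩ := exists_gl_rep
    (fun j i => ((D.m i.succ : ℂ) / D.m j.succ) • rho π C₀ i (Pi.single j 1)) (by
      intro j i l k
      rw [map_smul, map_smul, LinearMap.smul_apply, h.commL_rho]
      by_cases h1 : i = l <;> by_cases h2 : k = j
      · subst h1 h2
        simp only [Pi.single_eq_same, if_true, smul_sub, smul_smul, Int.cast_one, mul_one]
        congr 2
        · field_simp [m_ne_zero (D := D) i.succ, m_ne_zero (D := D) k.succ]
        · field_simp [m_ne_zero (D := D) i.succ, m_ne_zero (D := D) k.succ]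
      · subst h1
        simp only [Pi.single_eq_same, if_true, Pi.single_eq_of_ne h2, if_neg h2, smul_smul,
          Int.cast_zero, zero_smul, sub_zero, Int.cast_one, mul_one]
        congr 1
        field_simp [m_ne_zero (D := D) i.succ]
      · subst h2
        simp only [Pi.single_eq_same, if_true, Pi.single_eq_of_ne h1, if_neg h1, smul_neg, smul_smul,
          Int.cast_zero, zero_smul, zero_sub, Int.cast_one, mul_one]
        congr 2
        field_simp [m_ne_zero (D := D) k.succ]
      · simp only [Pi.single_eq_of_ne h1, Pi.single_eq_of_ne h2, if_neg h1, if_neg h2,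
          Int.cast_zero, zero_smul, sub_zero, smul_zero])
  have hρx : ∀ j r X, commL (rho π C₀ j r) (x X) = 0 := by
    intro j r X
    induction X using (gFixGr_grading (D := D)).induction with
    | h0 => simp
    | hadd X X' hX hX' => rw [map_add, map_add, hX, hX', add_zero]
    | hm k X hX =>
      rw [mem_gFixGr] at hX
      have h1 := hx k.out X.1 hX
      change x X = _ at h1
      have h2 := h.jetRep.comm_Y j ⟨(k.out, X.1), hX⟩ r 0
      rw [h.jetRep.current_eq _ (r + 0), sub_self, smul_zero] at h2
      have e : cur π C₀ ⟨(k.out, X.1), hX⟩ 0 = desc _ (π (D.x0 k.out X.1 hX)) := by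
        simp only [cur]
        congr 2
        exact x0_congr _ _ (by rw [sc_zero, add_zero])
      rw [h1, ← e, h2]
  have hρg : ∀ j r, rho π C₀ j r =
      ∑ i, ((D.m i.succ : ℂ) * r i / D.m j.succ) • g (Matrix.single i j 1) := by
    intro j r
    rw [h.rho_eq]
    refine Finset.sum_congr rfl fun i _ => ?_
    rw [hg, smul_smul]
    congr 1
    field_simp [m_ne_zero (D := D) i.succ, m_ne_zero (D := D) j.succ]
  refine ⟨g, x, ?_, ?_⟩
  · refine ⟨h.jetRep.finite, h.jetRep.nontrivial, t.fiber_grading, fun A X => ?_,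
      fun A lam v hv => ?_, fun l X hX lam v hv => ?_, fun N hN hA hX => ?_⟩
    · rw [← sub_eq_zero, ← commL_apply, hg']
      simp only [map_sum, LinearMap.sum_apply, map_smul, LinearMap.smul_apply, hρx, smul_zero,
        Finset.sum_const_zero]
    · rw [hg']
      simp only [LinearMap.sum_apply, LinearMap.smul_apply]
      exact sum_mem fun j _ => sum_mem fun i _ => Submodule.smul_mem _ _ (Submodule.smul_mem _ _
        (h.jetRep.deg_ρ _ _ _ _ hv))
    · have h1 := hx l X.1 hX
      change x X = _ at h1
      rw [h1]
      exact t.desc_mem (x0_trans' _ _ _) (fun k v hv => h.x0_mem hv _ _ _) lam hv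
    · refine h.jetRep.irreducible N hN (fun j r v hv => ?_) fun p s v hv => ?_
      · rw [Submodule.mem_comap, hρg, LinearMap.sum_apply]
        exact sum_mem fun i _ => N.smul_mem _ (hA _ hv)
      · rw [Submodule.mem_comap]
        simp only [cur]
        rw [← hx]
        exact hX _ hv
  · refine ⟨fun k v hv => t.toFiber_mem hv, fun k v hv h0 => t.eq_zero_of_toFiber hv h0,
      fun k y hy => t.exists_toFiber_eq hy, fun r w v => ?_, fun r v => ?_, fun r u k v hv => ?_,
      fun l X hX v => ?_⟩
    · rw [h.c0_eq, LinearMap.smul_apply, map_smul, toFiber_trans]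
    · rw [h.e0_zero_eq, LinearMap.smul_apply, map_smul, toFiber_trans]
    · rw [h.e0_eq_del, Module.End.mul_apply, toFiber_trans, LinearMap.add_apply, map_add,
        h.e0_zero_apply hv, map_smul, ← desc_apply (fun s => h.del_trans r s _), h.desc_del_cons,
        LinearMap.sum_apply, add_comm]
      congr 1
      refine Finset.sum_congr rfl fun i _ => ?_
      rw [hρg, LinearMap.smul_apply, LinearMap.sum_apply, Finset.smul_sum]
      refine Finset.sum_congr rfl fun j _ => ?_
      rw [LinearMap.smul_apply, smul_smul]
      congr 1
      simp only [sc]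
      push_cast
      field_simp [m_ne_zero (D := D) i.succ]
    · rw [hx, desc_apply (x0_trans' _ _ _)]

end IsTop
end TwistData
end Toroidal

namespace Toroidal
open Module (End)

lemma eq_zero_of_lie_eq_zero {L : Type*} [LieRing L] [LieAlgebra ℂ L] [FiniteDimensional ℂ L]
    [LieAlgebra.IsSimple ℂ L] {x : L} (h : ∀ y : L, ⁅x, y⁆ = 0) : x = 0 := by
  have h1 : x ∈ LieAlgebra.center ℂ L := fun y => by
    rw [← lie_skew, h y, neg_zero]
  rw [LieAlgebra.center_eq_bot] at h1
  simpa using h1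

/-- The semisimple part of an inner derivation is a derivation. -/
lemma exists_ad_eq_nilpotent {L : Type*} [LieRing L] [LieAlgebra ℂ L] [FiniteDimensional ℂ L]
    [LieAlgebra.IsSimple ℂ L] (x : L) : ∃ z : L, IsNilpotent (LieAlgebra.ad ℂ L z) ∧
      LieAlgebra.ad ℂ L z ∈ Algebra.adjoin ℂ {LieAlgebra.ad ℂ L x} ∧
      (LieAlgebra.ad ℂ L x - LieAlgebra.ad ℂ L z).IsSemisimple := by
  obtain ⟨N, hN₀, S, hS₀, hN, hS, hSN⟩ := (LieAlgebra.ad ℂ L x).exists_isNilpotent_isSemisimple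
  have hS₁ : Commute (LieAlgebra.ad ℂ L x) S := Algebra.commute_of_mem_adjoin_self hS₀
  have hN' : IsNilpotent (LieAlgebra.ad ℂ L x - S) := by rwa [hSN, add_sub_cancel_right]
  have aux {μ : ℂ} {y : L} (hy : y ∈ (LieAlgebra.ad ℂ L x).maxGenEigenspace μ) : S y = μ • y := by
    rw [Module.End.maxGenEigenspace_eq] at hy
    rw [Module.End.apply_eq_of_mem_of_comm_of_isFinitelySemisimple_of_isNil hy hS₁
      hS.isFinitelySemisimple hN']
  have h_der (y z : L) : S ⁅y, z⁆ = ⁅S y, z⁆ + ⁅y, S z⁆ := by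
    have htop : ∀ y, y ∈ ⨆ μ, (LieAlgebra.ad ℂ L x).maxGenEigenspace μ := fun y => by
      rw [Module.End.iSup_maxGenEigenspace_eq_top]; exact Submodule.mem_top
    refine Submodule.iSup_induction _
      (motive := fun y => S ⁅y, z⁆ = ⁅S y, z⁆ + ⁅y, S z⁆) (htop y) (fun α y hy => ?_) (by simp) ?_
    · refine Submodule.iSup_induction _
        (motive := fun z => S ⁅y, z⁆ = ⁅S y, z⁆ + ⁅y, S z⁆) (htop z) (fun β z hz => ?_) (by simp) ?_
      · have hyz : ⁅y, z⁆ ∈ (LieAlgebra.ad ℂ L x).maxGenEigenspace (α + β) :=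
          LieModule.lie_mem_maxGenEigenspace_toEnd hy hz
        rw [aux hy, aux hz, aux hyz, smul_lie, lie_smul, ← add_smul]
      · intro a b ha hb
        simp only [lie_add, map_add, ha, hb]; abel
    · intro a b ha hb
      simp only [add_lie, map_add, ha, hb]; abel
  have h_der' : ∀ y z : L, S ⁅y, z⁆ = ⁅y, S z⁆ - ⁅z, S y⁆ := fun y z => by
    rw [h_der, ← lie_skew (S y), add_comm, ← sub_eq_add_neg]
  obtain ⟨y, hy⟩ := LieDerivation.IsKilling.exists_eq_ad (⟨S, h_der'⟩ : LieDerivation ℂ L L)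
  have hyS : LieAlgebra.ad ℂ L y = S := by
    rw [← LieDerivation.coe_ad_apply_eq_ad_apply y, hy]
  have hz : LieAlgebra.ad ℂ L (x - y) = N := by
    rw [map_sub, hyS, hSN, add_sub_cancel_right]
  refine ⟨x - y, ?_, ?_, ?_⟩
  · rwa [hz]
  · rwa [hz]
  · rwa [hz, hSN, add_sub_cancel_left]

namespace TwistData
variable {n : ℕ} {𝔤 : Type*} [LieRing 𝔤] [LieAlgebra ℂ 𝔤] {D : TwistData n 𝔤}
  [FiniteDimensional ℂ 𝔤] [LieAlgebra.IsSimple ℂ 𝔤]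

lemma isSemisimple_ad (hD : LieAlgebra.IsSimple ℂ D.g00) {H : LieSubalgebra ℂ D.g00}
    (hH : H.IsCartanSubalgebra) (h : H) :
    (LieAlgebra.ad ℂ 𝔤 ((h : D.g00) : 𝔤)).IsSemisimple := by
  set x : 𝔤 := ((h : D.g00) : 𝔤) with hx
  obtain ⟨z, hz1, hz2, hz3⟩ := exists_ad_eq_nilpotent x
  have hcomm : ∀ u : End ℂ 𝔤, (∀ y, u ⁅x, y⁆ = ⁅x, u y⁆) → ∀ y, u ⁅z, y⁆ = ⁅z, u y⁆ := by
    intro u hu y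
    refine (LinearMap.congr_fun (commute_of_mem_adjoin (y := u) (fun s hs => ?_) hz2) y).symm
    rw [Set.mem_singleton_iff] at hs
    subst hs
    exact LinearMap.ext fun y => (hu y).symm
  have hfix : ∀ i, D.σ i x = x := fun i => by
    have := (h : D.g00).2 i
    simpa using this
  have hσ : ∀ i, D.σ i z = z := by
    intro i
    rw [← sub_eq_zero]
    refine eq_zero_of_lie_eq_zero fun y => ?_
    have h1 := hcomm (D.σ i).toLinearEquiv.toLinearMap (fun y => by
      change D.σ i ⁅x, y⁆ = ⁅x, D.σ i y⁆
      rw [LieEquiv.map_lie, hfix]) ((D.σ i).symm y)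
    change D.σ i ⁅z, (D.σ i).symm y⁆ = ⁅z, D.σ i ((D.σ i).symm y)⁆ at h1
    rw [LieEquiv.map_lie, LieEquiv.apply_symm_apply] at h1
    rw [sub_lie, h1, sub_self]
  have hzg : z ∈ D.g00 := fun i => by simp [hσ i]
  have hHz : ∀ h' : H, ⁅((h' : D.g00) : 𝔤), z⁆ = 0 := by
    intro h'
    have hab : ⁅x, ((h' : D.g00) : 𝔤)⁆ = 0 := by
      have := trivial_lie_zero H H h h'
      exact congrArg (fun y : H => ((y : D.g00) : 𝔤)) this
    refine eq_zero_of_lie_eq_zero fun y => ?_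
    have h1 := hcomm (LieAlgebra.ad ℂ 𝔤 ((h' : D.g00) : 𝔤)) (fun y => by
      simp only [LieAlgebra.ad_apply]
      rw [leibniz_lie x, hab, zero_lie, zero_add]) y
    simp only [LieAlgebra.ad_apply] at h1
    rw [lie_lie, h1, sub_self]
  have hzH : (⟨z, hzg⟩ : D.g00) ∈ H := by
    rw [← LieSubalgebra.IsCartanSubalgebra.self_normalizing (H := H), LieSubalgebra.mem_normalizer_iff]
    intro y hy
    have : ⁅(⟨z, hzg⟩ : D.g00), y⁆ = 0 := Subtype.ext (by
      have := hHz ⟨y, hy⟩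
      change ⁅z, (y : 𝔤)⁆ = 0
      rw [← lie_skew, this, neg_zero])
    rw [this]; exact zero_mem _
  have hz0 : (⟨z, hzg⟩ : D.g00) = 0 := by
    refine LieAlgebra.IsKilling.eq_zero_of_isNilpotent_ad_of_mem_isCartanSubalgebra ℂ D.g00 H hzH ?_
    obtain ⟨k, hk⟩ := hz1
    have h1 : ∀ (k : ℕ) (y : D.g00), (((LieAlgebra.ad ℂ D.g00 ⟨z, hzg⟩ ^ k) y : D.g00) : 𝔤) =
        (LieAlgebra.ad ℂ 𝔤 z ^ k) y := by
      intro k y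
      induction k with
      | zero => rfl
      | succ k ih => rw [pow_succ', pow_succ', Module.End.mul_apply, Module.End.mul_apply, ← ih]; rfl
    exact ⟨k, LinearMap.ext fun y => Subtype.ext (by rw [h1, hk]; rfl)⟩
  have hz0' : z = 0 := congrArg Subtype.val hz0
  rwa [hz0', map_zero, sub_zero] at hz3

end TwistData
end Toroidal

namespace Toroidal
open Module (End)

section Roots
variable {ι M N : Type*} [AddCommGroup M] [Module ℂ M] [AddCommGroup N] [Module ℂ N] [Finite ι]
  (R : RootPairing ι ℂ M N) [R.IsCrystallographic] {Q : Set ι}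

/-- Reflections that raise a positive root preserve positivity. -/
lemma reflectionPerm_mem (hadd : ∀ i j k, i ∈ Q → j ∈ Q → R.root k = R.root i + R.root j → k ∈ Q)
    (hneg : ∀ i j, i ∈ Q → R.root j = - R.root i → j ∉ Q) {a : ι} (ha : a ∈ Q) (k : ℕ) :
    ∀ b ∈ Q, R.pairingIn ℤ b a = -(k + 1 : ℕ) → R.reflectionPerm a b ∈ Q := by
  have hrefl : ∀ b, R.root (R.reflectionPerm a b) =
      R.root b - (R.pairingIn ℤ b a : ℂ) • R.root a := fun b => by
    rw [R.root_reflectionPerm, R.reflection_apply_root, ← R.algebraMap_pairingIn ℤ]; rfl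
  induction k using Nat.strong_induction_on with
  | _ k ih =>
    intro b hb hk
    have hne : R.root b ≠ - R.root a := fun h0 => hneg a b ha h0 hb
    obtain ⟨b', hb'⟩ := R.root_add_root_mem_of_pairingIn_neg (by rw [hk]; push_cast; omega) hne
    have hbQ : b' ∈ Q := hadd b a b' hb ha hb'
    have hp : R.pairingIn ℤ b' a = -(k + 1 : ℕ) + 2 := by
      have : ((R.pairingIn ℤ b' a : ℤ) : ℂ) = ((-(k + 1 : ℕ) + 2 : ℤ) : ℂ) := by
        have e1 : ∀ i j, ((R.pairingIn ℤ i j : ℤ) : ℂ) = R.pairing i j :=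
          fun i j => R.algebraMap_pairingIn ℤ i j
        rw [e1, ← R.root_coroot_eq_pairing, hb', map_add, LinearMap.add_apply,
          R.root_coroot_eq_pairing, R.root_coroot_eq_pairing, ← e1, ← e1, hk, R.pairingIn_same]
        push_cast; ring
      exact_mod_cast this
    match k, ih, hk, hp with
    | 0, _, hk, _ =>
      refine hadd b a _ hb ha ?_
      rw [hrefl, hk]; push_cast; module
    | 1, _, hk, _ =>
      refine hadd b' a _ hbQ ha ?_
      rw [hrefl, hk, hb']; push_cast; module
    | k + 2, ih, hk, hp =>
      have h1 := ih k (by omega) b' hbQ (by rw [hp]; push_cast; ring)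
      refine hadd _ a _ h1 ha ?_
      rw [hrefl, hrefl, hk, hp, hb']; push_cast; module

/-- The sum of the positive coroots is positive on positive roots. -/
lemma exists_positive_functional
    (hadd : ∀ i j k, i ∈ Q → j ∈ Q → R.root k = R.root i + R.root j → k ∈ Q)
    (hneg : ∀ i j, i ∈ Q → R.root j = - R.root i → j ∉ Q) :
    ∃ h : N, ∀ a ∈ Q, ∃ z : ℤ, 0 < z ∧ R.toLinearMap (R.root a) h = z := by
  classical
  have := Fintype.ofFinite ι
  let F : Finset ι := Finset.univ.filter (· ∈ Q)
  have hF : ∀ i, i ∈ F ↔ i ∈ Q := fun i => by simp [F]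
  refine ⟨∑ b ∈ F, R.coroot b, fun a ha => ⟨∑ b ∈ F, R.pairingIn ℤ a b, ?_, ?_⟩⟩
  · set c : ι → ℤ := fun b => R.pairingIn ℤ a b with hc
    set s := R.reflectionPerm a with hs
    have hcs : ∀ b, c (s b) = - c b := fun b => by
      simp only [hc, hs]
      rw [R.pairingIn_reflectionPerm, R.pairingIn_reflectionPerm_self_left]
    have hca : c a = 2 := R.pairingIn_same ℤ a
    have hsQ : ∀ b ∈ Q, c b < 0 → s b ∈ Q := by
      intro b hb hcb
      have h1 : R.pairingIn ℤ b a < 0 := (R.pairingIn_lt_zero_iff ℤ).1 hcb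
      refine reflectionPerm_mem R hadd hneg ha (-R.pairingIn ℤ b a - 1).toNat b hb ?_
      push_cast
      rw [Int.toNat_of_nonneg (by omega)]
      ring
    have h1 : ∑ b ∈ F, c b = ∑ b ∈ F.filter (c · < 0), c b + ∑ b ∈ F.filter (¬ c · < 0), c b :=
      (Finset.sum_filter_add_sum_filter_not _ _ _).symm
    have h2 : ∑ b ∈ insert a ((F.filter (c · < 0)).image s), c b ≤
        ∑ b ∈ F.filter (¬ c · < 0), c b := by
      refine Finset.sum_le_sum_of_subset_of_nonneg ?_ fun i hi _ => ?_
      · intro i hi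
        rw [Finset.mem_insert, Finset.mem_image] at hi
        rw [Finset.mem_filter, hF]
        rcases hi with rfl | ⟨b, hb, rfl⟩
        · exact ⟨ha, by rw [hca]; omega⟩
        · rw [Finset.mem_filter, hF] at hb
          exact ⟨hsQ b hb.1 hb.2, by rw [hcs]; omega⟩
      · rw [Finset.mem_filter] at hi; omega
    have h3 : a ∉ (F.filter (c · < 0)).image s := by
      rw [Finset.mem_image]
      rintro ⟨b, hb, hba⟩
      rw [Finset.mem_filter, hF] at hb
      refine hneg a b ha ?_ hb.1
      rw [← R.reflectionPerm_self a b, ← hs, hba, hs, R.root_reflectionPerm, R.reflection_apply_self]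
    rw [Finset.sum_insert h3, hca, Finset.sum_image fun _ _ _ _ h => s.injective h] at h2
    simp only [hcs, Finset.sum_neg_distrib] at h2
    rw [h1]
    omega
  · rw [map_sum]
    push_cast
    refine Finset.sum_congr rfl fun b _ => ?_
    rw [R.root_coroot_eq_pairing, ← R.algebraMap_pairingIn ℤ]
    rfl

end Roots

namespace TwistData
variable {n : ℕ} {𝔤 : Type*} [LieRing 𝔤] [LieAlgebra ℂ 𝔤] {D : TwistData n 𝔤}

lemma mem_wtSpace {H : LieSubalgebra ℂ D.g00} {α : Module.Dual ℂ H} {x : 𝔤} :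
    x ∈ wtSpace H α ↔ ∀ h : H, ⁅((h : D.g00) : 𝔤), x⁆ = α h • x := Iff.rfl

lemma σ_apply_of_mem_g00 (x : D.g00) (i : Fin (n + 1)) : D.σ i x = x := by
  have := x.2 i
  simpa using this

lemma mem_gFix_of_g00 (x : D.g00) : (x : 𝔤) ∈ D.gFix := σ_apply_of_mem_g00 x 0

variable [FiniteDimensional ℂ 𝔤] [LieAlgebra.IsSimple ℂ 𝔤]

omit [LieAlgebra.IsSimple ℂ 𝔤] in
lemma roots₀_eq_range (hD : LieAlgebra.IsSimple ℂ D.g00) (H : LieSubalgebra ℂ D.g00)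
    [H.IsCartanSubalgebra] :
    roots₀ H = Set.range (LieAlgebra.IsKilling.rootSystem H).root := by
  ext α
  constructor
  · rintro ⟨h0, hα⟩
    obtain ⟨x, ⟨hx1, hx2⟩, hx0⟩ := (Submodule.ne_bot_iff _).1 hα
    have hx : (⟨x, hx1⟩ : D.g00) ∈ LieAlgebra.rootSpace H α := by
      refine LieModule.weightSpace_le_genWeightSpace D.g00 α ?_
      rw [LieModule.mem_weightSpace]
      exact fun h => Subtype.ext (hx2 h)
    have hne : LieModule.genWeightSpace D.g00 (α : H → ℂ) ≠ ⊥ := by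
      rw [Ne, LieSubmodule.eq_bot_iff]
      exact fun h => hx0 (congrArg Subtype.val (h _ hx))
    let w : LieModule.Weight ℂ H D.g00 := ⟨α, hne⟩
    have hw : w.IsNonZero := fun hz => h0 (LinearMap.ext fun h => congrFun hz h)
    refine ⟨⟨w, by simpa using hw⟩, ?_⟩
    rw [LieAlgebra.IsKilling.rootSystem_root_apply]
    exact LinearMap.ext fun h => rfl
  · rintro ⟨w, rfl⟩
    refine ⟨(LieAlgebra.IsKilling.rootSystem H).ne_zero w, ?_⟩
    obtain ⟨x, hx, hx0⟩ := w.1.exists_ne_zero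
    refine (Submodule.ne_bot_iff _).2 ⟨x, ⟨x.2, fun h => ?_⟩, fun h => hx0 (Subtype.ext h)⟩
    exact congrArg Subtype.val (LieAlgebra.IsKilling.lie_eq_smul_of_mem_rootSpace hx h)

omit [LieAlgebra.IsSimple ℂ 𝔤] in
theorem exists_grading_element (hD : LieAlgebra.IsSimple ℂ D.g00) {H : LieSubalgebra ℂ D.g00}
    (hH : H.IsCartanSubalgebra) {P : Set (Module.Dual ℂ H)}
    (hP : IsPositiveSystem (rootsEn H) P) :
    ∃ h : H, ∀ α ∈ P, ∃ z : ℤ, 0 < z ∧ α h = z := by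
  have hR := roots₀_eq_range hD H
  set R := LieAlgebra.IsKilling.rootSystem H with hRdef
  have hsub : ∀ i, R.root i ∈ rootsEn H := fun i => Or.inl (hR ▸ ⟨i, rfl⟩)
  obtain ⟨h, hh⟩ := exists_positive_functional R (Q := {i | R.root i ∈ P})
    (fun i j k hi hj hk => by
      rw [Set.mem_ofPred_eq, hk]
      exact hP.add_mem _ hi _ hj (hk ▸ hsub k))
    (fun i j hi hj hj' => by
      rw [Set.mem_ofPred_eq, hj] at hj'
      exact hP.not_both _ hi hj')
  have key : ∀ α ∈ P, α ∈ roots₀ H → ∃ z : ℤ, 0 < z ∧ α h = z := by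
    intro α hα hα'
    rw [hR] at hα'
    obtain ⟨i, rfl⟩ := hα'
    exact hh i hα
  have dbl : ∀ β : Module.Dual ℂ H, β ∈ roots₀ H → -((2 : ℂ) • β) ∈ rootsEn H → (2 : ℂ) • β ∈ P →
      ∃ z : ℤ, 0 < z ∧ ((2 : ℂ) • β) h = z := by
    intro β hβ hβ' h2
    have hβP : β ∈ P := by
      refine (hP.pos_or_neg β (Or.inl hβ)).resolve_right fun hn => ?_
      have e : -((2 : ℂ) • β) = -β + -β := by module
      exact hP.not_both _ h2 (e ▸ hP.add_mem _ hn _ hn (e ▸ hβ'))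
    obtain ⟨z, hz, hz'⟩ := key β hβP hβ
    exact ⟨2 * z, by omega, by rw [LinearMap.smul_apply, hz']; push_cast; rfl⟩
  refine ⟨h, fun α hα => ?_⟩
  rcases hP.subset hα with h0 | ⟨l, ε, hB, i, hi | hi⟩
  · exact key α hα h0
  · subst hi
    exact dbl (ε i) ((hB _).2 (Or.inl ⟨i, Or.inl rfl⟩)) (Or.inr ⟨l, ε, hB, i, Or.inr rfl⟩) hα
  · subst hi
    rw [← smul_neg] at hα ⊢
    exact dbl (-ε i) ((hB _).2 (Or.inl ⟨i, Or.inr rfl⟩))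
      (Or.inr ⟨l, ε, hB, i, Or.inl (by module)⟩) hα

end TwistData
end Toroidal

namespace Toroidal
open Module (End)

section Triangular
variable {L M : Type*} [LieRing L] [LieAlgebra ℂ L] [AddCommGroup M] [Module ℂ M]

/-- A triangular decomposition of `L` given by the eigenvalues of an element `h₀`. -/
structure IsTriangular (h₀ : L) (Lm L₀ Lp : Set L) : Prop where
  span_eq_top : Submodule.span ℂ (Lm ∪ L₀ ∪ Lp) = ⊤
  neg : ∀ x ∈ Lm, ∃ m : ℕ, ⁅h₀, x⁆ = (-(m + 1 : ℕ) : ℂ) • x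
  zero : ∀ x ∈ L₀, ⁅h₀, x⁆ = 0
  pos : ∀ x ∈ Lp, ∃ m : ℕ, ⁅h₀, x⁆ = ((m + 1 : ℕ) : ℂ) • x

/-- The subrepresentation generated by a subspace. -/
def repSpan (y : L →ₗ⁅ℂ⁆ End ℂ M) (N : Submodule ℂ M) : Submodule ℂ M :=
  sInf {N' | N ≤ N' ∧ ∀ X, N' ≤ N'.comap (y X)}

/-- The sum of the eigenspaces with eigenvalues `c - 1, c - 2, …`. -/
def lowerEigen (T : End ℂ M) (c : ℂ) : Submodule ℂ M := ⨆ m : ℕ, T.eigenspace (c - (m + 1 : ℕ))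

lemma le_repSpan (y : L →ₗ⁅ℂ⁆ End ℂ M) (N : Submodule ℂ M) : N ≤ repSpan y N :=
  le_sInf fun _ h => h.1

lemma repSpan_stable (y : L →ₗ⁅ℂ⁆ End ℂ M) (N : Submodule ℂ M) (X : L) :
    repSpan y N ≤ (repSpan y N).comap (y X) := fun _ hv =>
  Submodule.mem_sInf.2 fun N' hN' => hN'.2 X (Submodule.mem_sInf.1 hv N' hN')

lemma repSpan_le {y : L →ₗ⁅ℂ⁆ End ℂ M} {N N' : Submodule ℂ M} (h : N ≤ N')
    (hN' : ∀ X, N' ≤ N'.comap (y X)) : repSpan y N ≤ N' := sInf_le ⟨h, hN'⟩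

lemma lowerEigen_le (T : End ℂ M) (c : ℂ) :
    lowerEigen T c ≤ ⨆ c', ⨆ (_ : c' ≠ c), T.eigenspace c' := by
  refine iSup_le fun m => le_iSup₂_of_le (c - (m + 1 : ℕ)) (fun h => ?_) le_rfl
  have h1 : ((m + 1 : ℕ) : ℂ) = 0 := by linear_combination -h
  exact Nat.succ_ne_zero m (Nat.cast_eq_zero.1 h1)

lemma disjoint_lowerEigen (T : End ℂ M) (c : ℂ) : Disjoint (T.eigenspace c) (lowerEigen T c) :=
  (End.eigenspaces_iSupIndep T c).mono_right (lowerEigen_le T c)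

lemma apply_mem_eigenspace {y : L →ₗ⁅ℂ⁆ End ℂ M} {h₀ x : L} {a c : ℂ} (hx : ⁅h₀, x⁆ = a • x) {v : M}
    (hv : v ∈ (y h₀).eigenspace c) : y x v ∈ (y h₀).eigenspace (c + a) := by
  rw [End.mem_eigenspace_iff] at hv ⊢
  have h1 : y ⁅h₀, x⁆ v = y h₀ (y x v) - y x (y h₀ v) := by rw [LieHom.map_lie]; rfl
  rw [hx, map_smul, LinearMap.smul_apply, hv, map_smul] at h1
  rw [add_smul, h1]; abel

namespace IsTriangular
variable {h₀ : L} {Lm L₀ Lp : Set L} (ht : IsTriangular h₀ Lm L₀ Lp)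
include ht

/-- The subrepresentation generated by a space of highest weight vectors. -/
lemma repSpan_le_sup {y : L →ₗ⁅ℂ⁆ End ℂ M} {N : Submodule ℂ M} {c : ℂ}
    (hN : N ≤ (y h₀).eigenspace c) (hpN : ∀ x ∈ Lp, ∀ v ∈ N, y x v = 0)
    (h0N : ∀ x ∈ L₀, ∀ v ∈ N, y x v ∈ N) : repSpan y N ≤ N ⊔ lowerEigen (y h₀) c := by
  let _ := LieRingModule.compLieHom M y
  have : LieModule ℂ L M := LieModule.compLieHom M y
  have e : ∀ x v, ⁅(x : L), (v : M)⁆ = y x v := fun x v => rfl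
  have hlow : ∀ (x : L) (k : ℕ), ⁅h₀, x⁆ = (-(k : ℂ)) • x → ∀ v ∈ lowerEigen (y h₀) c,
      y x v ∈ lowerEigen (y h₀) c := by
    intro x k hx v hv
    have : lowerEigen (y h₀) c ≤ (lowerEigen (y h₀) c).comap (y x) := by
      refine iSup_le fun m v hv => Submodule.mem_iSup_of_mem (m + k) ?_
      have := apply_mem_eigenspace hx hv
      convert this using 1
      push_cast; ring_nf
    exact this hv
  refine le_trans (repSpan_le (N' := (LieSubmodule.lieSpan ℂ L (N : Set M)).toSubmodule)
    (LieSubmodule.subset_lieSpan) fun X _ hv => ?_) (lieSpan_le_sup ht.span_eq_top N _ hpN h0N ?_ ?_ ?_)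
  · exact (LieSubmodule.lieSpan ℂ L (N : Set M)).lie_mem (x := X) hv
  · intro x hx v hv
    obtain ⟨m, hm⟩ := ht.neg x hx
    exact Submodule.mem_iSup_of_mem m (apply_mem_eigenspace hm (hN hv))
  · intro x hx v hv
    exact hlow x 0 (by simpa using ht.zero x hx) v hv
  · intro x hx v hv
    obtain ⟨m, hm⟩ := ht.neg x hx
    exact hlow x (m + 1) hm v hv

end IsTriangular

/-- The vectors killed by the operators `y x`, `x ∈ Lp`. -/
def highest (y : L →ₗ⁅ℂ⁆ End ℂ M) (Lp : Set L) : Submodule ℂ M where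
  carrier := {v | ∀ x ∈ Lp, y x v = 0}
  add_mem' ha hb x hx := by rw [map_add, ha x hx, hb x hx, add_zero]
  zero_mem' x _ := map_zero _
  smul_mem' c v hv x hx := by rw [map_smul, hv x hx, smul_zero]

lemma IsTriangular.exists_mem_highest {h₀ : L} {Lm L₀ Lp : Set L} (ht : IsTriangular h₀ Lm L₀ Lp)
    [FiniteDimensional ℂ M] [Nontrivial M] (y : L →ₗ⁅ℂ⁆ End ℂ M) : highest y Lp ≠ ⊥ := by
  have hfin : {c : ℂ | (y h₀).HasEigenvalue c}.Finite :=
    Module.End.finite_hasEigenvalue (y h₀)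
  obtain ⟨c, hc, hmax⟩ := hfin.exists_maximalFor Complex.re _
    (Module.End.exists_eigenvalue (y h₀))
  obtain ⟨v, hv⟩ := Module.End.HasEigenvalue.exists_hasEigenvector hc
  refine (Submodule.ne_bot_iff _).2 ⟨v, fun x hx => ?_, hv.2⟩
  obtain ⟨m, hm⟩ := ht.pos x hx
  by_contra h0
  have h1 := apply_mem_eigenspace hm hv.1
  have h2 : (y h₀).HasEigenvalue (c + (m + 1 : ℕ)) :=
    Module.End.hasEigenvalue_of_hasEigenvector ⟨h1, h0⟩
  have h3 := hmax h2 (by simp; positivity)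
  simp at h3
  have : (0 : ℝ) ≤ m := Nat.cast_nonneg m
  linarith

end Triangular

namespace TwistData
variable {n : ℕ} {𝔤 : Type*} [LieRing 𝔤] [LieAlgebra ℂ 𝔤] {D : TwistData n 𝔤}

/-- An element of `𝔤(0̄, 0̄)` as an element of `𝔤(σ₀)`. -/
def toFix (x : D.g00) : D.gFix := ⟨x, mem_gFix_of_g00 x⟩

variable (H : LieSubalgebra ℂ D.g00)

/-- The weight spaces of `𝔤(σ₀)`. -/
def wtFix (α : Module.Dual ℂ H) : Submodule ℂ D.gFix :=
  (wtSpace H α).comap D.gFix.toSubmodule.subtype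

/-- The union of the weight spaces of `𝔤(σ₀)` with weights in `P`. -/
def posFix (P : Set (Module.Dual ℂ H)) : Set D.gFix := {x | ∃ α ∈ P, (x : 𝔤) ∈ wtSpace H α}

variable {H}

lemma mem_cent_iff {x : D.gFix} : (x : 𝔤) ∈ D.cent H ↔ (x : 𝔤) ∈ wtSpace H 0 := by
  constructor
  · intro hx h
    rw [hx.2 h, LinearMap.zero_apply, zero_smul]
  · intro hx
    exact ⟨x.2, fun h => by rw [mem_wtSpace.1 hx h, LinearMap.zero_apply, zero_smul]⟩

lemma lie_mem_wtSpace {α β : Module.Dual ℂ H} {x y : 𝔤} (hx : x ∈ wtSpace H α)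
    (hy : y ∈ wtSpace H β) : ⁅x, y⁆ ∈ wtSpace H (α + β) := fun h =>
  lie_lie_of_eq (hx h) (hy h)

variable [FiniteDimensional ℂ 𝔤] [LieAlgebra.IsSimple ℂ 𝔤]

/-- `𝔤(σ₀)` is spanned by its homogeneous weight vectors. -/
lemma span_weightVectors (hD : LieAlgebra.IsSimple ℂ D.g00) (hH : H.IsCartanSubalgebra)
    (hΔ : weights H ⊆ rootsEn H ∪ {0}) {P : Set (Module.Dual ℂ H)}
    (hP : IsPositiveSystem (rootsEn H) P) :
    Submodule.span ℂ {x : D.gFix | ∃ l α, (x : 𝔤) ∈ D.gradeSpace (emb l) ∧ (x : 𝔤) ∈ wtSpace H α ∧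
      (α = 0 ∨ α ∈ P ∨ -α ∈ P)} = ⊤ := by
  let adh : H → End ℂ D.gFix := fun h => LieAlgebra.ad ℂ D.gFix (toFix (h : D.g00))
  have hadh : ∀ h x, (adh h x : 𝔤) = ⁅((h : D.g00) : 𝔤), (x : 𝔤)⁆ := fun h x => rfl
  let f : Fin (n + 1) ⊕ H → End ℂ D.gFix := Sum.elim D.σFix adh
  have hss : ∀ i, (f i).IsSemisimple := by
    rintro (i | h)
    · exact σFix_isSemisimple i
    · have hp : D.gFix.toSubmodule ∈
          (LieAlgebra.ad ℂ 𝔤 ((h : D.g00) : 𝔤)).invtSubmodule := fun x hx =>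
        D.gFix.lie_mem (mem_gFix_of_g00 (h : D.g00)) hx
      exact Module.End.IsSemisimple.restrict hp (isSemisimple_ad hD hH h)
  have h1 : ∀ i h, D.σFix i * adh h = adh h * D.σFix i := fun i h =>
    LinearMap.ext fun x => Subtype.ext (by
      rw [Module.End.mul_apply, Module.End.mul_apply, σFix_apply, hadh, hadh, σFix_apply,
        LieEquiv.map_lie, σ_apply_of_mem_g00])
  have hc : ∀ i j, f i * f j = f j * f i := by
    rintro (i | h) (j | h')
    · exact σFix_comm i j
    · exact h1 i h'
    · exact (h1 j h).symm
    · refine LinearMap.ext fun x => Subtype.ext ?_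
      change ⁅((h : D.g00) : 𝔤), ⁅((h' : D.g00) : 𝔤), (x : 𝔤)⁆⁆ =
        ⁅((h' : D.g00) : 𝔤), ⁅((h : D.g00) : 𝔤), (x : 𝔤)⁆⁆
      have hab : ⁅((h : D.g00) : 𝔤), ((h' : D.g00) : 𝔤)⁆ = 0 :=
        congrArg (fun y : H => ((y : D.g00) : 𝔤)) (trivial_lie_zero H H h h')
      rw [leibniz_lie, hab, zero_lie, zero_add]
  rw [eq_top_iff, ← iSup_iInf_eigenspace_eq_top f hc hss]
  refine iSup_le fun χ x hx => ?_
  by_cases hx0 : x = 0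
  · rw [hx0]; exact zero_mem _
  rw [Submodule.mem_iInf] at hx
  have hx' : ∀ i, f i x = χ i • x := fun i => End.mem_eigenspace_iff.1 (hx i)
  obtain ⟨l, hl⟩ := mem_gradeSpace_of_eigenvector hx0 (μ := fun i => χ (Sum.inl i))
    fun i => hx' (Sum.inl i)
  have hw : ∀ h : H, ⁅((h : D.g00) : 𝔤), (x : 𝔤)⁆ = χ (Sum.inr h) • (x : 𝔤) := fun h =>
    congrArg Subtype.val (hx' (Sum.inr h))
  have hx0' : (x : 𝔤) ≠ 0 := fun h => hx0 (Subtype.ext h)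
  have hinj := smul_left_injective ℂ hx0'
  let α : Module.Dual ℂ H :=
    { toFun := fun h => χ (Sum.inr h)
      map_add' := fun h h' => hinj (by
        simp only [add_smul]
        rw [← hw, ← hw, ← hw, ← add_lie]; rfl)
      map_smul' := fun c h => hinj (by
        simp only [RingHom.id_apply, smul_assoc]
        rw [← hw, ← hw, ← smul_lie]; rfl) }
  have hα : (x : 𝔤) ∈ wtSpace H α := hw
  refine Submodule.subset_span ⟨l, α, hl, hα, ?_⟩
  rcases hΔ (show α ∈ weights H from (Submodule.ne_bot_iff _).2 ⟨x, hα, hx0'⟩) with h | h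
  · exact Or.inr (hP.pos_or_neg α h)
  · exact Or.inl h

theorem exists_isTriangular (hD : LieAlgebra.IsSimple ℂ D.g00) (hH : H.IsCartanSubalgebra)
    (hΔ : weights H ⊆ rootsEn H ∪ {0}) {P : Set (Module.Dual ℂ H)}
    (hP : IsPositiveSystem (rootsEn H) P) :
    ∃ h : H, IsTriangular (toFix (h : D.g00)) {x | ∃ α, -α ∈ P ∧ (x : 𝔤) ∈ wtSpace H α}
      {x | (x : 𝔤) ∈ D.cent H} (posFix H P) := by
  obtain ⟨h, hh⟩ := exists_grading_element hD hH hP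
  refine ⟨h, ?_, ?_, ?_, ?_⟩
  · rw [eq_top_iff, ← span_weightVectors hD hH hΔ hP, Submodule.span_le]
    rintro x ⟨l, α, -, hx, h0 | h0 | h0⟩
    · exact Submodule.subset_span (Or.inl (Or.inr (mem_cent_iff.2 (h0 ▸ hx))))
    · exact Submodule.subset_span (Or.inr ⟨α, h0, hx⟩)
    · exact Submodule.subset_span (Or.inl (Or.inl ⟨α, h0, hx⟩))
  · rintro x ⟨α, hα, hx⟩
    obtain ⟨z, hz, hz'⟩ := hh _ hα
    refine ⟨(z - 1).toNat, Subtype.ext ?_⟩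
    have h1 : (((z - 1).toNat + 1 : ℕ) : ℂ) = z := by
      have : (((z - 1).toNat + 1 : ℕ) : ℤ) = z := by omega
      exact_mod_cast this
    rw [h1]
    rw [LinearMap.neg_apply] at hz'
    rw [← hz', neg_neg]
    exact hx h
  · intro x hx
    exact Subtype.ext (hx.2 h)
  · rintro x ⟨α, hα, hx⟩
    obtain ⟨z, hz, hz'⟩ := hh _ hα
    refine ⟨(z - 1).toNat, Subtype.ext ?_⟩
    have h1 : (((z - 1).toNat + 1 : ℕ) : ℂ) = z := by
      have : (((z - 1).toNat + 1 : ℕ) : ℤ) = z := by omega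
      exact_mod_cast this
    rw [h1, ← hz']
    exact hx h

end TwistData
end Toroidal

namespace Toroidal
open Module (End)

namespace TwistData
variable {n : ℕ} {𝔤 : Type*} [LieRing 𝔤] [LieAlgebra ℂ 𝔤] {D : TwistData n 𝔤}

lemma mem_gFixGr_iff {lam : D.Lam} {l : Lat n} (h : D.bar l = lam) {x : D.gFix} :
    x ∈ D.gFixGr lam ↔ (x : 𝔤) ∈ D.gradeSpace (emb l) := by
  rw [← h, mem_gFixGr_bar]

/-- A finite dimensional `Λ`-graded irreducible representation of `𝔤(σ₀)`. -/
structure GradedRep {U : Type*} [AddCommGroup U] [Module ℂ U] (grU : D.Lam → Submodule ℂ U)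
    (y : D.gFix →ₗ⁅ℂ⁆ End ℂ U) : Prop where
  finite : FiniteDimensional ℂ U
  nontrivial : Nontrivial U
  grading : IsGrading grU
  mem : ∀ mu, ∀ X ∈ D.gFixGr mu, ∀ lam, ∀ v ∈ grU lam, y X v ∈ grU (mu + lam)
  irreducible : ∀ N : Submodule ℂ U, (∀ lam, N ≤ N.comap (grading.proj lam)) →
    (∀ X, N ≤ N.comap (y X)) → N = ⊥ ∨ N = ⊤

variable [FiniteDimensional ℂ 𝔤] [LieAlgebra.IsSimple ℂ 𝔤]

section Weights
variable {H : LieSubalgebra ℂ D.g00}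

omit [FiniteDimensional ℂ 𝔤] [LieAlgebra.IsSimple ℂ 𝔤] in
lemma lie_toFix_mem (h : D.g00) (lam : D.Lam) : ∀ x ∈ D.gFixGr lam,
    LieAlgebra.ad ℂ D.gFix (toFix h) x ∈ D.gFixGr lam := by
  intro x hx i
  have hx := (mem_gFixGr.1 hx) i
  change D.σ i ⁅(h : 𝔤), (x : 𝔤)⁆ = _ • ⁅(h : 𝔤), (x : 𝔤)⁆
  rw [LieEquiv.map_lie, σ_apply_of_mem_g00, hx, lie_smul]

omit [LieAlgebra.IsSimple ℂ 𝔤] in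
lemma proj_mem_wtFix {α : Module.Dual ℂ H} {x : D.gFix} (hx : x ∈ wtFix H α) (lam : D.Lam) :
    gFixGr_grading.proj lam x ∈ wtFix H α := by
  intro h
  have h1 : LieAlgebra.ad ℂ D.gFix (toFix (h : D.g00)) x = α h • x := Subtype.ext (hx h)
  have h2 := (gFixGr_grading (D := D)).proj_apply_comm
    (fun k v hv => lie_toFix_mem (h : D.g00) k v hv) lam x
  rw [h1, map_smul] at h2
  exact (congrArg Subtype.val h2).symm

omit [LieAlgebra.IsSimple ℂ 𝔤] in
lemma proj_mem_cent {x : D.gFix} (hx : (x : 𝔤) ∈ D.cent H) (lam : D.Lam) :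
    (gFixGr_grading.proj lam x : 𝔤) ∈ D.cent H :=
  mem_cent_iff.2 (proj_mem_wtFix (mem_cent_iff.1 hx) lam)

omit [FiniteDimensional ℂ 𝔤] [LieAlgebra.IsSimple ℂ 𝔤] in
lemma lie_mem_posFix {P : Set (Module.Dual ℂ H)} {x z : D.gFix} (hx : (x : 𝔤) ∈ D.cent H)
    (hz : z ∈ posFix H P) : ⁅z, x⁆ ∈ posFix H P := by
  obtain ⟨α, hα, hz⟩ := hz
  refine ⟨α, hα, ?_⟩
  have := lie_mem_wtSpace hz (mem_cent_iff.1 hx)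
  rwa [add_zero] at this

end Weights

omit [LieAlgebra.IsSimple ℂ 𝔤] in
lemma toFix_mem_cent (hD : LieAlgebra.IsSimple ℂ D.g00) {H : LieSubalgebra ℂ D.g00}
    (hH : H.IsCartanSubalgebra) (h : H) : ((toFix (h : D.g00) : D.gFix) : 𝔤) ∈ D.cent H :=
  ⟨σ_apply_of_mem_g00 _ 0, fun h' =>
    congrArg (fun y : H => ((y : D.g00) : 𝔤)) (trivial_lie_zero H H h' h)⟩

section Rep
variable {U : Type*} [AddCommGroup U] [Module ℂ U] {grU : D.Lam → Submodule ℂ U}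
  {y : D.gFix →ₗ⁅ℂ⁆ End ℂ U} {H : LieSubalgebra ℂ D.g00} {P : Set (Module.Dual ℂ H)}

omit [FiniteDimensional ℂ 𝔤] [LieAlgebra.IsSimple ℂ 𝔤] in
lemma highest_stable {x : D.gFix} (hx : (x : 𝔤) ∈ D.cent H) :
    highest y (posFix H P) ≤ (highest y (posFix H P)).comap (y x) := by
  intro v hv z hz
  have h1 : y ⁅z, x⁆ v = y z (y x v) - y x (y z v) := by rw [LieHom.map_lie]; rfl
  rw [hv _ (lie_mem_posFix hx hz), hv z hz, map_zero, sub_zero] at h1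
  exact h1.symm

omit [LieAlgebra.IsSimple ℂ 𝔤] in
lemma apply_mem_of_homogeneous {N : Submodule ℂ U} {v : U}
    (h : ∀ mu, ∀ X ∈ D.gFixGr mu, y X v ∈ N) (X : D.gFix) : y X v ∈ N := by
  refine (gFixGr_grading (D := D)).induction X h ?_ fun a b ha hb => ?_
  · rw [map_zero]; exact zero_mem _
  · rw [map_add]; exact add_mem ha hb

variable (hg : IsGrading grU)
  (hmem : ∀ mu, ∀ X ∈ D.gFixGr mu, ∀ lam, ∀ v ∈ grU lam, y X v ∈ grU (mu + lam))
include hmem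

omit [FiniteDimensional ℂ 𝔤] [LieAlgebra.IsSimple ℂ 𝔤] in
lemma proj_apply {mu : D.Lam} {X : D.gFix} (hX : X ∈ D.gFixGr mu) (lam : D.Lam) (v : U) :
    hg.proj (mu + lam) (y X v) = y X (hg.proj lam v) :=
  hg.proj_comm hg (f := (mu + ·)) (add_right_injective _) (hmem mu X hX) lam v

omit [LieAlgebra.IsSimple ℂ 𝔤] in
lemma repSpan_graded {N : Submodule ℂ U} (hN : ∀ lam, N ≤ N.comap (hg.proj lam)) (lam : D.Lam) :
    repSpan y N ≤ (repSpan y N).comap (hg.proj lam) := by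
  let Q : Submodule ℂ U := ⨅ lam, (repSpan y N).comap (hg.proj lam)
  have hQ : repSpan y N ≤ Q := by
    refine repSpan_le (le_iInf fun lam v hv => (le_repSpan y N (hN lam hv) : _)) fun X v hv => ?_
    rw [Submodule.mem_comap]
    refine apply_mem_of_homogeneous (fun mu X hX => ?_) X
    rw [Submodule.mem_iInf] at hv ⊢
    intro lam
    obtain ⟨lam, rfl⟩ : ∃ lam', lam = mu + lam' := ⟨lam - mu, by abel⟩
    rw [Submodule.mem_comap, proj_apply hg hmem hX]
    exact repSpan_stable y N X (hv lam)
  exact hQ.trans (iInf_le _ lam)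

omit [LieAlgebra.IsSimple ℂ 𝔤] in
lemma highest_graded (lam : D.Lam) :
    highest y (posFix H P) ≤ (highest y (posFix H P)).comap (hg.proj lam) := by
  rintro v hv x ⟨α, hα, hx⟩
  have hx' : x ∈ wtFix H α := hx
  have := Fintype.ofFinite D.Lam
  rw [← gFixGr_grading.sum_proj x, map_sum, LinearMap.sum_apply]
  refine Finset.sum_eq_zero fun mu _ => ?_
  rw [← proj_apply hg hmem (gFixGr_grading.proj_mem mu x), hv _ ⟨α, hα, proj_mem_wtFix hx' mu⟩,
    map_zero]

end Rep

namespace GradedRep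
variable {U : Type*} [AddCommGroup U] [Module ℂ U] {grU : D.Lam → Submodule ℂ U}
  {y : D.gFix →ₗ⁅ℂ⁆ End ℂ U} {H : LieSubalgebra ℂ D.g00} {P : Set (Module.Dual ℂ H)}
  (h : GradedRep grU y) {h₀ : H}
  (ht : IsTriangular (toFix (h₀ : D.g00)) {x | ∃ α, -α ∈ P ∧ (x : 𝔤) ∈ wtSpace H α}
      {x | (x : 𝔤) ∈ D.cent H} (posFix H P))
include h ht

omit [LieAlgebra.IsSimple ℂ 𝔤] in
lemma top_le_sup {N : Submodule ℂ U} {c : ℂ} (hN : N ≤ highest y (posFix H P))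
    (hc : N ≤ (y (toFix (h₀ : D.g00))).eigenspace c)
    (hgr : ∀ lam, N ≤ N.comap (h.grading.proj lam))
    (hst : ∀ x : D.gFix, (x : 𝔤) ∈ D.cent H → N ≤ N.comap (y x)) (h0 : N ≠ ⊥) :
    ⊤ ≤ N ⊔ lowerEigen (y (toFix (h₀ : D.g00))) c := by
  have h1 : repSpan y N = ⊤ := (h.irreducible _ (repSpan_graded h.grading h.mem hgr)
    (repSpan_stable y N)).resolve_left fun hb => h0 (le_bot_iff.1 (hb ▸ le_repSpan y N))
  rw [← h1]
  exact ht.repSpan_le_sup hc (fun x hx v hv => hN hv x hx) fun x hx v hv => hst x hx hv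

omit [LieAlgebra.IsSimple ℂ 𝔤] in
theorem highest_irreducible (hcent : ((toFix (h₀ : D.g00) : D.gFix) : 𝔤) ∈ D.cent H) : ∃ c : ℂ,
    highest y (posFix H P) ≤ (y (toFix (h₀ : D.g00))).eigenspace c ∧
    ∀ N ≤ highest y (posFix H P), (∀ lam, N ≤ N.comap (h.grading.proj lam)) →
      (∀ x : D.gFix, (x : 𝔤) ∈ D.cent H → N ≤ N.comap (y x)) → N ≠ ⊥ →
      N = highest y (posFix H P) := by
  have := h.finite
  have := h.nontrivial
  set T := y (toFix (h₀ : D.g00)) with hT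
  set U' := highest y (posFix H P) with hU'
  have hcomm : ∀ x : D.gFix, (x : 𝔤) ∈ D.cent H → ∀ v, T (y x v) = y x (T v) := by
    intro x hx v
    have h1 : y ⁅toFix (h₀ : D.g00), x⁆ v = T (y x v) - y x (T v) := by rw [LieHom.map_lie]; rfl
    rw [show ⁅toFix (h₀ : D.g00), x⁆ = 0 from Subtype.ext (hx.2 h₀)] at h1
    rw [map_zero, LinearMap.zero_apply] at h1
    exact (sub_eq_zero.1 h1.symm)
  have hdeg : toFix (h₀ : D.g00) ∈ D.gFixGr 0 := by
    rw [mem_gFixGr_iff (l := 0) (by rfl), emb_zero]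
    exact (h₀ : D.g00).2
  have hproj : ∀ lam v, h.grading.proj lam (T v) = T (h.grading.proj lam v) := fun lam v => by
    have := proj_apply h.grading h.mem hdeg lam v
    rwa [zero_add] at this
  have key : ∀ (N : Submodule ℂ U) (c : ℂ), N ≤ U' →
      (∀ lam, N ≤ N.comap (h.grading.proj lam)) →
      (∀ x : D.gFix, (x : 𝔤) ∈ D.cent H → N ≤ N.comap (y x)) → N ⊓ T.eigenspace c ≠ ⊥ →
      ⊤ ≤ (N ⊓ T.eigenspace c) ⊔ lowerEigen T c := by
    intro N c hN hgr hst h0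
    refine h.top_le_sup ht (inf_le_left.trans hN) inf_le_right (fun lam v hv => ⟨hgr lam hv.1, ?_⟩)
      (fun x hx v hv => ⟨hst x hx hv.1, ?_⟩) h0
    · rw [SetLike.mem_coe, End.mem_eigenspace_iff, ← hproj, End.mem_eigenspace_iff.1 hv.2, map_smul]
    · rw [SetLike.mem_coe, End.mem_eigenspace_iff, hcomm x hx, End.mem_eigenspace_iff.1 hv.2,
        map_smul]
  have hgr' := highest_graded (H := H) (P := P) h.grading h.mem
  have hst' : ∀ x : D.gFix, (x : 𝔤) ∈ D.cent H → U' ≤ U'.comap (y x) := fun x hx =>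
    highest_stable hx
  -- an eigenvector of `T` in a non-zero stable subspace
  have hex : ∀ N : Submodule ℂ U, N ≠ ⊥ → N ≤ N.comap T → ∃ c, N ⊓ T.eigenspace c ≠ ⊥ := by
    intro N h0 hN
    have : Nontrivial N := (Submodule.nontrivial_iff_ne_bot).2 h0
    obtain ⟨c, hc⟩ := Module.End.exists_eigenvalue (T.restrict hN)
    obtain ⟨v, hv⟩ := hc.exists_hasEigenvector
    refine ⟨c, (Submodule.ne_bot_iff _).2 ⟨v, ⟨v.2, ?_⟩, fun hv0 => hv.2 (Subtype.ext hv0)⟩⟩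
    exact End.mem_eigenspace_iff.2 (congrArg Subtype.val (End.mem_eigenspace_iff.1 hv.1))
  obtain ⟨c, hc⟩ := hex U' (ht.exists_mem_highest y) (hst' _ hcent)
  have hdec := key U' c le_rfl hgr' hst' hc
  have hle : ∀ c', U' ⊓ T.eigenspace c' ≠ ⊥ → c' = c := by
    intro c' hc'
    have hdec' := key U' c' le_rfl hgr' hst' hc'
    have aux : ∀ a b, ⊤ ≤ (U' ⊓ T.eigenspace a) ⊔ lowerEigen T a → U' ⊓ T.eigenspace b ≠ ⊥ →
        ∃ m : ℕ, b = a - m := by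
      intro a b hab hb
      by_contra! hne
      refine hb (le_bot_iff.1 fun v hv => ?_)
      have h1 : (U' ⊓ T.eigenspace a) ⊔ lowerEigen T a ≤ ⨆ c', ⨆ (_ : c' ≠ b), T.eigenspace c' := by
        refine sup_le (inf_le_right.trans (le_iSup₂_of_le a ?_ le_rfl)) (iSup_le fun m =>
          le_iSup₂_of_le (a - (m + 1 : ℕ)) ?_ le_rfl)
        · have := hne 0
          rintro rfl
          simp at this
        · exact (hne (m + 1)).symm
      exact (End.eigenspaces_iSupIndep T b).le_bot ⟨hv.2, h1 (hab Submodule.mem_top)⟩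
    obtain ⟨m, hm⟩ := aux c c' hdec hc'
    obtain ⟨m', hm'⟩ := aux c' c hdec' hc
    have h1 : ((m + m' : ℕ) : ℂ) = 0 := by push_cast; linear_combination hm + hm'
    have h2 : m = 0 := by
      have := Nat.cast_eq_zero.1 h1
      omega
    rw [hm, h2]; simp
  have hUc : U' ≤ T.eigenspace c := by
    have htop : ⨆ μ, T.eigenspace μ = ⊤ := eq_top_iff.2 (hdec.trans (sup_le
      (inf_le_right.trans (le_iSup _ c)) (iSup_le fun m => le_iSup _ _)))
    have h1 := Submodule.inf_iSup_genEigenspace (p := U') (f := T)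
      (fun x hx => hst' _ hcent hx) 1
    change U' ⊓ ⨆ μ, T.eigenspace μ = ⨆ μ, U' ⊓ T.eigenspace μ at h1
    rw [htop, inf_top_eq] at h1
    rw [h1]
    refine iSup_le fun μ => ?_
    by_cases hμ : U' ⊓ T.eigenspace μ = ⊥
    · rw [hμ]; exact bot_le
    · rw [hle μ hμ]; exact inf_le_right
  refine ⟨c, hUc, fun N hN hgr hst h0 => le_antisymm hN fun v hv => ?_⟩
  have hd := h.top_le_sup ht hN (hN.trans hUc) hgr hst h0
  obtain ⟨a, ha, f, hf, rfl⟩ := Submodule.mem_sup.1 (hd (Submodule.mem_top (x := v)))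
  have hf' : f ∈ T.eigenspace c := by
    have := sub_mem (hUc hv) (hUc (hN ha))
    rwa [add_sub_cancel_left] at this
  have : f = 0 := by simpa using (disjoint_lowerEigen T c).le_bot ⟨hf', hf⟩
  rwa [this, add_zero]

end GradedRep
end TwistData
end Toroidal

namespace Toroidal
open Module (End)

namespace TwistData
variable {n : ℕ} {𝔤 : Type*} [LieRing 𝔤] [LieAlgebra ℂ 𝔤] {D : TwistData n 𝔤}
  {F : Type*} [AddCommGroup F] [Module ℂ F] {grF : D.Lam → Submodule ℂ F}
  {g : Matrix (Fin n) (Fin n) ℂ →ₗ⁅ℂ⁆ End ℂ F} {x : D.gFix →ₗ⁅ℂ⁆ End ℂ F}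
  {W : Type*} [AddCommGroup W] [Module ℂ W] {a : Matrix (Fin n) (Fin n) ℂ → End ℂ W}

/-- The multiplicity space of `W` in `F`. -/
abbrev Mult (a : Matrix (Fin n) (Fin n) ℂ → End ℂ W) (g : Matrix (Fin n) (Fin n) ℂ →ₗ⁅ℂ⁆ End ℂ F) :
    Submodule ℂ (W →ₗ[ℂ] F) := Intertwiners a (fun A => g A)

/-- The grading of the multiplicity space. -/
def multGr (a : Matrix (Fin n) (Fin n) ℂ → End ℂ W) (g : Matrix (Fin n) (Fin n) ℂ →ₗ⁅ℂ⁆ End ℂ F)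
    (grF : D.Lam → Submodule ℂ F) (lam : D.Lam) : Submodule ℂ (Mult a g) where
  carrier := {φ | ∀ w, φ.1 w ∈ grF lam}
  add_mem' ha hb w := add_mem (ha w) (hb w)
  zero_mem' _ := zero_mem _
  smul_mem' c _ hφ w := Submodule.smul_mem _ c (hφ w)

/-- The action of `𝔤(σ₀)` on the multiplicity space. -/
def multRep (a : Matrix (Fin n) (Fin n) ℂ → End ℂ W) (g : Matrix (Fin n) (Fin n) ℂ →ₗ⁅ℂ⁆ End ℂ F)
    (x : D.gFix →ₗ⁅ℂ⁆ End ℂ F) (hc : ∀ A X, g A * x X = x X * g A) :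
    D.gFix →ₗ⁅ℂ⁆ End ℂ (Mult a g) where
  toFun X :=
    { toFun := fun φ => ⟨x X ∘ₗ φ.1, fun A w => by
        have := LinearMap.congr_fun (hc A X) (φ.1 w)
        rw [LinearMap.comp_apply, φ.2 A w]
        exact this.symm⟩
      map_add' := fun φ φ' => Subtype.ext (LinearMap.comp_add _ _ _)
      map_smul' := fun c φ => Subtype.ext (LinearMap.comp_smul _ _ _) }
  map_add' X Y := LinearMap.ext fun φ => Subtype.ext (LinearMap.ext fun w => by simp)
  map_smul' c X := LinearMap.ext fun φ => Subtype.ext (LinearMap.ext fun w => by simp)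
  map_lie' {X Y} := LinearMap.ext fun φ => Subtype.ext (LinearMap.ext fun w => by
    rw [Ring.lie_def]
    change x ⁅X, Y⁆ (φ.1 w) = _
    rw [LieHom.map_lie]
    rfl)

lemma multRep_apply (hc : ∀ A X, g A * x X = x X * g A) (X : D.gFix) (φ : Mult a g) (w : W) :
    (multRep a g x hc X φ).1 w = x X (φ.1 w) := rfl

namespace FiberRep
variable (h : FiberRep grF g x)
include h

lemma x_mem' : ∀ mu, ∀ X ∈ D.gFixGr mu, ∀ lam, ∀ v ∈ grF lam, x X v ∈ grF (mu + lam) := by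
  intro mu X hX lam v hv
  have := h.x_mem mu.out X (mem_gFixGr.1 hX) lam v hv
  rwa [bar_out] at this

/-- The homogeneous components of an intertwiner. -/
lemma proj_comp_mem (φ : Mult a g) (lam : D.Lam) : h.grading.proj lam ∘ₗ φ.1 ∈ Mult a g := by
  intro A w
  rw [LinearMap.comp_apply, φ.2 A w]
  exact h.grading.proj_apply_comm (fun k v hv => h.g_mem A k v hv) lam (φ.1 w)

lemma mult_grading : IsGrading (multGr a g grF) := by
  constructor
  · rw [iSupIndep_def]
    intro lam
    rw [Submodule.disjoint_def]
    intro φ hφ hφ'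
    refine Subtype.ext (LinearMap.ext fun w => ?_)
    have h1 : (⨆ j, ⨆ (_ : j ≠ lam), multGr a g grF j) ≤
        (⨆ j, ⨆ (_ : j ≠ lam), grF j).comap (LinearMap.applyₗ w ∘ₗ (Mult a g).subtype) :=
      iSup₂_le fun j hj φ hφ => Submodule.mem_iSup_of_mem j (Submodule.mem_iSup_of_mem hj (hφ w))
    exact Submodule.disjoint_def.1 (h.grading.indep lam) _ (hφ w) (h1 hφ')
  · rw [eq_top_iff]
    rintro φ -
    have := Fintype.ofFinite D.Lam
    have e : φ = ∑ lam, (⟨_, h.proj_comp_mem φ lam⟩ : Mult a g) :=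
      Subtype.ext (LinearMap.ext fun w => by
        simp [LinearMap.sum_apply, h.grading.sum_proj])
    rw [e]
    exact sum_mem fun lam _ => Submodule.mem_iSup_of_mem lam fun w => h.grading.proj_mem lam _

lemma mult_proj (φ : Mult a g) (lam : D.Lam) (w : W) :
    ((h.mult_grading (a := a)).proj lam φ).1 w = h.grading.proj lam (φ.1 w) := by
  induction φ using (h.mult_grading (a := a)).induction with
  | hm k φ hφ =>
    by_cases hk : lam = k
    · subst hk
      rw [IsGrading.proj_of_mem _ hφ, h.grading.proj_of_mem (hφ w)]
    · rw [IsGrading.proj_of_ne _ hk hφ, h.grading.proj_of_ne hk (hφ w)]; rfl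
  | h0 => simp
  | hadd φ φ' h1 h2 =>
    simp only [map_add, Submodule.coe_add, LinearMap.add_apply, h1, h2]

variable [FiniteDimensional ℂ W] [Nontrivial W]
  (hirr : ∀ N : Submodule ℂ W, (∀ A, N ≤ N.comap (a A)) → N = ⊥ ∨ N = ⊤)
include hirr

omit [FiniteDimensional ℂ W] [Nontrivial W] hirr in
/-- Evaluation on a subrepresentation of the multiplicity space. -/
lemma range_eval_eq (N : Submodule ℂ (Mult a g))
    (hN : ∀ lam, N ≤ N.comap ((h.mult_grading (a := a)).proj lam))
    (hx : ∀ X, N ≤ N.comap (multRep a g x h.comm X)) (h0 : N ≠ ⊥) :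
    Submodule.span ℂ {f | ∃ w, ∃ φ ∈ N, f = φ.1 w} = ⊤ := by
  refine (h.irreducible _ (fun lam => ?_) (fun A => ?_) (fun X => ?_)).resolve_left ?_
  · refine Submodule.span_le.2 ?_
    rintro _ ⟨w, φ, hφ, rfl⟩
    exact Submodule.subset_span ⟨w, _, hN lam hφ, (h.mult_proj φ lam w).symm⟩
  · refine Submodule.span_le.2 ?_
    rintro _ ⟨w, φ, hφ, rfl⟩
    exact Submodule.subset_span ⟨a A w, φ, hφ, (φ.2 A w).symm⟩
  · refine Submodule.span_le.2 ?_
    rintro _ ⟨w, φ, hφ, rfl⟩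
    exact Submodule.subset_span ⟨w, _, hx X hφ, rfl⟩
  · obtain ⟨φ, hφ, hφ0⟩ := (Submodule.ne_bot_iff _).1 h0
    intro hb
    refine hφ0 (Subtype.ext (LinearMap.ext fun w => ?_))
    have : φ.1 w ∈ Submodule.span ℂ {f | ∃ w, ∃ φ ∈ N, f = φ.1 w} :=
      Submodule.subset_span ⟨w, φ, hφ, rfl⟩
    rw [hb] at this
    simpa using this

omit h in
/-- A vector `∑ φᵢ(wᵢ)` with `φᵢ ∈ N` that equals `φ(w)`, `w ≠ 0`, forces `φ ∈ N`. -/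
lemma mem_of_span_eval_eq_top (N : Submodule ℂ (Mult a g))
    (htop : Submodule.span ℂ {f | ∃ w, ∃ φ ∈ N, f = φ.1 w} = ⊤) : N = ⊤ := by
  rw [eq_top_iff]
  rintro φ -
  obtain ⟨w, hw⟩ := exists_ne (0 : W)
  obtain ⟨f, hf⟩ := Module.Projective.exists_dual_ne_zero ℂ hw
  let θ : W ⊗[ℂ] Mult a g →ₗ[ℂ] Mult a g := TensorProduct.lift (LinearMap.lsmul ℂ _ ∘ₗ f)
  have hθ : ∀ w φ, θ (w ⊗ₜ φ) = f w • φ := fun w φ => rfl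
  let R : Submodule ℂ (W ⊗[ℂ] Mult a g) := Submodule.span ℂ {t | ∃ w, ∃ φ ∈ N, t = w ⊗ₜ φ}
  have hR : R ≤ N.comap θ := by
    refine Submodule.span_le.2 ?_
    rintro _ ⟨w, φ, hφ, rfl⟩
    exact N.smul_mem _ hφ
  have hmap : R.map (evalIntertwiners a (fun A => g A)) = ⊤ := by
    rw [← htop, Submodule.map_span]
    congr 1
    ext y
    constructor
    · rintro ⟨_, ⟨w, φ, hφ, rfl⟩, rfl⟩
      exact ⟨w, φ, hφ, evalIntertwiners_tmul _ _ _ _⟩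
    · rintro ⟨w, φ, hφ, rfl⟩
      exact ⟨_, ⟨w, φ, hφ, rfl⟩, evalIntertwiners_tmul _ _ _ _⟩
  obtain ⟨t, ht, htw⟩ := hmap.ge (Submodule.mem_top (x := φ.1 w))
  rw [← evalIntertwiners_tmul a (fun A => g A)] at htw
  have h1 := evalIntertwiners_injective hirr htw
  have h2 : f w • φ ∈ N := by
    rw [← hθ, ← h1]; exact hR ht
  exact (N.smul_mem_iff hf).1 h2

lemma gradedRep_mult [Nontrivial (Mult a g)] :
    GradedRep (multGr a g grF) (multRep a g x h.comm) where
  finite := by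
    have := h.finite
    infer_instance
  nontrivial := inferInstance
  grading := h.mult_grading
  mem mu X hX lam φ hφ w := h.x_mem' mu X hX lam _ (hφ w)
  irreducible N hN hx := by
    by_cases h0 : N = ⊥
    · exact Or.inl h0
    · exact Or.inr (mem_of_span_eval_eq_top hirr N (h.range_eval_eq N hN hx h0))

lemma evalIntertwiners_bijective [Nontrivial (Mult a g)] :
    Function.Bijective (evalIntertwiners a (fun A => g A)) := by
  refine ⟨evalIntertwiners_injective hirr, ?_⟩
  rw [← LinearMap.range_eq_top, eq_top_iff,
    ← h.range_eval_eq (a := a) ⊤ (fun _ _ _ => Submodule.mem_top) (fun _ _ _ => Submodule.mem_top)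
      top_ne_bot, Submodule.span_le]
  rintro _ ⟨w, φ, -, rfl⟩
  exact ⟨w ⊗ₜ φ, evalIntertwiners_tmul _ _ _ _⟩

end FiberRep
end TwistData
end Toroidal

namespace Toroidal
open Module (End)

namespace TwistData
variable {n : ℕ} {𝔤 : Type*} [LieRing 𝔤] [LieAlgebra ℂ 𝔤] {D : TwistData n 𝔤}

section Section
variable {M F W U : Type*} [AddCommGroup M] [Module ℂ M] [AddCommGroup F] [Module ℂ F]
  [AddCommGroup W] [Module ℂ W] [AddCommGroup U] [Module ℂ U]
  {gr : Lat n → Submodule ℂ M} {grF : D.Lam → Submodule ℂ F} {grU : D.Lam → Submodule ℂ U}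
  {q : M →ₗ[ℂ] F} {ev : W ⊗[ℂ] U →ₗ[ℂ] F}

lemma eval_lTensor_mem (hmem : ∀ lam w, ∀ u ∈ grU lam, ev (w ⊗ₜ u) ∈ grF lam) (lam : D.Lam)
    (t : W ⊗[ℂ] grU lam) : ev ((grU lam).subtype.lTensor W t) ∈ grF lam := by
  induction t using TensorProduct.induction_on with
  | zero => simp
  | tmul w u => exact hmem lam w u u.2
  | add a b ha hb => rw [map_add, map_add]; exact add_mem ha hb

/-- The identification of `⨁ₖ W ⊗ U_k̄ ⊗ t^k` with a subspace of the space of tensor fields. -/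
lemma exists_tensorSpace_map (hqm : ∀ k, ∀ v ∈ gr k, q v ∈ grF (D.bar k))
    (hqi : ∀ k, ∀ v ∈ gr k, q v = 0 → v = 0) (hqs : ∀ k, ∀ y ∈ grF (D.bar k), ∃ v ∈ gr k, q v = y)
    (hmem : ∀ lam w, ∀ u ∈ grU lam, ev (w ⊗ₜ u) ∈ grF lam) :
    ∃ Θ : TensorSpace W grU →ₗ[ℂ] M, ∀ k (t : W ⊗[ℂ] grU (D.bar k)),
      Θ (DirectSum.of (fun k : Lat n => W ⊗[ℂ] grU (D.bar k)) k t) ∈ gr k ∧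
      q (Θ (DirectSum.of (fun k : Lat n => W ⊗[ℂ] grU (D.bar k)) k t)) =
        ev ((grU (D.bar k)).subtype.lTensor W t) := by
  let qe : ∀ k, gr k ≃ₗ[ℂ] grF (D.bar k) := fun k => LinearEquiv.ofBijective (q.restrict (hqm k)) <| by
    constructor
    · rw [← LinearMap.ker_eq_bot, Submodule.eq_bot_iff]
      exact fun v hv => Subtype.ext (hqi k v v.2 (congrArg Subtype.val (LinearMap.mem_ker.1 hv)))
    · rintro ⟨y, hy⟩
      obtain ⟨v, hv, rfl⟩ := hqs k y hy
      exact ⟨⟨v, hv⟩, rfl⟩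
  have hqe : ∀ k y, q ((qe k).symm y : gr k) = y := fun k y =>
    congrArg Subtype.val ((qe k).apply_symm_apply y)
  let f : ∀ k : Lat n, W ⊗[ℂ] grU (D.bar k) →ₗ[ℂ] M := fun k =>
    (gr k).subtype ∘ₗ (qe k).symm.toLinearMap ∘ₗ
      (ev ∘ₗ (grU (D.bar k)).subtype.lTensor W).codRestrict _ (eval_lTensor_mem hmem (D.bar k))
  refine ⟨DirectSum.toModule ℂ _ _ f, fun k t => ?_⟩
  rw [← DirectSum.lof_eq_of ℂ, DirectSum.toModule_lof]
  exact ⟨Submodule.coe_mem _, hqe k _⟩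

lemma eval_lTensor_proj (hU : IsGrading grU) (hF : IsGrading grF)
    (hmem : ∀ lam w, ∀ u ∈ grU lam, ev (w ⊗ₜ u) ∈ grF lam) (lam : D.Lam) (t : W ⊗[ℂ] U) :
    ev ((hU.proj lam).lTensor W t) = hF.proj lam (ev t) := by
  induction t using TensorProduct.induction_on with
  | zero => simp
  | tmul w u =>
    rw [LinearMap.lTensor_tmul]
    exact (hU.proj_comm hF (x := ev ∘ₗ TensorProduct.mk ℂ W U w) (f := id) Function.injective_id
      (fun k v hv => hmem k w v hv) lam u).symm
  | add a b ha hb => simp only [map_add, ha, hb]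

lemma exists_eq_lTensor (hU : IsGrading grU) (hF : IsGrading grF) (hev : Function.Injective ev)
    (hmem : ∀ lam w, ∀ u ∈ grU lam, ev (w ⊗ₜ u) ∈ grF lam) {lam : D.Lam} {t : W ⊗[ℂ] U}
    (ht : ev t ∈ grF lam) : ∃ t' : W ⊗[ℂ] grU lam, (grU lam).subtype.lTensor W t' = t := by
  refine ⟨((hU.proj lam).codRestrict _ (hU.proj_mem lam)).lTensor W t, hev ?_⟩
  refine Eq.trans ?_ ((eval_lTensor_proj hU hF hmem lam t).trans (hF.proj_of_mem ht))
  congr 1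
  rw [← LinearMap.comp_apply, ← LinearMap.lTensor_comp]
  rfl

end Section

variable [FiniteDimensional ℂ 𝔤] [LieAlgebra.IsSimple ℂ 𝔤]

lemma sum_smul_dd {r : Lat (n + 1)} (hr : r ∈ D.gam) (u : Fin n → ℂ) :
    ∑ i : Fin n, u i • (dd r hr i.succ : D.tau) = de r hr (Fin.cons 0 u) := by
  have h1 : ∀ i : Fin n, u i • (dd r hr i.succ : D.tau) =
      de r hr (u i • Pi.single i.succ 1) := fun i => by rw [de_smul, dd_eq_de]
  let f : (Fin (n + 1) → ℂ) →ₗ[ℂ] D.tau :=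
    { toFun := de r hr, map_add' := de_add r hr, map_smul' := de_smul r hr }
  have h2 : ∀ w, de r hr w = f w := fun _ => rfl
  simp only [h1, h2]
  rw [← map_sum]
  congr 1
  ext j
  refine Fin.cases ?_ (fun j => ?_) j
  · simp [Finset.sum_apply]
  · simp [Finset.sum_apply, Pi.single_apply]

variable {M F W U N : Type*} [AddCommGroup M] [Module ℂ M] [AddCommGroup F] [Module ℂ F]
  [AddCommGroup W] [Module ℂ W] [AddCommGroup U] [Module ℂ U]
  [LieRingModule (Matrix (Fin n) (Fin n) ℂ) W]
  {gr : Lat n → Submodule ℂ M} {grF : D.Lam → Submodule ℂ F} {grU : D.Lam → Submodule ℂ U}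
  {q : M →ₗ[ℂ] F} {ev : W ⊗[ℂ] U →ₗ[ℂ] F}
  {π : D.tau0 →ₗ⁅ℂ⁆ End ℂ M} {α : Fin n → ℂ} {d C₀ : ℂ}
  {g : Matrix (Fin n) (Fin n) ℂ →ₗ⁅ℂ⁆ End ℂ F} {x : D.gFix →ₗ⁅ℂ⁆ End ℂ F}

/-- A submodule of a module of tensor fields that is cut out by a subspace `W ⊗ U` of the fibre is
the module `⨁ₖ W ⊗ U_k̄ ⊗ t^k`. -/
theorem exists_isTensorAction (h : IsTop π gr α d C₀) (he : IsEval π gr α d C₀ grF g x q)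
    (hF : IsGrading grF) (hU : IsGrading grU) (hev : Function.Injective ev)
    (hmem : ∀ lam w, ∀ u ∈ grU lam, ev (w ⊗ₜ u) ∈ grF lam)
    (hgl : ∀ A w u, g A (ev (w ⊗ₜ u)) = ev (⁅A, w⁆ ⊗ₜ u))
    {𝔨 : LieSubalgebra ℂ 𝔤} (h𝔨 : 𝔨 ≤ D.gFix) (ρU : 𝔨 →ₗ⁅ℂ⁆ End ℂ U)
    (hρ : ∀ l (X : 𝔨), (X : 𝔤) ∈ D.gradeSpace (emb l) → ∀ lam, ∀ u ∈ grU lam,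
      ρU X u ∈ grU (D.bar l + lam))
    (hx : ∀ (X : 𝔨) w u, x ⟨X, h𝔨 X.2⟩ (ev (w ⊗ₜ u)) = ev (w ⊗ₜ ρU X u))
    {𝔱 : LieSubalgebra ℂ D.tau} (h𝔱 : 𝔱 ≤ D.tau0)
    [AddCommGroup N] [Module ℂ N] [LieRingModule 𝔱 N] [LieModule ℂ 𝔱 N]
    {j : N →ₗ[ℂ] M} (hj : Function.Injective j)
    (hπ : ∀ (y : 𝔱) v, π ⟨y, h𝔱 y.2⟩ (j v) = j ⁅y, v⁆)
    (hrange : ∀ v, v ∈ LinearMap.range j ↔ ∀ k, q (h.grading.proj k v) ∈ LinearMap.range ev) :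
    ∃ ρ : 𝔱 →ₗ⁅ℂ⁆ End ℂ (TensorSpace W grU), IsTensorAction 𝔱 𝔨 grU ρU α d C₀ ρ ∧
      ∃ e : N ≃ₗ[ℂ] TensorSpace W grU, ∀ y v, e ⁅y, v⁆ = ρ y (e v) := by
  classical
  obtain ⟨Θ, hΘ⟩ := exists_tensorSpace_map he.mem he.inj he.surj hmem
  have hproj : ∀ k f, h.grading.proj k (Θ f) =
      Θ (DirectSum.of (fun k : Lat n => W ⊗[ℂ] grU (D.bar k)) k (f k)) := by
    intro k f
    induction f using DirectSum.induction_on with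
    | zero => simp
    | of l t =>
      by_cases hkl : k = l
      · subst hkl
        rw [h.grading.proj_of_mem (hΘ k t).1, DirectSum.of_eq_same]
      · rw [h.grading.proj_of_ne hkl (hΘ l t).1, DirectSum.of_eq_of_ne _ _ _ hkl, map_zero, map_zero]
    | add a b ha hb => simp only [map_add, ha, hb, DirectSum.add_apply]
  have hinj : Function.Injective Θ := by
    rw [← LinearMap.ker_eq_bot, Submodule.eq_bot_iff]
    intro f hf
    refine DFinsupp.ext fun k => ?_
    have h1 := hproj k f
    rw [LinearMap.mem_ker.1 hf, map_zero] at h1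
    have h2 := (hΘ k (f k)).2
    rw [← h1, map_zero] at h2
    have h3 := Module.Flat.lTensor_preserves_injective_linearMap (M := W) (grU (D.bar k)).subtype
      (Submodule.subtype_injective _)
    have h4 : (grU (D.bar k)).subtype.lTensor W (f k) = 0 := hev (by rw [← h2, map_zero])
    exact h3 (h4.trans (map_zero _).symm)
  have hr : LinearMap.range j = LinearMap.range Θ := by
    ext v
    constructor
    · intro hv
      rw [hrange] at hv
      refine h.grading.mem_of_proj_mem fun k => ?_
      obtain ⟨t, ht⟩ := hv k
      obtain ⟨t', rfl⟩ := exists_eq_lTensor hU hF hev hmem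
        (ht ▸ he.mem k _ (h.grading.proj_mem k v) : ev t ∈ grF (D.bar k))
      refine ⟨DirectSum.of (fun k : Lat n => W ⊗[ℂ] grU (D.bar k)) k t', ?_⟩
      rw [← sub_eq_zero]
      refine he.inj k _ (sub_mem (hΘ k t').1 (h.grading.proj_mem k v)) ?_
      rw [map_sub, (hΘ k t').2, ht, sub_self]
    · rintro ⟨f, rfl⟩
      rw [hrange]
      intro k
      rw [hproj, (hΘ k _).2]
      exact ⟨_, rfl⟩
  let e : N ≃ₗ[ℂ] TensorSpace W grU := LinearEquiv.ofInjective j hj ≪≫ₗ LinearEquiv.ofEq _ _ hr ≪≫ₗ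
    (LinearEquiv.ofInjective Θ hinj).symm
  have hΘe : ∀ v, Θ (e v) = j v := fun v => by
    have := (LinearEquiv.ofInjective Θ hinj).apply_symm_apply
      (LinearEquiv.ofEq _ _ hr (LinearEquiv.ofInjective j hj v))
    exact congrArg Subtype.val this
  let ρ : 𝔱 →ₗ⁅ℂ⁆ End ℂ (TensorSpace W grU) := e.lieConj.toLieHom.comp (LieModule.toEnd ℂ 𝔱 N)
  have hρe : ∀ y v, ρ y (e v) = e ⁅y, v⁆ := fun y v => by
    change e ⁅y, e.symm (e v)⁆ = _
    rw [e.symm_apply_apply]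
  have hΘρ : ∀ y f, Θ (ρ y f) = π ⟨y, h𝔱 y.2⟩ (Θ f) := fun y f => by
    obtain ⟨v, rfl⟩ := e.surjective f
    rw [hρe, hΘe, hΘe, hπ]
  have hmono : ∀ k w u (hu : u ∈ grU (D.bar k)), Θ (mono k w u hu) ∈ gr k ∧
      q (Θ (mono k w u hu)) = ev (w ⊗ₜ u) := fun k w u hu => hΘ k _
  have key : ∀ (y : 𝔱) k w u (hu : u ∈ grU (D.bar k)) k' w' u' (hu' : u' ∈ grU (D.bar k')),
      π ⟨y, h𝔱 y.2⟩ (Θ (mono k w u hu)) ∈ gr k' →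
      q (π ⟨y, h𝔱 y.2⟩ (Θ (mono k w u hu))) = ev (w' ⊗ₜ u') →
      ρ y (mono k w u hu) = mono k' w' u' hu' := by
    intro y k w u hu k' w' u' hu' h1 h2
    refine hinj (sub_eq_zero.1 (he.inj k' _ ?_ ?_))
    · rw [hΘρ]
      exact sub_mem h1 (hmono _ _ _ _).1
    · rw [map_sub, hΘρ, h2, (hmono _ _ _ _).2, sub_self]
  have hbar : ∀ k r, ∀ u ∈ grU (D.bar k), u ∈ grU (D.bar (k + D.sc r)) := fun k r u hu => by
    rwa [bar_add_sc]
  refine ⟨ρ, ⟨?_, ?_, ?_, ?_, ?_⟩, e, fun y v => (hρe y v).symm⟩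
  · intro r hr u y hy k w v hv
    obtain ⟨r, rfl⟩ := D.exists_sc_eq hr
    have e1 : (⟨y, h𝔱 y.2⟩ : D.tau0) = D.e0 r (Fin.cons 0 u) :=
      Subtype.ext (hy.trans (sum_smul_dd (D.emb_sc_mem r) u))
    refine ⟨hbar k r v hv, key _ _ _ _ _ _ _ _ _ ?_ ?_⟩
    · rw [e1]; exact h.e0_mem (hmono _ _ _ _).1 r _
    · rw [e1, he.e0 r u k _ (hmono _ _ _ _).1, (hmono _ _ _ _).2]
      simp only [hgl, TensorProduct.add_tmul, TensorProduct.sum_tmul, ← TensorProduct.smul_tmul',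
        map_add, map_sum, map_smul]
  · intro l X hX hX' y hy k w v hv
    have e1 : (⟨y, h𝔱 y.2⟩ : D.tau0) = D.x0 l X hX := Subtype.ext hy
    have hv' : ρU ⟨X, hX'⟩ v ∈ grU (D.bar (k + l)) := by
      rw [bar_add, add_comm]; exact hρ l ⟨X, hX'⟩ hX _ v hv
    refine ⟨hv', key _ _ _ _ _ _ _ _ _ ?_ ?_⟩
    · rw [e1]; exact h.x0_mem (hmono _ _ _ _).1 l X hX
    · rw [e1, he.x0, (hmono _ _ _ _).2]
      exact hx ⟨X, hX'⟩ w v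
  · intro r hr y hy k w v hv
    obtain ⟨r, rfl⟩ := D.exists_sc_eq hr
    have e1 : (⟨y, h𝔱 y.2⟩ : D.tau0) = D.e0 r (Pi.single 0 1) := Subtype.ext hy
    refine ⟨hbar k r v hv, key _ _ _ _ _ _ _ _ _ ?_ ?_⟩
    · rw [e1]; exact h.e0_mem (hmono _ _ _ _).1 r _
    · rw [e1, he.e0_zero, (hmono _ _ _ _).2, ← TensorProduct.smul_tmul', map_smul]
  · intro r hr y hy k w v hv
    obtain ⟨r, rfl⟩ := D.exists_sc_eq hr
    have e1 : (⟨y, h𝔱 y.2⟩ : D.tau0) = D.c0 r (Pi.single 0 1) := Subtype.ext hy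
    refine ⟨hbar k r v hv, key _ _ _ _ _ _ _ _ _ ?_ ?_⟩
    · rw [e1]; exact h.c0_mem (hmono _ _ _ _).1 r _
    · rw [e1, he.c0, (hmono _ _ _ _).2, ← TensorProduct.smul_tmul', map_smul]
      simp
  · intro r hr p y hy k w v hv
    obtain ⟨r, rfl⟩ := D.exists_sc_eq hr
    have e1 : (⟨y, h𝔱 y.2⟩ : D.tau0) = D.c0 r (Pi.single p.succ 1) := Subtype.ext hy
    have h0 : ρ y (mono k w v hv) = mono (k + D.sc r) 0 v (hbar k r v hv) := by
      refine key _ _ _ _ _ _ _ _ _ ?_ ?_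
      · rw [e1]; exact h.c0_mem (hmono _ _ _ _).1 r _
      · rw [e1, he.c0, TensorProduct.zero_tmul, map_zero]; simp
    rw [h0, mono, TensorProduct.zero_tmul, map_zero]

end TwistData
end Toroidal

namespace Toroidal
open Module (End)

namespace TwistData
variable {n : ℕ} {𝔤 : Type*} [LieRing 𝔤] [LieAlgebra ℂ 𝔤] {D : TwistData n 𝔤}
  [FiniteDimensional ℂ 𝔤] [LieAlgebra.IsSimple ℂ 𝔤] {H : LieSubalgebra ℂ D.g00}
  {P : Set (Module.Dual ℂ H)}

/-- The homogeneous components of `𝔤(σ₀)` are spanned by weight vectors. -/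
lemma mem_span_weightVectors (hD : LieAlgebra.IsSimple ℂ D.g00) (hH : H.IsCartanSubalgebra)
    (hΔ : weights H ⊆ rootsEn H ∪ {0}) (hP : IsPositiveSystem (rootsEn H) P) {lam : D.Lam}
    {x : D.gFix} (hx : x ∈ D.gFixGr lam) :
    x ∈ Submodule.span ℂ {x : D.gFix | x ∈ D.gFixGr lam ∧ ∃ α, (x : 𝔤) ∈ wtSpace H α ∧
      (α = 0 ∨ α ∈ P ∨ -α ∈ P)} := by
  set A := Submodule.span ℂ {x : D.gFix | x ∈ D.gFixGr lam ∧ ∃ α, (x : 𝔤) ∈ wtSpace H α ∧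
      (α = 0 ∨ α ∈ P ∨ -α ∈ P)} with hA
  have h1 : (⊤ : Submodule ℂ D.gFix) ≤ A.comap (gFixGr_grading.proj lam) := by
    rw [← span_weightVectors hD hH hΔ hP, Submodule.span_le]
    rintro x ⟨l, α, hl, hα, h0⟩
    rw [← mem_gFixGr_bar] at hl
    rw [SetLike.mem_coe, Submodule.mem_comap]
    by_cases hlam : lam = D.bar l
    · subst hlam
      rw [gFixGr_grading.proj_of_mem hl]
      exact Submodule.subset_span ⟨hl, α, hα, h0⟩
    · rw [gFixGr_grading.proj_of_ne hlam hl]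
      exact zero_mem _
  have h2 := h1 (Submodule.mem_top (x := x))
  rwa [Submodule.mem_comap, gFixGr_grading.proj_of_mem hx] at h2

lemma lie_hh_x0 (h : H) (l : Lat n) (X : 𝔤) (hX : X ∈ D.gradeSpace (emb l)) {α : Module.Dual ℂ H}
    (hα : X ∈ wtSpace H α) : ⁅hh H h, (D.x0 l X hX : D.tau)⁆ = α h • (D.x0 l X hX : D.tau) := by
  have h1 : (0 : Lat (n + 1)) + emb l = emb l := zero_add _
  have h2 := hα h
  refine tau_ext ?_ ?_ ?_
  · change brLoop (Finsupp.single 0 _) (Finsupp.single (emb l) X) +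
      (brDerLoop 0 _ - brDerLoop 0 _) = α h • Finsupp.single (emb l) X
    rw [brLoop_single, h1, h2, map_zero, Finsupp.smul_single]
    simp
  · change brLoopCen D (Finsupp.single 0 _) (Finsupp.single (emb l) X) +
      (brDerCen 0 0 - brDerCen 0 0) + cocycle D 0 0 = α h • (0 : Cen (n + 1))
    rw [brLoopCen_single, vec_zero]
    simp
  · change brDer 0 0 = α h • (0 : Lat (n + 1) →₀ _)
    simp

lemma lie_hh_c0 (h : H) (r : Lat n) (w : Fin (n + 1) → ℂ) : ⁅hh H h, (D.c0 r w : D.tau)⁆ = 0 := by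
  rw [← lie_skew, neg_eq_zero]
  exact lie_cc_xx _ _ (D.emb_sc_mem r) _ _ _

lemma lie_hh_e0 (h : H) (r : Lat n) (w : Fin (n + 1) → ℂ) : ⁅hh H h, (D.e0 r w : D.tau)⁆ = 0 := by
  rw [← lie_skew, neg_eq_zero]
  refine (lie_de_xx _ 0 (D.emb_sc_mem r) w _ (h : D.g00).2
    (by rw [D.gradeSpace_add_gam (D.emb_sc_mem r)]; exact (h : D.g00).2)).trans ?_
  rw [vec_zero, map_zero, zero_smul]

/-- A root vector of `τ₀` for a positive root is a combination of elements `X t^l`. -/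
lemma mem_span_of_weight (hD : LieAlgebra.IsSimple ℂ D.g00) (hH : H.IsCartanSubalgebra)
    (hΔ : weights H ⊆ rootsEn H ∪ {0}) (hP : IsPositiveSystem (rootsEn H) P)
    {α : Module.Dual ℂ H} (hα : α ∈ P) {y : D.tau0} (hy : ∀ h : H, ⁅hh H h, (y : D.tau)⁆ = α h • (y : D.tau)) :
    y ∈ Submodule.span ℂ {y : D.tau0 | ∃ l X hX, (∃ β ∈ P, X ∈ wtSpace H β) ∧ y = D.x0 l X hX} := by
  obtain ⟨h₀, hh₀⟩ := exists_grading_element hD hH hP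
  let B : Set D.tau0 := {y | (∃ l X hX, (∃ β, X ∈ wtSpace H β ∧ (β = 0 ∨ β ∈ P ∨ -β ∈ P)) ∧
    y = D.x0 l X hX)} ∪ ({y | ∃ r w, y = D.c0 r w} ∪ {y | ∃ r a, y = D.e0 r a})
  let k₀ : D.tau0 := ⟨hh H h₀, (lie_d_xx 0 0 _ (h₀ : D.g00).2).trans (by simp)⟩
  have hk : ∀ (y : D.tau0) (c : ℂ), ⁅hh H h₀, (y : D.tau)⁆ = c • (y : D.tau) →
      LieAlgebra.ad ℂ D.tau0 k₀ y = c • y := fun y c h => Subtype.ext h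
  have hB : ∀ b ∈ B, ∃ c : ℂ, LieAlgebra.ad ℂ D.tau0 k₀ b = c • b := by
    rintro _ (⟨l, X, hX, ⟨β, hβ, -⟩, rfl⟩ | ⟨r, w, rfl⟩ | ⟨r, w, rfl⟩)
    · exact ⟨β h₀, hk _ _ (lie_hh_x0 h₀ l X hX hβ)⟩
    · exact ⟨0, hk _ _ (by rw [lie_hh_c0, zero_smul])⟩
    · exact ⟨0, hk _ _ (by rw [lie_hh_e0, zero_smul])⟩
  have hspan : Submodule.span ℂ B = ⊤ := by
    rw [eq_top_iff, ← tau0_span, Submodule.span_le]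
    rintro _ ((⟨l, X, hX, rfl⟩ | ⟨r, w, rfl⟩) | ⟨r, w, rfl⟩)
    · have hX' : (⟨X, mem_gFix_of_mem_gradeSpace hX⟩ : D.gFix) ∈ D.gFixGr (D.bar l) :=
        mem_gFixGr_bar.2 hX
      have h1 := mem_span_weightVectors hD hH hΔ hP hX'
      have h2 : ∀ Y ∈ Submodule.span ℂ {x : D.gFix | x ∈ D.gFixGr (D.bar l) ∧
          ∃ α, (x : 𝔤) ∈ wtSpace H α ∧ (α = 0 ∨ α ∈ P ∨ -α ∈ P)},
          ∃ hY : (Y : 𝔤) ∈ D.gradeSpace (emb l), D.x0 l (Y : 𝔤) hY ∈ Submodule.span ℂ B := by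
        intro Y hY
        induction hY using Submodule.span_induction with
        | mem Y hY =>
          exact ⟨mem_gFixGr_bar.1 hY.1,
            Submodule.subset_span (Or.inl ⟨l, Y, mem_gFixGr_bar.1 hY.1, hY.2, rfl⟩)⟩
        | zero =>
          refine ⟨zero_mem _, ?_⟩
          have : D.x0 l 0 (zero_mem _) = (0 : D.tau0) :=
            Subtype.ext (tau_ext (by simp [x0]) rfl rfl)
          exact this ▸ zero_mem _
        | add Y Z _ _ hY hZ =>
          obtain ⟨hY, hY'⟩ := hY
          obtain ⟨hZ, hZ'⟩ := hZ
          refine ⟨add_mem hY hZ, ?_⟩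
          have : D.x0 l (Y + Z : 𝔤) (add_mem hY hZ) = D.x0 l (Y : 𝔤) hY + D.x0 l (Z : 𝔤) hZ :=
            x0_add _ _ _ _ _
          exact this ▸ add_mem hY' hZ'
        | smul c Y _ hY =>
          obtain ⟨hY, hY'⟩ := hY
          refine ⟨Submodule.smul_mem _ c hY, ?_⟩
          have : D.x0 l (c • Y : 𝔤) (Submodule.smul_mem _ c hY) = c • D.x0 l (Y : 𝔤) hY :=
            x0_smul _ _ _ _
          exact this ▸ Submodule.smul_mem _ c hY'
      obtain ⟨_, h3⟩ := h2 _ h1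
      exact h3
    · exact Submodule.subset_span (Or.inr (Or.inl ⟨r, w, rfl⟩))
    · exact Submodule.subset_span (Or.inr (Or.inr ⟨r, w, rfl⟩))
  obtain ⟨z, hz, hz'⟩ := hh₀ α hα
  have hzc : (z : ℂ) ≠ 0 := Int.cast_ne_zero.2 hz.ne'
  have h1 := mem_span_eigenvectors hB (hspan ▸ Submodule.mem_top (x := y)) (hk y (α h₀) (hy h₀))
  refine (Submodule.span_le.2 ?_) h1
  rintro b ⟨hb, hbz⟩
  by_cases hb0 : b = 0
  · rw [hb0]; exact zero_mem _
  have huniq : ∀ c : ℂ, LieAlgebra.ad ℂ D.tau0 k₀ b = c • b → c = z := fun c hc => by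
    rw [hbz, hz'] at hc
    exact (smul_left_injective ℂ hb0 hc).symm
  rcases hb with ⟨l, X, hX, ⟨β, hβ, hβ'⟩, rfl⟩ | ⟨r, w, rfl⟩ | ⟨r, w, rfl⟩
  · have h2 := huniq _ (hk _ _ (lie_hh_x0 h₀ l X hX hβ))
    refine Submodule.subset_span ⟨l, X, hX, ⟨β, ?_, hβ⟩, rfl⟩
    rcases hβ' with rfl | h3 | h3
    · rw [LinearMap.zero_apply] at h2
      exact absurd h2.symm hzc
    · exact h3
    · obtain ⟨z', hz1, hz2⟩ := hh₀ _ h3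
      rw [LinearMap.neg_apply, h2] at hz2
      have : -z = z' := by exact_mod_cast hz2
      omega
  · exact absurd (huniq 0 (hk _ _ (by rw [lie_hh_c0, zero_smul]))).symm hzc
  · exact absurd (huniq 0 (hk _ _ (by rw [lie_hh_e0, zero_smul]))).symm hzc

section TopT
variable {V : Type*} [AddCommGroup V] [Module ℂ V] [LieRingModule D.tau V] [LieModule ℂ D.tau V]

lemma mem_topT_iff (hD : LieAlgebra.IsSimple ℂ D.g00) (hH : H.IsCartanSubalgebra)
    (hΔ : weights H ⊆ rootsEn H ∪ {0}) (hP : IsPositiveSystem (rootsEn H) P) {v : D.topS V} :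
    (v : V) ∈ topT H V P ↔ ∀ l X hX, (∃ β ∈ P, X ∈ wtSpace H β) → ⁅D.x0 l X hX, v⁆ = 0 := by
  constructor
  · rintro ⟨-, hv⟩ l X hX ⟨β, hβ, hX'⟩
    exact Subtype.ext (hv β hβ (D.x0 l X hX) (D.x0 l X hX).2 fun h => lie_hh_x0 h l X hX hX')
  · intro hv
    refine ⟨v.2, fun α hα y h0 hy => ?_⟩
    have h1 := mem_span_of_weight hD hH hΔ hP hα (y := ⟨y, h0⟩) hy
    have h2 : ∀ y ∈ Submodule.span ℂ {y : D.tau0 | ∃ l X hX, (∃ β ∈ P, X ∈ wtSpace H β) ∧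
        y = D.x0 l X hX}, ⁅y, v⁆ = 0 := by
      intro y hy
      induction hy using Submodule.span_induction with
      | mem y hy =>
        obtain ⟨l, X, hX, hβ, rfl⟩ := hy
        exact hv l X hX hβ
      | zero => exact zero_lie _
      | add y z _ _ h1 h2 => rw [add_lie, h1, h2, add_zero]
      | smul c y _ h1 => rw [smul_lie, h1, smul_zero]
    exact congrArg Subtype.val (h2 _ h1)

/-- Membership in `T` is decided in the fibre. -/
lemma mem_topT_iff_eval (hD : LieAlgebra.IsSimple ℂ D.g00) (hH : H.IsCartanSubalgebra)
    (hΔ : weights H ⊆ rootsEn H ∪ {0}) (hP : IsPositiveSystem (rootsEn H) P)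
    {gr : Lat n → Submodule ℂ (D.topS V)} {α : Fin n → ℂ} {d C₀ : ℂ}
    (h : IsTop (LieModule.toEnd ℂ D.tau0 (D.topS V)) gr α d C₀)
    {F : Type*} [AddCommGroup F] [Module ℂ F] {grF : D.Lam → Submodule ℂ F}
    {g : Matrix (Fin n) (Fin n) ℂ →ₗ⁅ℂ⁆ End ℂ F} {x : D.gFix →ₗ⁅ℂ⁆ End ℂ F}
    {q : D.topS V →ₗ[ℂ] F} (he : IsEval (LieModule.toEnd ℂ D.tau0 (D.topS V)) gr α d C₀ grF g x q)
    {v : D.topS V} :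
    (v : V) ∈ topT H V P ↔ ∀ k, q (h.grading.proj k v) ∈ highest x (posFix H P) := by
  have hpr : ∀ l X hX k, h.grading.proj (k + l) ⁅D.x0 l X hX, v⁆ =
      ⁅D.x0 l X hX, h.grading.proj k v⁆ := fun l X hX k =>
    h.grading.proj_comm h.grading (f := (· + l))
      (x := LieModule.toEnd ℂ D.tau0 (D.topS V) (D.x0 l X hX)) (add_left_injective _)
      (fun k v hv => h.x0_mem hv l X hX) k v
  have hq : ∀ l X hX k, q ⁅D.x0 l X hX, h.grading.proj k v⁆ =
      x ⟨X, mem_gFix_of_mem_gradeSpace hX⟩ (q (h.grading.proj k v)) := fun l X hX k =>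
    he.x0 l X hX _
  rw [mem_topT_iff hD hH hΔ hP]
  constructor
  · rintro hv k X ⟨β, hβ, hX⟩
    have := Fintype.ofFinite D.Lam
    have hX' : X ∈ wtFix H β := hX
    rw [← gFixGr_grading.sum_proj X, map_sum, LinearMap.sum_apply]
    refine Finset.sum_eq_zero fun mu _ => ?_
    have h1 : (gFixGr_grading.proj mu X : 𝔤) ∈ D.gradeSpace (emb mu.out) :=
      mem_gFixGr.1 (gFixGr_grading.proj_mem mu X)
    rw [← hq _ _ h1, ← hpr, hv _ _ h1 ⟨β, hβ, proj_mem_wtFix hX' mu⟩, map_zero, map_zero]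
  · rintro hv l X hX ⟨β, hβ, hX'⟩
    refine h.grading.eq_zero_of_proj fun k => ?_
    obtain ⟨k, rfl⟩ : ∃ k', k = k' + l := ⟨k - l, by abel⟩
    rw [hpr]
    refine he.inj (k + l) _ (h.x0_mem (h.grading.proj_mem k v) l X hX) ?_
    rw [hq]
    exact hv k _ ⟨β, hβ, hX'⟩

end TopT
end TwistData
end Toroidal

namespace Toroidal
open Module (End)

/-- A copy of `ℂᵐ` without further structure. -/
def Model (m : ℕ) : Type := Fin m → ℂ

instance (m : ℕ) : AddCommGroup (Model m) := inferInstanceAs (AddCommGroup (Fin m → ℂ))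
instance (m : ℕ) : Module ℂ (Model m) := inferInstanceAs (Module ℂ (Fin m → ℂ))
instance (m : ℕ) : FiniteDimensional ℂ (Model m) := inferInstanceAs (FiniteDimensional ℂ (Fin m → ℂ))

lemma exists_equiv_model (M : Type*) [AddCommGroup M] [Module ℂ M] [FiniteDimensional ℂ M] :
    ∃ m, Nonempty (M ≃ₗ[ℂ] Model m) :=
  ⟨_, ⟨(Module.finBasis ℂ M).equivFun⟩⟩

section Irreducible
variable {L F : Type*} [LieRing L] [LieAlgebra ℂ L] [AddCommGroup F] [Module ℂ F]
  [FiniteDimensional ℂ F] [Nontrivial F] (g : L →ₗ⁅ℂ⁆ End ℂ F)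

lemma exists_minimal_stable : ∃ N : Submodule ℂ F, N ≠ ⊥ ∧ (∀ A, N ≤ N.comap (g A)) ∧
    ∀ N' ≤ N, (∀ A, N' ≤ N'.comap (g A)) → N' = ⊥ ∨ N' = N := by
  obtain ⟨N, ⟨hN0, hN⟩, hmin⟩ := WellFounded.has_min (wellFounded_lt (α := Submodule ℂ F))
    {N | N ≠ ⊥ ∧ ∀ A, N ≤ N.comap (g A)} ⟨⊤, top_ne_bot, fun _ _ _ => Submodule.mem_top⟩
  refine ⟨N, hN0, hN, fun N' hle hN' => ?_⟩
  by_contra! hne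
  exact hmin N' ⟨hne.1, hN'⟩ (lt_of_le_of_ne hle hne.2)

/-- A finite dimensional representation contains an irreducible one. -/
lemma exists_irreducible_model : ∃ (m : ℕ) (a : L →ₗ⁅ℂ⁆ End ℂ (Model m)) (φ : Model m →ₗ[ℂ] F),
    Nontrivial (Model m) ∧ (∀ N : Submodule ℂ (Model m), (∀ A, N ≤ N.comap (a A)) → N = ⊥ ∨ N = ⊤) ∧
    Function.Injective φ ∧ ∀ A w, φ (a A w) = g A (φ w) := by
  obtain ⟨N, h0, hN, hmin⟩ := exists_minimal_stable g
  obtain ⟨m, ⟨e⟩⟩ := exists_equiv_model N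
  have hnt : Nontrivial N := Submodule.nontrivial_iff_ne_bot.2 h0
  let a₀ : L →ₗ⁅ℂ⁆ End ℂ N :=
    { toFun := fun A => (g A).restrict (hN A)
      map_add' := fun A B => by ext v; simp
      map_smul' := fun c A => by ext v; simp
      map_lie' := fun {A B} => LinearMap.ext fun v => Subtype.ext (by
        change g ⁅A, B⁆ v = _
        rw [LieHom.map_lie]; rfl) }
  refine ⟨m, e.lieConj.toLieHom.comp a₀, N.subtype ∘ₗ e.symm.toLinearMap, e.symm.nontrivial, ?_,
    N.subtype_injective.comp e.symm.injective, fun A w => ?_⟩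
  · intro K hK
    have h1 := hmin ((K.comap e.toLinearMap).map N.subtype) (Submodule.map_subtype_le _ _) ?_
    · rcases h1 with h1 | h1
      · left
        rw [Submodule.eq_bot_iff] at h1 ⊢
        intro w hw
        have := h1 (e.symm w : N) ⟨e.symm w, by simpa using hw, rfl⟩
        simpa using this
      · right
        rw [eq_top_iff]
        rintro w -
        have : ((e.symm w : N) : F) ∈ (K.comap e.toLinearMap).map N.subtype := h1.ge (e.symm w).2
        obtain ⟨v, hv, hvw⟩ := this
        rw [Subtype.ext (a1 := v) hvw] at hv
        simpa using hv
    · rintro A _ ⟨v, hv, rfl⟩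
      refine ⟨a₀ A v, ?_, rfl⟩
      have := hK A hv
      change e (a₀ A (e.symm (e v))) ∈ K at this
      rwa [e.symm_apply_apply] at this
  · change N.subtype (e.symm (e (a₀ A (e.symm w)))) = _
    rw [e.symm_apply_apply]; rfl

end Irreducible

namespace TwistData
variable {n : ℕ} {𝔤 : Type*} [LieRing 𝔤] [LieAlgebra ℂ 𝔤] {D : TwistData n 𝔤}
  {F : Type*} [AddCommGroup F] [Module ℂ F] {grF : D.Lam → Submodule ℂ F}
  {g : Matrix (Fin n) (Fin n) ℂ →ₗ⁅ℂ⁆ End ℂ F} {x : D.gFix →ₗ⁅ℂ⁆ End ℂ F}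
  {W : Type*} [AddCommGroup W] [Module ℂ W] {a : Matrix (Fin n) (Fin n) ℂ → End ℂ W}

lemma FiberRep.range_eval_highest (h : FiberRep grF g x) [FiniteDimensional ℂ W] [Nontrivial W]
    (hirr : ∀ N : Submodule ℂ W, (∀ A, N ≤ N.comap (a A)) → N = ⊥ ∨ N = ⊤) [Nontrivial (Mult a g)]
    (Lp : Set D.gFix) :
    LinearMap.range (evalIntertwiners a (fun A => g A) ∘ₗ
      (highest (multRep a g x h.comm) Lp).subtype.lTensor W) = highest x Lp := by
  classical
  have hev := h.evalIntertwiners_bijective hirr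
  have hX : ∀ X t, evalIntertwiners a (fun A => g A) ((multRep a g x h.comm X).lTensor W t) =
      x X (evalIntertwiners a (fun A => g A) t) := by
    intro X t
    induction t using TensorProduct.induction_on with
    | zero => simp
    | tmul w φ =>
      rw [LinearMap.lTensor_tmul, evalIntertwiners_tmul, evalIntertwiners_tmul]; rfl
    | add a b ha hb => simp only [map_add, ha, hb]
  apply le_antisymm
  · rintro _ ⟨t, rfl⟩ X hXL
    rw [LinearMap.comp_apply, ← hX, ← LinearMap.comp_apply (f := LinearMap.lTensor _ _),
      ← LinearMap.lTensor_comp]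
    have : multRep a g x h.comm X ∘ₗ (highest (multRep a g x h.comm) Lp).subtype = 0 :=
      LinearMap.ext fun φ => φ.2 X hXL
    rw [this, LinearMap.lTensor_zero, LinearMap.zero_apply, map_zero]
  · intro f hf
    obtain ⟨t, rfl⟩ := hev.2 f
    let b := Module.finBasis ℂ W
    let E := TensorProduct.equivFinsuppOfBasisLeft (N := Mult a g) b
    have hE : ∀ i t X, E ((multRep a g x h.comm X).lTensor W t) i = multRep a g x h.comm X (E t i) := by
      intro i t X
      induction t using TensorProduct.induction_on with
      | zero => simp
      | tmul w φ =>
        rw [LinearMap.lTensor_tmul, TensorProduct.equivFinsuppOfBasisLeft_apply_tmul_apply,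
          TensorProduct.equivFinsuppOfBasisLeft_apply_tmul_apply, map_smul]
      | add a b ha hb => simp only [map_add, Finsupp.add_apply, ha, hb]
    have h1 : ∀ i, E t i ∈ highest (multRep a g x h.comm) Lp := by
      intro i X hXL
      rw [← hE]
      have : (multRep a g x h.comm X).lTensor W t = 0 := hev.1 (by rw [hX, hf X hXL, map_zero])
      rw [this, map_zero, Finsupp.zero_apply]
    have h2 : t = ∑ i, b i ⊗ₜ E t i := by
      refine E.injective (Finsupp.ext fun i => ?_)
      rw [map_sum, Finsupp.finsetSum_apply, Finset.sum_eq_single i]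
      · rw [TensorProduct.equivFinsuppOfBasisLeft_apply_tmul_apply]; simp
      · intro j _ hj
        rw [TensorProduct.equivFinsuppOfBasisLeft_apply_tmul_apply]
        simp [Finsupp.single_eq_of_ne hj.symm]
      · simp
    refine ⟨∑ i, b i ⊗ₜ ⟨E t i, h1 i⟩, ?_⟩
    conv_rhs => rw [h2]
    simp [map_sum]

end TwistData
end Toroidal

namespace Toroidal
open Module (End)

namespace TwistData
variable {n : ℕ} {𝔤 : Type*} [LieRing 𝔤] [LieAlgebra ℂ 𝔤] {D : TwistData n 𝔤}
  [FiniteDimensional ℂ 𝔤] [LieAlgebra.IsSimple ℂ 𝔤] {H : LieSubalgebra ℂ D.g00}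
  {P : Set (Module.Dual ℂ H)}

/-- An element of `𝔞` as an element of `𝔤(σ₀)`. -/
abbrev centFix (X : D.cent H) : D.gFix := ⟨X, D.cent_le_gFix H X.2⟩

omit [LieAlgebra.IsSimple ℂ 𝔤] in
/-- The highest weight vectors of a graded irreducible `𝔤(σ₀)`-module form a graded irreducible
`𝔞`-module. -/
lemma GradedRep.exists_highest_model {U : Type*} [AddCommGroup U] [Module ℂ U]
    {grU : D.Lam → Submodule ℂ U} {y : D.gFix →ₗ⁅ℂ⁆ End ℂ U} (h : GradedRep grU y) {h₀ : H}
    (ht : IsTriangular (toFix (h₀ : D.g00)) {x | ∃ α, -α ∈ P ∧ (x : 𝔤) ∈ wtSpace H α}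
      {x | (x : 𝔤) ∈ D.cent H} (posFix H P))
    (hcent : ((toFix (h₀ : D.g00) : D.gFix) : 𝔤) ∈ D.cent H) :
    ∃ (m : ℕ) (e : highest y (posFix H P) ≃ₗ[ℂ] Model m) (ρ : D.cent H →ₗ⁅ℂ⁆ End ℂ (Model m))
      (gr : D.Lam → Submodule ℂ (Model m)), Nontrivial (Model m) ∧ IsGrading gr ∧
      (∀ lam v, v ∈ gr lam ↔ (e.symm v : U) ∈ grU lam) ∧
      (∀ X v, (e.symm (ρ X v) : U) = y (centFix X) (e.symm v)) ∧
      (∀ l (X : D.cent H), (X : 𝔤) ∈ D.gradeSpace (emb l) → ∀ lam, ∀ v ∈ gr lam,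
        ρ X v ∈ gr (D.bar l + lam)) ∧
      ∀ N : Submodule ℂ (Model m), N ≤ ⨆ lam, N ⊓ gr lam → (∀ X, N ≤ N.comap (ρ X)) →
        N = ⊥ ∨ N = ⊤ := by
  have := h.finite
  have := h.nontrivial
  set U' := highest y (posFix H P) with hU'
  have hnt : Nontrivial U' := Submodule.nontrivial_iff_ne_bot.2 (ht.exists_mem_highest y)
  obtain ⟨m, ⟨e⟩⟩ := exists_equiv_model U'
  obtain ⟨c, -, hirr⟩ := h.highest_irreducible ht hcent
  let ρ₀ : D.cent H →ₗ⁅ℂ⁆ End ℂ U' :=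
    { toFun := fun X => (y (centFix X)).restrict (highest_stable X.2)
      map_add' := fun X Y => LinearMap.ext fun v => Subtype.ext (by
        change y (centFix X + centFix Y) v = _
        rw [map_add]; rfl)
      map_smul' := fun c X => LinearMap.ext fun v => Subtype.ext (by
        change y (c • centFix X) v = _
        rw [map_smul]; rfl)
      map_lie' := fun {X Y} => LinearMap.ext fun v => Subtype.ext (by
        change y ⁅centFix X, centFix Y⁆ v = _
        rw [LieHom.map_lie]; rfl) }
  let ι : Model m →ₗ[ℂ] U := U'.subtype ∘ₗ e.symm.toLinearMap
  have hgr : IsGrading fun lam => (grU lam).comap ι := by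
    have h1 := (h.grading.comap_subtype (N := U')
      (fun lam => highest_graded (H := H) (P := P) h.grading h.mem lam)).map_equiv e
    have h2 : (fun lam => (grU lam).comap ι) =
        fun lam => ((grU lam).comap U'.subtype).map e.toLinearMap := by
      ext lam v
      constructor
      · exact fun hv => ⟨e.symm v, hv, e.apply_symm_apply v⟩
      · rintro ⟨w, hw, rfl⟩
        change ((e.symm (e w) : U') : U) ∈ grU lam
        rwa [e.symm_apply_apply]
    rw [h2]; exact h1
  have hρ : ∀ X v, ι (e.lieConj.toLieHom.comp ρ₀ X v) = y (centFix X) (ι v) := fun X v => by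
    change ((e.symm (e (ρ₀ X (e.symm v))) : U') : U) = _
    rw [e.symm_apply_apply]; rfl
  refine ⟨m, e, e.lieConj.toLieHom.comp ρ₀, fun lam => (grU lam).comap ι, e.symm.nontrivial, hgr,
    fun lam v => Iff.rfl, hρ, fun l X hX lam v hv => ?_, fun N hN hst => ?_⟩
  · rw [Submodule.mem_comap, hρ]
    exact h.mem (D.bar l) (centFix X) (mem_gFixGr_bar.2 hX) lam _ hv
  rw [hgr.le_iSup_inf_iff] at hN
  by_cases hb : N = ⊥
  · exact Or.inl hb
  right
  have hιi : Function.Injective ι := U'.subtype_injective.comp e.symm.injective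
  have h1 := hirr (N.map ι) ?_ ?_ ?_ ?_
  · rw [eq_top_iff]
    rintro v -
    obtain ⟨w, hw, hwv⟩ := h1.ge (e.symm v).2
    rwa [← hιi (a₁ := w) (a₂ := v) hwv]
  · rintro _ ⟨v, -, rfl⟩
    exact (e.symm v).2
  · rintro lam _ ⟨v, hv, rfl⟩
    exact ⟨_, hN lam hv, (hgr.proj_comm h.grading (f := id) (x := ι) Function.injective_id
      (fun k v hv => hv) lam v).symm⟩
  · rintro X hX _ ⟨v, hv, rfl⟩
    exact ⟨_, hst ⟨X, hX⟩ hv, hρ _ _⟩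
  · intro h0
    rw [Submodule.eq_bot_iff] at h0
    exact hb ((Submodule.eq_bot_iff _).2 fun v hv => hιi ((h0 _ ⟨v, hv, rfl⟩).trans (map_zero _).symm))

lemma tauUp0_le (H : LieSubalgebra ℂ D.g00) : tauUp0 H ≤ D.tau0 := fun _ h => h.1

variable {V : Type*} [AddCommGroup V] [Module ℂ V] [LieRingModule D.tau V] [LieModule ℂ D.tau V]
  {ψ : Fin (n + 1) → ℂ}

lemma exists_topGr_ne_zero (hirr : LieModule.IsIrreducible ℂ D.tau V) (hV : D.IsBounded V ψ) :
    ∃ d, (∀ v ∈ D.topS V, ⁅D.d 0, v⁆ = d • v) ∧ ∃ (α : Fin n → ℂ) (v : D.topS V), v ≠ 0 ∧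
      v ∈ D.topGr V α d 0 := by
  obtain ⟨d, hd, v, hv, hv0⟩ := exists_d_topS (D := D) (V := V) hV
  refine ⟨d, hd, ?_⟩
  have G : IsGrading (D.weightSpace V) := .of_isInternal hV.isInternal
  by_contra! hne
  refine hv0 (G.eq_zero_of_proj fun lam => ?_)
  by_contra h0
  have h1 := proj_mem_topS G hv lam
  have h2 := G.proj_mem lam v
  have h3 : lam 0 = d := by
    have := (h2 0).symm.trans (hd _ h1)
    exact smul_left_injective ℂ h0 this
  refine hne (fun i => lam i.succ) ⟨_, h1⟩ (fun h => h0 (congrArg Subtype.val h)) ?_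
  have h4 : (Fin.cons d fun i => lam i.succ + ((0 : Lat n) i : ℂ) : Fin (n + 1) → ℂ) = lam := by
    ext i
    refine Fin.cases ?_ (fun i => ?_) i
    · simp [h3]
    · simp
  change G.proj lam v ∈ D.weightSpace V _
  rw [h4]
  exact h2

lemma exists_topData_of_isTensorAction {W₁ W₂ : Type} [AddCommGroup W₁] [Module ℂ W₁]
    [AddCommGroup W₂] [Module ℂ W₂] [LieRingModule (Matrix (Fin n) (Fin n) ℂ) W₁]
    [LieModule ℂ (Matrix (Fin n) (Fin n) ℂ) W₁] [LieRingModule (D.cent H) W₂]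
    [LieModule ℂ (D.cent H) W₂] [FiniteDimensional ℂ W₁] [FiniteDimensional ℂ W₂] [Nontrivial W₁]
    [Nontrivial W₂] {gr : D.Lam → Submodule ℂ W₂} (hgr : IsGrading gr) {α : Fin n → ℂ} {d C₀ : ℂ}
    (h₁ : ∀ N : Submodule ℂ W₁, (∀ A : Matrix (Fin n) (Fin n) ℂ,
      N ≤ N.comap (LieModule.toEnd ℂ _ W₁ A)) → N = ⊥ ∨ N = ⊤)
    (hl : ∀ (l : Lat n) (x : D.cent H), (x : 𝔤) ∈ D.gradeSpace (emb l) →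
      ∀ (lam : D.Lam), ∀ w ∈ gr lam, ⁅x, w⁆ ∈ gr (D.bar l + lam))
    (h₂ : ∀ N : Submodule ℂ W₂, N ≤ ⨆ lam, N ⊓ gr lam →
      (∀ X : D.cent H, N ≤ N.comap (LieModule.toEnd ℂ _ W₂ X)) → N = ⊥ ∨ N = ⊤)
    (hT : ∃ ρ : tauUp0 H →ₗ⁅ℂ⁆ End ℂ (TensorSpace W₁ gr),
      IsTensorAction (tauUp0 H) (D.cent H) gr (LieModule.toEnd ℂ (D.cent H) W₂) α d C₀ ρ ∧
      ∃ e : topT H V P ≃ₗ[ℂ] TensorSpace W₁ gr, ∀ x v, e ⁅x, v⁆ = ρ x (e v)) :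
    ∃ E : TopData H, TopTIso E P V C₀ := by
  let E : TopData H :=
    { W₁ := W₁
      finiteDimensional₁ := inferInstance
      irreducible₁ := LieModule.IsIrreducible.mk fun N hN => by
        have := (h₁ N.toSubmodule fun A w hw => N.lie_mem hw).resolve_left (by simpa using hN)
        simpa using this
      W₂ := W₂
      finiteDimensional₂ := inferInstance
      gr := gr
      isInternal := by convert hgr.isInternal
      lie_mem_gr := hl
      nontrivial₂ := inferInstance
      irreducible₂ := fun N hN => by
        have := h₂ N.toSubmodule hN fun A w hw => N.lie_mem hw
        simpa using this
      α := α
      d := d }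
  exact ⟨E, hT⟩

theorem exists_topData_of_isEval (hD : LieAlgebra.IsSimple ℂ D.g00) (hH : H.IsCartanSubalgebra)
    (hΔ : weights H ⊆ rootsEn H ∪ {0}) (hP : IsPositiveSystem (rootsEn H) P)
    {gr : Lat n → Submodule ℂ (D.topS V)} {α : Fin n → ℂ} {d C₀ : ℂ}
    (h : IsTop (LieModule.toEnd ℂ D.tau0 (D.topS V)) gr α d C₀)
    {F : Type*} [AddCommGroup F] [Module ℂ F] {grF : D.Lam → Submodule ℂ F}
    {g : Matrix (Fin n) (Fin n) ℂ →ₗ⁅ℂ⁆ End ℂ F} {x : D.gFix →ₗ⁅ℂ⁆ End ℂ F}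
    {q : D.topS V →ₗ[ℂ] F} (hFR : FiberRep grF g x)
    (he : IsEval (LieModule.toEnd ℂ D.tau0 (D.topS V)) gr α d C₀ grF g x q) :
    ∃ E : TopData H, TopTIso E P V C₀ := by
  have := hFR.finite
  have := hFR.nontrivial
  obtain ⟨h₀, ht⟩ := exists_isTriangular hD hH hΔ hP
  obtain ⟨m, a, φ, hnt, hWirr, hφ, hφa⟩ := exists_irreducible_model g
  have hnt' : Nontrivial (Mult (fun A => a A) g) := by
    refine ⟨⟨φ, hφa⟩, 0, fun h0 => ?_⟩
    obtain ⟨w, hw⟩ := exists_ne (0 : Model m)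
    exact hw (hφ ((LinearMap.congr_fun (congrArg Subtype.val h0) w).trans (map_zero _).symm))
  have hG := hFR.gradedRep_mult (a := fun A => a A) hWirr
  obtain ⟨m₂, e, ρ, gr₂, hnt₂, hgr₂, hgrU, hρ, hρgr, hirr₂⟩ :=
    hG.exists_highest_model ht (toFix_mem_cent hD hH h₀)
  let _ : LieRingModule (Matrix (Fin n) (Fin n) ℂ) (Model m) := LieRingModule.compLieHom (Model m) a
  have : LieModule ℂ (Matrix (Fin n) (Fin n) ℂ) (Model m) := LieModule.compLieHom (Model m) a
  let _ : LieRingModule (D.cent H) (Model m₂) := LieRingModule.compLieHom (Model m₂) ρ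
  have : LieModule ℂ (D.cent H) (Model m₂) := LieModule.compLieHom (Model m₂) ρ
  let U' := highest (multRep (fun A => a A) g x hFR.comm) (posFix H P)
  let ι : Model m₂ →ₗ[ℂ] Mult (fun A => a A) g := U'.subtype ∘ₗ e.symm.toLinearMap
  have hι : Function.Injective ι := U'.subtype_injective.comp e.symm.injective
  let ev : Model m ⊗[ℂ] Model m₂ →ₗ[ℂ] _ := evalIntertwiners (fun A => a A) (fun A => g A) ∘ₗ
    ι.lTensor (Model m)
  have hev : ∀ w u, ev (w ⊗ₜ u) = (ι u).1 w := fun w u => evalIntertwiners_tmul _ _ _ _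
  refine exists_topData_of_isTensorAction hgr₂ hWirr hρgr hirr₂
    (exists_isTensorAction (W := Model m) (U := Model m₂) (ev := ev) h he hFR.grading hgr₂ ?_ ?_ ?_ (D.cent_le_gFix H) ρ hρgr ?_ (tauUp0_le H)
    (j := (⟨⟨fun v => ⟨v, v.2.1⟩, fun _ _ => rfl⟩, fun _ _ => rfl⟩ : topT H V P →ₗ[ℂ] D.topS V))
    (fun v w hvw => Subtype.ext (congrArg (fun v : D.topS V => (v : V)) hvw)) (fun y v => rfl) ?_)
  · exact (hFR.evalIntertwiners_bijective hWirr).1.comp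
      (Module.Flat.lTensor_preserves_injective_linearMap _ hι)
  · intro lam w u hu
    rw [hev]
    exact (hgrU lam u).1 hu w
  · intro A w u
    rw [hev, hev]
    exact ((ι u).2 A w).symm
  · intro X w u
    rw [hev, hev]
    exact (LinearMap.congr_fun (congrArg Subtype.val (hρ X u)) w).symm
  · intro v
    have h1 : LinearMap.range ev = highest x (posFix H P) := by
      rw [← hFR.range_eval_highest hWirr]
      have : ev = (evalIntertwiners (fun A => a A) (fun A => g A) ∘ₗ U'.subtype.lTensor (Model m)) ∘ₗ
          e.symm.toLinearMap.lTensor (Model m) := by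
        rw [LinearMap.comp_assoc, ← LinearMap.lTensor_comp]
      rw [this, LinearMap.range_comp, LinearMap.range_eq_top.2, Submodule.map_top]
      exact LinearMap.lTensor_surjective _ e.symm.surjective
    rw [h1, ← mem_topT_iff_eval hD hH hΔ hP h he]
    constructor
    · rintro ⟨w, rfl⟩
      exact w.2
    · exact fun hv => ⟨⟨v, hv⟩, rfl⟩

theorem exists_topData (hirr : LieModule.IsIrreducible ℂ D.tau V) (hV : D.IsBounded V ψ)
    (hC₀ : ψ 0 ≠ 0) (hD : LieAlgebra.IsSimple ℂ D.g00) (hH : H.IsCartanSubalgebra)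
    (hΔ : weights H ⊆ rootsEn H ∪ {0}) (hP : IsPositiveSystem (rootsEn H) P) :
    ∃ E : TopData H, TopTIso E P V (ψ 0) := by
  obtain ⟨d, hd, α, v₀, hv₀, hvk⟩ := exists_topGr_ne_zero hirr hV
  have h := isTop_topS hV hC₀ hd hv₀ hvk
  obtain ⟨g, x, hFR, he⟩ := h.exists_fiberRep
  exact exists_topData_of_isEval hD hH hΔ hP h hFR he

end TwistData
end Toroidal

namespace Toroidal
open Module (End)

section Enveloping
variable {L M : Type*} [LieRing L] [LieAlgebra ℂ L] [AddCommGroup M] [Module ℂ M]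
  [Module (UniversalEnvelopingAlgebra ℂ L) M] [IsScalarTower ℂ (UniversalEnvelopingAlgebra ℂ L) M]

lemma smul_mem_of_ι_smul_mem {Q : Submodule ℂ M}
    (hQ : ∀ X : L, ∀ v ∈ Q, UniversalEnvelopingAlgebra.ι ℂ X • v ∈ Q)
    (u : UniversalEnvelopingAlgebra ℂ L) : ∀ v ∈ Q, u • v ∈ Q := by
  let A : Subalgebra ℂ (UniversalEnvelopingAlgebra ℂ L) :=
    { carrier := {u | ∀ v ∈ Q, u • v ∈ Q}
      mul_mem' := fun ha hb v hv => by rw [mul_smul]; exact ha _ (hb v hv)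
      add_mem' := fun ha hb v hv => by rw [add_smul]; exact add_mem (ha v hv) (hb v hv)
      algebraMap_mem' := fun c v hv => by rw [algebraMap_smul]; exact Q.smul_mem c hv }
  let f : L →ₗ⁅ℂ⁆ A :=
    { toFun := fun X => ⟨UniversalEnvelopingAlgebra.ι ℂ X, hQ X⟩
      map_add' := fun X Y => Subtype.ext (map_add _ X Y)
      map_smul' := fun c X => Subtype.ext (map_smul _ c X)
      map_lie' := fun {X Y} => Subtype.ext (LieHom.map_lie _ X Y) }
  have h1 : A.val.comp (UniversalEnvelopingAlgebra.lift ℂ f) = AlgHom.id ℂ _ := by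
    apply UniversalEnvelopingAlgebra.hom_ext
    ext X
    simp [f]
  have h2 := DFunLike.congr_fun h1 u
  have h3 := (UniversalEnvelopingAlgebra.lift ℂ f u).2
  change A.val (UniversalEnvelopingAlgebra.lift ℂ f u) = u at h2
  rw [← h2]
  exact h3

variable (L M) in
/-- The representation of `L` on a `U(L)`-module. -/
def envRep : L →ₗ⁅ℂ⁆ End ℂ M :=
  (AlgHom.toLieHom (Algebra.lsmul ℂ ℂ M : UniversalEnvelopingAlgebra ℂ L →ₐ[ℂ] End ℂ M)).comp
    (UniversalEnvelopingAlgebra.ι ℂ)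

lemma envRep_apply (X : L) (v : M) : envRep L M X v = UniversalEnvelopingAlgebra.ι ℂ X • v := rfl

end Enveloping

namespace TwistData
variable {n : ℕ} {𝔤 : Type*} [LieRing 𝔤] [LieAlgebra ℂ 𝔤] {D : TwistData n 𝔤}
  {H : LieSubalgebra ℂ D.g00}
  {P : Set (Module.Dual ℂ H)} {E : TopData H}

/-- The inclusion of `W₂` in the induced module. -/
def indMk (E : TopData H) (P : Set (Module.Dual ℂ H)) : E.W₂ →ₗ[ℂ] Ind E P :=
  (indRel E P).mkQ.restrictScalars ℂ ∘ₗ TensorProduct.mk ℂ D.UFix E.W₂ 1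

lemma indMk_apply (w : E.W₂) : indMk E P w = Submodule.Quotient.mk (1 ⊗ₜ[ℂ] w) := rfl

lemma smul_indMk (u : D.UFix) (w : E.W₂) : u • indMk E P w = Submodule.Quotient.mk (u ⊗ₜ[ℂ] w) := by
  rw [indMk_apply, ← Submodule.Quotient.mk_smul, TensorProduct.smul_tmul', smul_eq_mul, mul_one]

lemma eq_top_of_indMk_mem {Q : Submodule ℂ (Ind E P)}
    (hQ : ∀ X : D.gFix, ∀ v ∈ Q, UniversalEnvelopingAlgebra.ι ℂ X • v ∈ Q)
    (h1 : ∀ w, indMk E P w ∈ Q) : Q = ⊤ := by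
  rw [eq_top_iff]
  rintro v -
  obtain ⟨t, rfl⟩ := Submodule.Quotient.mk_surjective _ v
  induction t using TensorProduct.induction_on with
  | zero => rw [Submodule.Quotient.mk_zero]; exact zero_mem _
  | tmul u w => rw [← smul_indMk]; exact smul_mem_of_ι_smul_mem hQ u _ (h1 w)
  | add a b ha hb => rw [Submodule.Quotient.mk_add]; exact add_mem ha hb

lemma ι_smul_indMk_cent (X : D.cent H) (w : E.W₂) :
    UniversalEnvelopingAlgebra.ι ℂ (centFix X) • indMk E P w = indMk E P ⁅X, w⁆ := by
  rw [smul_indMk, indMk_apply, Submodule.Quotient.eq]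
  exact Submodule.subset_span (Or.inl ⟨X, w, rfl⟩)

lemma ι_smul_indMk_pos {X : D.gFix} (hX : X ∈ posFix H P) (w : E.W₂) :
    UniversalEnvelopingAlgebra.ι ℂ X • indMk E P w = 0 := by
  obtain ⟨α, hα, hX⟩ := hX
  rw [smul_indMk, Submodule.Quotient.mk_eq_zero]
  exact Submodule.subset_span (Or.inr ⟨α, hα, X, w, hX, rfl⟩)

lemma TopData.grading (E : TopData H) : IsGrading E.gr := .of_isInternal E.isInternal

lemma ι_smul_mem_indGr {mu lam : D.Lam} {X : D.gFix} (hX : X ∈ D.gFixGr mu) {v : Ind E P}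
    (hv : v ∈ indGr E P lam) : UniversalEnvelopingAlgebra.ι ℂ X • v ∈ indGr E P (mu + lam) := by
  have : indGr E P lam ≤ (indGr E P (mu + lam)).comap (envRep D.gFix (Ind E P) X) := by
    refine Submodule.span_le.2 fun v hv => Submodule.subset_span ?_
    have := IsHomog.act mu.out lam X (mem_gFixGr.1 hX) v hv
    rwa [bar_out] at this
  exact this hv

lemma iSup_indGr [FiniteDimensional ℂ 𝔤] : ⨆ lam, indGr E P lam = ⊤ := by
  refine eq_top_of_indMk_mem (fun X v hv => ?_) fun w => ?_
  · have h1 : ∀ mu, ∀ X ∈ D.gFixGr mu, envRep D.gFix (Ind E P) X v ∈ ⨆ lam, indGr E P lam := by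
      intro mu X hX
      have : ⨆ lam, indGr E P lam ≤ (⨆ lam, indGr E P lam).comap (envRep D.gFix (Ind E P) X) :=
        iSup_le fun lam v hv => Submodule.mem_iSup_of_mem (mu + lam) (ι_smul_mem_indGr hX hv)
      exact this hv
    exact apply_mem_of_homogeneous h1 X
  · have : (⊤ : Submodule ℂ E.W₂) ≤ (⨆ lam, indGr E P lam).comap (indMk E P) := by
      rw [← E.grading.iSup_eq_top]
      exact iSup_le fun lam w hw =>
        Submodule.mem_iSup_of_mem lam (Submodule.subset_span (.base lam w hw))
    exact this Submodule.mem_top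

lemma range_indMk_le {h₀ : H} (hcent : ((toFix (h₀ : D.g00) : D.gFix) : 𝔤) ∈ D.cent H) {c : ℂ}
    (hc : ∀ w : E.W₂, ⁅(⟨_, hcent⟩ : D.cent H), w⁆ = c • w) : LinearMap.range (indMk E P) ≤
      (envRep D.gFix (Ind E P) (toFix (h₀ : D.g00))).eigenspace c := by
  rintro _ ⟨w, rfl⟩
  rw [End.mem_eigenspace_iff]
  refine (ι_smul_indMk_cent ⟨_, hcent⟩ w).trans ?_
  rw [hc, map_smul]

/-- The induced module is spanned by `W₂` and vectors of lower weight. -/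
lemma top_le_range_indMk_sup {h₀ : H}
    (ht : IsTriangular (toFix (h₀ : D.g00)) {x | ∃ α, -α ∈ P ∧ (x : 𝔤) ∈ wtSpace H α}
      {x | (x : 𝔤) ∈ D.cent H} (posFix H P))
    (hcent : ((toFix (h₀ : D.g00) : D.gFix) : 𝔤) ∈ D.cent H) {c : ℂ}
    (hc : ∀ w : E.W₂, ⁅(⟨_, hcent⟩ : D.cent H), w⁆ = c • w) : ⊤ ≤ LinearMap.range (indMk E P) ⊔
      lowerEigen (envRep D.gFix (Ind E P) (toFix (h₀ : D.g00))) c := by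
  have h1 : repSpan (envRep D.gFix (Ind E P)) (LinearMap.range (indMk E P)) = ⊤ :=
    eq_top_of_indMk_mem (fun X v hv => repSpan_stable _ _ X hv) fun w => le_repSpan _ _ ⟨w, rfl⟩
  rw [← h1]
  refine ht.repSpan_le_sup (range_indMk_le hcent hc) ?_ ?_
  · rintro X hX _ ⟨w, rfl⟩
    exact ι_smul_indMk_pos hX w
  · rintro X hX _ ⟨w, rfl⟩
    have hX' : (X : 𝔤) ∈ D.cent H := hX
    have e := ι_smul_indMk_cent (P := P) ⟨X, hX'⟩ w
    rw [envRep_apply]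
    change UniversalEnvelopingAlgebra.ι ℂ (centFix ⟨(X : 𝔤), hX'⟩) • indMk E P w ∈ _
    rw [e]
    exact LinearMap.mem_range_self _ _

section Quotient
variable {U : Type*} [AddCommGroup U] [Module ℂ U] [Module D.UFix U] [IsScalarTower ℂ D.UFix U]
  {φ : E.W₂ →ₗ[ℂ] U}

/-- The universal property of the induced module. -/
lemma exists_indLift
    (hφ : ∀ (X : D.cent H) w, φ ⁅X, w⁆ = UniversalEnvelopingAlgebra.ι ℂ (centFix X) • φ w)
    (hφ' : ∀ w, ∀ X ∈ posFix H P, UniversalEnvelopingAlgebra.ι ℂ X • φ w = 0) :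
    ∃ Ψ : Ind E P →ₗ[D.UFix] U, ∀ w, Ψ (indMk E P w) = φ w := by
  let b : D.UFix →ₗ[D.UFix] E.W₂ →ₗ[ℂ] U :=
    { toFun := fun u => Algebra.lsmul ℂ ℂ U u ∘ₗ φ
      map_add' := fun u v => LinearMap.ext fun w => add_smul _ _ _
      map_smul' := fun u v => LinearMap.ext fun w => mul_smul _ _ _ }
  let Ψ₀ : D.UFix ⊗[ℂ] E.W₂ →ₗ[D.UFix] U := TensorProduct.AlgebraTensorModule.lift b
  have h0 : ∀ u w, Ψ₀ (u ⊗ₜ w) = u • φ w := fun u w => rfl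
  refine ⟨(indRel E P).liftQ Ψ₀ (Submodule.span_le.2 ?_), fun w => ?_⟩
  · rintro _ (⟨X, w, rfl⟩ | ⟨α, hα, X, w, hX, rfl⟩)
    · rw [SetLike.mem_coe, LinearMap.mem_ker, map_sub, h0, h0, one_smul, hφ, sub_self]
    · rw [SetLike.mem_coe, LinearMap.mem_ker, h0]
      exact hφ' w X ⟨α, hα, hX⟩
  · exact (h0 1 w).trans (one_smul _ _)

variable {Ψ : Ind E P →ₗ[D.UFix] U} (hΨ : ∀ w, Ψ (indMk E P w) = φ w)
  {grU : D.Lam → Submodule ℂ U} (h : GradedRep grU (envRep D.gFix U))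
  (hgr : ∀ lam, ∀ w ∈ E.gr lam, φ w ∈ grU lam) (hinj : Function.Injective φ)
include hΨ h hgr

lemma indLift_mem {lam : D.Lam} {v : Ind E P} (hv : v ∈ indGr E P lam) : Ψ v ∈ grU lam := by
  have : indGr E P lam ≤ (grU lam).comap (Ψ.restrictScalars ℂ) := by
    clear hv
    refine Submodule.span_le.2 fun v hv => ?_
    change Ψ v ∈ grU lam
    induction hv with
    | base lam w hw => rw [← indMk_apply, hΨ]; exact hgr lam w hw
    | act l lam x hx y hy ih =>
      rw [map_smul]
      exact h.mem _ x (mem_gFixGr_bar.2 hx) lam _ ih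
  exact this hv

omit hΨ hgr in
lemma map_graded {N : Submodule D.UFix (Ind E P)} (hΨm : ∀ lam, ∀ v ∈ indGr E P lam, Ψ v ∈ grU lam)
    (hN : N.restrictScalars ℂ ≤ ⨆ lam, N.restrictScalars ℂ ⊓ indGr E P lam)
    (hne : ¬ N ≤ LinearMap.ker Ψ) : N.map Ψ = ⊤ := by
  have h1 := h.irreducible ((N.map Ψ).restrictScalars ℂ) (h.grading.le_iSup_inf_iff.1 ?_)
    (fun X v hv => (N.map Ψ).smul_mem _ hv)
  · rcases h1 with h1 | h1
    · refine absurd (fun v hv => ?_) hne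
      have : Ψ v ∈ (N.map Ψ).restrictScalars ℂ := ⟨v, hv, rfl⟩
      rw [h1] at this
      exact LinearMap.mem_ker.2 (by simpa using this)
    · rwa [Submodule.restrictScalars_eq_top_iff] at h1
  · rintro _ ⟨v, hv, rfl⟩
    have h2 : ⨆ lam, N.restrictScalars ℂ ⊓ indGr E P lam ≤
        (⨆ lam, (N.map Ψ).restrictScalars ℂ ⊓ grU lam).comap (Ψ.restrictScalars ℂ) :=
      iSup_le fun lam v hv => Submodule.mem_iSup_of_mem lam ⟨⟨v, hv.1, rfl⟩, hΨm lam v hv.2⟩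
    exact h2 (hN hv)

include hinj in
/-- The maximal graded submodule is the kernel of the map to a graded irreducible module. -/
lemma maxGraded_eq_ker [FiniteDimensional ℂ 𝔤] {h₀ : H}
    (ht : IsTriangular (toFix (h₀ : D.g00)) {x | ∃ α, -α ∈ P ∧ (x : 𝔤) ∈ wtSpace H α}
      {x | (x : 𝔤) ∈ D.cent H} (posFix H P))
    (hcent : ((toFix (h₀ : D.g00) : D.gFix) : 𝔤) ∈ D.cent H)
    (hφ : ∀ (X : D.cent H) w, φ ⁅X, w⁆ = UniversalEnvelopingAlgebra.ι ℂ (centFix X) • φ w)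
    (hφ' : ∀ w, ∀ X ∈ posFix H P, UniversalEnvelopingAlgebra.ι ℂ X • φ w = 0) :
    maxGraded E P = LinearMap.ker Ψ := by
  have hm : ∀ lam, ∀ v ∈ indGr E P lam, Ψ v ∈ grU lam := fun lam v hv =>
    indLift_mem hΨ h hgr hv
  apply le_antisymm
  · refine sSup_le fun N hN => ?_
    by_contra hne
    have hmap := map_graded h hm hN.2 hne
    obtain ⟨c, hc, -⟩ := h.highest_irreducible ht hcent
    have hφc : ∀ w, φ w ∈ (envRep D.gFix U (toFix (h₀ : D.g00))).eigenspace c := fun w =>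
      hc fun X hX => hφ' w X hX
    set T := envRep D.gFix (Ind E P) (toFix (h₀ : D.g00)) with hT
    have hc' : ∀ w : E.W₂, ⁅(⟨_, hcent⟩ : D.cent H), w⁆ = c • w := fun w => hinj (by
      rw [hφ, map_smul]
      exact End.mem_eigenspace_iff.1 (hφc w))
    have hWc := range_indMk_le (P := P) hcent hc'
    have hdec := top_le_range_indMk_sup ht hcent hc'
    have hlow : lowerEigen T c ≤ (lowerEigen (envRep D.gFix U (toFix (h₀ : D.g00))) c).comap
        (Ψ.restrictScalars ℂ) := by
      refine iSup_le fun m v hv => Submodule.mem_iSup_of_mem m ?_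
      rw [End.mem_eigenspace_iff] at hv ⊢
      have h2 : Ψ (UniversalEnvelopingAlgebra.ι ℂ (toFix (h₀ : D.g00)) • v) =
          UniversalEnvelopingAlgebra.ι ℂ (toFix (h₀ : D.g00)) • Ψ v := map_smul _ _ _
      refine h2.symm.trans ?_
      rw [← map_smul]
      exact congrArg (Ψ.restrictScalars ℂ) hv
    refine hN.1 ?_
    have hmem : ∀ w, indMk E P w ∈ N := by
      intro w
      obtain ⟨v, hv, hvw⟩ := hmap.ge (Submodule.mem_top (x := φ w))
      obtain ⟨_, ⟨w', rfl⟩, f, hf, rfl⟩ := Submodule.mem_sup.1 (hdec (Submodule.mem_top (x := v)))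
      rw [map_add, hΨ] at hvw
      have h3 : Ψ f ∈ (envRep D.gFix U (toFix (h₀ : D.g00))).eigenspace c := by
        have := sub_mem (hφc w) (hφc w')
        rwa [← hvw, add_sub_cancel_left] at this
      have h4 : Ψ f = 0 := by
        simpa using (disjoint_lowerEigen _ c).le_bot ⟨h3, hlow hf⟩
      rw [h4, add_zero] at hvw
      rw [← hinj hvw]
      exact eigencomponent_mem (T := T) (N := N.restrictScalars ℂ) (fun v hv => N.smul_mem _ hv)
        (End.mem_eigenspace_iff.1 (hWc ⟨w', rfl⟩)) (lowerEigen_le T c hf) hv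
    have := eq_top_of_indMk_mem (Q := N.restrictScalars ℂ) (fun X v hv => N.smul_mem _ hv) hmem
    rwa [Submodule.restrictScalars_eq_top_iff] at this
  · refine le_sSup ⟨fun htop => ?_, fun v hv => ?_⟩
    · have := E.nontrivial₂
      obtain ⟨w, hw⟩ := exists_ne (0 : E.W₂)
      refine hw (hinj ?_)
      rw [← hΨ, map_zero]
      exact LinearMap.mem_ker.1 (htop.ge Submodule.mem_top)
    · have hv' : v ∈ ⨆ lam, indGr E P lam := iSup_indGr (E := E) (P := P) ▸ Submodule.mem_top
      rw [Submodule.mem_iSup_iff_exists_finsupp] at hv'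
      obtain ⟨f, hf, rfl⟩ := hv'
      refine sum_mem fun lam _ => Submodule.mem_iSup_of_mem lam ⟨?_, hf lam⟩
      have h1 : Ψ (f.sum fun _ x => x) = 0 := hv
      have h2 : h.grading.proj lam (Ψ (f.sum fun _ x => x)) = Ψ (f lam) := by
        rw [Finsupp.sum, map_sum, map_sum, Finset.sum_eq_single lam,
          h.grading.proj_of_mem (hm lam _ (hf lam))]
        · intro mu _ hmu
          exact h.grading.proj_of_ne hmu.symm (hm mu _ (hf mu))
        · intro hlam
          rw [Finsupp.notMem_support_iff.1 hlam, map_zero, map_zero]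
      rw [h1, map_zero] at h2
      exact h2.symm

end Quotient
end TwistData
end Toroidal

namespace Toroidal
open Module (End)

/-- A degree preserving map to a graded space is surjective in each degree onto its image. -/
lemma IsGrading.exists_mem_apply_eq {ι M N : Type*} [AddCommGroup M] [Module ℂ M] [AddCommGroup N]
    [Module ℂ N] {gr : ι → Submodule ℂ N} (h : IsGrading gr) {gr' : ι → Submodule ℂ M}
    {f : M →ₗ[ℂ] N} (hf : ∀ k, ∀ v ∈ gr' k, f v ∈ gr k) {v : M} (hv : v ∈ ⨆ k, gr' k) {k : ι}
    (hk : f v ∈ gr k) : ∃ v' ∈ gr' k, f v' = f v := by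
  classical
  rw [Submodule.mem_iSup_iff_exists_finsupp] at hv
  obtain ⟨g, hg, rfl⟩ := hv
  refine ⟨g k, hg k, ?_⟩
  rw [← h.proj_of_mem hk, Finsupp.sum, map_sum, map_sum, Finset.sum_eq_single k,
    h.proj_of_mem (hf k _ (hg k))]
  · intro j _ hj
    exact h.proj_of_ne hj.symm (hf j _ (hg j))
  · intro hk'
    rw [Finsupp.notMem_support_iff.1 hk', map_zero, map_zero]

namespace TwistData
variable {n : ℕ} {𝔤 : Type*} [LieRing 𝔤] [LieAlgebra ℂ 𝔤] {D : TwistData n 𝔤}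
  {H : LieSubalgebra ℂ D.g00} {P : Set (Module.Dual ℂ H)} {E : TopData H}
  {U : Type*} [AddCommGroup U] [Module ℂ U] {grU : D.Lam → Submodule ℂ U} {φ : E.W₂ →ₗ[ℂ] U}
  [FiniteDimensional ℂ 𝔤] {h₀ : H}

lemma exists_sigma_equiv_of_module [Module D.UFix U] [IsScalarTower ℂ D.UFix U]
    (h : GradedRep grU (envRep D.gFix U))
    (hgr : ∀ lam, ∀ w ∈ E.gr lam, φ w ∈ grU lam) (hinj : Function.Injective φ)
    (ht : IsTriangular (toFix (h₀ : D.g00)) {x | ∃ α, -α ∈ P ∧ (x : 𝔤) ∈ wtSpace H α}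
      {x | (x : 𝔤) ∈ D.cent H} (posFix H P))
    (hcent : ((toFix (h₀ : D.g00) : D.gFix) : 𝔤) ∈ D.cent H)
    (hφ : ∀ (X : D.cent H) w, φ ⁅X, w⁆ = envRep D.gFix U (centFix X) (φ w))
    (hφ' : ∀ w, φ w ∈ highest (envRep D.gFix U) (posFix H P)) :
    ∃ e : W₂σ E P ≃ₗ[ℂ] U, (∀ X v, e (actσ E P X v) = envRep D.gFix U X (e v)) ∧
      ∀ lam v, v ∈ grσ E P lam ↔ e v ∈ grU lam := by
  have hφ'' : ∀ w, ∀ X ∈ posFix H P, UniversalEnvelopingAlgebra.ι ℂ X • φ w = 0 :=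
    fun w X hX => hφ' w X hX
  obtain ⟨Ψ, hΨ⟩ := exists_indLift (P := P) hφ hφ''
  have hm : ∀ lam, ∀ v ∈ indGr E P lam, Ψ v ∈ grU lam := fun lam v hv =>
    indLift_mem hΨ h hgr hv
  have hker := maxGraded_eq_ker hΨ h hgr hinj ht hcent hφ hφ''
  have hsurj : LinearMap.range Ψ = ⊤ := by
    rw [← Submodule.map_top]
    refine map_graded h hm ?_ fun hle => ?_
    · have : (⊤ : Submodule D.UFix (Ind E P)).restrictScalars ℂ = ⊤ := rfl
      simp only [this, top_inf_eq, iSup_indGr, le_refl]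
    · have := E.nontrivial₂
      obtain ⟨w, hw⟩ := exists_ne (0 : E.W₂)
      refine hw (hinj ?_)
      rw [← hΨ, map_zero]
      exact LinearMap.mem_ker.1 (hle Submodule.mem_top)
  let e₀ : W₂σ E P ≃ₗ[D.UFix] U := (Submodule.quotEquivOfEq _ _ hker).trans
    (Ψ.quotKerEquivOfSurjective (LinearMap.range_eq_top.1 hsurj))
  have he₀ : ∀ v : Ind E P, e₀ (Submodule.Quotient.mk v) = Ψ v := fun v => rfl
  refine ⟨e₀.restrictScalars ℂ, fun X v => map_smul e₀ _ v, fun lam v => ⟨?_, fun hv => ?_⟩⟩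
  · rintro ⟨v, hv, rfl⟩
    exact hm lam v hv
  · obtain ⟨v, rfl⟩ := Submodule.Quotient.mk_surjective _ v
    obtain ⟨v', hv', hvv'⟩ := h.grading.exists_mem_apply_eq (f := Ψ.restrictScalars ℂ) hm
      (v := v) (by rw [iSup_indGr]; exact Submodule.mem_top) hv
    refine ⟨v', hv', e₀.injective ?_⟩
    exact hvv'

lemma exists_sigma_equiv {y : D.gFix →ₗ⁅ℂ⁆ End ℂ U} (h : GradedRep grU y)
    (hgr : ∀ lam, ∀ w ∈ E.gr lam, φ w ∈ grU lam) (hinj : Function.Injective φ)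
    (ht : IsTriangular (toFix (h₀ : D.g00)) {x | ∃ α, -α ∈ P ∧ (x : 𝔤) ∈ wtSpace H α}
      {x | (x : 𝔤) ∈ D.cent H} (posFix H P))
    (hcent : ((toFix (h₀ : D.g00) : D.gFix) : 𝔤) ∈ D.cent H)
    (hφ : ∀ (X : D.cent H) w, φ ⁅X, w⁆ = y (centFix X) (φ w))
    (hφ' : ∀ w, φ w ∈ highest y (posFix H P)) :
    ∃ e : W₂σ E P ≃ₗ[ℂ] U, (∀ X v, e (actσ E P X v) = y X (e v)) ∧
      ∀ lam v, v ∈ grσ E P lam ↔ e v ∈ grU lam := by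
  let _ : Module D.UFix U := Module.compHom U (UniversalEnvelopingAlgebra.lift ℂ y).toRingHom
  have hs : ∀ (u : D.UFix) (v : U), u • v = UniversalEnvelopingAlgebra.lift ℂ y u v :=
    fun _ _ => rfl
  have : IsScalarTower ℂ D.UFix U := ⟨fun c u v => by
    rw [hs, hs, map_smul, LinearMap.smul_apply]⟩
  have hy : envRep D.gFix U = y := by
    ext X v
    rw [envRep_apply, hs, UniversalEnvelopingAlgebra.lift_ι_apply]
  rw [← hy] at h hφ' ⊢
  simp only [← hy] at hφ
  exact exists_sigma_equiv_of_module h hgr hinj ht hcent hφ hφ'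

end TwistData
end Toroidal

namespace Toroidal
open Module (End)

namespace TwistData
variable {n : ℕ} {𝔤 : Type*} [LieRing 𝔤] [LieAlgebra ℂ 𝔤] {D : TwistData n 𝔤}

section Mono
variable {W U : Type*} [AddCommGroup W] [Module ℂ W] [AddCommGroup U] [Module ℂ U]
  {grU : D.Lam → Submodule ℂ U}

variable (W grU) in
/-- The monomials `w ⊗ u ⊗ t^k` as a bilinear map. -/
def monoLin (k : Lat n) : W →ₗ[ℂ] grU (D.bar k) →ₗ[ℂ] TensorSpace W grU :=
  (TensorProduct.mk ℂ W (grU (D.bar k))).compr₂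
    (DirectSum.lof ℂ (Lat n) (fun k : Lat n => W ⊗[ℂ] grU (D.bar k)) k)

lemma monoLin_apply {k : Lat n} (w : W) {u : U} (hu : u ∈ grU (D.bar k)) :
    monoLin W grU k w ⟨u, hu⟩ = mono k w u hu := rfl

lemma mono_smul {k : Lat n} (c : ℂ) (w : W) {u : U} (hu : u ∈ grU (D.bar k)) :
    mono k (c • w) u hu = c • mono k w u hu := by
  rw [← monoLin_apply, map_smul]; rfl

lemma mono_congr {k k' : Lat n} (h : k = k') (w : W) {u : U} (hu : u ∈ grU (D.bar k))
    (hu' : u ∈ grU (D.bar k')) : mono k w u hu = mono k' w u hu' := by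
  subst h; rfl

lemma eq_zero_of_mono_eq_zero {k : Lat n} {w : W} (hw : w ≠ 0) {u : U} (hu : u ∈ grU (D.bar k))
    (h : mono k w u hu = 0) : u = 0 := by
  classical
  have h1 : w ⊗ₜ[ℂ] (⟨u, hu⟩ : grU (D.bar k)) = 0 :=
    DirectSum.of_injective (β := fun k : Lat n => W ⊗[ℂ] grU (D.bar k)) k (h.trans (map_zero _).symm)
  obtain ⟨f, hf⟩ := Module.Projective.exists_dual_ne_zero ℂ hw
  have h2 := congrArg (TensorProduct.lift (LinearMap.lsmul ℂ (grU (D.bar k)) ∘ₗ f)) h1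
  rw [map_zero] at h2
  have h3 : f w • (⟨u, hu⟩ : grU (D.bar k)) = 0 := h2
  exact congrArg Subtype.val ((smul_eq_zero.1 h3).resolve_left hf)

end Mono

variable [FiniteDimensional ℂ 𝔤] [LieAlgebra.IsSimple ℂ 𝔤] {H : LieSubalgebra ℂ D.g00}

lemma coe_e0_zero (i : Fin (n + 1)) : (D.e0 0 (Pi.single i 1) : D.tau) = D.d i :=
  de_congr (D.emb_sc_mem 0) (zero_mem _) (by rw [sc_zero, emb_zero]) _

lemma e0_mem_tauUp0 (r : Lat n) (w : Fin (n + 1) → ℂ) : (D.e0 r w : D.tau) ∈ tauUp0 H :=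
  ⟨(D.e0 r w).2, fun h => lie_hh_e0 h r w⟩

lemma c0_mem_tauUp0 (r : Lat n) (w : Fin (n + 1) → ℂ) : (D.c0 r w : D.tau) ∈ tauUp0 H :=
  ⟨(D.c0 r w).2, fun h => lie_hh_c0 h r w⟩

lemma x0_mem_tauUp0 {l : Lat n} {X : 𝔤} (hX : X ∈ D.gradeSpace (emb l)) (hX' : X ∈ D.cent H) :
    (D.x0 l X hX : D.tau) ∈ tauUp0 H :=
  ⟨(D.x0 l X hX).2, fun h => by
    rw [lie_hh_x0 (α := 0) h l X hX ((mem_cent_iff (x := ⟨X, hX'.1⟩)).1 hX')]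
    exact zero_smul _ _⟩

section Action
variable {W U : Type*} [AddCommGroup W] [Module ℂ W] [AddCommGroup U] [Module ℂ U]
  [LieRingModule (Matrix (Fin n) (Fin n) ℂ) W]
  {grU : D.Lam → Submodule ℂ U} {α : Fin n → ℂ} {d C₀ : ℂ}
  {ρU : D.cent H →ₗ⁅ℂ⁆ End ℂ U} {ρ : tauUp0 H →ₗ⁅ℂ⁆ End ℂ (TensorSpace W grU)}
  (hA : IsTensorAction (tauUp0 H) (D.cent H) grU ρU α d C₀ ρ)
  {k : Lat n} (w : W) {u : U} (hu : u ∈ grU (D.bar k))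
include hA

lemma IsTensorAction.e0_apply (r : Lat n) (a : Fin n → ℂ) :
    ρ ⟨D.e0 r (Fin.cons 0 a), e0_mem_tauUp0 _ _⟩ (mono k w u hu) = mono (k + D.sc r)
      ((∑ i, a i * (k i + α i)) • w + ∑ i, ∑ j, (a i * D.sc r j) •
        ⁅(Matrix.single j i 1 : Matrix (Fin n) (Fin n) ℂ), w⁆) u (by rwa [bar_add_sc]) := by
  obtain ⟨hv', e⟩ := hA.der (D.sc r) (D.sc_mem r) a ⟨D.e0 r (Fin.cons 0 a), e0_mem_tauUp0 _ _⟩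
    (sum_smul_dd _ a).symm k w u hu
  exact e

lemma IsTensorAction.d_succ_apply (i : Fin n) {y : tauUp0 H} (hy : (y : D.tau) = D.d i.succ) :
    ρ y (mono k w u hu) = (α i + k i) • mono k w u hu := by
  have hy' : y = ⟨D.e0 0 (Fin.cons 0 (Pi.single i 1)), e0_mem_tauUp0 _ _⟩ :=
    Subtype.ext (hy.trans (by
      rw [← coe_e0_zero]
      congr 2
      ext j
      refine Fin.cases ?_ (fun j => ?_) j <;> simp [Pi.single_apply]))
  rw [hy', hA.e0_apply, mono_congr (k' := k) (by simp [sc_zero]) _ _ hu]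
  simp [sc_zero, Pi.single_apply, mono_smul, add_comm]

lemma IsTensorAction.d_zero_apply {y : tauUp0 H} (hy : (y : D.tau) = D.d 0) :
    ρ y (mono k w u hu) = d • mono k w u hu := by
  obtain ⟨hv', e⟩ := hA.der₀ 0 (zero_mem _) y (hy.trans
    (de_congr (zero_mem _) (emb_mem_gam (zero_mem _)) emb_zero.symm _)) k w u hu
  rw [e, mono_congr (k' := k) (add_zero k) _ _ hu, mono_smul]

variable {M F : Type*} [AddCommGroup M] [Module ℂ M] [AddCommGroup F] [Module ℂ F]
  {gr : Lat n → Submodule ℂ M} {grF : D.Lam → Submodule ℂ F} {q : M →ₗ[ℂ] F}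
  {π : D.tau0 →ₗ⁅ℂ⁆ End ℂ M} {g : Matrix (Fin n) (Fin n) ℂ →ₗ⁅ℂ⁆ End ℂ F}
  {x : D.gFix →ₗ⁅ℂ⁆ End ℂ F} (h : IsTop π gr α d C₀) (he : IsEval π gr α d C₀ grF g x q)
  {Φ : TensorSpace W grU →ₗ[ℂ] M}
  (hΦ : ∀ (y : tauUp0 H) f, π ⟨y, y.2.1⟩ (Φ f) = Φ (ρ y f))
include h hΦ

lemma map_mono_mem : Φ (mono k w u hu) ∈ gr k := by
  rw [h.mem_gr]
  intro i
  have := hΦ ⟨_, e0_mem_tauUp0 0 (Pi.single i.succ 1)⟩ (mono k w u hu)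
  rw [hA.d_succ_apply w hu i (coe_e0_zero _), map_smul] at this
  exact this

include he

lemma eval_mono_congr {k' : Lat n} (hk : D.bar k = D.bar k') (hu' : u ∈ grU (D.bar k')) :
    q (Φ (mono k w u hu)) = q (Φ (mono k' w u hu')) := by
  obtain ⟨r, rfl⟩ := bar_eq_iff.1 hk
  have h1 := hΦ ⟨_, c0_mem_tauUp0 r (Pi.single 0 1)⟩ (mono k w u hu)
  obtain ⟨hv', e⟩ := hA.cen₀ (D.sc r) (D.sc_mem r) ⟨_, c0_mem_tauUp0 r (Pi.single 0 1)⟩ rfl k w u hu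
  rw [e, mono_smul] at h1
  have h2 := he.c0 r (Pi.single 0 1) (Φ (mono k w u hu))
  have h3 : C₀ • q (Φ (mono (k + D.sc r) w u hv')) = C₀ • q (Φ (mono k w u hu)) := by
    rw [← map_smul, ← map_smul]
    refine (congrArg q h1.symm).trans (h2.trans ?_)
    simp
  exact (smul_right_injective F h.ne_zero h3).symm

lemma eval_mono_gl [LieModule ℂ (Matrix (Fin n) (Fin n) ℂ) W] (A : Matrix (Fin n) (Fin n) ℂ) :
    q (Φ (mono k ⁅A, w⁆ u hu)) = g A (q (Φ (mono k w u hu))) := by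
  let f : W →ₗ[ℂ] F := q ∘ₗ Φ ∘ₗ (monoLin W grU k).flip ⟨u, hu⟩
  have hf : ∀ w, q (Φ (mono k w u hu)) = f w := fun w => rfl
  have h1 : ∀ i j, f ⁅(Matrix.single j i 1 : Matrix (Fin n) (Fin n) ℂ), w⁆ =
      g (Matrix.single j i 1) (f w) := by
    intro i j
    have h2 := he.e0 (Pi.single j 1) (Pi.single i 1) k _ (map_mono_mem hA w hu h hΦ)
    have h3 := hΦ ⟨_, e0_mem_tauUp0 (Pi.single j 1) (Fin.cons 0 (Pi.single i 1))⟩ (mono k w u hu)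
    rw [hA.e0_apply] at h3
    have h4 := (congrArg q h3).symm.trans h2
    have h5 : ∀ {B : Type _} [AddCommGroup B] [Module ℂ B] (f : Fin n → Fin n → B),
        ∑ i', ∑ j', ((Pi.single i 1 : Fin n → ℂ) i' *
        (D.sc (Pi.single j 1) j' : ℂ)) • f i' j' = (D.m j.succ : ℂ) • f i j := by
      intro B _ _ f
      rw [Finset.sum_eq_single i, Finset.sum_eq_single j]
      · simp [sc]
      · intro b _ hb; simp [sc, hb]
      · simp
      · intro b _ hb; simp [hb]
      · simp
    rw [eval_mono_congr hA _ _ h he hΦ (bar_add_sc k _) hu, hf, hf, map_add, map_smul,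
      add_right_inj] at h4
    simp only [map_sum, map_smul] at h4
    rw [h5, h5] at h4
    exact smul_right_injective F (Nat.cast_ne_zero.2 (D.m_pos _).ne') h4
  change f _ = g A (f w)
  induction A using Matrix.induction_on' with
  | h_zero => rw [zero_lie, map_zero, map_zero, LinearMap.zero_apply]
  | h_add A B hA hB => rw [add_lie, map_add, hA, hB, map_add, LinearMap.add_apply]
  | h_std_basis j i c =>
    have e : Matrix.single j i c = c • (Matrix.single j i 1 : Matrix (Fin n) (Fin n) ℂ) := by
      rw [Matrix.smul_single, smul_eq_mul, mul_one]
    rw [e, smul_lie, map_smul, h1, map_smul, LinearMap.smul_apply]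

lemma eval_mono_cent {l : Lat n} {X : D.cent H} (hX : (X : 𝔤) ∈ D.gradeSpace (emb l))
    {k' : Lat n} (hu' : ρU X u ∈ grU (D.bar k')) (hk : D.bar k' = D.bar (k + l)) :
    q (Φ (mono k' w (ρU X u) hu')) = x ⟨X, D.cent_le_gFix H X.2⟩ (q (Φ (mono k w u hu))) := by
  have h1 := hΦ ⟨_, x0_mem_tauUp0 hX X.2⟩ (mono k w u hu)
  obtain ⟨hv', e⟩ := hA.loop l X hX X.2 ⟨_, x0_mem_tauUp0 hX X.2⟩ rfl k w u hu
  rw [e] at h1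
  rw [eval_mono_congr hA w hu' h he hΦ hk hv']
  exact (congrArg q h1.symm).trans (he.x0 l X hX _)

end Action
end TwistData
end Toroidal

namespace Toroidal
open Module (End)

namespace TwistData
variable {n : ℕ} {𝔤 : Type*} [LieRing 𝔤] [LieAlgebra ℂ 𝔤] {D : TwistData n 𝔤}
  [FiniteDimensional ℂ 𝔤] [LieAlgebra.IsSimple ℂ 𝔤] {H : LieSubalgebra ℂ D.g00}

section Action
variable {W U : Type*} [AddCommGroup W] [Module ℂ W] [AddCommGroup U] [Module ℂ U]
  [LieRingModule (Matrix (Fin n) (Fin n) ℂ) W] [LieModule ℂ (Matrix (Fin n) (Fin n) ℂ) W]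
  {grU : D.Lam → Submodule ℂ U} {α : Fin n → ℂ} {d C₀ : ℂ}
  {ρU : D.cent H →ₗ⁅ℂ⁆ End ℂ U} {ρ : tauUp0 H →ₗ⁅ℂ⁆ End ℂ (TensorSpace W grU)}
  {M F : Type*} [AddCommGroup M] [Module ℂ M] [AddCommGroup F] [Module ℂ F]
  {gr : Lat n → Submodule ℂ M} {grF : D.Lam → Submodule ℂ F} {q : M →ₗ[ℂ] F}
  {π : D.tau0 →ₗ⁅ℂ⁆ End ℂ M} {g : Matrix (Fin n) (Fin n) ℂ →ₗ⁅ℂ⁆ End ℂ F}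
  {x : D.gFix →ₗ⁅ℂ⁆ End ℂ F} {Φ : TensorSpace W grU →ₗ[ℂ] M}

/-- The fibre of a submodule of tensor fields, as a subspace of the multiplicity space. -/
theorem exists_multMap (hA : IsTensorAction (tauUp0 H) (D.cent H) grU ρU α d C₀ ρ)
    (hU : IsGrading grU) (hρU : ∀ l (X : D.cent H), (X : 𝔤) ∈ D.gradeSpace (emb l) → ∀ lam,
      ∀ u ∈ grU lam, ρU X u ∈ grU (D.bar l + lam))
    [Nontrivial W] (h : IsTop π gr α d C₀) (hF : FiberRep grF g x)
    (he : IsEval π gr α d C₀ grF g x q)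
    (hΦ : ∀ (y : tauUp0 H) f, π ⟨y, y.2.1⟩ (Φ f) = Φ (ρ y f)) (hi : Function.Injective Φ) :
    ∃ φ : U →ₗ[ℂ] Mult (fun A => LieModule.toEnd ℂ (Matrix (Fin n) (Fin n) ℂ) W A) g,
      (∀ k w u (hu : u ∈ grU (D.bar k)), (φ u).1 w = q (Φ (mono k w u hu))) ∧
      Function.Injective φ ∧ (∀ lam, ∀ u ∈ grU lam, φ u ∈ multGr _ g grF lam) ∧
      ∀ X u, φ (ρU X u) = multRep _ g x hF.comm (centFix X) (φ u) := by
  let G : ∀ lam, grU lam →ₗ[ℂ] W →ₗ[ℂ] F := fun lam =>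
    ((monoLin W grU lam.out).compr₂ (q ∘ₗ Φ)).flip ∘ₗ
      Submodule.inclusion (show grU lam ≤ grU (D.bar lam.out) by rw [bar_out])
  have hG : ∀ lam u w (hu : u ∈ grU (D.bar lam.out)) (hu' : u ∈ grU lam),
      G lam ⟨u, hu'⟩ w = q (Φ (mono lam.out w u hu)) := fun _ _ _ _ _ => rfl
  obtain ⟨φ, hφ⟩ := hU.exists_linearMap fun lam => (G lam).codRestrict
    (Mult (fun A => LieModule.toEnd ℂ (Matrix (Fin n) (Fin n) ℂ) W A) g) fun u A w => by
      have hu : (u : U) ∈ grU (D.bar lam.out) := by rw [bar_out]; exact u.2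
      exact (hG lam u _ hu u.2).trans ((eval_mono_gl hA w hu h he hΦ A).trans
        (congrArg (g A) (hG lam u w hu u.2).symm))
  have hφ' : ∀ k w u (hu : u ∈ grU (D.bar k)), (φ u).1 w = q (Φ (mono k w u hu)) := by
    intro k w u hu
    have hu' : u ∈ grU (D.bar (D.bar k).out) := by rwa [bar_out]
    rw [hφ (D.bar k) u hu]
    exact (hG _ u w hu' hu).trans (eval_mono_congr hA w hu' h he hΦ (bar_out _) hu)
  have hgr : ∀ lam, ∀ u ∈ grU lam, φ u ∈ multGr _ g grF lam := by
    intro lam u hu w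
    have hu' : u ∈ grU (D.bar lam.out) := by rwa [bar_out]
    rw [hφ' lam.out w u hu']
    have := he.mem _ _ (map_mono_mem hA w hu' h hΦ)
    rwa [bar_out] at this
  refine ⟨φ, hφ', ?_, hgr, ?_⟩
  · rw [← LinearMap.ker_eq_bot, Submodule.eq_bot_iff]
    intro u hu
    refine hU.eq_zero_of_proj fun lam => ?_
    have h1 := hU.proj_comm hF.mult_grading (f := id) Function.injective_id hgr lam u
    rw [LinearMap.mem_ker.1 hu, map_zero] at h1
    obtain ⟨w, hw⟩ := exists_ne (0 : W)
    have hu' : hU.proj lam u ∈ grU (D.bar lam.out) := by rw [bar_out]; exact hU.proj_mem lam u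
    have h2 := hφ' lam.out w _ hu'
    rw [← h1] at h2
    exact eq_zero_of_mono_eq_zero hw hu' (hi ((he.inj _ _ (map_mono_mem hA w hu' h hΦ)
      h2.symm).trans (map_zero _).symm))
  · intro X u
    have hom : ∀ mu, ∀ X : D.cent H, centFix X ∈ D.gFixGr mu → ∀ u,
        φ (ρU X u) = multRep _ g x hF.comm (centFix X) (φ u) := by
      intro mu X hX u
      have hX' := mem_gFixGr.1 hX
      suffices φ ∘ₗ ρU X = multRep _ g x hF.comm (centFix X) ∘ₗ φ from LinearMap.congr_fun this u
      refine hU.linearMap_ext fun lam u hu => Subtype.ext (LinearMap.ext fun w => ?_)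
      have hu' : u ∈ grU (D.bar lam.out) := by rwa [bar_out]
      have h1 := hρU _ X hX' lam u hu
      have h2 : ρU X u ∈ grU (D.bar (mu.out + lam.out)) := by rwa [bar_add, bar_out lam]
      refine (hφ' (mu.out + lam.out) w _ h2).trans ((eval_mono_cent hA w hu' h he hΦ hX' h2
        (by rw [add_comm])).trans ?_)
      exact congrArg (x (centFix X)) (hφ' _ w u hu').symm
    have := Fintype.ofFinite D.Lam
    let Y : D.Lam → D.cent H := fun mu => ⟨gFixGr_grading.proj mu (centFix X),
      proj_mem_cent (x := centFix X) X.2 mu⟩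
    have hY : ∀ mu, centFix (Y mu) = gFixGr_grading.proj mu (centFix X) := fun mu => rfl
    have hsum : ∑ mu, centFix (Y mu) = centFix X := by
      simp only [hY, gFixGr_grading.sum_proj]
    have hsum' : ∑ mu, Y mu = X := by
      refine Subtype.ext ?_
      have := congrArg Subtype.val hsum
      simpa using this
    rw [← hsum, map_sum, LinearMap.sum_apply]
    conv_lhs => rw [← hsum', map_sum, LinearMap.sum_apply, map_sum]
    exact Finset.sum_congr rfl fun mu _ => hom mu (Y mu) (gFixGr_grading.proj_mem mu _) u

end Action
end TwistData
end Toroidal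

namespace Toroidal
open Module (End)

namespace TwistData
variable {n : ℕ} {𝔤 : Type*} [LieRing 𝔤] [LieAlgebra ℂ 𝔤] {D : TwistData n 𝔤}
  [FiniteDimensional ℂ 𝔤] [LieAlgebra.IsSimple ℂ 𝔤] {H : LieSubalgebra ℂ D.g00}
  {P : Set (Module.Dual ℂ H)}
  {V : Type*} [AddCommGroup V] [Module ℂ V] [LieRingModule D.tau V] [LieModule ℂ D.tau V]
  {ψ : Fin (n + 1) → ℂ} {E : TopData H}

variable (V P) in
/-- The inclusion of `T` in `S`. -/
def topInclusion : topT H V P →ₗ[ℂ] D.topS V :=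
  ⟨⟨fun v => ⟨v, v.2.1⟩, fun _ _ => rfl⟩, fun _ _ => rfl⟩

lemma topInclusion_injective : Function.Injective (topInclusion (H := H) P V) := fun _ _ hvw =>
  Subtype.ext (congrArg (fun v : D.topS V => (v : V)) hvw)

omit [FiniteDimensional ℂ 𝔤] [LieAlgebra.IsSimple ℂ 𝔤] in
lemma TopData.nontrivial₁ (E : TopData H) : Nontrivial E.W₁ := by
  have := E.irreducible₁
  exact LieModule.nontrivial_of_isIrreducible ℂ (Matrix (Fin n) (Fin n) ℂ) E.W₁

omit [FiniteDimensional ℂ 𝔤] [LieAlgebra.IsSimple ℂ 𝔤] in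
lemma TopData.eq_bot_or_eq_top (E : TopData H) (N : Submodule ℂ E.W₁)
    (hN : ∀ A : Matrix (Fin n) (Fin n) ℂ, N ≤ N.comap (LieModule.toEnd ℂ _ E.W₁ A)) :
    N = ⊥ ∨ N = ⊤ := by
  have := E.irreducible₁
  have h1 := IsSimpleOrder.eq_bot_or_eq_top ({ N with lie_mem := fun {A w} hw => hN A hw } :
    LieSubmodule ℂ (Matrix (Fin n) (Fin n) ℂ) E.W₁)
  rcases h1 with h1 | h1
  · exact Or.inl (congrArg LieSubmodule.toSubmodule h1)
  · exact Or.inr (congrArg LieSubmodule.toSubmodule h1)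

/-- The parameters `α`, `d` of `T` are determined by the weights of `S`. -/
lemma TopTIso.exists_mem_topGr {C₀ : ℂ} (hT : TopTIso E P V C₀) :
    ∃ (k : Lat n) (v : D.topS V), v ≠ 0 ∧ v ∈ D.topGr V E.α E.d k := by
  obtain ⟨ρ, hA, e, he⟩ := hT
  have := E.nontrivial₁
  have := E.nontrivial₂
  obtain ⟨w, hw⟩ := exists_ne (0 : E.W₁)
  obtain ⟨lam, u, hu, hu0⟩ : ∃ lam, ∃ u ∈ E.gr lam, u ≠ 0 := by
    by_contra! h0
    obtain ⟨u, hu⟩ := exists_ne (0 : E.W₂)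
    exact hu (E.grading.eq_zero_of_proj fun lam => h0 lam _ (E.grading.proj_mem lam u))
  have hu' : u ∈ E.gr (D.bar lam.out) := by rwa [bar_out]
  have hact : ∀ (y : tauUp0 H) (c : ℂ), ρ y (mono lam.out w u hu') = c • mono lam.out w u hu' →
      ⁅(y : D.tau), (e.symm (mono lam.out w u hu') : V)⁆ =
        c • (e.symm (mono lam.out w u hu') : V) := by
    intro y c hy
    have h1 : ⁅y, e.symm (mono lam.out w u hu')⁆ = c • e.symm (mono lam.out w u hu') := by
      apply e.injective
      rw [he, map_smul, e.apply_symm_apply, hy]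
    exact congrArg (fun v : topT H V P => (v : V)) h1
  have hd : ∀ i, D.d i ∈ tauUp0 H := fun i => by
    rw [← coe_e0_zero]; exact e0_mem_tauUp0 _ _
  refine ⟨lam.out, topInclusion P V (e.symm (mono lam.out w u hu')), fun h0 => ?_, fun i => ?_⟩
  · have h1 := topInclusion_injective (h0.trans (map_zero _).symm)
    rw [LinearEquiv.map_eq_zero_iff] at h1
    exact hu0 (eq_zero_of_mono_eq_zero hw hu' h1)
  · refine Fin.cases ?_ (fun i => ?_) i
    · exact hact ⟨_, hd 0⟩ _ (hA.d_zero_apply w hu' rfl)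
    · exact hact ⟨_, hd i.succ⟩ _ (hA.d_succ_apply w hu' i rfl)

theorem TopTIso.topSIso_of_isEval (hD : LieAlgebra.IsSimple ℂ D.g00) (hH : H.IsCartanSubalgebra)
    (hΔ : weights H ⊆ rootsEn H ∪ {0}) (hP : IsPositiveSystem (rootsEn H) P) {C₀ : ℂ}
    (hT : TopTIso E P V C₀) {gr : Lat n → Submodule ℂ (D.topS V)}
    (h : IsTop (LieModule.toEnd ℂ D.tau0 (D.topS V)) gr E.α E.d C₀)
    {F : Type*} [AddCommGroup F] [Module ℂ F] {grF : D.Lam → Submodule ℂ F}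
    {g : Matrix (Fin n) (Fin n) ℂ →ₗ⁅ℂ⁆ End ℂ F} {x : D.gFix →ₗ⁅ℂ⁆ End ℂ F}
    {q : D.topS V →ₗ[ℂ] F} (hFR : FiberRep grF g x)
    (he : IsEval (LieModule.toEnd ℂ D.tau0 (D.topS V)) gr E.α E.d C₀ grF g x q) :
    TopSIso E P V C₀ ∧ FiniteDimensional ℂ (W₂σ E P) := by
  obtain ⟨ρ, hA, e, hρ⟩ := hT
  have := E.nontrivial₁
  have := E.nontrivial₂
  have := E.finiteDimensional₁
  obtain ⟨h₀, ht⟩ := exists_isTriangular hD hH hΔ hP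
  have hi : Function.Injective (topInclusion P V ∘ₗ e.symm.toLinearMap) :=
    topInclusion_injective.comp e.symm.injective
  have hΦ : ∀ (y : tauUp0 H) f, LieModule.toEnd ℂ D.tau0 (D.topS V) ⟨y, y.2.1⟩
      ((topInclusion P V ∘ₗ e.symm.toLinearMap) f) =
        (topInclusion P V ∘ₗ e.symm.toLinearMap) (ρ y f) := by
    intro y f
    have h1 : e.symm (ρ y f) = ⁅y, e.symm f⁆ := by
      rw [LinearEquiv.symm_apply_eq, hρ, e.apply_symm_apply]
    change _ = topInclusion P V (e.symm (ρ y f))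
    rw [h1]
    rfl
  obtain ⟨φ, hφ, hφi, hφg, hφx⟩ := exists_multMap hA E.grading E.lie_mem_gr h hFR he hΦ hi
  have hnt := hφi.nontrivial
  have hG := hFR.gradedRep_mult E.eq_bot_or_eq_top
  have hhigh : ∀ u, φ u ∈ highest (multRep _ g x hFR.comm) (posFix H P) := by
    intro u
    induction u using E.grading.induction with
    | hm lam u hu =>
      intro X hX
      refine Subtype.ext (LinearMap.ext fun w => ?_)
      have hu' : u ∈ E.gr (D.bar lam.out) := by rwa [bar_out]
      have h1 := (mem_topT_iff_eval hD hH hΔ hP h he (v := topInclusion P V (e.symm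
        (mono lam.out w u hu')))).1 (Subtype.coe_prop (e.symm (mono lam.out w u hu'))) lam.out
      rw [show topInclusion P V (e.symm (mono lam.out w u hu')) = (topInclusion P V ∘ₗ
        e.symm.toLinearMap) (mono lam.out w u hu') from rfl,
        h.grading.proj_of_mem (map_mono_mem hA w hu' h hΦ)] at h1
      rw [multRep_apply, hφ lam.out w u hu']
      exact h1 X hX
    | h0 => rw [map_zero]; exact zero_mem _
    | hadd a b ha hb => rw [map_add]; exact add_mem ha hb
  obtain ⟨θ, hθ, hθg⟩ := exists_sigma_equiv hG hφg hφi ht (toFix_mem_cent hD hH h₀) hφx hhigh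
  have hfin := hG.finite
  refine ⟨?_, θ.symm.finiteDimensional⟩
  have hσ : IsGrading (grσ E P) := by
    have h1 := hG.grading.map_equiv θ.symm
    convert h1 using 2 with lam
    ext v
    rw [hθg]
    constructor
    · exact fun hv => ⟨_, hv, θ.symm_apply_apply v⟩
    · rintro ⟨v, hv, rfl⟩
      rwa [LinearEquiv.coe_coe, θ.apply_symm_apply]
  let a : Matrix (Fin n) (Fin n) ℂ → End ℂ E.W₁ := fun A => LieModule.toEnd ℂ _ E.W₁ A
  let ev : E.W₁ ⊗[ℂ] W₂σ E P →ₗ[ℂ] F := evalIntertwiners a (fun A => g A) ∘ₗ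
    θ.toLinearMap.lTensor E.W₁
  have hev : ∀ w u, ev (w ⊗ₜ u) = (θ u).1 w := fun w u => evalIntertwiners_tmul _ _ _ _
  have hbij := hFR.evalIntertwiners_bijective (a := a) E.eq_bot_or_eq_top
  refine exists_isTensorAction (W := E.W₁) (U := W₂σ E P) (ev := ev) h he hFR.grading hσ ?_ ?_ ?_
    le_rfl (actσ E P) ?_ ?_ le_rfl (N := D.topS V) (j := LinearMap.id) Function.injective_id
    (fun y v => rfl) ?_
  · exact hbij.1.comp (Module.Flat.lTensor_preserves_injective_linearMap _ θ.injective)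
  · intro lam w u hu
    rw [hev]
    exact (hθg lam u).1 hu w
  · intro A w u
    rw [hev, hev]
    exact ((θ u).2 A w).symm
  · intro l X hX lam u hu
    rw [hθg] at hu ⊢
    rw [hθ]
    exact hG.mem (D.bar l) X (mem_gFixGr_bar.2 hX) lam _ hu
  · intro X w u
    rw [hev, hev, hθ]
    rfl
  · intro v
    have h1 : LinearMap.range ev = ⊤ := by
      rw [LinearMap.range_comp, LinearMap.range_eq_top.2
        (LinearMap.lTensor_surjective _ θ.surjective), Submodule.map_top,
        LinearMap.range_eq_top.2 hbij.2]
    rw [h1, LinearMap.range_id]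
    simp

theorem TopTIso.topSIso (hirr : LieModule.IsIrreducible ℂ D.tau V) (hV : D.IsBounded V ψ)
    (hC₀ : ψ 0 ≠ 0) (hD : LieAlgebra.IsSimple ℂ D.g00) (hH : H.IsCartanSubalgebra)
    (hΔ : weights H ⊆ rootsEn H ∪ {0}) (hP : IsPositiveSystem (rootsEn H) P)
    (hT : TopTIso E P V (ψ 0)) : TopSIso E P V (ψ 0) ∧ FiniteDimensional ℂ (W₂σ E P) := by
  obtain ⟨d, hd, -⟩ := exists_d_topS (D := D) (V := V) hV
  obtain ⟨k, v, hv, hvk⟩ := hT.exists_mem_topGr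
  have hdE : d = E.d := by
    have h1 := (hd v v.2).symm.trans (hvk 0)
    exact smul_left_injective ℂ (fun h0 => hv (Subtype.ext h0)) h1
  subst hdE
  have h := isTop_topS hV hC₀ hd hv hvk
  obtain ⟨g, x, hFR, he⟩ := h.exists_fiberRep
  exact hT.topSIso_of_isEval hD hH hΔ hP h hFR he

end TwistData
end Toroidal

end

open Toroidal TwistData in
theorem theorem5p5 {n : ℕ} (hn : 0 < n)
    {𝔤 : Type*} [LieRing 𝔤] [LieAlgebra ℂ 𝔤] [FiniteDimensional ℂ 𝔤] [LieAlgebra.IsSimple ℂ 𝔤]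
    (D : TwistData n 𝔤) (hD : LieAlgebra.IsSimple ℂ D.g00)
    (H : LieSubalgebra ℂ D.g00) (hH : H.IsCartanSubalgebra)
    (hΔ : weights H ⊆ rootsEn H ∪ {0})
    (P : Set (Module.Dual ℂ H)) (hP : IsPositiveSystem (rootsEn H) P)
    {V : Type*} [AddCommGroup V] [Module ℂ V] [LieRingModule D.tau V] [LieModule ℂ D.tau V]
    (hirr : LieModule.IsIrreducible ℂ D.tau V)
    (ψ : Fin (n + 1) → ℂ) (hV : D.IsBounded V ψ) (hC₀ : ψ 0 ≠ 0) :
    (∃ E : TopData H, TopTIso E P V (ψ 0)) ∧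
    ∀ E : TopData H, TopTIso E P V (ψ 0) →
      TopSIso E P V (ψ 0) ∧ FiniteDimensional ℂ (W₂σ E P) := by
  exact ⟨exists_topData hirr hV hC₀ hD hH hΔ hP, fun E hT =>
    hT.topSIso hirr hV hC₀ hD hH hΔ hP⟩
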